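/- **Setting.** Let $V\in\mathbb R\setminus\{0\}$, $\delta\in\mathbb R$, $A_\pm>0$, $p_\pm=\mp V/2+iA_\pm$. Let $\Sigma_\pm=[\overline{p_\pm},p_\pm]$ be the vertical segments, oriented upward, and $\Sigma=\mathbb R\cup\Sigma_+\cup\Sigma_-$, with $\mathbb R$ oriented from left to right. Superscripts $+$ / $-$ denote boundary values from the left / right of $\Sigma$. Write $\Sigma_{\pm1}^o$, $\Sigma_{\pm2}^o$ for the parts of $\Sigma_\pm$ in the open upper, lower half plane without the branch points. Put $\theta_o(x,t,k)=k(x-2kt)$ and $\sigma_3=\mathrm{diag}(1,-1)$. Let $K=\{k_1,\dots,k_N\}$ be a finite set of $N\ge 0$ distinct points in $\mathbb C^+\setminus\Sigma$, let $c_1,\dots,c_N\in\mathbb C$, and let $\rho$ (on $\mathbb R\cup\Sigma_{+1}^o$, without zeros on $\Sigma_{+1}^o$) and $r$ (on $\Sigma_{-1}^o$) be complex-valued functions. Let $J=e^{i\theta_o\sigma_3}J_oe^{-i\theta_o\sigma_3}$ with $$J_o=\begin{pmatrix}1&\rho\\ \bar\rho&1+|\rho|^2\end{pmatrix}\ (\mathbb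 R),\quad \begin{pmatrix}i\rho e^{-i\delta}&0\\-ie^{-i\delta}&-ie^{i\delta}/\rho\end{pmatrix}\ (\Sigma_{+1}^o),\quad \begin{pmatrix}ie^{-i\delta}/\overline{\rho(\bar k)}&-ie^{i\delta}\\0&-i\overline{\rho(\bar k)}e^{i\delta}\end{pmatrix}\ (\Sigma_{+2}^o),$$ $$J_o=\begin{pmatrix}1&-r\\0&1\end{pmatrix}\ (\Sigma_{-1}^o),\qquad \begin{pmatrix}1&0\\ \overline{r(\bar k)}&1\end{pmatrix}\ (\Sigma_{-2}^o).$$ **Riemann-Hilbert problem (RHP) at $(x,t)$.** Find a $2\times2$ matrix $M(x,t,k)$ such that 1. $M$ is analytic in $k\in\mathbb C\setminus(\Sigma\cup K\cup\overline K)$; 2. $M$ extends continuously from each side to $\mathbb R\setminus\{\pm V/2\}$ and to $\Sigma_{\pm1}^o\cup\Sigma_{\pm2}^o$, with $M^+=M^-J$ there, and $M$ is bounded near the crossing points $\pm V/2$; 3. $M=I+O(1/k)$ as $k\to\infty$; 4. with columns $M_1,M_2$: $\operatorname{Res}_{k_n}M=(0,\ c_ne^{2i\theta_o(k_n)}M_1(k_n))$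 and $\operatorname{Res}_{\overline{k_n}}M=(-\overline{c_n}e^{-2i\theta_o(\overline{k_n})}M_2(\overline{k_n}),\ 0)$, the singularities being at most simple poles; 5. the limits of $M(k-p_+)^{\sigma_3/4}$ as $k\to p_+$, of $M(k-\overline{p_+})^{-\sigma_3/4}$ as $k\to\overline{p_+}$, and of $M$ as $k\to p_-$ and as $k\to\overline{p_-}$ exist. The fourth roots are cut along $\Sigma_+$ near the branch points. **Statement.** Assume that $\int_{\mathbb R}k^2|\rho(k)|\,dk<\infty$ and that $\rho|_{\mathbb R}$ is Lipschitz near $+\infty$ and near $-\infty$. Let $U\subset\mathbb R\times\mathbb R$ be open (for example $U=\mathbb R\times\mathbb R$ or $\mathbb R\times(0,\infty)$), and let $M(x,t,\cdot)$ solve the RHP at every $(x,t)\in U$. Then $[M^-(J-I)]_{12}$ is absolutely integrable over $\Sigma$, and with $$q(x,t)=-2i\sum_{n=1}^Nc_ne^{2i\theta_o(x,t,k_n)}M_{11}(x,t,k_n)+\frac1\pi\int_\Sigma\big[M^-(x,t,\xi)(J(x,t,\xi)-I)\big]_{12}\,d\xi,\qquad Q=\begin{pmatrix}0&q\\-\bar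 q&0\end{pmatrix},$$ the following hold on $U$. * The limit exists and $Q(x,t)=-i\lim_{k\to\infty}k[\sigma_3,M(x,t,k)]$, where $k\to\infty$ in $\mathbb C\setminus\Sigma$. * $q$ is differentiable in $x$, and for each $k\in\mathbb C\setminus(\Sigma\cup K\cup\overline K)$ the matrix $M$ is differentiable in $x$ and in $t$ and satisfies the modified Lax pair $$M_x-ik[\sigma_3,M]=QM,\qquad M_t+2ik^2[\sigma_3,M]=\big(i\sigma_3(Q_x-Q^2)-2kQ\big)M.$$ * $q$ is a classical solution of the focusing NLS equation $iq_t+q_{xx}+2|q|^2q=0$ (the derivatives $q_t$ and $q_{xx}$ exist). -/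

import Mathlib

open Filter Topology MeasureTheory Asymptotics

noncomputable section

namespace CounterflowNLS

/-- Complex `2 × 2` matrices; row and column indices `0, 1` stand for `1, 2`. -/
abbrev Mat2 := Matrix (Fin 2) (Fin 2) ℂ

/-- The Pauli matrix `σ₃ = diag(1, -1)`. -/
def sigma3 : Mat2 := !![1, 0; 0, -1]

/-- The matrix `z ^ σ₃ = diag(z, z⁻¹)`. -/
def powSigma3 (z : ℂ) : Mat2 := !![z, 0; 0, z⁻¹]

/-- The potential matrix with upper right entry `q` and lower left entry `-conj q`. -/
def potentialMatrix (q : ℂ) : Mat2 := !![0, q; -(starRingEnd ℂ q), 0]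

/-- The phase `θ_o(x,t,k) = k (x - 2 k t)`. -/
def phase (x t : ℝ) (k : ℂ) : ℂ := k * ((x : ℂ) - 2 * k * (t : ℂ))

/-- The data that enter the Riemann-Hilbert problem: velocity `V`, phase `δ`, amplitudes
`A₊ = Ap` and `A₋ = Am`, the reflection coefficients `ρ` (used on the real line and on `Σ₊₁`)
and `r` (used on `Σ₋₁`), the poles `k_n` in the upper half plane and norming constants `c_n`. -/
structure RHPData where
  V : ℝ
  δ : ℝ
  Ap : ℝ
  Am : ℝ
  ρ : ℂ → ℂ
  r : ℂ → ℂ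
  N : ℕ
  pole : Fin N → ℂ
  c : Fin N → ℂ

namespace RHPData

variable (D : RHPData)

/-- The point with imaginary part `s` on the vertical line through `-V/2`, which carries `Σ₊`. -/
def ptPlus (s : ℝ) : ℂ := ⟨-D.V / 2, s⟩

/-- The point with imaginary part `s` on the vertical line through `V/2`, which carries `Σ₋`. -/
def ptMinus (s : ℝ) : ℂ := ⟨D.V / 2, s⟩

/-- The cut `Σ₊`, the closed segment from `conj p₊` to `p₊ = -V/2 + i A₊`. -/
def cutPlus : Set ℂ := {k | k.re = -D.V / 2 ∧ |k.im| ≤ D.Ap}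

/-- The cut `Σ₋`, the closed segment from `conj p₋` to `p₋ = V/2 + i A₋`. -/
def cutMinus : Set ℂ := {k | k.re = D.V / 2 ∧ |k.im| ≤ D.Am}

/-- The contour `Σ = ℝ ∪ Σ₊ ∪ Σ₋`. -/
def contour : Set ℂ := {k | k.im = 0} ∪ D.cutPlus ∪ D.cutMinus

/-- The poles `K ∪ conj K`. -/
def poles : Set ℂ := {z | ∃ n, z = D.pole n ∨ z = starRingEnd ℂ (D.pole n)}

open Classical in
/-- The matrix `J_o(k)`; the last value is irrelevant (it is used off the contour and at the
branch points only). -/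
def Jo (k : ℂ) : Mat2 :=
  if k.im = 0 then
    !![1, D.ρ k;
       starRingEnd ℂ (D.ρ k), 1 + D.ρ k * starRingEnd ℂ (D.ρ k)]
  else if k.re = -D.V / 2 ∧ 0 < k.im ∧ k.im < D.Ap then
    !![Complex.I * D.ρ k * Complex.exp (-(Complex.I * D.δ)), 0;
       -(Complex.I * Complex.exp (-(Complex.I * D.δ))),
       -(Complex.I * Complex.exp (Complex.I * D.δ) / D.ρ k)]
  else if k.re = -D.V / 2 ∧ -D.Ap < k.im ∧ k.im < 0 then
    !![Complex.I * Complex.exp (-(Complex.I * D.δ)) / starRingEnd ℂ (D.ρ (starRingEnd ℂ k)),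
       -(Complex.I * Complex.exp (Complex.I * D.δ));
       0,
       -(Complex.I * starRingEnd ℂ (D.ρ (starRingEnd ℂ k)) * Complex.exp (Complex.I * D.δ))]
  else if k.re = D.V / 2 ∧ 0 < k.im ∧ k.im < D.Am then
    !![1, -D.r k; 0, 1]
  else if k.re = D.V / 2 ∧ -D.Am < k.im ∧ k.im < 0 then
    !![1, 0; starRingEnd ℂ (D.r (starRingEnd ℂ k)), 1]
  else 1

/-- The jump matrix `J = exp(i θ_o σ₃) J_o exp(-i θ_o σ₃)`. -/
def J (x t : ℝ) (k : ℂ) : Mat2 :=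
  powSigma3 (Complex.exp (Complex.I * phase x t k)) * D.Jo k *
    powSigma3 (Complex.exp (-(Complex.I * phase x t k)))

/-- The fourth root `(k - p₊)^(1/4)` with its cut running downward from `p₊`, hence along `Σ₊`
near `p₊`: the argument of `k - p₊` lies in `(-π/2, 3π/2]`. -/
def rootUpper (k : ℂ) : ℂ :=
  Complex.exp (Complex.I * (Real.pi / 8)) *
    (-Complex.I * (k - D.ptPlus D.Ap)) ^ (1 / 4 : ℂ)

/-- The fourth root `(k - conj p₊)^(1/4)` with its cut running upward from `conj p₊`, hence along
`Σ₊` near `conj p₊`: the argument of `k - conj p₊` lies in `(-3π/2, π/2]`. -/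
def rootLower (k : ℂ) : ℂ :=
  Complex.exp (-(Complex.I * (Real.pi / 8))) *
    (Complex.I * (k - D.ptPlus (-D.Ap))) ^ (1 / 4 : ℂ)

/-- The conditions on the data under which the jump matrix and the residue conditions make
sense: positive amplitudes, `V ≠ 0`, `ρ` without zeros on `Σ₊₁ᵒ` (its reciprocal appears in the
jump), and finitely many distinct poles in the upper half plane off the contour. -/
structure Admissible : Prop where
  V_ne : D.V ≠ 0
  Ap_pos : 0 < D.Ap
  Am_pos : 0 < D.Am
  rho_ne : ∀ s : ℝ, 0 < s → s < D.Ap → D.ρ (D.ptPlus s) ≠ 0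
  pole_injective : Function.Injective D.pole
  pole_im_pos : ∀ n, 0 < (D.pole n).im
  pole_not_mem : ∀ n, D.pole n ∉ D.contour

/-- Smoothness class of the reflection coefficient on the real line: `k² ρ(k)` is integrable over
`ℝ`, and `ρ` is Lipschitz near `+∞` and near `-∞`. -/
structure Regular : Prop where
  integrable : Integrable (fun ξ : ℝ => (ξ : ℂ) ^ 2 * D.ρ (ξ : ℂ))
  lipschitz : ∃ (L : NNReal) (R : ℝ),
    LipschitzOnWith L (fun ξ : ℝ => D.ρ (ξ : ℂ)) (Set.Ici R) ∧
    LipschitzOnWith L (fun ξ : ℝ => D.ρ (ξ : ℂ)) (Set.Iic (-R))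

/-- `M`, with boundary values `Mp = M⁺` (from the left) and `Mm = M⁻` (from the right) on the
contour, solves the Riemann-Hilbert problem at the fixed point `(x, t)`. The real line is oriented
from left to right, the cuts upward. The matrix `M` is a function of `k` on all of `ℂ`, but its
values on the contour are irrelevant, and at a pole only those of the regular column matter. -/
structure IsSolution (x t : ℝ) (M Mp Mm : ℂ → Mat2) : Prop where
  /-- analyticity off the contour and the poles -/
  analytic : ∀ i j, DifferentiableOn ℂ (fun k => M k i j) (D.contour ∪ D.poles)ᶜ
  /-- boundary values from above and below on the real line, and the jump there -/
  jump_real : ∀ ξ : ℝ, ξ ≠ -D.V / 2 → ξ ≠ D.V / 2 →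
    Tendsto M (𝓝[{z | 0 < z.im}] (ξ : ℂ)) (𝓝 (Mp ξ)) ∧
    Tendsto M (𝓝[{z | z.im < 0}] (ξ : ℂ)) (𝓝 (Mm ξ)) ∧
    Mp ξ = Mm ξ * D.J x t ξ
  /-- boundary values and jump on `Σ₊` -/
  jump_plus : ∀ s : ℝ, 0 < |s| → |s| < D.Ap →
    Tendsto M (𝓝[{z | z.re < -D.V / 2}] (D.ptPlus s)) (𝓝 (Mp (D.ptPlus s))) ∧
    Tendsto M (𝓝[{z | -D.V / 2 < z.re}] (D.ptPlus s)) (𝓝 (Mm (D.ptPlus s))) ∧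
    Mp (D.ptPlus s) = Mm (D.ptPlus s) * D.J x t (D.ptPlus s)
  /-- boundary values and jump on `Σ₋` -/
  jump_minus : ∀ s : ℝ, 0 < |s| → |s| < D.Am →
    Tendsto M (𝓝[{z | z.re < D.V / 2}] (D.ptMinus s)) (𝓝 (Mp (D.ptMinus s))) ∧
    Tendsto M (𝓝[{z | D.V / 2 < z.re}] (D.ptMinus s)) (𝓝 (Mm (D.ptMinus s))) ∧
    Mp (D.ptMinus s) = Mm (D.ptMinus s) * D.J x t (D.ptMinus s)
  /-- boundedness at the points where the cuts cross the real line -/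
  bounded_plus : ∀ i j, (fun k => M k i j) =O[𝓝[D.contourᶜ] (D.ptPlus 0)] (fun _ => (1 : ℂ))
  bounded_minus : ∀ i j, (fun k => M k i j) =O[𝓝[D.contourᶜ] (D.ptMinus 0)] (fun _ => (1 : ℂ))
  /-- normalization `M = I + O(1/k)` at infinity -/
  normalization : ∀ i j, (fun k => M k i j - (1 : Mat2) i j)
    =O[Bornology.cobounded ℂ ⊓ 𝓟 D.contourᶜ] (fun k => k⁻¹)
  /-- residue condition at `k_n`: the first column is regular, the second has a simple pole -/
  regular_upper : ∀ n i, AnalyticAt ℂ (fun k => M k i 0) (D.pole n)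
  residue_upper : ∀ n i, Tendsto (fun k => (k - D.pole n) * M k i 1) (𝓝[≠] D.pole n)
    (𝓝 (D.c n * Complex.exp (2 * Complex.I * phase x t (D.pole n)) * M (D.pole n) i 0))
  /-- residue condition at `conj k_n`: the second column is regular, the first has a simple pole -/
  regular_lower : ∀ n i, AnalyticAt ℂ (fun k => M k i 1) (starRingEnd ℂ (D.pole n))
  residue_lower : ∀ n i, Tendsto (fun k => (k - starRingEnd ℂ (D.pole n)) * M k i 0)
    (𝓝[≠] (starRingEnd ℂ (D.pole n)))
    (𝓝 (-(starRingEnd ℂ (D.c n)) *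
      Complex.exp (-(2 * Complex.I * phase x t (starRingEnd ℂ (D.pole n)))) *
      M (starRingEnd ℂ (D.pole n)) i 1))
  /-- growth conditions at the four branch points -/
  growth_p_plus : ∃ B : Mat2, Tendsto (fun k => M k * powSigma3 (D.rootUpper k))
    (𝓝[D.contourᶜ] (D.ptPlus D.Ap)) (𝓝 B)
  growth_conj_p_plus : ∃ B : Mat2, Tendsto (fun k => M k * powSigma3 (D.rootLower k)⁻¹)
    (𝓝[D.contourᶜ] (D.ptPlus (-D.Ap))) (𝓝 B)
  growth_p_minus : ∃ B : Mat2, Tendsto M (𝓝[D.contourᶜ] (D.ptMinus D.Am)) (𝓝 B)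
  growth_conj_p_minus : ∃ B : Mat2, Tendsto M (𝓝[D.contourᶜ] (D.ptMinus (-D.Am))) (𝓝 B)

/-- Absolute integrability over the contour `Σ`. -/
def ContourIntegrable (f : ℂ → ℂ) : Prop :=
  Integrable (fun ξ : ℝ => f (ξ : ℂ)) ∧
  IntervalIntegrable (fun s : ℝ => f (D.ptPlus s)) volume (-D.Ap) D.Ap ∧
  IntervalIntegrable (fun s : ℝ => f (D.ptMinus s)) volume (-D.Am) D.Am

/-- The integral `∫_Σ f(ξ) dξ` over the oriented contour. -/
def contourIntegral (f : ℂ → ℂ) : ℂ :=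
  (∫ ξ : ℝ, f (ξ : ℂ)) +
  (∫ s in (-D.Ap)..D.Ap, f (D.ptPlus s) * Complex.I) +
  (∫ s in (-D.Am)..D.Am, f (D.ptMinus s) * Complex.I)

/-- The integrand `[M⁻ (J - I)]₁₂`. -/
def jumpEntry (x t : ℝ) (Mm : ℂ → Mat2) (ξ : ℂ) : ℂ := (Mm ξ * (D.J x t ξ - 1)) 0 1

/-- The potential given by the reconstruction formula
`q = -2i ∑ c_n exp(2iθ_o(k_n)) M₁₁(k_n) + (1/π) ∫_Σ [M⁻ (J - I)]₁₂ dξ`. -/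
def reconstruction (M Mm : ℝ → ℝ → ℂ → Mat2) (x t : ℝ) : ℂ :=
  -2 * Complex.I * ∑ n, D.c n * Complex.exp (2 * Complex.I * phase x t (D.pole n)) *
      M x t (D.pole n) 0 0
    + (1 / (Real.pi : ℂ)) * D.contourIntegral (D.jumpEntry x t (Mm x t))

end RHPData

/-- The modified Lax pair at `(x, t, k)`, for a matrix function `M` and the potential `q`:
`q` is differentiable in `x`, `M` is differentiable in `x` and in `t`, and
`M_x - i k [σ₃, M] = Q M`, `M_t + 2 i k² [σ₃, M] = (i σ₃ (Q_x - Q²) - 2 k Q) M`. -/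
def ModifiedLaxPairAt (q : ℝ → ℝ → ℂ) (M : ℝ → ℝ → ℂ → Mat2) (x t : ℝ) (k : ℂ) : Prop :=
  ∃ qx : ℂ, ∃ Mx Mt : Mat2,
    HasDerivAt (fun y => q y t) qx x ∧
    (∀ i j, HasDerivAt (fun y => M y t k i j) (Mx i j) x) ∧
    (∀ i j, HasDerivAt (fun s => M x s k i j) (Mt i j) t) ∧
    Mx - (Complex.I * k) • (sigma3 * M x t k - M x t k * sigma3)
      = potentialMatrix (q x t) * M x t k ∧
    Mt + (2 * Complex.I * k ^ 2) • (sigma3 * M x t k - M x t k * sigma3)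
      = (Complex.I • (sigma3 * (potentialMatrix qx - potentialMatrix (q x t) ^ 2))
          - (2 * k) • potentialMatrix (q x t)) * M x t k

/-- `q` satisfies the focusing nonlinear Schrödinger equation `i q_t + q_xx + 2 |q|² q = 0`
in the classical sense at `(x, t)`. -/
def SolvesNLSAt (q : ℝ → ℝ → ℂ) (x t : ℝ) : Prop :=
  DifferentiableAt ℝ (fun s => q x s) t ∧
  (∀ᶠ y in 𝓝 x, DifferentiableAt ℝ (fun z => q z t) y) ∧
  DifferentiableAt ℝ (deriv fun z => q z t) x ∧
  Complex.I * deriv (fun s => q x s) t + deriv (deriv fun z => q z t) x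
    + 2 * (‖q x t‖ : ℂ) ^ 2 * q x t = 0

end CounterflowNLS

end

/-! The jump matrix is J = e^{iθσ₃} J_o e^{-iθσ₃} with J_o independent of (x,t), and the residue and
branch point conditions have a matching structure. For solutions M at (x,t) and M₁ at (x₁,t₁), with
phases θ and θ₁, the quotient F of M₁ e^{iθ₁σ₃} by M e^{iθσ₃} therefore has no jumps, and its
remaining singularities are removable: F is entire (`exists_entire_twist`). The inverse is replaced
from the start by reflection, so that one works with N₁(k) N(k̄)ᴴ; for equal parameters Liouville's
theorem then gives M(k) M(k̄)ᴴ = I (`twist_self`), which is at once the invertibility and the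
symmetry of M.

Nothing is assumed about the way in which M depends on (x,t); regularity has to come out of F. Let
M_s be the solution at (x+sa, t+sb), F_s its factor and φ(k) = ak - 2bk² the derivative of the
phase. At infinity F_s carries the exponentials, whereas M_s M⁻¹ is I + O(1/k) there but jumps
across ℝ. So F_s is used inside a large circle and M_s M⁻¹ outside. The glued function is a Cauchy
integral of its jumps on the circle and on the two real rays outside (`cauchy_inside`,
`cauchy_outside`). The jump on the circle is O(s) times the size of F_s, and the jump on the rays is
O(s |φρ|), integrable because k²ρ is. A bootstrap with the maximum principle bounds F_s uniformly
(`exists_factor_bound`), then F_s = I + O(s) (`exists_factor_lipschitz`), and dominated convergence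
yields the derivative of F_s at s = 0. That derivative is entire of quadratic growth, hence a
polynomial of degree at most two in k (`exists_factor_deriv`). The product rule turns it into a
linear equation Ṁ = (polynomial) M - iφ M σ₃ for M_x and M_t.

The polynomial is found by expanding M = I + m₁/k + m₂/k² + ... along the imaginary axis. Both M_x
and M_t are O(1/k) there, which fixes all coefficients and gives the Lax pair; the next order gives
∂ₓm₁. In M_t + 2k M_x the high powers of k cancel, and its expansion gives ∂ₜm₁ + 2 ∂ₓm₂ = 2 (∂ₓm₁)
m₁ (`exists_lax`). With q = -2i (m₁)₁₂ the NLS equation is an algebraic consequence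
(`lax_and_nls_of_moments`).

Two things remain. The limit of k[σ₃, M] is wanted for all k → ∞ off Σ, also for k approaching the
real line, where a Cauchy integral need not be small. Near such a point the integral is pushed into
the half plane opposite to k, with ρ frozen by its Lipschitz bound (`exists_near_bound`,
`tendsto_setIntegral_div_of_near`). Finally, Cauchy's theorem on growing squares, applied to M₁₂
minus its principal parts, evaluates the contour integral in the definition of q
(`contourIntegral_jumpEntry`). -/

namespace CounterflowNLS

/-! ### Cauchy's theorem with boundary values, and removable singularities -/

section Cauchy

open Complex Set Metric
open scoped Interval

variable {E : Type*} [NormedAddCommGroup E] [NormedSpace ℂ E]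

/-- Convergence of integrals over shrinking intervals of functions that converge to a boundary
value and are dominated. -/
theorem tendsto_integral_shrink {F : ℝ → ℝ → E} {fb : ℝ → E} {g : ℝ → ℝ} {a b : ℝ} (hab : a < b)
    {s : Set ℝ} {l : Filter ℝ} {h : ℝ → ℝ} (hl : Tendsto h (𝓝[>] 0) l)
    (hs : ∀ᶠ ε in 𝓝[>] (0 : ℝ), h ε ∈ s)
    (hcont : ∀ y ∈ s, ContinuousOn (fun x => F x y) (Ioo a b))
    (hlim : ∀ᵐ x, x ∈ Ioo a b → Tendsto (F x) l (𝓝 (fb x)))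
    (hdom : ∀ᵐ x, x ∈ Ioo a b → ∀ y ∈ s, ‖F x y‖ ≤ g x) (hg : IntegrableOn g (Ioo a b)) :
    Tendsto (fun ε => ∫ x in (a + ε)..(b - ε), F x (h ε)) (𝓝[>] 0) (𝓝 (∫ x in a..b, fb x)) := by
  have key : Tendsto (fun ε => ∫ x in Ioo a b, (Ioo (a + ε) (b - ε)).indicator
      (fun x => F x (h ε)) x) (𝓝[>] 0) (𝓝 (∫ x in Ioo a b, fb x)) := by
    refine tendsto_integral_filter_of_dominated_convergence g ?_ ?_ hg ?_
    · filter_upwards [hs] with ε hε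
      exact (((hcont _ hε).aestronglyMeasurable measurableSet_Ioo).indicator measurableSet_Ioo)
    · filter_upwards [hs] with ε hε
      filter_upwards [ae_restrict_mem measurableSet_Ioo, ae_restrict_of_ae hdom] with x hx hx'
      rw [norm_indicator_eq_indicator_norm]
      refine indicator_apply_le' (fun _ => hx' hx _ hε) fun _ => ?_
      exact (norm_nonneg _).trans (hx' hx _ hε)
    · filter_upwards [ae_restrict_mem measurableSet_Ioo, ae_restrict_of_ae hlim] with x hx hx2
      refine ((hx2 hx).comp hl).congr' ?_
      have h1 : ∀ᶠ ε in 𝓝[>] (0 : ℝ), a + ε < x :=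
        nhdsWithin_le_nhds (((continuous_const.add continuous_id).tendsto' 0 a (by simp)).eventually
          (gt_mem_nhds hx.1))
      have h2 : ∀ᶠ ε in 𝓝[>] (0 : ℝ), x < b - ε :=
        nhdsWithin_le_nhds (((continuous_const.sub continuous_id).tendsto' 0 b (by simp)).eventually
          (lt_mem_nhds hx.2))
      filter_upwards [h1, h2] with ε h1 h2
      rw [indicator_of_mem (show x ∈ Ioo (a + ε) (b - ε) from ⟨h1, h2⟩)]
      rfl
  rw [intervalIntegral.integral_of_le hab.le, integral_Ioc_eq_integral_Ioo]
  refine key.congr' ?_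
  have h1 : ∀ᶠ ε in 𝓝[>] (0 : ℝ), ε < (b - a) / 2 :=
    nhdsWithin_le_nhds (gt_mem_nhds (by linarith))
  filter_upwards [h1, self_mem_nhdsWithin] with ε h1 h0
  have h0 : 0 < ε := h0
  rw [intervalIntegral.integral_of_le (by linarith), integral_Ioc_eq_integral_Ioo,
    setIntegral_indicator measurableSet_Ioo, inter_eq_right.2]
  exact Ioo_subset_Ioo (by linarith) (by linarith)

omit [NormedSpace ℂ E] in
/-- Integrability of boundary values that are attained almost everywhere. -/
theorem integrableOn_of_boundary {F : ℝ → ℝ → E} {fb : ℝ → E} {g : ℝ → ℝ} {a b : ℝ}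
    {s : Set ℝ} {l : Filter ℝ} {h : ℝ → ℝ} (hl : Tendsto h (𝓝[>] 0) l)
    (hs : ∀ᶠ ε in 𝓝[>] (0 : ℝ), h ε ∈ s)
    (hcont : ∀ y ∈ s, ContinuousOn (fun x => F x y) (Ioo a b))
    (hlim : ∀ᵐ x, x ∈ Ioo a b → Tendsto (F x) l (𝓝 (fb x)))
    (hdom : ∀ᵐ x, x ∈ Ioo a b → ∀ y ∈ s, ‖F x y‖ ≤ g x) (hg : IntegrableOn g (Ioo a b)) :
    IntegrableOn fb (Ioo a b) := by
  classical
  have hm : AEStronglyMeasurable fb (volume.restrict (Ioo a b)) := by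
    refine aestronglyMeasurable_of_tendsto_ae (𝓝[>] (0 : ℝ))
      (f := fun ε x => if h ε ∈ s then F x (h ε) else 0) (fun ε => ?_) ?_
    · by_cases hε : h ε ∈ s
      · simpa only [hε, if_true] using (hcont _ hε).aestronglyMeasurable measurableSet_Ioo
      · simp only [hε, if_false]
        exact aestronglyMeasurable_const
    · filter_upwards [ae_restrict_mem measurableSet_Ioo, ae_restrict_of_ae hlim] with x hx hx2
      refine ((hx2 hx).comp hl).congr' ?_
      filter_upwards [hs] with ε hε
      simp [hε]
  refine Integrable.mono' hg hm ?_
  filter_upwards [ae_restrict_mem measurableSet_Ioo, ae_restrict_of_ae hlim,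
    ae_restrict_of_ae hdom] with x hx hx2 hx3
  refine le_of_tendsto ((hx2 hx).comp hl).norm ?_
  filter_upwards [hs] with ε hε using hx3 hx _ hε

/-- Cauchy's theorem for a rectangle and a function that has boundary values almost everywhere on
the sides and is dominated by integrable functions. -/
theorem integral_boundary_rect_eq_zero_of_dominated {f : ℂ → E} {a b c d : ℝ} (hab : a < b)
    (hcd : c < d) (hf : DifferentiableOn ℂ f (Ioo a b ×ℂ Ioo c d))
    {fb ft fl fr : ℝ → E} {g₁ g₂ : ℝ → ℝ}
    (hb : ∀ᵐ x : ℝ, x ∈ Ioo a b → Tendsto (fun y : ℝ => f (x + y * I)) (𝓝[>] c) (𝓝 (fb x)))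
    (ht : ∀ᵐ x : ℝ, x ∈ Ioo a b → Tendsto (fun y : ℝ => f (x + y * I)) (𝓝[<] d) (𝓝 (ft x)))
    (hl : ∀ᵐ y : ℝ, y ∈ Ioo c d → Tendsto (fun x : ℝ => f (x + y * I)) (𝓝[>] a) (𝓝 (fl y)))
    (hr : ∀ᵐ y : ℝ, y ∈ Ioo c d → Tendsto (fun x : ℝ => f (x + y * I)) (𝓝[<] b) (𝓝 (fr y)))
    (h₁ : ∀ x ∈ Ioo a b, ∀ y ∈ Ioo c d, ‖f (x + y * I)‖ ≤ g₁ x)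
    (h₂ : ∀ᵐ y : ℝ, y ∈ Ioo c d → ∀ x ∈ Ioo a b, ‖f (x + y * I)‖ ≤ g₂ y)
    (hg₁ : IntegrableOn g₁ (Ioo a b)) (hg₂ : IntegrableOn g₂ (Ioo c d)) :
    (IntegrableOn fb (Ioo a b) ∧ IntegrableOn ft (Ioo a b) ∧ IntegrableOn fl (Ioo c d) ∧
      IntegrableOn fr (Ioo c d)) ∧
    (∫ x in a..b, fb x) - (∫ x in a..b, ft x) + I • (∫ y in c..d, fr y)
      - I • (∫ y in c..d, fl y) = 0 := by
  have hadd : ∀ u : ℝ, Tendsto (fun ε : ℝ => u + ε) (𝓝[>] 0) (𝓝[>] u) := fun u => by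
    refine tendsto_nhdsWithin_iff.2 ⟨?_, ?_⟩
    · exact ((continuous_const.add continuous_id).tendsto' 0 u (by simp)).mono_left
        nhdsWithin_le_nhds
    · filter_upwards [self_mem_nhdsWithin] with ε h0
      have h0 : 0 < ε := h0
      simp [h0]
  have hsub : ∀ u : ℝ, Tendsto (fun ε : ℝ => u - ε) (𝓝[>] 0) (𝓝[<] u) := fun u => by
    refine tendsto_nhdsWithin_iff.2 ⟨?_, ?_⟩
    · exact ((continuous_const.sub continuous_id).tendsto' 0 u (by simp)).mono_left
        nhdsWithin_le_nhds
    · filter_upwards [self_mem_nhdsWithin] with ε h0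
      have h0 : 0 < ε := h0
      simp [h0]
  have madd : ∀ {u v : ℝ}, u < v → ∀ᶠ ε in 𝓝[>] (0 : ℝ), u + ε ∈ Ioo u v := fun huv =>
    (hadd _).eventually (Ioo_mem_nhdsGT huv)
  have msub : ∀ {u v : ℝ}, u < v → ∀ᶠ ε in 𝓝[>] (0 : ℝ), v - ε ∈ Ioo u v := fun huv =>
    (hsub _).eventually (Ioo_mem_nhdsLT huv)
  have hc1 : ∀ y ∈ Ioo c d, ContinuousOn (fun x : ℝ => f (x + y * I)) (Ioo a b) := fun y hy =>
    hf.continuousOn.comp (by fun_prop) fun x hx => by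
      simp only [mem_reProdIm]; simpa using And.intro hx hy
  have hc2 : ∀ x ∈ Ioo a b, ContinuousOn (fun y : ℝ => f (x + y * I)) (Ioo c d) := fun x hx =>
    hf.continuousOn.comp (by fun_prop) fun y hy => by
      simp only [mem_reProdIm]; simpa using And.intro hx hy
  have h₁' : ∀ᵐ x : ℝ, x ∈ Ioo a b → ∀ y ∈ Ioo c d, ‖f (x + y * I)‖ ≤ g₁ x := ae_of_all _ h₁
  refine ⟨⟨integrableOn_of_boundary (F := fun x y => f (x + y * I)) (hadd c) (madd hcd) hc1 hb h₁' hg₁,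
    integrableOn_of_boundary (F := fun x y => f (x + y * I)) (hsub d) (msub hcd) hc1 ht h₁' hg₁,
    integrableOn_of_boundary (F := fun y x => f (x + y * I)) (hadd a) (madd hab) hc2 hl h₂ hg₂,
    integrableOn_of_boundary (F := fun y x => f (x + y * I)) (hsub b) (msub hab) hc2 hr h₂ hg₂⟩, ?_⟩
  have T1 := tendsto_integral_shrink (F := fun x y => f (x + y * I)) hab (hadd c) (madd hcd) hc1 hb
    h₁' hg₁
  have T2 := tendsto_integral_shrink (F := fun x y => f (x + y * I)) hab (hsub d) (msub hcd) hc1 ht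
    h₁' hg₁
  have T3 := tendsto_integral_shrink (F := fun y x => f (x + y * I)) hcd (hsub b) (msub hab) hc2 hr
    h₂ hg₂
  have T4 := tendsto_integral_shrink (F := fun y x => f (x + y * I)) hcd (hadd a) (madd hab) hc2 hl
    h₂ hg₂
  have T := ((T1.sub T2).add (T3.const_smul I)).sub (T4.const_smul I)
  -- On the rectangle shrunk by ε the classical theorem applies, so the combination is zero for all
  -- small ε.
  refine tendsto_nhds_unique_of_eventuallyEq T tendsto_const_nhds ?_
  have e1 : ∀ᶠ ε in 𝓝[>] (0 : ℝ), ε < (b - a) / 2 :=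
    nhdsWithin_le_nhds (gt_mem_nhds (by linarith))
  have e2 : ∀ᶠ ε in 𝓝[>] (0 : ℝ), ε < (d - c) / 2 :=
    nhdsWithin_le_nhds (gt_mem_nhds (by linarith))
  filter_upwards [e1, e2, self_mem_nhdsWithin] with ε e1 e2 h0
  have h0 : 0 < ε := h0
  have := integral_boundary_rect_eq_zero_of_differentiableOn f
    (⟨a + ε, c + ε⟩ : ℂ) (⟨b - ε, d - ε⟩ : ℂ) (hf.mono ?_)
  · simpa using this
  · simp only
    rw [uIcc_of_le (by linarith), uIcc_of_le (by linarith)]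
    intro z hz
    rw [mem_reProdIm] at hz ⊢
    exact ⟨⟨by linarith [hz.1.1], by linarith [hz.1.2]⟩,
      ⟨by linarith [hz.2.1], by linarith [hz.2.2]⟩⟩

/-- **Painlevé's theorem** for a horizontal line: a function that is continuous on a ball and
differentiable off a horizontal line is differentiable. -/
theorem differentiableOn_ball_of_im_ne [CompleteSpace E] {f : ℂ → E} {c : ℂ} {r y₀ : ℝ}
    (hc : ContinuousOn f (ball c r)) (hd : ∀ z ∈ ball c r, z.im ≠ y₀ → DifferentiableAt ℂ f z) :
    DifferentiableOn ℂ f (ball c r) := by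
  refine (IsConservativeOn.isExactOn_ball hc ?_).differentiableOn isOpen_ball
  intro z w hzw
  rw [← add_eq_zero_iff_eq_neg, wedgeIntegral_add_wedgeIntegral_eq]
  have hzw' : ([[z.re, w.re]] ×ℂ [[z.im, w.im]]) ⊆ ball c r := hzw
  -- a rectangle whose interior does not meet the line
  have base : ∀ z w : ℂ, ([[z.re, w.re]] ×ℂ [[z.im, w.im]]) ⊆ ball c r →
      y₀ ∉ Ioo (min z.im w.im) (max z.im w.im) →
      (∫ x : ℝ in z.re..w.re, f (x + z.im * I)) - (∫ x : ℝ in z.re..w.re, f (x + w.im * I)) +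
        I • (∫ y : ℝ in z.im..w.im, f (w.re + y * I)) -
        I • (∫ y : ℝ in z.im..w.im, f (z.re + y * I)) = 0 := by
    intro z w hsub hy
    refine integral_boundary_rect_eq_zero_of_continuousOn_of_differentiableOn f z w
      (hc.mono hsub) fun u hu => ?_
    refine (hd u (hsub ?_) ?_).differentiableWithinAt
    · exact ⟨Ioo_subset_Icc_self hu.1, Ioo_subset_Icc_self hu.2⟩
    · rintro rfl
      exact hy hu.2
  -- A rectangle that straddles the line is cut along it. Each half has a holomorphic interior and
  -- continuous boundary values, and the two integrals over the common side cancel.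
  by_cases hy : y₀ ∈ Ioo (min z.im w.im) (max z.im w.im)
  · have hmem : y₀ ∈ [[z.im, w.im]] := Ioo_subset_Icc_self hy
    have s1 : [[z.im, y₀]] ⊆ [[z.im, w.im]] := uIcc_subset_uIcc_left hmem
    have s2 : [[y₀, w.im]] ⊆ [[z.im, w.im]] := uIcc_subset_uIcc_right hmem
    have b1 := base z ⟨w.re, y₀⟩ ?_ ?_
    · have b2 := base ⟨z.re, y₀⟩ w ?_ ?_
      · simp only at b1 b2
        have i : ∀ x ∈ [[z.re, w.re]], ∀ u v : ℝ, u ∈ [[z.im, w.im]] → v ∈ [[z.im, w.im]] →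
            IntervalIntegrable (fun y : ℝ => f (x + y * I)) volume u v := by
          intro x hx u v hu hv
          refine (hc.comp (by fun_prop) fun y hy => hzw' ?_).intervalIntegrable
          rw [mem_reProdIm]
          simpa using And.intro hx (uIcc_subset_uIcc hu hv hy)
        rw [← intervalIntegral.integral_add_adjacent_intervals
            (i w.re right_mem_uIcc _ _ left_mem_uIcc hmem)
            (i w.re right_mem_uIcc _ _ hmem right_mem_uIcc),
          ← intervalIntegral.integral_add_adjacent_intervals
            (i z.re left_mem_uIcc _ _ left_mem_uIcc hmem)
            (i z.re left_mem_uIcc _ _ hmem right_mem_uIcc)]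
        rw [← add_zero (0 : E)]
        nth_rw 1 [← b1]
        rw [← b2]
        simp only [smul_add]
        abel
      · exact fun u hu => hzw' ⟨hu.1, s2 hu.2⟩
      · simp only [mem_Ioo, not_and_or, not_lt]
        rcases le_total y₀ w.im with h | h <;> simp [h]
    · exact fun u hu => hzw' ⟨hu.1, s1 hu.2⟩
    · simp only [mem_Ioo, not_and_or, not_lt]
      rcases le_total y₀ z.im with h | h <;> simp [h]
  · exact base z w hzw' hy

/-- **Painlevé's theorem** for a vertical line. -/
theorem differentiableOn_ball_of_re_ne [CompleteSpace E] {f : ℂ → E} {c : ℂ} {r x₀ : ℝ}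
    (hc : ContinuousOn f (ball c r)) (hd : ∀ z ∈ ball c r, z.re ≠ x₀ → DifferentiableAt ℂ f z) :
    DifferentiableOn ℂ f (ball c r) := by
  -- Multiplication by `I` turns the vertical line into a horizontal one.
  have hball : ∀ z, z ∈ ball (I * c) r → -I * z ∈ ball c r := fun z hz => by
    rw [mem_ball, dist_eq] at hz ⊢
    calc ‖-I * z - c‖ = ‖-I * (z - I * c)‖ := by
          congr 1; linear_combination -c * I_sq
      _ < r := by simpa using hz
  have h := differentiableOn_ball_of_im_ne (f := fun z => f (-I * z)) (c := I * c) (r := r)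
    (y₀ := x₀) (hc.comp (by fun_prop) hball) fun z hz hz' => by
      have : DifferentiableAt ℂ f (-I * z) := hd _ (hball z hz) (by simpa using hz')
      exact this.comp z (by fun_prop)
  have h2 : DifferentiableOn ℂ (fun z => (fun z => f (-I * z)) (I * z)) (ball c r) := by
    refine h.comp (by fun_prop) fun z hz => ?_
    rw [mem_ball, dist_eq] at hz ⊢
    rw [← mul_sub]; simpa using hz
  refine h2.congr fun z _ => ?_
  simp only
  congr 1
  linear_combination z * I_sq

/-- Removal of finitely many isolated singularities in an open set. -/
theorem exists_differentiableAt_of_isolated [CompleteSpace E] {Ω : Set ℂ} (hΩ : IsOpen Ω)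
    {f : ℂ → E} (S : Finset ℂ)
    (hS : ∀ z ∈ S, z ∈ Ω) (hd : ∀ z ∈ Ω, z ∉ S → DifferentiableAt ℂ f z)
    (ho : ∀ z ∈ S, Tendsto (fun k => (k - z) • f k) (𝓝[≠] z) (𝓝 0)) :
    ∃ g : ℂ → E, (∀ z ∈ Ω, DifferentiableAt ℂ g z) ∧ ∀ z ∉ S, g z = f z := by
  classical
  induction S using Finset.induction_on generalizing f with
  | empty => exact ⟨f, fun z hz => hd z hz (by simp), fun _ _ => rfl⟩
  | insert c S hcS ih =>
    set f' := Function.update f c (limUnder (𝓝[≠] c) f) with hf'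
    have hSo : IsOpen (Ω ∩ (↑S : Set ℂ)ᶜ) := hΩ.inter S.finite_toSet.isClosed.isOpen_compl
    have hSc : Ω ∩ (↑S : Set ℂ)ᶜ ∈ 𝓝 c := hSo.mem_nhds ⟨hS c (by simp), by simpa⟩
    -- Subtracting the constant `f c` is harmless, since (z - c) • f c tends to zero.
    have ho' : (fun z => f z - f c) =o[𝓝[≠] c] fun z => (z - c)⁻¹ := by
      have h1 : Tendsto (fun k => (k - c) • (f k - f c)) (𝓝[≠] c) (𝓝 0) := by
        have h2 : Tendsto (fun k => (k - c) • f c) (𝓝[≠] c) (𝓝 0) := by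
          have : Continuous fun k => (k - c) • f c := by fun_prop
          exact (this.tendsto' c 0 (by simp)).mono_left nhdsWithin_le_nhds
        simpa [smul_sub] using (ho c (by simp)).sub h2
      rw [isLittleO_iff]
      intro ε hε
      have h3 := (tendsto_zero_iff_norm_tendsto_zero.1 h1).eventually (gt_mem_nhds hε)
      filter_upwards [h3, self_mem_nhdsWithin] with z hz hne
      have hpos : 0 < ‖z - c‖ := norm_pos_iff.2 (sub_ne_zero.2 hne)
      rw [norm_smul] at hz
      rw [norm_inv, ← div_eq_mul_inv, le_div_iff₀ hpos]
      linarith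
    have hd' : DifferentiableOn ℂ f' (Ω ∩ (↑S : Set ℂ)ᶜ) :=
      differentiableOn_update_limUnder_of_isLittleO hSc
        (fun z hz => (hd z hz.1.1 (by
          simp only [Finset.mem_insert, not_or]
          exact ⟨hz.2, by simpa using hz.1.2⟩)).differentiableWithinAt) ho'
    obtain ⟨g, hg, hgf⟩ := ih (fun z hz => hS z (by simp [hz]))
      (fun z hz hzS => hd'.differentiableAt (hSo.mem_nhds ⟨hz, by simpa⟩)) fun z hz => by
        have hne : z ≠ c := fun h => hcS (h ▸ hz)
        refine (ho z (by simp [hz])).congr' ?_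
        have : ∀ᶠ k in 𝓝[≠] z, k ≠ c := nhdsWithin_le_nhds (isOpen_ne.mem_nhds hne)
        filter_upwards [this] with k hk
        rw [hf', Function.update_of_ne hk]
    refine ⟨g, hg, fun z hz => ?_⟩
    simp only [Finset.mem_insert, not_or] at hz
    rw [hgf z hz.2, hf', Function.update_of_ne hz.1]

end Cauchy

end CounterflowNLS

/-! ### Contour deformation outside a disc, with a jump on the real line -/

namespace CounterflowNLS

/-- The two rays of the real line outside of `[-R, R]`. -/
def rays (R : ℝ) : Set ℝ := {ξ | R < |ξ|}

theorem measurableSet_rays (R : ℝ) : MeasurableSet (rays R) :=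
  (isOpen_lt continuous_const continuous_abs).measurableSet

theorem rays_eq (R : ℝ) : rays R = Set.Iio (-R) ∪ Set.Ioi R := by
  ext ξ
  simp only [rays, Set.mem_ofPred_eq, Set.mem_union, Set.mem_Iio, Set.mem_Ioi, lt_abs]
  constructor
  · rintro (h | h)
    · exact Or.inr h
    · exact Or.inl (by linarith)
  · rintro (h | h)
    · exact Or.inr (by linarith)
    · exact Or.inl h

theorem integrableOn_comp_neg_iff {E : Type*} [NormedAddCommGroup E] {f : ℝ → E} {s : Set ℝ} :
    IntegrableOn (fun ξ => f (-ξ)) ((fun ξ : ℝ => -ξ) ⁻¹' s) ↔ IntegrableOn f s := by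
  have me : MeasurableEmbedding (fun ξ : ℝ => -ξ) :=
    (Homeomorph.neg ℝ).isClosedEmbedding.measurableEmbedding
  have := me.integrableOn_map_iff (f := f) (μ := volume) (s := s)
  rw [Measure.map_neg_eq_self] at this
  exact this.symm

theorem integrableOn_inv_sq_rays {R : ℝ} (hR : 0 < R) :
    IntegrableOn (fun ξ : ℝ => (ξ ^ 2)⁻¹) (rays R) := by
  have h : IntegrableOn (fun ξ : ℝ => (ξ ^ 2)⁻¹) (Set.Ioi R) := by
    refine (integrableOn_Ioi_rpow_of_lt (by norm_num : (-2 : ℝ) < -1) hR).congr_fun ?_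
      measurableSet_Ioi
    intro x hx
    have hx : R < x := hx
    simp only
    rw [Real.rpow_neg (by linarith)]
    norm_num
  rw [rays_eq R]
  refine IntegrableOn.union ?_ h
  rw [← integrableOn_comp_neg_iff]
  simpa using h

section Rays

open Complex Set Metric
open scoped Interval Real

variable {E : Type*} [NormedAddCommGroup E] [NormedSpace ℂ E]

theorem tendsto_add_mul_I (ξ : ℝ) :
    Tendsto (fun η : ℝ => (ξ : ℂ) + η * I) (𝓝[>] 0) (𝓝[{z | 0 < z.im}] (ξ : ℂ)) := by
  refine tendsto_nhdsWithin_iff.2 ⟨?_, ?_⟩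
  · have : Continuous fun η : ℝ => (ξ : ℂ) + η * I := by fun_prop
    exact (this.tendsto' 0 _ (by simp)).mono_left nhdsWithin_le_nhds
  · filter_upwards [self_mem_nhdsWithin] with η hη
    simpa using hη

omit [NormedSpace ℂ E] in
theorem norm_le_of_boundary {h : ℂ → E} {v : E} {g : ℝ → ℝ} {R ξ : ℝ} (hξ : R < |ξ|)
    (hlim : Tendsto h (𝓝[{z | 0 < z.im}] (ξ : ℂ)) (𝓝 v)) (hg : ContinuousAt g |ξ|)
    (hb : ∀ k : ℂ, R ≤ ‖k‖ → 0 < k.im → ‖h k‖ ≤ g ‖k‖) : ‖v‖ ≤ g |ξ| := by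
  have h1 := (hlim.comp (tendsto_add_mul_I ξ)).norm
  have h2 : Tendsto (fun η : ℝ => ‖(ξ : ℂ) + η * I‖) (𝓝[>] 0) (𝓝 |ξ|) := by
    have : Continuous fun η : ℝ => ‖(ξ : ℂ) + η * I‖ := by fun_prop
    exact (this.tendsto' 0 _ (by simp)).mono_left nhdsWithin_le_nhds
  refine le_of_tendsto_of_tendsto h1 (hg.tendsto.comp h2) ?_
  filter_upwards [self_mem_nhdsWithin, h2.eventually (lt_mem_nhds hξ)] with η hη hn
  have hη : 0 < η := hη
  exact hb _ hn.le (by simpa using hη)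

omit [NormedSpace ℂ E] in
/-- Boundary values from above on the rays are measurable. -/
theorem aestronglyMeasurable_boundary {h : ℂ → E} {hp : ℝ → E} {R : ℝ}
    (hd : ∀ k : ℂ, R ≤ ‖k‖ → 0 < k.im → ContinuousAt h k)
    (hlim : ∀ ξ : ℝ, R < |ξ| → Tendsto h (𝓝[{z | 0 < z.im}] (ξ : ℂ)) (𝓝 (hp ξ))) :
    AEStronglyMeasurable hp (volume.restrict (rays R)) := by
  refine aestronglyMeasurable_of_tendsto_ae (𝓝[>] (0 : ℝ))
    (f := fun (η : ℝ) (ξ : ℝ) => if 0 < η then h (ξ + η * I) else 0) (fun η => ?_) ?_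
  · by_cases hη : 0 < η
    · simp only [hη, if_true]
      refine ContinuousOn.aestronglyMeasurable (fun ξ hξ => ?_) (measurableSet_rays R)
      have hξ : R < |ξ| := hξ
      have h1 : ContinuousAt h ((ξ : ℂ) + η * I) := by
        refine hd _ ?_ (by simpa using hη)
        calc R ≤ |ξ| := hξ.le
          _ = |((ξ : ℂ) + η * I).re| := by simp
          _ ≤ _ := abs_re_le_norm _
      exact (ContinuousAt.comp (f := fun ξ : ℝ => (ξ : ℂ) + η * I) h1
        (by fun_prop)).continuousWithinAt
    · simp only [hη, if_false]
      exact aestronglyMeasurable_const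
  · filter_upwards [ae_restrict_mem (measurableSet_rays R)] with ξ hξ
    refine ((hlim ξ hξ).comp (tendsto_add_mul_I ξ)).congr' ?_
    filter_upwards [self_mem_nhdsWithin] with η hη
    have hη : 0 < η := hη
    simp [hη]

omit [NormedSpace ℂ E] in
theorem integrableOn_rays_boundary {h : ℂ → E} {hp : ℝ → E} {R C : ℝ} (hR : 0 < R)
    (hd : ∀ k : ℂ, R ≤ ‖k‖ → 0 < k.im → ContinuousAt h k)
    (hlim : ∀ ξ : ℝ, R < |ξ| → Tendsto h (𝓝[{z | 0 < z.im}] (ξ : ℂ)) (𝓝 (hp ξ)))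
    (hb : ∀ k : ℂ, R ≤ ‖k‖ → 0 < k.im → ‖h k‖ ≤ C * (‖k‖ ^ 2)⁻¹) :
    IntegrableOn hp (rays R) := by
  refine Integrable.mono' ((integrableOn_inv_sq_rays hR).const_mul C)
    (aestronglyMeasurable_boundary hd hlim) ?_
  filter_upwards [ae_restrict_mem (measurableSet_rays R)] with ξ hξ
  have hξ : R < |ξ| := hξ
  have h0 : |ξ| ≠ 0 := by linarith
  have := norm_le_of_boundary (g := fun u => C * (u ^ 2)⁻¹) hξ (hlim ξ hξ)
    (by fun_prop (disch := positivity)) hb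
  simpa using this

/-- Deformation of a contour from the two rays to the upper half of a circle. -/
theorem setIntegral_rays_eq_upper_arc {h : ℂ → E} {hp : ℝ → E} {R C : ℝ} (hR : 0 < R)
    (hd : ∀ k : ℂ, R ≤ ‖k‖ → 0 < k.im → DifferentiableAt ℂ h k)
    (hlim : ∀ ξ : ℝ, R < |ξ| → Tendsto h (𝓝[{z | 0 < z.im}] (ξ : ℂ)) (𝓝 (hp ξ)))
    (hb : ∀ k : ℂ, R ≤ ‖k‖ → 0 < k.im → ‖h k‖ ≤ C * (‖k‖ ^ 2)⁻¹) :
    ∫ ξ in rays R, hp ξ = ∫ y in (0 : ℝ)..π, (circleMap 0 R y * I) • h (circleMap 0 R y) := by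
  have hint := integrableOn_rays_boundary hR (fun k h1 h2 => (hd k h1 h2).continuousAt) hlim hb
  have hC : 0 ≤ C := by
    have h1 := hb (R * I) (by simp [abs_of_pos hR]) (by simpa)
    have h2 := (norm_nonneg _).trans h1
    by_contra hneg
    have : C * (‖(R * I : ℂ)‖ ^ 2)⁻¹ < 0 :=
      mul_neg_of_neg_of_pos (not_le.1 hneg) (by simp; positivity)
    linarith
  -- Logarithmic coordinates: exp maps the half strip Re w > log R, 0 < Im w < π onto the part of
  -- the upper half plane outside the disc. The horizontal sides go to the rays and the left side to
  -- the arc, so only rectangles are needed.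
  set a := Real.log R with ha
  have hea : Real.exp a = R := Real.exp_log hR
  set H : ℂ → E := fun w => exp w • h (exp w) with hH
  have hexp : ∀ x y : ℝ, exp ((x : ℂ) + y * I) = circleMap 0 (Real.exp x) y := fun x y => by
    simp [circleMap, exp_add]
  have him : ∀ x y : ℝ, (exp ((x : ℂ) + y * I)).im = Real.exp x * Real.sin y := fun x y => by
    simp [exp_im]
  have hnorm : ∀ x y : ℝ, ‖exp ((x : ℂ) + y * I)‖ = Real.exp x := fun x y => by
    simp [norm_exp]
  have hge : ∀ x : ℝ, a ≤ x → R ≤ Real.exp x := fun x hx => hea ▸ Real.exp_le_exp.2 hx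
  have hbd : ∀ x y : ℝ, a ≤ x → y ∈ Ioo 0 π → ‖H (x + y * I)‖ ≤ C * Real.exp (-x) := by
    intro x y hx hy
    have h1 := hb (exp ((x : ℂ) + y * I)) (by rw [hnorm]; exact hge x hx)
      (by rw [him]; exact mul_pos (Real.exp_pos _) (Real.sin_pos_of_mem_Ioo hy))
    rw [hnorm] at h1
    rw [hH]
    simp only [norm_smul]
    rw [hnorm]
    calc Real.exp x * ‖h (exp (x + y * I))‖ ≤ Real.exp x * (C * (Real.exp x ^ 2)⁻¹) := by gcongr
      _ = C * Real.exp (-x) := by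
        rw [Real.exp_neg]; field_simp
  have hdiff : ∀ x y : ℝ, a ≤ x → y ∈ Ioo 0 π → DifferentiableAt ℂ H (x + y * I) := by
    intro x y hx hy
    have h1 : DifferentiableAt ℂ h (exp ((x : ℂ) + y * I)) :=
      hd _ (by rw [hnorm]; exact hge x hx)
        (by rw [him]; exact mul_pos (Real.exp_pos _) (Real.sin_pos_of_mem_Ioo hy))
    exact differentiableAt_exp.smul (h1.comp _ differentiableAt_exp)
  have hrect : ∀ L : ℝ, a < L →
      (∫ x in a..L, Real.exp x • hp (Real.exp x)) - (∫ x in a..L, -(Real.exp x • hp (-Real.exp x)))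
        + I • (∫ y in (0 : ℝ)..π, H (L + y * I)) - I • (∫ y in (0 : ℝ)..π, H (a + y * I)) = 0 := by
    intro L hL
    refine (integral_boundary_rect_eq_zero_of_dominated (f := H) hL Real.pi_pos
      (g₁ := fun x => C * Real.exp (-x)) (g₂ := fun _ => C * Real.exp (-a)) ?_ ?_ ?_ ?_ ?_ ?_ ?_ ?_
      ?_).2
    · intro z hz
      rw [mem_reProdIm] at hz
      have := hdiff z.re z.im hz.1.1.le hz.2
      rw [re_add_im] at this
      exact this.differentiableWithinAt
    · refine ae_of_all _ fun x hx => ?_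
      have hc : Continuous fun y : ℝ => exp ((x : ℂ) + y * I) := by fun_prop
      have t0 : Tendsto (fun y : ℝ => exp ((x : ℂ) + y * I)) (𝓝[>] 0) (𝓝 (Real.exp x : ℂ)) :=
        (hc.tendsto' 0 _ (by simp)).mono_left nhdsWithin_le_nhds
      have t1 : Tendsto (fun y : ℝ => exp ((x : ℂ) + y * I)) (𝓝[>] 0)
          (𝓝[{z | 0 < z.im}] ((Real.exp x : ℝ) : ℂ)) := by
        refine tendsto_nhdsWithin_iff.2 ⟨t0, ?_⟩
        filter_upwards [Ioo_mem_nhdsGT Real.pi_pos] with y hy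
        rw [him]
        exact mul_pos (Real.exp_pos _) (Real.sin_pos_of_mem_Ioo hy)
      have := t0.smul ((hlim (Real.exp x) (by
        rw [abs_of_pos (Real.exp_pos _), ← hea]; exact Real.exp_lt_exp.2 hx.1)).comp t1)
      simpa [coe_smul, -ofReal_exp] using this
    · refine ae_of_all _ fun x hx => ?_
      have hc : Continuous fun y : ℝ => exp ((x : ℂ) + y * I) := by fun_prop
      have t0 : Tendsto (fun y : ℝ => exp ((x : ℂ) + y * I)) (𝓝[<] π)
          (𝓝 ((-Real.exp x : ℝ) : ℂ)) :=
        (hc.tendsto' π _ (by simp [exp_add])).mono_left nhdsWithin_le_nhds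
      have t1 : Tendsto (fun y : ℝ => exp ((x : ℂ) + y * I)) (𝓝[<] π)
          (𝓝[{z | 0 < z.im}] ((-Real.exp x : ℝ) : ℂ)) := by
        refine tendsto_nhdsWithin_iff.2 ⟨t0, ?_⟩
        filter_upwards [Ioo_mem_nhdsLT Real.pi_pos] with y hy
        rw [him]
        exact mul_pos (Real.exp_pos _) (Real.sin_pos_of_mem_Ioo hy)
      have := t0.smul ((hlim (-Real.exp x) (by
        rw [abs_neg, abs_of_pos (Real.exp_pos _), ← hea]; exact Real.exp_lt_exp.2 hx.1)).comp t1)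
      rw [← neg_smul]
      simpa only [coe_smul, Function.comp_def, hH] using this
    · refine ae_of_all _ fun y hy => ?_
      have hc : Continuous fun x : ℝ => (x : ℂ) + y * I := by fun_prop
      exact ((hdiff a y le_rfl hy).continuousAt.tendsto.comp (hc.tendsto a)).mono_left
        nhdsWithin_le_nhds
    · refine ae_of_all _ fun y hy => ?_
      have hc : Continuous fun x : ℝ => (x : ℂ) + y * I := by fun_prop
      exact ((hdiff L y hL.le hy).continuousAt.tendsto.comp (hc.tendsto L)).mono_left
        nhdsWithin_le_nhds
    · exact fun x hx y hy => hbd x y hx.1.le hy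
    · refine ae_of_all _ fun y hy x hx => (hbd x y hx.1.le hy).trans ?_
      exact mul_le_mul_of_nonneg_left (Real.exp_le_exp.2 (by linarith [hx.1])) hC
    · exact (Continuous.integrableOn_Icc (by fun_prop)).mono_set Ioo_subset_Icc_self
    · exact (continuous_const.integrableOn_Icc).mono_set Ioo_subset_Icc_self
  have himg : Real.exp '' Ioi a = Ioi R := by
    ext u
    simp only [mem_image, mem_Ioi]
    constructor
    · rintro ⟨x, hx, rfl⟩
      rw [← hea]; exact Real.exp_lt_exp.2 hx
    · intro hu
      exact ⟨Real.log u, Real.log_lt_log hR hu, Real.exp_log (hR.trans hu)⟩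
  rw [rays_eq R] at hint ⊢
  have hIoi : IntegrableOn hp (Ioi R) := hint.mono_set subset_union_right
  have hIio : IntegrableOn hp (Iio (-R)) := hint.mono_set subset_union_left
  have hIoi' : IntegrableOn (fun ξ => hp (-ξ)) (Ioi R) := by
    rw [← integrableOn_comp_neg_iff] at hIio
    simpa using hIio
  -- The substitution ξ = exp x turns the horizontal sides into integrals over the rays.
  have cv : ∀ u : ℝ → E, IntegrableOn u (Ioi R) →
      Tendsto (fun L : ℝ => ∫ x in a..L, Real.exp x • u (Real.exp x)) atTop
        (𝓝 (∫ ξ in Ioi R, u ξ)) := by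
    intro u hu
    have hder : ∀ x ∈ Ioi a, HasDerivWithinAt Real.exp (Real.exp x) (Ioi a) x :=
      fun x _ => (Real.hasDerivAt_exp x).hasDerivWithinAt
    rw [← himg] at hu ⊢
    rw [integral_image_eq_integral_abs_deriv_smul measurableSet_Ioi hder
      Real.exp_injective.injOn]
    rw [integrableOn_image_iff_integrableOn_abs_deriv_smul measurableSet_Ioi hder
      Real.exp_injective.injOn] at hu
    simp only [Real.abs_exp] at hu ⊢
    exact intervalIntegral_tendsto_integral_Ioi a hu tendsto_id
  have hdisj : Disjoint (Iio (-R)) (Ioi R) := Set.disjoint_left.2 fun x h1 h2 => by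
    have h1 : x < -R := h1
    have h2 : R < x := h2
    linarith
  rw [setIntegral_union hdisj
    measurableSet_Ioi hIio hIoi]
  have hneg : ∫ ξ in Iio (-R), hp ξ = ∫ ξ in Ioi R, hp (-ξ) := by
    rw [← integral_Iic_eq_integral_Iio, integral_comp_neg_Ioi]
  rw [hneg]
  -- The right side of the rectangle vanishes in the limit: decay like ‖k‖⁻² beats the factor ‖k‖ of
  -- the change of variables.
  have T3 : Tendsto (fun L : ℝ => I • ∫ y in (0 : ℝ)..π, H (L + y * I)) atTop (𝓝 0) := by
    rw [tendsto_zero_iff_norm_tendsto_zero]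
    have hz : Tendsto (fun L : ℝ => C * Real.exp (-L) * |π - 0|) atTop (𝓝 0) := by
      have := (Real.tendsto_exp_neg_atTop_nhds_zero.const_mul C).mul_const |π - 0|
      simpa using this
    refine squeeze_zero' (Eventually.of_forall fun L => norm_nonneg _) ?_ hz
    filter_upwards [eventually_ge_atTop a] with L hL
    rw [norm_smul, norm_I, one_mul]
    refine intervalIntegral.norm_integral_le_of_norm_le_const_ae ?_
    have hpi : ∀ᵐ y : ℝ, y ≠ π := by simp [ae_iff, measure_singleton]
    filter_upwards [hpi] with y hne hy
    rw [uIoc_of_le Real.pi_pos.le] at hy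
    exact hbd L y hL ⟨hy.1, lt_of_le_of_ne hy.2 hne⟩
  have T := (((cv _ hIoi').add (cv _ hIoi)).add T3)
  rw [add_zero] at T
  have e : (fun L : ℝ => ((∫ x in a..L, Real.exp x • hp (-Real.exp x)) +
      ∫ x in a..L, Real.exp x • hp (Real.exp x)) + I • ∫ y in (0 : ℝ)..π, H (L + y * I))
      =ᶠ[atTop] fun _ => I • ∫ y in (0 : ℝ)..π, H (a + y * I) := by
    filter_upwards [eventually_gt_atTop a] with L hL
    have := hrect L hL
    rw [intervalIntegral.integral_neg, sub_neg_eq_add, sub_eq_zero] at this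
    rw [← this]; abel
  rw [tendsto_nhds_unique_of_eventuallyEq T tendsto_const_nhds e,
    ← intervalIntegral.integral_smul]
  refine intervalIntegral.integral_congr fun y _ => ?_
  simp only [hH]
  rw [hexp, hea, smul_smul, mul_comm]

/-- **Cauchy's theorem outside of a disk**, for a function with a jump on the real line. -/
theorem circleIntegral_eq_setIntegral_jump {h : ℂ → E} {hp hm : ℝ → E} {R C : ℝ} (hR : 0 < R)
    (hd : ∀ k : ℂ, R ≤ ‖k‖ → k.im ≠ 0 → DifferentiableAt ℂ h k)
    (hlimp : ∀ ξ : ℝ, R < |ξ| → Tendsto h (𝓝[{z | 0 < z.im}] (ξ : ℂ)) (𝓝 (hp ξ)))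
    (hlimm : ∀ ξ : ℝ, R < |ξ| → Tendsto h (𝓝[{z | z.im < 0}] (ξ : ℂ)) (𝓝 (hm ξ)))
    (hb : ∀ k : ℂ, R ≤ ‖k‖ → k.im ≠ 0 → ‖h k‖ ≤ C * (‖k‖ ^ 2)⁻¹) :
    (∮ k in C(0, R), h k) = ∫ ξ in rays R, (hp ξ - hm ξ) := by
  -- The lower half plane reduces to the upper one by k ↦ -k, which preserves the pair of rays.
  have hneg : ∀ ξ : ℝ, Tendsto (fun k : ℂ => -k) (𝓝[{z | 0 < z.im}] (ξ : ℂ))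
      (𝓝[{z | z.im < 0}] ((-ξ : ℝ) : ℂ)) := fun ξ => by
    refine tendsto_nhdsWithin_iff.2 ⟨?_, ?_⟩
    · exact (continuous_neg.tendsto' _ _ (by simp)).mono_left nhdsWithin_le_nhds
    · filter_upwards [self_mem_nhdsWithin] with z hz
      simpa using hz
  have dp : ∀ k : ℂ, R ≤ ‖k‖ → 0 < k.im → DifferentiableAt ℂ h k := fun k h1 h2 => hd k h1 h2.ne'
  have bp : ∀ k : ℂ, R ≤ ‖k‖ → 0 < k.im → ‖h k‖ ≤ C * (‖k‖ ^ 2)⁻¹ := fun k h1 h2 => hb k h1 h2.ne'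
  have dm : ∀ k : ℂ, R ≤ ‖k‖ → 0 < k.im → DifferentiableAt ℂ (fun k => h (-k)) k := fun k h1 h2 =>
    (hd (-k) (by simpa using h1) (by simpa using h2.ne')).comp k differentiableAt_id.neg
  have lm : ∀ ξ : ℝ, R < |ξ| → Tendsto (fun k => h (-k)) (𝓝[{z | 0 < z.im}] (ξ : ℂ))
      (𝓝 (hm (-ξ))) := fun ξ hξ => (hlimm (-ξ) (by simpa using hξ)).comp (hneg ξ)
  have bm : ∀ k : ℂ, R ≤ ‖k‖ → 0 < k.im → ‖h (-k)‖ ≤ C * (‖k‖ ^ 2)⁻¹ := fun k h1 h2 => by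
    simpa using hb (-k) (by simpa using h1) (by simpa using h2.ne')
  have Up := setIntegral_rays_eq_upper_arc hR dp hlimp bp
  have Lo := setIntegral_rays_eq_upper_arc hR dm lm bm
  have ip := integrableOn_rays_boundary hR (fun k h1 h2 => (dp k h1 h2).continuousAt) hlimp bp
  have im' := integrableOn_rays_boundary hR (fun k h1 h2 => (dm k h1 h2).continuousAt) lm bm
  have hrefl : (fun ξ : ℝ => -ξ) ⁻¹' rays R = rays R := by
    ext ξ; simp [rays]
  have me : MeasurableEmbedding (fun ξ : ℝ => -ξ) :=
    (Homeomorph.neg ℝ).isClosedEmbedding.measurableEmbedding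
  have im : IntegrableOn hm (rays R) := by
    rw [← integrableOn_comp_neg_iff, hrefl]
    exact im'
  have em : ∫ ξ in rays R, hm (-ξ) = ∫ ξ in rays R, hm ξ := by
    have := me.setIntegral_map (μ := volume) hm (rays R)
    rw [Measure.map_neg_eq_self, hrefl] at this
    exact this.symm
  rw [integral_sub ip im, Up, ← em, Lo, circleIntegral]
  set G : ℝ → E := fun y => (circleMap 0 R y * I) • h (circleMap 0 R y) with hG
  have cont : ∀ k : ℂ, R ≤ ‖k‖ → k.im ≠ 0 → ContinuousAt h k := fun k h1 h2 =>
    (hd k h1 h2).continuousAt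
  have himc : ∀ y : ℝ, (circleMap 0 R y).im = R * Real.sin y := fun y => by
    simp [circleMap, exp_im]
  have hint : ∀ a b : ℝ, a ≤ b → (∀ y ∈ Ioo a b, Real.sin y ≠ 0) → IntervalIntegrable G volume a b := by
    intro a b hab hs
    rw [intervalIntegrable_iff_integrableOn_Ioo_of_le hab]
    refine Integrable.mono' (g := fun _ => R * (C * (R ^ 2)⁻¹))
      (continuous_const.integrableOn_Icc.mono_set Ioo_subset_Icc_self) ?_ ?_
    · refine ContinuousOn.aestronglyMeasurable (fun y hy => ?_) measurableSet_Ioo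
      have : ContinuousAt h (circleMap 0 R y) := cont _ (by simp [abs_of_pos hR])
        (by rw [himc]; exact mul_ne_zero hR.ne' (hs y hy))
      refine (ContinuousAt.smul ?_ ?_).continuousWithinAt
      · exact ((continuous_circleMap 0 R).mul continuous_const).continuousAt
      · exact ContinuousAt.comp (f := circleMap 0 R) this (continuous_circleMap 0 R).continuousAt
    · filter_upwards [ae_restrict_mem measurableSet_Ioo] with y hy
      have := hb (circleMap 0 R y) (by simp [abs_of_pos hR])
        (by rw [himc]; exact mul_ne_zero hR.ne' (hs y hy))
      simp only [hG, norm_smul, norm_mul, norm_I, norm_circleMap_zero, abs_of_pos hR, mul_one] at this ⊢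
      gcongr
  have i1 : IntervalIntegrable G volume 0 π := hint 0 π Real.pi_pos.le fun y hy =>
    (Real.sin_pos_of_mem_Ioo hy).ne'
  have i2 : IntervalIntegrable G volume π (2 * π) := hint π (2 * π) (by linarith [Real.pi_pos])
    fun y hy => by
      have : 0 < Real.sin (y - π) := Real.sin_pos_of_mem_Ioo ⟨by linarith [hy.1], by linarith [hy.2]⟩
      rw [Real.sin_sub_pi] at this
      linarith
  have h2 : ∫ y in π..(2 * π), G y = -∫ y in (0 : ℝ)..π, (circleMap 0 R y * I) •
      h (-circleMap 0 R y) := by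
    rw [← intervalIntegral.integral_neg]
    have := intervalIntegral.integral_comp_add_right (a := 0) (b := π) G π
    rw [zero_add, ← two_mul] at this
    rw [← this]
    refine intervalIntegral.integral_congr fun y _ => ?_
    have e : circleMap 0 R (y + π) = -circleMap 0 R y := by
      simp [circleMap, add_mul, exp_add]
    simp only [hG, e]
    simp
  have h3 := intervalIntegral.integral_add_adjacent_intervals i1 i2
  simp only [deriv_circleMap]
  rw [h2] at h3
  rw [sub_eq_add_neg]
  exact h3.symm

end Rays

end CounterflowNLS

/-! ### Cauchy's formula for a function glued along a circle -/

namespace CounterflowNLS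

section Pairing

open Complex Set Metric
open scoped Interval Real

variable {E : Type*} [NormedAddCommGroup E]

/-- Continuity is available only off the real axis, so the two open half circles are treated
separately; boundedness makes the end points harmless. -/
theorem circleIntegrable_of_im_ne_zero {h : ℂ → E} {R B : ℝ} (hR : 0 < R)
    (hc : ∀ k : ℂ, ‖k‖ = R → k.im ≠ 0 → ContinuousAt h k)
    (hb : ∀ k : ℂ, ‖k‖ = R → k.im ≠ 0 → ‖h k‖ ≤ B) : CircleIntegrable h 0 R := by
  have hn : ∀ y : ℝ, ‖circleMap 0 R y‖ = R := fun y => by simp [abs_of_pos hR]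
  have himc : ∀ y : ℝ, (circleMap 0 R y).im = R * Real.sin y := fun y => by
    simp [circleMap, exp_im]
  have hint : ∀ a b : ℝ, a ≤ b → (∀ y ∈ Ioo a b, Real.sin y ≠ 0) →
      IntervalIntegrable (fun y => h (circleMap 0 R y)) volume a b := by
    intro a b hab hs
    rw [intervalIntegrable_iff_integrableOn_Ioo_of_le hab]
    refine Integrable.mono' (g := fun _ => B)
      (continuous_const.integrableOn_Icc.mono_set Ioo_subset_Icc_self) ?_ ?_
    · refine ContinuousOn.aestronglyMeasurable (fun y hy => ?_) measurableSet_Ioo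
      have : ContinuousAt h (circleMap 0 R y) := hc _ (hn y)
        (by rw [himc]; exact mul_ne_zero hR.ne' (hs y hy))
      exact (ContinuousAt.comp (f := circleMap 0 R) this
        (continuous_circleMap 0 R).continuousAt).continuousWithinAt
    · filter_upwards [ae_restrict_mem measurableSet_Ioo] with y hy
      exact hb _ (hn y) (by rw [himc]; exact mul_ne_zero hR.ne' (hs y hy))
  refine (hint 0 π Real.pi_pos.le fun y hy => (Real.sin_pos_of_mem_Ioo hy).ne').trans
    (hint π (2 * π) (by linarith [Real.pi_pos]) fun y hy => ?_)
  have : 0 < Real.sin (y - π) := Real.sin_pos_of_mem_Ioo ⟨by linarith [hy.1], by linarith [hy.2]⟩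
  rw [Real.sin_sub_pi] at this
  linarith

/-- Almost every point of a circle about the origin is not real. -/
theorem ae_circleMap_im_ne_zero {R : ℝ} (hR : 0 < R) :
    ∀ᵐ y : ℝ, y ∈ Ι (0 : ℝ) (2 * π) → (circleMap 0 R y).im ≠ 0 := by
  have h1 : ∀ᵐ y : ℝ, y ≠ π := by simp [ae_iff, measure_singleton]
  have h2 : ∀ᵐ y : ℝ, y ≠ 2 * π := by simp [ae_iff, measure_singleton]
  filter_upwards [h1, h2] with y h1 h2 hy
  rw [uIoc_of_le (by positivity)] at hy
  have himc : (circleMap 0 R y).im = R * Real.sin y := by simp [circleMap, exp_im]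
  rw [himc]
  refine mul_ne_zero hR.ne' ?_
  rcases lt_or_gt_of_ne h1 with h | h
  · exact (Real.sin_pos_of_mem_Ioo ⟨hy.1, h⟩).ne'
  · have : 0 < Real.sin (y - π) := Real.sin_pos_of_mem_Ioo
      ⟨by linarith, by linarith [lt_of_le_of_ne hy.2 h2]⟩
    rw [Real.sin_sub_pi] at this
    linarith

theorem CircleIntegrable.smul_of_continuous [NormedSpace ℂ E] {d : ℂ → E} {R : ℝ}
    (hd : CircleIntegrable d 0 R) (hR : 0 ≤ R)
    {κ : ℂ → ℂ} (hκ : ContinuousOn κ (sphere 0 R)) : CircleIntegrable (fun k => κ k • d k) 0 R := by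
  have hc : Continuous fun y : ℝ => κ (circleMap 0 R y) :=
    hκ.comp_continuous (continuous_circleMap 0 R) fun y => circleMap_mem_sphere 0 hR y
  exact IntervalIntegrable.continuousOn_smul hd hc.continuousOn

variable [NormedSpace ℂ E]

/-- The integral of a scalar kernel against a density on the circle of radius `R` and a density on
the two rays outside of it. -/
noncomputable def pairing (R : ℝ) (d : ℂ → E) (j : ℝ → E) (κ : ℂ → ℂ) : E :=
  (∮ k in C(0, R), κ k • d k) + ∫ ξ in rays R, κ ξ • j ξ

theorem norm_circleMap_zero_of_pos {R : ℝ} (hR : 0 < R) (y : ℝ) : ‖circleMap 0 R y‖ = R := by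
  simp [abs_of_pos hR]

/-- Cauchy's formula in the disk, for an entire function `F` and a function `G` outside of the disk
which tends to `e` at infinity and has a jump on the real line. -/
theorem cauchy_inside [CompleteSpace E] {F G : ℂ → E} {e : E} {gp gm : ℝ → E} {R C : ℝ}
    (hR : 0 < R) (hF : Differentiable ℂ F)
    (hd : ∀ k : ℂ, R ≤ ‖k‖ → k.im ≠ 0 → DifferentiableAt ℂ G k)
    (hlimp : ∀ ξ : ℝ, R < |ξ| → Tendsto G (𝓝[{z | 0 < z.im}] (ξ : ℂ)) (𝓝 (gp ξ)))
    (hlimm : ∀ ξ : ℝ, R < |ξ| → Tendsto G (𝓝[{z | z.im < 0}] (ξ : ℂ)) (𝓝 (gm ξ)))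
    (hb : ∀ k : ℂ, R ≤ ‖k‖ → k.im ≠ 0 → ‖G k - e‖ ≤ C * ‖k‖⁻¹) {z : ℂ} (hz : ‖z‖ < R) :
    (2 * π * I : ℂ) • (F z - e) =
      pairing R (fun k => F k - G k) (fun ξ => gp ξ - gm ξ) (fun k => (k - z)⁻¹) := by
  have hne : ∀ k : ℂ, R ≤ ‖k‖ → k - z ≠ 0 := fun k hk h => by
    rw [sub_eq_zero.1 h] at hk; linarith
  have hcκ : ContinuousOn (fun k : ℂ => (k - z)⁻¹) (sphere 0 R) := fun k hk => by
    refine ((continuousAt_id.sub continuousAt_const).inv₀ (hne k ?_)).continuousWithinAt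
    simpa using (mem_sphere_zero_iff_norm.1 hk).ge
  have hcont : ∀ ξ : ℝ, R < |ξ| → ContinuousAt (fun k : ℂ => (k - z)⁻¹) (ξ : ℂ) := fun ξ hξ =>
    (continuousAt_id.sub continuousAt_const).inv₀ (hne _ (by simpa using hξ.le))
  -- The kernel supplies the second power of decay. The constant comes from ‖k - z‖ ≥ ‖k‖ (1 - ‖z‖ /
  -- R), valid for ‖k‖ ≥ R > ‖z‖.
  have h1 := circleIntegral_eq_setIntegral_jump (h := fun k => (k - z)⁻¹ • (G k - e))
    (hp := fun ξ => ((ξ : ℂ) - z)⁻¹ • (gp ξ - e)) (hm := fun ξ => ((ξ : ℂ) - z)⁻¹ • (gm ξ - e))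
    (C := C * (1 - ‖z‖ / R)⁻¹) hR
    (fun k hk hi => ((differentiableAt_id.sub_const z).inv (hne k hk)).smul
      ((hd k hk hi).sub_const e))
    (fun ξ hξ => ((hcont ξ hξ).tendsto.mono_left nhdsWithin_le_nhds).smul
      ((hlimp ξ hξ).sub_const e))
    (fun ξ hξ => ((hcont ξ hξ).tendsto.mono_left nhdsWithin_le_nhds).smul
      ((hlimm ξ hξ).sub_const e)) ?_
  · have h2 := (hF.sub_const e).diffContOnCl.circleIntegral_sub_inv_smul (c := 0) (R := R) (w := z)
      (by simpa using hz)
    have cF : CircleIntegrable (fun k => (k - z)⁻¹ • (F k - e)) 0 R :=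
      CircleIntegrable.smul_of_continuous (hF.sub_const e).continuous.continuousOn.circleIntegrable'
        hR.le hcκ
    have cG : CircleIntegrable (fun k => (k - z)⁻¹ • (G k - e)) 0 R := by
      refine CircleIntegrable.smul_of_continuous
        (circleIntegrable_of_im_ne_zero (B := C * R⁻¹) hR (fun k hk hi => ?_) fun k hk hi => ?_)
        hR.le hcκ
      · exact ((hd k hk.ge hi).sub_const e).continuousAt
      · simpa [hk] using hb k hk.ge hi
    have h3 : (∮ k in C(0, R), (k - z)⁻¹ • (F k - G k)) =
        (∮ k in C(0, R), (k - z)⁻¹ • (F k - e)) - ∮ k in C(0, R), (k - z)⁻¹ • (G k - e) := by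
      rw [← circleIntegral.integral_sub cF cG]
      refine circleIntegral.integral_congr hR.le fun k _ => ?_
      rw [← smul_sub]; congr 1; abel
    rw [pairing, h3, h2, h1]
    have : ∀ ξ : ℝ, ((ξ : ℂ) - z)⁻¹ • (gp ξ - e) - ((ξ : ℂ) - z)⁻¹ • (gm ξ - e) =
        ((ξ : ℂ) - z)⁻¹ • (gp ξ - gm ξ) := fun ξ => by
      rw [← smul_sub]; congr 1; abel
    simp only [this, sub_add_cancel]
  · intro k hk hi
    have hkpos : 0 < ‖k‖ := hR.trans_le hk
    have hz1 : 0 < 1 - ‖z‖ / R := by rw [sub_pos, div_lt_one hR]; exact hz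
    have h1 : ‖k‖ * (1 - ‖z‖ / R) ≤ ‖k - z‖ := by
      have := norm_sub_norm_le k z
      have h2 : ‖z‖ ≤ ‖k‖ * (‖z‖ / R) := by
        rw [← mul_div_assoc, le_div_iff₀ hR, mul_comm]; gcongr
      linarith
    rw [norm_smul, norm_inv]
    calc ‖k - z‖⁻¹ * ‖G k - e‖ ≤ (‖k‖ * (1 - ‖z‖ / R))⁻¹ * (C * ‖k‖⁻¹) := by
          gcongr
          exact hb k hk hi
      _ = C * (1 - ‖z‖ / R)⁻¹ * (‖k‖ ^ 2)⁻¹ := by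
          rw [mul_inv, pow_two, mul_inv]; ring

/-- Cauchy's formula outside of the disk, in the setting of `cauchy_inside`. -/
theorem cauchy_outside [CompleteSpace E] {F G : ℂ → E} {e : E} {gp gm : ℝ → E} {R C : ℝ}
    (hR : 0 < R) (hF : Differentiable ℂ F)
    (hd : ∀ k : ℂ, R ≤ ‖k‖ → k.im ≠ 0 → DifferentiableAt ℂ G k)
    (hlimp : ∀ ξ : ℝ, R < |ξ| → Tendsto G (𝓝[{z | 0 < z.im}] (ξ : ℂ)) (𝓝 (gp ξ)))
    (hlimm : ∀ ξ : ℝ, R < |ξ| → Tendsto G (𝓝[{z | z.im < 0}] (ξ : ℂ)) (𝓝 (gm ξ)))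
    (hb : ∀ k : ℂ, R ≤ ‖k‖ → k.im ≠ 0 → ‖G k - e‖ ≤ C * ‖k‖⁻¹) {z : ℂ} (hz : R < ‖z‖)
    (hzi : z.im ≠ 0) :
    (2 * π * I : ℂ) • (G z - e) =
      pairing R (fun k => F k - G k) (fun ξ => gp ξ - gm ξ) (fun k => (k - z)⁻¹) := by
  have hC : 0 ≤ C * ‖z‖⁻¹ := (norm_nonneg _).trans (hb z hz.le hzi)
  have hC : 0 ≤ C := by
    by_contra h
    have : C * ‖z‖⁻¹ < 0 := mul_neg_of_neg_of_pos (not_le.1 h) (inv_pos.2 (hR.trans hz))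
    linarith
  -- The divided difference has no pole at `z`, but it decays only like -(G z - e) / k; the added
  -- term cancels this and leaves O(‖k‖⁻²).
  set h : ℂ → E := fun k => dslope G z k + k⁻¹ • (G z - e) with hh
  have hform : ∀ k : ℂ, k ≠ z → h k = (k - z)⁻¹ • (G k - e) - ((k - z)⁻¹ - k⁻¹) • (G z - e) := by
    intro k hk
    simp only [hh]
    rw [dslope_of_ne _ hk, slope_def_module, sub_smul, ← sub_add, ← smul_sub, sub_sub_sub_cancel_right]
  have hGz := hd z hz.le hzi
  have hslope : ContinuousAt (dslope G z) z := continuousAt_dslope_same.2 hGz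
  have hU : {k : ℂ | R < ‖k‖ ∧ k.im ≠ 0} ∈ 𝓝 z :=
    ((isOpen_lt continuous_const continuous_norm).inter
      (isOpen_ne.preimage continuous_im)).mem_nhds ⟨hz, hzi⟩
  have hds : DifferentiableAt ℂ (dslope G z) z := by
    refine DifferentiableOn.differentiableAt (s := {k : ℂ | R < ‖k‖ ∧ k.im ≠ 0}) ?_ hU
    rw [differentiableOn_dslope hU]
    exact fun k hk => (hd k hk.1.le hk.2).differentiableWithinAt
  have hk0 : ∀ k : ℂ, R ≤ ‖k‖ → k ≠ 0 := fun k hk => norm_pos_iff.1 (hR.trans_le hk)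
  have hlim : ∀ ξ : ℝ, R < |ξ| → ∀ (l : Filter ℂ) (v : E), l ≤ 𝓝 (ξ : ℂ) → Tendsto G l (𝓝 v) →
      Tendsto h l (𝓝 (((ξ : ℂ) - z)⁻¹ • (v - e) - (((ξ : ℂ) - z)⁻¹ - (ξ : ℂ)⁻¹) • (G z - e))) := by
    intro ξ hξ l v hl hv
    have hξz : (ξ : ℂ) ≠ z := fun h => hzi (by rw [← h]; simp)
    have e1 : h =ᶠ[l] fun k => (k - z)⁻¹ • (G k - e) - ((k - z)⁻¹ - k⁻¹) • (G z - e) := by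
      filter_upwards [hl (isOpen_ne.mem_nhds hξz)] with k hk
      exact hform k hk
    refine Tendsto.congr' e1.symm ?_
    have t1 : Tendsto (fun k : ℂ => (k - z)⁻¹) l (𝓝 ((ξ : ℂ) - z)⁻¹) :=
      ((continuousAt_id.sub continuousAt_const).inv₀ (sub_ne_zero.2 hξz)).tendsto.mono_left hl
    have t2 : Tendsto (fun k : ℂ => k⁻¹) l (𝓝 (ξ : ℂ)⁻¹) :=
      (continuousAt_id.inv₀ (hk0 (ξ : ℂ) (by simpa using hξ.le))).tendsto.mono_left hl
    exact (t1.smul (hv.sub_const e)).sub ((t1.sub t2).smul tendsto_const_nhds)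
  -- Two regimes for the decay bound: near `z` continuity of the divided difference (constant `C₁`),
  -- away from `z` the explicit formula (constant `C₂`).
  obtain ⟨δ, hδ, hδB⟩ := Metric.eventually_nhds_iff_ball.1
    (hslope.norm.eventually (gt_mem_nhds (lt_add_one _)))
  set B := ‖dslope G z z‖ + 1 with hB
  set A := ‖z‖ + δ with hA
  set C₁ := A ^ 2 * B + A * ‖G z - e‖ with hC1
  set C₂ := (1 + ‖z‖ / δ) * (C + ‖z‖ * ‖G z - e‖) with hC2
  have h1 := circleIntegral_eq_setIntegral_jump (h := h)
    (hp := fun ξ => ((ξ : ℂ) - z)⁻¹ • (gp ξ - e) - (((ξ : ℂ) - z)⁻¹ - (ξ : ℂ)⁻¹) • (G z - e))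
    (hm := fun ξ => ((ξ : ℂ) - z)⁻¹ • (gm ξ - e) - (((ξ : ℂ) - z)⁻¹ - (ξ : ℂ)⁻¹) • (G z - e))
    (C := C₁ + C₂) hR ?_
    (fun ξ hξ => hlim ξ hξ _ _ nhdsWithin_le_nhds (hlimp ξ hξ))
    (fun ξ hξ => hlim ξ hξ _ _ nhdsWithin_le_nhds (hlimm ξ hξ)) ?_
  · have hcκ : ContinuousOn (fun k : ℂ => (k - z)⁻¹) (sphere 0 R) := fun k hk => by
      refine ((continuousAt_id.sub continuousAt_const).inv₀ (sub_ne_zero.2 ?_)).continuousWithinAt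
      rintro rfl
      rw [mem_sphere_zero_iff_norm] at hk
      simp only [id] at hz; linarith
    have hc0 : ContinuousOn (fun k : ℂ => k⁻¹) (sphere 0 R) := fun k hk =>
      (continuousAt_id.inv₀ (hk0 k (mem_sphere_zero_iff_norm.1 hk).ge)).continuousWithinAt
    have dκ : DiffContOnCl ℂ (fun k : ℂ => (k - z)⁻¹) (ball 0 R) := by
      refine DifferentiableOn.diffContOnCl fun k hk => ?_
      rw [closure_ball _ hR.ne', mem_closedBall_zero_iff] at hk
      refine ((differentiableAt_id.sub_const z).inv (sub_ne_zero.2 ?_)).differentiableWithinAt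
      rintro rfl
      simp only [id] at hz; linarith
    have z1 : (∮ k in C(0, R), (k - z)⁻¹ • (F k - e)) = 0 :=
      (dκ.smul (hF.sub_const e).diffContOnCl).circleIntegral_eq_zero hR.le
    have z2 : (∮ k in C(0, R), (k - z)⁻¹) = 0 := dκ.circleIntegral_eq_zero hR.le
    have z3 : (∮ k in C(0, R), k⁻¹) = 2 * π * I := by
      simpa using circleIntegral.integral_sub_center_inv (0 : ℂ) hR.ne'
    have cκ : CircleIntegrable (fun k : ℂ => (k - z)⁻¹) 0 R := hcκ.circleIntegrable hR.le
    have c0 : CircleIntegrable (fun k : ℂ => k⁻¹) 0 R := hc0.circleIntegrable hR.le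
    have cF : CircleIntegrable (fun k => (k - z)⁻¹ • (F k - e)) 0 R :=
      CircleIntegrable.smul_of_continuous (hF.sub_const e).continuous.continuousOn.circleIntegrable'
        hR.le hcκ
    have cG : CircleIntegrable (fun k => (k - z)⁻¹ • (G k - e)) 0 R := by
      refine CircleIntegrable.smul_of_continuous
        (circleIntegrable_of_im_ne_zero (B := C * R⁻¹) hR (fun k hk hi => ?_) fun k hk hi => ?_)
        hR.le hcκ
      · exact ((hd k hk.ge hi).sub_const e).continuousAt
      · simpa [hk] using hb k hk.ge hi
    have cz : CircleIntegrable (fun k : ℂ => ((k - z)⁻¹ - k⁻¹) • (G z - e)) 0 R :=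
      ((hcκ.sub hc0).smul continuousOn_const).circleIntegrable hR.le
    -- The kernel (k - z)⁻¹ integrates to zero since `z` lies outside the circle, so only k⁻¹
    -- contributes, with 2πi.
    have h3 : (∮ k in C(0, R), h k) = (∮ k in C(0, R), (k - z)⁻¹ • (G k - e)) +
        (2 * π * I : ℂ) • (G z - e) := by
      have : (∮ k in C(0, R), h k) = ∮ k in C(0, R), ((k - z)⁻¹ • (G k - e) -
          ((k - z)⁻¹ - k⁻¹) • (G z - e)) := by
        refine circleIntegral.integral_congr hR.le fun k hk => hform k ?_
        rintro rfl
        rw [mem_sphere_zero_iff_norm] at hk; linarith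
      rw [this, circleIntegral.integral_sub cG cz, circleIntegral.integral_smul_const,
        circleIntegral.integral_sub cκ c0, z2, z3, zero_sub, neg_smul, sub_neg_eq_add]
    have h4 : (∮ k in C(0, R), (k - z)⁻¹ • (F k - G k)) =
        -∮ k in C(0, R), (k - z)⁻¹ • (G k - e) := by
      rw [← zero_sub, ← z1, ← circleIntegral.integral_sub cF cG]
      refine circleIntegral.integral_congr hR.le fun k _ => ?_
      rw [← smul_sub]; congr 1; abel
    have h5 : ∀ ξ : ℝ, ((ξ : ℂ) - z)⁻¹ • (gp ξ - gm ξ) =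
        (((ξ : ℂ) - z)⁻¹ • (gp ξ - e) - (((ξ : ℂ) - z)⁻¹ - (ξ : ℂ)⁻¹) • (G z - e)) -
        (((ξ : ℂ) - z)⁻¹ • (gm ξ - e) - (((ξ : ℂ) - z)⁻¹ - (ξ : ℂ)⁻¹) • (G z - e)) := fun ξ => by
      rw [sub_sub_sub_cancel_right, ← smul_sub, sub_sub_sub_cancel_right]
    rw [pairing, h4]
    simp only [h5]
    rw [← h1, h3]; abel
  · intro k hk hi
    have dinv : DifferentiableAt ℂ (fun k : ℂ => k⁻¹ • (G z - e)) k :=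
      (differentiableAt_id.inv (hk0 k hk)).smul_const _
    rcases eq_or_ne k z with rfl | hkz
    · exact hds.add dinv
    · refine DifferentiableAt.add ?_ dinv
      exact (differentiableAt_dslope_of_ne hkz).2 (hd k hk hi)
  · intro k hk hi
    have hkpos : 0 < ‖k‖ := hR.trans_le hk
    have hC1' : 0 ≤ C₁ := by positivity
    have hC2' : 0 ≤ C₂ := by positivity
    rw [← div_eq_mul_inv, le_div_iff₀ (by positivity)]
    by_cases hkz : k ∈ ball z δ
    · have h2 : ‖k‖ ≤ A := by
        have := norm_sub_norm_le k z
        rw [mem_ball, dist_eq] at hkz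
        linarith
      have h3 : ‖h k‖ ≤ B + ‖k‖⁻¹ * ‖G z - e‖ := by
        refine (norm_add_le _ _).trans (add_le_add (hδB k hkz).le ?_)
        rw [norm_smul, norm_inv]
      calc ‖h k‖ * ‖k‖ ^ 2 ≤ (B + ‖k‖⁻¹ * ‖G z - e‖) * ‖k‖ ^ 2 := by gcongr
        _ = ‖k‖ ^ 2 * B + ‖k‖ * ‖G z - e‖ := by field_simp
        _ ≤ C₁ := by rw [hC1]; gcongr
        _ ≤ C₁ + C₂ := by linarith
    · have hkz' : δ ≤ ‖k - z‖ := by simpa [dist_eq] using hkz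
      have hpos : 0 < ‖k - z‖ := hδ.trans_le hkz'
      have hne : k ≠ z := fun h => by simp [h] at hpos
      have h2 : ‖k‖ ≤ (1 + ‖z‖ / δ) * ‖k - z‖ := by
        have e1 := norm_sub_norm_le k z
        have e2 : ‖z‖ ≤ ‖z‖ / δ * ‖k - z‖ := by
          rw [div_mul_eq_mul_div, le_div_iff₀ hδ]; gcongr
        linarith
      have e3 : (k - z)⁻¹ - k⁻¹ = z * ((k - z)⁻¹ * k⁻¹) := by
        have := hk0 k hk
        have h' : k - z ≠ 0 := sub_ne_zero.2 hne
        field_simp; ring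
      have h3 : ‖h k‖ ≤ ‖k - z‖⁻¹ * ‖k‖⁻¹ * (C + ‖z‖ * ‖G z - e‖) := by
        rw [hform k hne, e3]
        refine (norm_sub_le _ _).trans ?_
        rw [norm_smul, norm_smul, norm_mul, norm_mul, norm_inv, norm_inv]
        have := hb k hk hi
        calc _ ≤ ‖k - z‖⁻¹ * (C * ‖k‖⁻¹) + ‖z‖ * (‖k - z‖⁻¹ * ‖k‖⁻¹) * ‖G z - e‖ := by gcongr
          _ = _ := by ring
      calc ‖h k‖ * ‖k‖ ^ 2 ≤ ‖k - z‖⁻¹ * ‖k‖⁻¹ * (C + ‖z‖ * ‖G z - e‖) * ‖k‖ ^ 2 := by gcongr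
        _ = ‖k‖ * ‖k - z‖⁻¹ * (C + ‖z‖ * ‖G z - e‖) := by field_simp
        _ ≤ ((1 + ‖z‖ / δ) * ‖k - z‖) * ‖k - z‖⁻¹ * (C + ‖z‖ * ‖G z - e‖) := by gcongr
        _ = C₂ := by rw [hC2]; field_simp
        _ ≤ C₁ + C₂ := by linarith

end Pairing

end CounterflowNLS

/-! ### Limits of Cauchy integrals, expansions at infinity, Liouville's theorem -/

namespace CounterflowNLS

section Limits

open Complex Set Metric
open scoped Interval Real

variable {E : Type*} [NormedAddCommGroup E] [NormedSpace ℂ E]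

theorem tendsto_circleIntegral {ι : Type*} {l : Filter ι} [l.IsCountablyGenerated]
    {D : ι → ℂ → E} {D' : ℂ → E} {R B : ℝ} (hR : 0 < R)
    (hm : ∀ᶠ i in l, CircleIntegrable (D i) 0 R)
    (hb : ∀ᶠ i in l, ∀ k : ℂ, ‖k‖ = R → k.im ≠ 0 → ‖D i k‖ ≤ B)
    (hlim : ∀ k : ℂ, ‖k‖ = R → k.im ≠ 0 → Tendsto (fun i => D i k) l (𝓝 (D' k))) :
    Tendsto (fun i => ∮ k in C(0, R), D i k) l (𝓝 (∮ k in C(0, R), D' k)) := by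
  refine intervalIntegral.tendsto_integral_filter_of_dominated_convergence (fun _ => R * B) ?_ ?_
    ?_ ?_
  · filter_upwards [hm] with i hi
    exact (intervalIntegrable_iff.1 hi.out).aestronglyMeasurable
  · filter_upwards [hb] with i hi
    filter_upwards [ae_circleMap_im_ne_zero hR] with y hy hy'
    rw [norm_smul, deriv_circleMap, norm_mul, norm_I, mul_one, norm_circleMap_zero_of_pos hR]
    exact mul_le_mul_of_nonneg_left (hi _ (norm_circleMap_zero_of_pos hR y) (hy hy')) hR.le
  · exact intervalIntegrable_const
  · filter_upwards [ae_circleMap_im_ne_zero hR] with y hy hy'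
    exact (hlim _ (norm_circleMap_zero_of_pos hR y) (hy hy')).const_smul _

theorem norm_pairing_le {d : ℂ → E} {j : ℝ → E} {κ : ℂ → ℂ} {g : ℝ → ℝ} {R B K₁ K₂ : ℝ}
    (hR : 0 < R) (hd : ∀ k : ℂ, ‖k‖ = R → k.im ≠ 0 → ‖d k‖ ≤ B)
    (hj : ∀ ξ ∈ rays R, ‖j ξ‖ ≤ g ξ) (hg : IntegrableOn g (rays R))
    (h₁ : ∀ k : ℂ, ‖k‖ = R → ‖κ k‖ ≤ K₁) (h₂ : ∀ ξ ∈ rays R, ‖κ (ξ : ℂ)‖ ≤ K₂) :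
    ‖pairing R d j κ‖ ≤ 2 * π * R * (K₁ * B) + K₂ * ∫ ξ in rays R, g ξ := by
  have hK1 : 0 ≤ K₁ := (norm_nonneg _).trans (h₁ R (by simp [abs_of_pos hR]))
  have hK2 : 0 ≤ K₂ := (norm_nonneg _).trans (h₂ (R + 1) (by
    change R < |R + 1|
    rw [abs_of_pos (by linarith)]; linarith))
  refine (norm_add_le _ _).trans (add_le_add ?_ ?_)
  · rw [circleIntegral]
    refine (intervalIntegral.norm_integral_le_of_norm_le_const_ae (C := R * (K₁ * B)) ?_).trans ?_
    · filter_upwards [ae_circleMap_im_ne_zero hR] with y hy hy'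
      have hn := norm_circleMap_zero_of_pos hR y
      rw [norm_smul, deriv_circleMap, norm_mul, norm_I, mul_one, hn, norm_smul]
      have h1 := h₁ _ hn
      have h2 := hd _ hn (hy hy')
      gcongr
    · rw [sub_zero, abs_of_pos (by positivity)]
      apply le_of_eq; ring
  · rw [← integral_const_mul]
    refine norm_integral_le_of_norm_le (hg.const_mul K₂) ?_
    filter_upwards [ae_restrict_mem (measurableSet_rays R)] with ξ hξ
    rw [norm_smul]
    have h1 := h₂ ξ hξ
    have h2 := hj ξ hξ
    gcongr

/-- Dominated convergence for `pairing`. -/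
theorem tendsto_pairing {ι : Type*} {l : Filter ι} [l.IsCountablyGenerated]
    {d : ι → ℂ → E} {d' : ℂ → E} {j : ι → ℝ → E} {j' : ℝ → E} {κ : ℂ → ℂ} {g : ℝ → ℝ} {R B : ℝ}
    (hR : 0 < R) (hm : ∀ᶠ i in l, CircleIntegrable (d i) 0 R)
    (hb : ∀ᶠ i in l, ∀ k : ℂ, ‖k‖ = R → k.im ≠ 0 → ‖d i k‖ ≤ B)
    (hlim : ∀ k : ℂ, ‖k‖ = R → k.im ≠ 0 → Tendsto (fun i => d i k) l (𝓝 (d' k)))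
    (jm : ∀ᶠ i in l, AEStronglyMeasurable (j i) (volume.restrict (rays R)))
    (jb : ∀ᶠ i in l, ∀ ξ ∈ rays R, ‖j i ξ‖ ≤ g ξ)
    (jlim : ∀ ξ ∈ rays R, Tendsto (fun i => j i ξ) l (𝓝 (j' ξ)))
    (hκ : ContinuousOn κ (sphere 0 R)) (hκm : Measurable κ)
    (hg : IntegrableOn (fun ξ : ℝ => ‖κ ξ‖ * g ξ) (rays R)) :
    Tendsto (fun i => pairing R (d i) (j i) κ) l (𝓝 (pairing R d' j' κ)) := by
  obtain ⟨K, hK⟩ := (isCompact_sphere (0 : ℂ) R).exists_bound_of_continuousOn hκ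
  refine Tendsto.add ?_ ?_
  · refine tendsto_circleIntegral (B := K * B) hR ?_ ?_ ?_
    · filter_upwards [hm] with i hi
      exact CircleIntegrable.smul_of_continuous hi hR.le hκ
    · filter_upwards [hb] with i hi k hk hki
      rw [norm_smul]
      have h1 := hK k (by simpa using hk)
      have h2 := hi k hk hki
      have : 0 ≤ K := (norm_nonneg _).trans h1
      gcongr
    · exact fun k hk hki => (hlim k hk hki).const_smul _
  · refine tendsto_integral_filter_of_dominated_convergence _ ?_ ?_ hg ?_
    · filter_upwards [jm] with i hi
      exact (hκm.comp measurable_ofReal).aestronglyMeasurable.smul hi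
    · filter_upwards [jb] with i hi
      filter_upwards [ae_restrict_mem (measurableSet_rays R)] with ξ hξ
      rw [norm_smul]
      exact mul_le_mul_of_nonneg_left (hi ξ hξ) (norm_nonneg _)
    · filter_upwards [ae_restrict_mem (measurableSet_rays R)] with ξ hξ
      exact (jlim ξ hξ).const_smul _

theorem pairing_smul (c : ℂ) (R : ℝ) (d : ℂ → E) (j : ℝ → E) (κ : ℂ → ℂ) :
    pairing R (fun k => c • d k) (fun ξ => c • j ξ) κ = c • pairing R d j κ := by
  simp only [pairing, smul_comm _ c, circleIntegral.integral_smul, integral_smul, smul_add]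

theorem pairing_smul_kernel (c : ℂ) (R : ℝ) (d : ℂ → E) (j : ℝ → E) (κ : ℂ → ℂ) :
    pairing R d j (fun k => c * κ k) = c • pairing R d j κ := by
  simp only [pairing, mul_smul, circleIntegral.integral_smul, integral_smul, smul_add]

theorem norm_sub_mul_I_ge (ξ y : ℝ) : |y| ≤ ‖(ξ : ℂ) - y * I‖ := by
  simpa using abs_im_le_norm ((ξ : ℂ) - y * I)

instance isCountablyGenerated_cocompact_real : (cocompact ℝ).IsCountablyGenerated := by
  rw [cocompact_eq_atBot_atTop]; infer_instance

theorem tendsto_abs_cocompact : Tendsto (fun y : ℝ => |y|) (cocompact ℝ) atTop :=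
  tendsto_norm_cocompact_atTop

/-- The value -1 is the leading coefficient of the Cauchy kernel at infinity; it accounts for the
minus sign in the moments below. -/
theorem tendsto_mul_inv_sub (k : ℂ) :
    Tendsto (fun y : ℝ => y * I * (k - y * I)⁻¹) (cocompact ℝ) (𝓝 (-1)) := by
  have h0 : Tendsto (fun y : ℝ => (y : ℂ)⁻¹) (cocompact ℝ) (𝓝 0) := by
    rw [tendsto_zero_iff_norm_tendsto_zero]
    simp only [norm_inv, norm_real]
    exact tendsto_inv_atTop_zero.comp tendsto_norm_cocompact_atTop
  have h1 : Tendsto (fun y : ℝ => I * (k * (y : ℂ)⁻¹ - I)⁻¹) (cocompact ℝ) (𝓝 (-1)) := by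
    have h2 : Tendsto (fun y : ℝ => k * (y : ℂ)⁻¹ - I) (cocompact ℝ) (𝓝 (k * 0 - I)) :=
      (h0.const_mul k).sub_const I
    have h3 := (h2.inv₀ (by simp)).const_mul I
    have e : I * (k * 0 - I)⁻¹ = -1 := by
      rw [mul_zero, zero_sub, inv_neg, inv_I, neg_neg, I_mul_I]
    rwa [e] at h3
  refine h1.congr' ?_
  filter_upwards [tendsto_abs_cocompact.eventually_gt_atTop 0] with y hy
  have hy0 : (y : ℂ) ≠ 0 := by simpa using hy
  have : k - y * I = y * (k * (y : ℂ)⁻¹ - I) := by field_simp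
  rw [this, mul_inv]; field_simp

/-- First order expansion of a Cauchy integral along the imaginary axis. -/
theorem tendsto_pairing_cauchy {d : ℂ → E} {j : ℝ → E} {R B : ℝ} (hR : 0 < R)
    (hd : CircleIntegrable d 0 R) (hb : ∀ k : ℂ, ‖k‖ = R → k.im ≠ 0 → ‖d k‖ ≤ B)
    (hj : IntegrableOn j (rays R)) :
    Tendsto (fun y : ℝ => (y * I) • pairing R d j (fun k => (k - y * I)⁻¹)) (cocompact ℝ)
      (𝓝 (-pairing R d j (fun _ => 1))) := by
  have hB : 0 ≤ B := (norm_nonneg _).trans (hb (R * I) (by simp [abs_of_pos hR]) (by simp [hR.ne']))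
  simp only [← pairing_smul_kernel]
  have e : -pairing R d j (fun _ => 1) =
      (∮ k in C(0, R), (-1 : ℂ) • d k) + ∫ ξ in rays R, (-1 : ℂ) • j ξ := by
    rw [← neg_one_smul ℂ, ← pairing_smul_kernel]; simp [pairing]
  rw [e]
  have hlarge := tendsto_abs_cocompact.eventually_ge_atTop (2 * R)
  refine Tendsto.add ?_ ?_
  · refine tendsto_circleIntegral (B := 2 * B) hR ?_ ?_ ?_
    · filter_upwards [hlarge] with y hy
      refine CircleIntegrable.smul_of_continuous hd hR.le fun k hk => ?_
      rw [mem_sphere_zero_iff_norm] at hk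
      refine (continuousAt_const.mul ((continuousAt_id.sub continuousAt_const).inv₀
        (sub_ne_zero.2 fun h => ?_))).continuousWithinAt
      simp only [id] at h
      rw [h] at hk
      simp at hk
      linarith
    · filter_upwards [hlarge] with y hy k hk hki
      have h1 : |y| / 2 ≤ ‖k - y * I‖ := by
        have := norm_sub_norm_le (y * I : ℂ) k
        rw [norm_sub_rev] at this
        simp only [norm_mul, norm_I, mul_one, norm_real, Real.norm_eq_abs, hk] at this
        linarith
      have hpos : 0 < |y| / 2 := by linarith
      rw [norm_smul]
      refine mul_le_mul ?_ (hb k hk hki) (norm_nonneg _) (by norm_num)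
      rw [norm_mul, norm_inv, norm_mul, norm_I, mul_one, norm_real, Real.norm_eq_abs,
        ← div_eq_mul_inv, div_le_iff₀ (hpos.trans_le h1)]
      linarith
    · exact fun k _ _ => (tendsto_mul_inv_sub k).smul tendsto_const_nhds
  · refine tendsto_integral_filter_of_dominated_convergence (fun ξ => ‖j ξ‖) ?_ ?_ hj.norm ?_
    · refine Eventually.of_forall fun y => ?_
      have : Measurable fun ξ : ℝ => (y * I * ((ξ : ℂ) - y * I)⁻¹ : ℂ) := by fun_prop
      exact this.aestronglyMeasurable.smul hj.aestronglyMeasurable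
    · filter_upwards [tendsto_abs_cocompact.eventually_gt_atTop 0] with y hy
      refine ae_of_all _ fun ξ => ?_
      rw [norm_smul]
      refine mul_le_of_le_one_left (norm_nonneg _) ?_
      have := norm_sub_mul_I_ge ξ y
      rw [norm_mul, norm_inv, norm_mul, norm_I, mul_one, norm_real, Real.norm_eq_abs,
        ← div_eq_mul_inv, div_le_one (hy.trans_le this)]
      exact this
    · exact ae_of_all _ fun ξ => (tendsto_mul_inv_sub ξ).smul tendsto_const_nhds

/-- Second order expansion of a Cauchy integral along the imaginary axis. -/
theorem tendsto_pairing_cauchy_sq {d : ℂ → E} {j : ℝ → E} {R B : ℝ} (hR : 0 < R)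
    (hd : CircleIntegrable d 0 R) (hb : ∀ k : ℂ, ‖k‖ = R → k.im ≠ 0 → ‖d k‖ ≤ B)
    (hj : IntegrableOn j (rays R)) (hj' : IntegrableOn (fun ξ : ℝ => (ξ : ℂ) • j ξ) (rays R)) :
    Tendsto (fun y : ℝ => (y * I) • ((y * I) • pairing R d j (fun k => (k - y * I)⁻¹)
      + pairing R d j (fun _ => 1))) (cocompact ℝ) (𝓝 (-pairing R d j (fun k => k))) := by
  -- Since k / (k - iy) = 1 + iy / (k - iy), the second order expansion is the first order one for
  -- the densities multiplied by k.
  have h := tendsto_pairing_cauchy (d := fun k => k • d k) (j := fun ξ => (ξ : ℂ) • j ξ)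
    (B := R * B) hR (CircleIntegrable.smul_of_continuous hd hR.le continuousOn_id)
    (fun k hk hki => by
      rw [norm_smul, hk]; exact mul_le_mul_of_nonneg_left (hb k hk hki) hR.le) hj'
  have e : pairing R (fun k => k • d k) (fun ξ => (ξ : ℂ) • j ξ) (fun _ => 1) =
      pairing R d j (fun k => k) := by simp [pairing]
  rw [e] at h
  refine h.congr' ?_
  filter_upwards [tendsto_abs_cocompact.eventually_ge_atTop (2 * R)] with y hy
  have hy0 : 0 < |y| := by linarith
  congr 1
  have hne : ∀ k : ℂ, ‖k‖ = R → k - y * I ≠ 0 := fun k hk h => by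
    rw [sub_eq_zero.1 h] at hk; simp at hk; linarith
  have hc : ContinuousOn (fun k : ℂ => (k - y * I)⁻¹) (sphere 0 R) := fun k hk =>
    ((continuousAt_id.sub continuousAt_const).inv₀
      (hne k (mem_sphere_zero_iff_norm.1 hk))).continuousWithinAt
  have hne' : ∀ ξ : ℝ, (ξ : ℂ) - y * I ≠ 0 := fun ξ =>
    norm_pos_iff.1 (hy0.trans_le (norm_sub_mul_I_ge ξ y))
  rw [← pairing_smul_kernel]
  simp only [pairing]
  have c1 : CircleIntegrable (fun k => (y * I * (k - y * I)⁻¹) • d k) 0 R :=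
    CircleIntegrable.smul_of_continuous hd hR.le (continuousOn_const.mul hc)
  have j1 : IntegrableOn (fun ξ : ℝ => (y * I * ((ξ : ℂ) - y * I)⁻¹) • j ξ) (rays R) := by
    refine Integrable.mono hj ?_ ?_
    · have : Measurable fun ξ : ℝ => (y * I * ((ξ : ℂ) - y * I)⁻¹ : ℂ) := by fun_prop
      exact this.aestronglyMeasurable.smul hj.aestronglyMeasurable
    · refine ae_of_all _ fun ξ => ?_
      rw [norm_smul]
      refine mul_le_of_le_one_left (norm_nonneg _) ?_
      have := norm_sub_mul_I_ge ξ y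
      rw [norm_mul, norm_inv, norm_mul, norm_I, mul_one, norm_real, Real.norm_eq_abs,
        ← div_eq_mul_inv, div_le_one (hy0.trans_le this)]
      exact this
  have key : ∀ k : ℂ, k - y * I ≠ 0 → ∀ v : E, (k - y * I)⁻¹ • k • v =
      (y * I * (k - y * I)⁻¹) • v + (1 : ℂ) • v := fun k hk v => by
    rw [← add_smul, smul_smul]; congr 1; field_simp; ring
  have a1 : (∮ k in C(0, R), (k - y * I)⁻¹ • k • d k) =
      (∮ k in C(0, R), (y * I * (k - y * I)⁻¹) • d k) + ∮ k in C(0, R), (1 : ℂ) • d k := by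
    rw [← circleIntegral.integral_add c1 (by simpa using hd)]
    exact circleIntegral.integral_congr hR.le fun k hk =>
      key k (hne k (mem_sphere_zero_iff_norm.1 hk)) _
  have a2 : (∫ ξ in rays R, ((ξ : ℂ) - y * I)⁻¹ • (ξ : ℂ) • j ξ) =
      (∫ ξ in rays R, (y * I * ((ξ : ℂ) - y * I)⁻¹) • j ξ) + ∫ ξ in rays R, (1 : ℂ) • j ξ := by
    rw [← integral_add j1 (by simp only [one_smul]; exact hj)]
    exact integral_congr_ae (ae_of_all _ fun ξ => key ξ (hne' ξ) _)
  rw [a1, a2]; abel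

/-- An entire function of at most quadratic growth is a polynomial of degree at most two. -/
theorem exists_quadratic_of_growth [CompleteSpace E] {f : ℂ → E} (hf : Differentiable ℂ f) {C R₀ : ℝ}
    (hC : ∀ z, R₀ ≤ ‖z‖ → ‖f z‖ ≤ C * ‖z‖ ^ 2) :
    ∃ c₀ c₁ c₂ : E, ∀ z, f z = c₀ + z • c₁ + z ^ 2 • c₂ := by
  -- Cauchy's estimates on circles of radius R bound the n-th derivative by a multiple of R^(2 - n).
  have h3 : ∀ n : ℕ, 3 ≤ n → iteratedDeriv n f 0 = 0 := by
    intro n hn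
    have hlim : Tendsto (fun R : ℝ => n.factorial * C * R ^ (-((n : ℤ) - 2))) atTop (𝓝 0) := by
      have := (tendsto_zpow_atTop_zero (𝕜 := ℝ) (n := -((n : ℤ) - 2)) (by omega)).const_mul
        (n.factorial * C)
      simpa using this
    rw [← norm_le_zero_iff]
    refine ge_of_tendsto hlim ?_
    filter_upwards [eventually_gt_atTop 0, eventually_ge_atTop R₀] with R hR hR0
    have h := norm_iteratedDeriv_le_of_forall_mem_sphere_norm_le n hR hf.diffContOnCl
      (C := C * R ^ 2) (c := 0) fun z hz => by
        rw [mem_sphere_zero_iff_norm] at hz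
        simpa [hz] using hC z (by rw [hz]; exact hR0)
    refine h.trans (le_of_eq ?_)
    rw [neg_sub, zpow_sub₀ hR.ne']
    simp only [zpow_natCast]
    norm_cast
    ring
  refine ⟨f 0, deriv f 0, (2 : ℂ)⁻¹ • iteratedDeriv 2 f 0, fun z => ?_⟩
  have h := hasSum_taylorSeries_of_entire hf 0 z
  have h' : HasSum (fun n : ℕ => ((n.factorial : ℂ))⁻¹ • (z - 0) ^ n • iteratedDeriv n f 0) _ :=
    hasSum_sum_of_ne_finset_zero (s := Finset.range 3) fun n hn => by
      rw [h3 n (by simpa using hn)]; simp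
  rw [h.unique h']
  simp [Finset.sum_range_succ, iteratedDeriv_one, smul_comm (z ^ 2), Nat.factorial]

/-- A pointwise limit of locally bounded entire functions is entire. -/
theorem differentiable_of_tendsto_of_bounded [CompleteSpace E] {ι : Type*} {l : Filter ι} [l.NeBot]
    [l.IsCountablyGenerated] {u : ι → ℂ → E} {v : ℂ → E} (hu : ∀ i, Differentiable ℂ (u i))
    (hlim : ∀ z, Tendsto (fun i => u i z) l (𝓝 (v z)))
    (hb : ∀ R : ℝ, ∃ B, ∀ᶠ i in l, ∀ z : ℂ, ‖z‖ ≤ R → ‖u i z‖ ≤ B) : Differentiable ℂ v := by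
  intro z₀
  set R := ‖z₀‖ + 1 with hRdef
  have hR : 0 < R := by positivity
  obtain ⟨B, hB⟩ := hb R
  have hvB : ∀ z : ℂ, ‖z‖ ≤ R → ‖v z‖ ≤ B := fun z hz =>
    le_of_tendsto (hlim z).norm (hB.mono fun i hi => hi z hz)
  have hmeas : AEStronglyMeasurable (fun y : ℝ => v (circleMap 0 R y))
      (volume.restrict (Ι (0 : ℝ) (2 * π))) := by
    refine aestronglyMeasurable_of_tendsto_ae l (f := fun i y => u i (circleMap 0 R y))
      (fun i => ?_) (ae_of_all _ fun y => hlim _)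
    exact ((hu i).continuous.comp (continuous_circleMap 0 R)).aestronglyMeasurable
  have hci : CircleIntegrable v 0 R := by
    rw [CircleIntegrable, intervalIntegrable_iff]
    have hc : IntegrableOn (fun _ : ℝ => B) (Ι (0 : ℝ) (2 * π)) :=
      intervalIntegrable_iff.1 intervalIntegrable_const
    exact Integrable.mono' hc hmeas
      (ae_of_all _ fun y => hvB _ (norm_circleMap_zero_of_pos hR y).le)
  -- Pointwise bounded convergence suffices to pass to the limit in Cauchy's formula, so the limit
  -- is itself a Cauchy integral and hence analytic.
  have hv : ∀ z ∈ ball (0 : ℂ) R, v z = (2 * π * I : ℂ)⁻¹ • ∮ k in C(0, R), (k - z)⁻¹ • v k := by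
    intro z hz
    have hcκ : ContinuousOn (fun k : ℂ => (k - z)⁻¹) (sphere 0 R) := fun k hk => by
      refine ((continuousAt_id.sub continuousAt_const).inv₀ (sub_ne_zero.2 ?_)).continuousWithinAt
      rintro rfl
      rw [mem_sphere_zero_iff_norm] at hk
      rw [mem_ball_zero_iff] at hz
      simp only [id] at hz; linarith
    obtain ⟨K, hK⟩ := (isCompact_sphere (0 : ℂ) R).exists_bound_of_continuousOn hcκ
    refine tendsto_nhds_unique (hlim z) ?_
    have : ∀ i, u i z = (2 * π * I : ℂ)⁻¹ • ∮ k in C(0, R), (k - z)⁻¹ • u i k := fun i =>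
      ((hu i).diffContOnCl.two_pi_i_inv_smul_circleIntegral_sub_inv_smul hz).symm
    simp only [this]
    refine Tendsto.const_smul (tendsto_circleIntegral (B := K * B) hR ?_ ?_ ?_) _
    · exact Eventually.of_forall fun i => CircleIntegrable.smul_of_continuous
        (hu i).continuous.continuousOn.circleIntegrable' hR.le hcκ
    · filter_upwards [hB] with i hi k hk _
      rw [norm_smul]
      have h1 := hK k (by simpa using hk)
      have h2 := hi k hk.le
      have : 0 ≤ K := (norm_nonneg _).trans h1
      gcongr
    · exact fun k _ _ => (hlim k).const_smul _
  have hpow := hasFPowerSeriesOn_cauchy_integral (R := ⟨R, hR.le⟩) hci (by exact_mod_cast hR)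
  have hd : DifferentiableOn ℂ (fun z => (2 * π * I : ℂ)⁻¹ • ∮ k in C(0, R), (k - z)⁻¹ • v k)
      (ball 0 R) := by
    have := hpow.differentiableOn
    exact this.mono (Metric.eball_coe (x := (0 : ℂ)) (ε := ⟨R, hR.le⟩)).ge
  have hz0 : ball (0 : ℂ) R ∈ 𝓝 z₀ := isOpen_ball.mem_nhds (by simp [hRdef])
  exact (hd.congr hv).differentiableAt hz0

end Limits

end CounterflowNLS

/-! ### Extension across arcs and isolated points -/

namespace CounterflowNLS

section Extension

open Complex Set Metric

/-- Extension of a holomorphic function across arcs of horizontal and vertical lines, on both sides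
of which it has the same limits, and across finitely many weak isolated singularities. -/
theorem exists_entire_extension {E : Type*} [NormedAddCommGroup E] [NormedSpace ℂ E]
    [CompleteSpace E] {Ω : Set ℂ} {A : ℂ → E} {S : Finset ℂ}
    (hΩ : IsOpen Ω) (hdense : ∀ z, (𝓝[Ω] z).NeBot) (hd : DifferentiableOn ℂ A Ω)
    (hS : ∀ z ∈ S, z ∉ Ω) (hlim : ∀ z ∉ S, z ∉ Ω → ∃ L, Tendsto A (𝓝[Ω] z) (𝓝 L))
    (hline : ∀ z ∉ S, z ∉ Ω → (∀ᶠ k in 𝓝 z, k.im ≠ z.im → k ∈ Ω) ∨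
      ∀ᶠ k in 𝓝 z, k.re ≠ z.re → k ∈ Ω)
    (hsing : ∀ z ∈ S, Tendsto (fun k => (k - z) • A k) (𝓝[Ω] z) (𝓝 0)) :
    ∃ F : ℂ → E, Differentiable ℂ F ∧ ∀ z ∈ Ω, F z = A z := by
  set B := extendFrom Ω A with hB
  have hlim' : ∀ z ∉ S, ∃ L, Tendsto A (𝓝[Ω] z) (𝓝 L) := fun z hz => by
    by_cases hzΩ : z ∈ Ω
    · exact ⟨A z, (hd z hzΩ).continuousWithinAt⟩
    · exact hlim z hz hzΩ
  have hBΩ : ∀ z ∈ Ω, B z = A z := fun z hz =>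
    extendFrom_eq (mem_closure_iff_nhdsWithin_neBot.2 (hdense z)) (hd z hz).continuousWithinAt
  have hBt : ∀ z ∉ S, Tendsto A (𝓝[Ω] z) (𝓝 (B z)) := fun z hz => tendsto_extendFrom (hlim' z hz)
  have hSo : IsOpen ((S : Set ℂ)ᶜ) := S.finite_toSet.isClosed.isOpen_compl
  have hBc : ContinuousOn B (S : Set ℂ)ᶜ :=
    continuousOn_extendFrom (fun z _ => mem_closure_iff_nhdsWithin_neBot.2 (hdense z))
      fun z hz => hlim' z hz
  have hBd : ∀ z ∈ Ω, DifferentiableAt ℂ B z := fun z hz =>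
    ((hd.congr hBΩ).differentiableAt (hΩ.mem_nhds hz))
  have hBS : ∀ z ∉ S, DifferentiableAt ℂ B z := by
    intro z hz
    by_cases hzΩ : z ∈ Ω
    · exact hBd z hzΩ
    · have hzS : ∀ᶠ k in 𝓝 z, k ∈ (S : Set ℂ)ᶜ := hSo.mem_nhds hz
      rcases hline z hz hzΩ with h | h
      · obtain ⟨r, hr, hrz⟩ := Metric.eventually_nhds_iff_ball.1 (h.and hzS)
        exact (differentiableOn_ball_of_im_ne (hBc.mono fun k hk => (hrz k hk).2)
          fun k hk hki => hBd k ((hrz k hk).1 hki)).differentiableAt (ball_mem_nhds z hr)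
      · obtain ⟨r, hr, hrz⟩ := Metric.eventually_nhds_iff_ball.1 (h.and hzS)
        exact (differentiableOn_ball_of_re_ne (hBc.mono fun k hk => (hrz k hk).2)
          fun k hk hki => hBd k ((hrz k hk).1 hki)).differentiableAt (ball_mem_nhds z hr)
  -- At the points of `S` the decay is known only along Ω. Density of Ω and continuity of the
  -- extension off `S` carry it over to a full punctured neighbourhood.
  obtain ⟨F, hF, hFB⟩ := exists_differentiableAt_of_isolated isOpen_univ S (fun _ _ => Set.mem_univ _)
    (fun z _ => hBS z) fun z hz => by
    rw [tendsto_zero_iff_norm_tendsto_zero, Metric.tendsto_nhds]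
    intro ε hε
    have h1 := (hsing z hz).norm
    rw [norm_zero] at h1
    have h2 := eventually_nhdsWithin_iff.1 (h1.eventually (gt_mem_nhds (half_pos hε)))
    have h3 : ∀ᶠ k in 𝓝[≠] z, k ∉ S := by
      have : ∀ᶠ k in 𝓝 z, k ∉ S.erase z :=
        (S.erase z).finite_toSet.isClosed.isOpen_compl.mem_nhds (by simp)
      filter_upwards [nhdsWithin_le_nhds this, self_mem_nhdsWithin] with k hk hkz hkS
      exact hk (Finset.mem_erase.2 ⟨hkz, hkS⟩)
    filter_upwards [nhdsWithin_le_nhds h2.eventually_nhds, h3] with k hk hkS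
    have := hdense k
    have h4 : Tendsto (fun u => ‖(u - z) • A u‖) (𝓝[Ω] k) (𝓝 ‖(k - z) • B k‖) := by
      have : Continuous fun u : ℂ => u - z := by fun_prop
      exact (((this.tendsto k).mono_left nhdsWithin_le_nhds).smul (hBt k hkS)).norm
    have h5 : ‖(k - z) • B k‖ ≤ ε / 2 :=
      le_of_tendsto h4 (eventually_nhdsWithin_iff.2 (hk.mono fun u hu huΩ => (hu huΩ).le))
    rw [dist_zero_right, norm_norm]
    linarith
  exact ⟨F, fun z => hF z (Set.mem_univ z), fun z hz => by rw [hFB z fun h => hS z h hz, hBΩ z hz]⟩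

end Extension

-- Matrix functions and the symmetries of the jump matrix

attribute [local instance] Matrix.normedAddCommGroup Matrix.normedSpace

/-- The entrywise sup norm is not submultiplicative: each entry of a product is a sum of two terms.
The numerical constants further on are largely powers of this 2. -/
theorem norm_mul_le_two (A B : Mat2) : ‖A * B‖ ≤ 2 * ‖A‖ * ‖B‖ := by
  rw [Matrix.norm_le_iff (by positivity)]
  intro i j
  rw [Matrix.mul_apply, Fin.sum_univ_two]
  refine (norm_add_le _ _).trans ?_
  rw [norm_mul, norm_mul]
  have h := fun a b => Matrix.norm_entry_le_entrywise_sup_norm A (i := a) (j := b)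
  have h' := fun a b => Matrix.norm_entry_le_entrywise_sup_norm B (i := a) (j := b)
  calc ‖A i 0‖ * ‖B 0 j‖ + ‖A i 1‖ * ‖B 1 j‖ ≤ ‖A‖ * ‖B‖ + ‖A‖ * ‖B‖ := by gcongr <;> simp [h, h']
    _ = 2 * ‖A‖ * ‖B‖ := by ring

theorem powSigma3_mul (z w : ℂ) : powSigma3 z * powSigma3 w = powSigma3 (z * w) := by
  ext i j; fin_cases i <;> fin_cases j <;> simp [powSigma3, Matrix.mul_apply, mul_comm]

theorem powSigma3_one : powSigma3 1 = 1 := by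
  ext i j; fin_cases i <;> fin_cases j <;> simp [powSigma3]

theorem conjTranspose_powSigma3 (z : ℂ) :
    (powSigma3 z).conjTranspose = powSigma3 (starRingEnd ℂ z) := by
  ext i j; fin_cases i <;> fin_cases j <;> simp [powSigma3, Matrix.conjTranspose_apply]

theorem differentiableAt_mat {f : ℂ → Mat2} {z : ℂ} :
    DifferentiableAt ℂ f z ↔ ∀ i j, DifferentiableAt ℂ (fun k => f k i j) z := by
  have h1 := differentiableAt_pi (𝕜 := ℂ) (F' := fun _ : Fin 2 => Fin 2 → ℂ) (Φ := f) (x := z)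
  have h2 := fun i => differentiableAt_pi (𝕜 := ℂ) (F' := fun _ : Fin 2 => ℂ)
    (Φ := fun k => f k i) (x := z)
  exact h1.trans (forall_congr' h2)

theorem tendsto_mat {ι : Type*} {f : ι → Mat2} {l : Filter ι} {L : Mat2} :
    Tendsto f l (𝓝 L) ↔ ∀ i j, Tendsto (fun k => f k i j) l (𝓝 (L i j)) := by
  have h1 := tendsto_pi_nhds (A := fun _ : Fin 2 => Fin 2 → ℂ) (f := f) (g := L) (u := l)
  have h2 := fun i => tendsto_pi_nhds (A := fun _ : Fin 2 => ℂ) (f := fun k => f k i) (g := L i)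
    (u := l)
  exact h1.trans (forall_congr' h2)

theorem DifferentiableAt.mat_mul {f g : ℂ → Mat2} {z : ℂ} (hf : DifferentiableAt ℂ f z)
    (hg : DifferentiableAt ℂ g z) : DifferentiableAt ℂ (fun k => f k * g k) z := by
  rw [differentiableAt_mat] at *
  intro i j
  simp only [Matrix.mul_apply]
  exact DifferentiableAt.fun_sum fun l _ => (hf i l).mul (hg l j)

theorem Tendsto.mat_mul {ι : Type*} {f g : ι → Mat2} {l : Filter ι} {A B : Mat2}
    (hf : Tendsto f l (𝓝 A)) (hg : Tendsto g l (𝓝 B)) :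
    Tendsto (fun k => f k * g k) l (𝓝 (A * B)) := hf.mul hg

theorem Tendsto.mat_star {ι : Type*} {f : ι → Mat2} {l : Filter ι} {A : Mat2}
    (hf : Tendsto f l (𝓝 A)) :
    Tendsto (fun k => (f k).conjTranspose) l (𝓝 A.conjTranspose) := by
  rw [tendsto_mat] at *
  exact fun i j => (hf j i).star

theorem DifferentiableAt.mat_star {f : ℂ → Mat2} {z : ℂ}
    (hf : DifferentiableAt ℂ f (starRingEnd ℂ z)) :
    DifferentiableAt ℂ (fun k => (f (starRingEnd ℂ k)).conjTranspose) z := by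
  rw [differentiableAt_mat] at *
  intro i j
  have := (hf j i).conj_conj
  rw [Complex.conj_conj] at this
  exact this

/-- The diagonal matrix `exp(i θ_o σ₃)`. -/
noncomputable def expPhase (x t : ℝ) (k : ℂ) : Mat2 := powSigma3 (Complex.exp (Complex.I * phase x t k))

theorem differentiable_expPhase (x t : ℝ) : Differentiable ℂ (expPhase x t) := by
  intro k
  rw [differentiableAt_mat]
  intro i j
  fin_cases i <;> fin_cases j <;> simp only [expPhase, powSigma3, phase] <;> simp [← Complex.exp_neg] <;> fun_prop

theorem conj_phase (x t : ℝ) (k : ℂ) :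
    starRingEnd ℂ (phase x t k) = phase x t (starRingEnd ℂ k) := by
  simp [phase, Complex.conj_ofNat]

/-- The phase is a real polynomial in k, so reflection and adjoint together invert the exponential
factor. -/
theorem conjTranspose_expPhase (x t : ℝ) (k : ℂ) :
    (expPhase x t (starRingEnd ℂ k)).conjTranspose =
      powSigma3 (Complex.exp (-(Complex.I * phase x t k))) := by
  rw [expPhase, conjTranspose_powSigma3, ← Complex.exp_conj]
  simp [conj_phase]

namespace RHPData

variable (D : RHPData)

/-- This removes the parameters: M e^{iθσ₃} jumps by J_o, the same matrix for all (x,t). -/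
theorem J_mul_expPhase (x t : ℝ) (k : ℂ) : D.J x t k * expPhase x t k = expPhase x t k * D.Jo k := by
  rw [J, expPhase, mul_assoc, powSigma3_mul, ← Complex.exp_add]
  simp [powSigma3_one]

/-- Reflection exchanges the two sides of the real line; being Hermitian is what makes N₁(k) N₂(k̄)ᴴ
continuous there. -/
theorem isHermitian_Jo (ξ : ℝ) : (D.Jo ξ).conjTranspose = D.Jo ξ := by
  ext i j; fin_cases i <;> fin_cases j <;> simp [Jo, Matrix.conjTranspose_apply, mul_comm]

variable {D}

theorem conj_ptPlus (D : RHPData) (u : ℝ) : starRingEnd ℂ (D.ptPlus u) = D.ptPlus (-u) := by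
  apply Complex.ext <;> simp [ptPlus]

theorem conj_ptMinus (D : RHPData) (u : ℝ) : starRingEnd ℂ (D.ptMinus u) = D.ptMinus (-u) := by
  apply Complex.ext <;> simp [ptMinus]

theorem Jo_ptPlus_of_pos {s : ℝ} (h : 0 < s) (hs : s < D.Ap) :
    D.Jo (D.ptPlus s) = !![Complex.I * D.ρ (D.ptPlus s) * Complex.exp (-(Complex.I * D.δ)), 0;
       -(Complex.I * Complex.exp (-(Complex.I * D.δ))),
       -(Complex.I * Complex.exp (Complex.I * D.δ) / D.ρ (D.ptPlus s))] := by
  rw [Jo, if_neg (by simpa [ptPlus] using h.ne'), if_pos (by simp [ptPlus]; exact ⟨h, hs⟩)]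

theorem Jo_ptPlus_of_neg {s : ℝ} (h : s < 0) (hs : -D.Ap < s) :
    D.Jo (D.ptPlus s) = !![Complex.I * Complex.exp (-(Complex.I * D.δ)) /
        starRingEnd ℂ (D.ρ (D.ptPlus (-s))), -(Complex.I * Complex.exp (Complex.I * D.δ)); 0,
       -(Complex.I * starRingEnd ℂ (D.ρ (D.ptPlus (-s))) * Complex.exp (Complex.I * D.δ))] := by
  rw [Jo, if_neg (by simpa [ptPlus] using h.ne), if_neg (by simp [ptPlus]; intro; linarith),
    if_pos (by simp [ptPlus]; exact ⟨hs, h⟩), conj_ptPlus]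

theorem Jo_ptMinus_of_pos (hV : D.V ≠ 0) {s : ℝ} (h : 0 < s) (hs : s < D.Am) :
    D.Jo (D.ptMinus s) = !![1, -D.r (D.ptMinus s); 0, 1] := by
  have hV' : ¬ D.V / 2 = -D.V / 2 := fun h => hV (by linarith)
  rw [Jo, if_neg (by simpa [ptMinus] using h.ne'), if_neg (by simp [ptMinus, hV']),
    if_neg (by simp [ptMinus, hV']), if_pos (by simp [ptMinus]; exact ⟨h, hs⟩)]

theorem Jo_ptMinus_of_neg (hV : D.V ≠ 0) {s : ℝ} (h : s < 0) (hs : -D.Am < s) :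
    D.Jo (D.ptMinus s) = !![1, 0; starRingEnd ℂ (D.r (D.ptMinus (-s))), 1] := by
  have hV' : ¬ D.V / 2 = -D.V / 2 := fun h => hV (by linarith)
  rw [Jo, if_neg (by simpa [ptMinus] using h.ne), if_neg (by simp [ptMinus, hV']),
    if_neg (by simp [ptMinus, hV']), if_neg (by simp [ptMinus]; intro; linarith),
    if_pos (by simp [ptMinus]; exact ⟨hs, h⟩), conj_ptMinus]

/-- Reflection keeps each side of a vertical cut, so the compatibility condition on a cut is that
the jumps at k and at k̄ are inverse up to the adjoint. -/
theorem Jo_mul_conj_plus (hD : D.Admissible) {s : ℝ} (h0 : 0 < |s|) (hs : |s| < D.Ap) :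
    D.Jo (D.ptPlus s) * (D.Jo (D.ptPlus (-s))).conjTranspose = 1 := by
  have hexp : Complex.exp (-(Complex.I * D.δ)) * Complex.exp (Complex.I * D.δ) = 1 := by
    rw [← Complex.exp_add]; simp
  have c1 : starRingEnd ℂ (Complex.exp (-(Complex.I * D.δ))) = Complex.exp (Complex.I * D.δ) := by
    rw [← Complex.exp_conj]; simp
  have c2 : starRingEnd ℂ (Complex.exp (Complex.I * D.δ)) = Complex.exp (-(Complex.I * D.δ)) := by
    rw [← Complex.exp_conj]; simp
  -- One identity with u = ρ, v = e^{-iδ}, w = e^{iδ} serves both halves of the cut: the lower half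
  -- is its adjoint.
  have main : ∀ u v w : ℂ, u ≠ 0 → v * w = 1 → starRingEnd ℂ v = w → starRingEnd ℂ w = v →
      !![Complex.I * u * v, 0; -(Complex.I * v), -(Complex.I * w / u)] *
      (!![Complex.I * v / starRingEnd ℂ u, -(Complex.I * w); 0,
       -(Complex.I * starRingEnd ℂ u * w)]).conjTranspose = 1 := by
    intro u v w hu hvw hv hw
    have hI := Complex.I_sq
    ext i j
    fin_cases i <;> fin_cases j <;>
      simp [Matrix.mul_apply, Fin.sum_univ_two, Matrix.conjTranspose_apply, hv, hw]
    · field_simp; linear_combination (-1 : ℂ) * hI + (-Complex.I ^ 2) * hvw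
    · field_simp; ring
    · field_simp; linear_combination (-1 : ℂ) * hI + (-Complex.I ^ 2) * hvw
  rw [abs_lt] at hs
  rcases lt_or_gt_of_ne (abs_pos.1 h0) with h | h
  · rw [Jo_ptPlus_of_neg h hs.1, Jo_ptPlus_of_pos (by linarith : 0 < -s) (by linarith)]
    have := main _ _ _ (hD.rho_ne (-s) (by linarith) (by linarith)) hexp c1 c2
    have h2 := congrArg Matrix.conjTranspose this
    rw [Matrix.conjTranspose_mul, Matrix.conjTranspose_conjTranspose,
      Matrix.conjTranspose_one] at h2
    exact h2
  · rw [Jo_ptPlus_of_pos h hs.2, Jo_ptPlus_of_neg (by linarith : -s < 0) (by linarith), neg_neg]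
    exact main _ _ _ (hD.rho_ne s h hs.2) hexp c1 c2

theorem Jo_mul_conj_minus (hD : D.Admissible) {s : ℝ} (h0 : 0 < |s|) (hs : |s| < D.Am) :
    D.Jo (D.ptMinus s) * (D.Jo (D.ptMinus (-s))).conjTranspose = 1 := by
  rw [abs_lt] at hs
  rcases lt_or_gt_of_ne (abs_pos.1 h0) with h | h
  · rw [Jo_ptMinus_of_neg hD.V_ne h hs.1, Jo_ptMinus_of_pos hD.V_ne (by linarith : 0 < -s) (by linarith)]
    ext i j; fin_cases i <;> fin_cases j <;>
      simp [Matrix.mul_apply, Fin.sum_univ_two, Matrix.conjTranspose_apply]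
  · rw [Jo_ptMinus_of_pos hD.V_ne h hs.2, Jo_ptMinus_of_neg hD.V_ne (by linarith : -s < 0) (by linarith), neg_neg]
    ext i j; fin_cases i <;> fin_cases j <;>
      simp [Matrix.mul_apply, Fin.sum_univ_two, Matrix.conjTranspose_apply]

/-- The complement of the contour and of the poles. -/
def regularSet (D : RHPData) : Set ℂ := (D.contour ∪ D.poles)ᶜ

/-- The branch points, the crossing points and the poles. -/
noncomputable def singularSet (D : RHPData) : Finset ℂ := by
  classical exact {D.ptPlus 0, D.ptMinus 0, D.ptPlus D.Ap, D.ptPlus (-D.Ap), D.ptMinus D.Am,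
    D.ptMinus (-D.Am)} ∪ (Finset.univ.image D.pole ∪
      Finset.univ.image fun n => starRingEnd ℂ (D.pole n))

theorem mem_singularSet {z : ℂ} : z ∈ D.singularSet ↔ z = D.ptPlus 0 ∨ z = D.ptMinus 0 ∨
    z = D.ptPlus D.Ap ∨ z = D.ptPlus (-D.Ap) ∨ z = D.ptMinus D.Am ∨ z = D.ptMinus (-D.Am) ∨
    z ∈ D.poles := by
  classical
  simp only [singularSet, poles, Finset.mem_union, Finset.mem_insert, Finset.mem_singleton,
    Finset.mem_image, Finset.mem_univ, true_and, Set.mem_ofPred_eq, exists_or, eq_comm, or_assoc]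

theorem finite_poles (D : RHPData) : D.poles.Finite :=
  D.singularSet.finite_toSet.subset fun z hz => by
    rw [Finset.mem_coe, mem_singularSet]; tauto

theorem isClosed_contour (D : RHPData) : IsClosed D.contour := by
  have h1 : IsClosed {k : ℂ | k.im = 0} := isClosed_eq Complex.continuous_im continuous_const
  have h2 : IsClosed D.cutPlus := (isClosed_eq Complex.continuous_re continuous_const).inter
    (isClosed_le Complex.continuous_im.abs continuous_const)
  have h3 : IsClosed D.cutMinus := (isClosed_eq Complex.continuous_re continuous_const).inter
    (isClosed_le Complex.continuous_im.abs continuous_const)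
  exact (h1.union h2).union h3

theorem isOpen_regularSet (D : RHPData) : IsOpen D.regularSet :=
  (D.isClosed_contour.union D.finite_poles.isClosed).isOpen_compl

theorem mem_contour {z : ℂ} : z ∈ D.contour ↔ z.im = 0 ∨ (z.re = -D.V / 2 ∧ |z.im| ≤ D.Ap) ∨
    (z.re = D.V / 2 ∧ |z.im| ≤ D.Am) := by
  simp [contour, cutPlus, cutMinus, or_assoc]

theorem conj_mem_contour {z : ℂ} : starRingEnd ℂ z ∈ D.contour ↔ z ∈ D.contour := by
  simp [mem_contour]

theorem conj_mem_poles {z : ℂ} : starRingEnd ℂ z ∈ D.poles ↔ z ∈ D.poles := by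
  have : ∀ w, starRingEnd ℂ z = w ↔ z = starRingEnd ℂ w := fun w =>
    ⟨fun h => by rw [← h, Complex.conj_conj], fun h => by rw [h, Complex.conj_conj]⟩
  simp only [poles, Set.mem_ofPred_eq, this, Complex.conj_conj, or_comm]

theorem conj_mem_regularSet {z : ℂ} : starRingEnd ℂ z ∈ D.regularSet ↔ z ∈ D.regularSet := by
  simp only [regularSet, Set.mem_compl_iff, Set.mem_union, conj_mem_contour, conj_mem_poles]

theorem tendsto_conj_regularSet (D : RHPData) (z : ℂ) : Tendsto (starRingEnd ℂ) (𝓝[D.regularSet] z)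
    (𝓝[D.regularSet] (starRingEnd ℂ z)) :=
  tendsto_nhdsWithin_iff.2 ⟨(Complex.continuous_conj.tendsto z).mono_left nhdsWithin_le_nhds,
    eventually_nhdsWithin_of_forall fun _ hk => conj_mem_regularSet.2 hk⟩

theorem regularSet_subset (D : RHPData) : D.regularSet ⊆ D.contourᶜ :=
  Set.compl_subset_compl.2 Set.subset_union_left

/-- Moving from z in the direction 1 + i leaves the real line, both vertical lines and the finite
set of poles at once. -/
theorem neBot_nhdsWithin_regularSet (D : RHPData) (z : ℂ) : (𝓝[D.regularSet] z).NeBot := by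
  have hc : Continuous fun ε : ℝ => z + ε * (1 + Complex.I) := by fun_prop
  have hne : ∀ (u v : ℝ), ∀ᶠ ε in 𝓝[>] (0 : ℝ), u + ε ≠ v := fun u v => by
    have hcu : Continuous fun ε : ℝ => u + ε := by fun_prop
    by_cases h : u = v
    · filter_upwards [self_mem_nhdsWithin] with ε hε
      have hε : 0 < ε := hε
      rw [h]; intro h'; linarith
    · exact nhdsWithin_le_nhds ((hcu.tendsto' 0 u (by simp)).eventually (isOpen_ne.mem_nhds h))
  have hp : ∀ᶠ ε : ℝ in 𝓝[>] (0 : ℝ), z + ε * (1 + Complex.I) ∉ D.poles := by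
    have h1 : ∀ᶠ k in 𝓝 z, k ∉ D.poles \ {z} :=
      (D.finite_poles.subset Set.sdiff_subset).isClosed.isOpen_compl.mem_nhds (by simp)
    filter_upwards [nhdsWithin_le_nhds ((hc.tendsto' 0 z (by simp)).eventually h1),
      self_mem_nhdsWithin] with ε h2 h3 h4
    have h3 : 0 < ε := h3
    refine h2 ⟨h4, fun h5 => ?_⟩
    have := congrArg Complex.re h5
    simp at this; linarith
  refine Tendsto.neBot (f := fun ε : ℝ => z + ε * (1 + Complex.I)) (x := 𝓝[>] 0)
    (tendsto_nhdsWithin_iff.2 ⟨(hc.tendsto' 0 z (by simp)).mono_left nhdsWithin_le_nhds, ?_⟩)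
  filter_upwards [hne z.re (-D.V / 2), hne z.re (D.V / 2), hne z.im 0, hp] with ε h1 h2 h3 h4
  rw [regularSet, Set.mem_compl_iff, Set.mem_union, mem_contour]
  simp only [Complex.add_re, Complex.add_im, Complex.mul_re, Complex.mul_im, Complex.ofReal_re,
    Complex.ofReal_im, Complex.one_re, Complex.one_im, Complex.I_re, Complex.I_im]
  simp only [h4, or_false]
  intro h
  rcases h with h | h | h
  · exact h3 (by linarith)
  · exact h1 (by linarith [h.1])
  · exact h2 (by linarith [h.1])

end RHPData

end CounterflowNLS

/-! ### The entire quotient of two solutions -/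

namespace CounterflowNLS

attribute [local instance] Matrix.normedAddCommGroup Matrix.normedSpace

theorem mul_expPhase_apply (A : Mat2) (x t : ℝ) (k : ℂ) (i j : Fin 2) :
    (A * expPhase x t k) i j = A i j * expPhase x t k j j := by
  fin_cases j <;> simp [Matrix.mul_apply, Fin.sum_univ_two, expPhase, powSigma3]

theorem isBigO_mat {ι : Type*} {f : ι → Mat2} {l : Filter ι} {g : ι → ℝ}
    (h : ∀ i j, (fun k => f k i j) =O[l] g) : f =O[l] g := by
  have h2 := fun i => (isBigO_pi (E' := fun _ : Fin 2 => ℂ) (f := fun k => f k i)).2 (h i)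
  exact (isBigO_pi (E' := fun _ : Fin 2 => Fin 2 → ℂ) (f := f)).2 h2

theorem tendsto_sub_smul_of_isBigO_one {f : ℂ → Mat2} {s : Set ℂ} {z : ℂ}
    (h : f =O[𝓝[s] z] fun _ => (1 : ℝ)) : Tendsto (fun k => (k - z) • f k) (𝓝[s] z) (𝓝 0) := by
  have h1 : Tendsto (fun k : ℂ => k - z) (𝓝[s] z) (𝓝 0) := by
    have : Continuous fun k : ℂ => k - z := by fun_prop
    exact (this.tendsto' z 0 (by simp)).mono_left nhdsWithin_le_nhds
  have h2 : (fun k : ℂ => k - z) =o[𝓝[s] z] fun _ => (1 : ℝ) := (isLittleO_one_iff ℝ).2 h1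
  have h3 := h2.smul_isBigO h
  have h4 : (fun k => (k - z) • f k) =o[𝓝[s] z] fun _ => (1 : ℝ) := by
    simpa only [smul_eq_mul, mul_one] using h3
  exact (isLittleO_one_iff ℝ).1 h4

/-- The matrix function `N₁(k) N₂(conj k)ᴴ`. -/
def twist (N₁ N₂ : ℂ → Mat2) (k : ℂ) : Mat2 := N₁ k * (N₂ (starRingEnd ℂ k)).conjTranspose

theorem twist_apply (N₁ N₂ : ℂ → Mat2) (k : ℂ) (i j : Fin 2) : twist N₁ N₂ k i j =
    N₁ k i 0 * starRingEnd ℂ (N₂ (starRingEnd ℂ k) j 0) +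
    N₁ k i 1 * starRingEnd ℂ (N₂ (starRingEnd ℂ k) j 1) := by
  simp [twist, Matrix.mul_apply, Fin.sum_univ_two, Matrix.conjTranspose_apply]

/-- Exchanging the two solutions amounts to reflection, so singular points in the lower half plane
reduce to those in the upper one. -/
theorem conjTranspose_twist (N₁ N₂ : ℂ → Mat2) (k : ℂ) :
    (twist N₁ N₂ (starRingEnd ℂ k)).conjTranspose = twist N₂ N₁ k := by
  simp [twist, Matrix.conjTranspose_mul]

theorem tendsto_twist {N₁ N₂ : ℂ → Mat2} {l l' : Filter ℂ} {A B : Mat2}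
    (h₁ : Tendsto N₁ l (𝓝 A)) (hc : Tendsto (starRingEnd ℂ) l l') (h₂ : Tendsto N₂ l' (𝓝 B)) :
    Tendsto (twist N₁ N₂) l (𝓝 (A * B.conjTranspose)) :=
  Tendsto.mat_mul h₁ (Tendsto.mat_star (h₂.comp hc))

theorem tendsto_conj_upper (ξ : ℝ) : Tendsto (starRingEnd ℂ) (𝓝[{z | 0 < z.im}] (ξ : ℂ))
    (𝓝[{z | z.im < 0}] (ξ : ℂ)) :=
  tendsto_nhdsWithin_iff.2 ⟨(Complex.continuous_conj.tendsto' _ _ (by simp)).mono_left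
    nhdsWithin_le_nhds, eventually_nhdsWithin_of_forall fun k (hk : 0 < k.im) => by simpa using hk⟩

theorem tendsto_conj_lower (ξ : ℝ) : Tendsto (starRingEnd ℂ) (𝓝[{z | z.im < 0}] (ξ : ℂ))
    (𝓝[{z | 0 < z.im}] (ξ : ℂ)) :=
  tendsto_nhdsWithin_iff.2 ⟨(Complex.continuous_conj.tendsto' _ _ (by simp)).mono_left
    nhdsWithin_le_nhds, eventually_nhdsWithin_of_forall fun k (hk : k.im < 0) => by simpa using hk⟩

theorem tendsto_conj_re_lt (z : ℂ) (c : ℝ) : Tendsto (starRingEnd ℂ) (𝓝[{z | z.re < c}] z)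
    (𝓝[{z | z.re < c}] (starRingEnd ℂ z)) :=
  tendsto_nhdsWithin_iff.2 ⟨(Complex.continuous_conj.tendsto z).mono_left
    nhdsWithin_le_nhds, eventually_nhdsWithin_of_forall fun k (hk : k.re < c) => by simpa using hk⟩

theorem tendsto_conj_lt_re (z : ℂ) (c : ℝ) : Tendsto (starRingEnd ℂ) (𝓝[{z | c < z.re}] z)
    (𝓝[{z | c < z.re}] (starRingEnd ℂ z)) :=
  tendsto_nhdsWithin_iff.2 ⟨(Complex.continuous_conj.tendsto z).mono_left
    nhdsWithin_le_nhds, eventually_nhdsWithin_of_forall fun k (hk : c < k.re) => by simpa using hk⟩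

namespace RHPData

variable {D : RHPData}

theorem tendsto_conj_contour (D : RHPData) (z : ℂ) : Tendsto (starRingEnd ℂ) (𝓝[D.contourᶜ] z)
    (𝓝[D.contourᶜ] (starRingEnd ℂ z)) :=
  tendsto_nhdsWithin_iff.2 ⟨(Complex.continuous_conj.tendsto z).mono_left nhdsWithin_le_nhds,
    eventually_nhdsWithin_of_forall fun _ hk => (not_congr conj_mem_contour).2 hk⟩

theorem norm_rootUpper (D : RHPData) (k : ℂ) :
    ‖D.rootUpper k‖ = ‖k - D.ptPlus D.Ap‖ ^ (1 / 4 : ℝ) := by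
  have h := Complex.norm_cpow_real (-Complex.I * (k - D.ptPlus D.Ap)) (1 / 4)
  push_cast at h
  rw [rootUpper, norm_mul, h, norm_mul, norm_neg, Complex.norm_I, one_mul, mul_comm Complex.I]
  have := Complex.norm_exp_ofReal_mul_I (Real.pi / 8)
  push_cast at this
  rw [this, one_mul]

theorem norm_rootLower (D : RHPData) (k : ℂ) :
    ‖D.rootLower k‖ = ‖k - D.ptPlus (-D.Ap)‖ ^ (1 / 4 : ℝ) := by
  have h := Complex.norm_cpow_real (Complex.I * (k - D.ptPlus (-D.Ap))) (1 / 4)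
  push_cast at h
  rw [rootLower, norm_mul, h, norm_mul, Complex.norm_I, one_mul, mul_comm Complex.I]
  have := Complex.norm_exp_ofReal_mul_I (-(Real.pi / 8))
  push_cast at this
  rw [← neg_mul, this, one_mul]

theorem isBigO_of_mul_tendsto {f r : ℂ → ℂ} {l : Filter ℂ} {L : ℂ} {g : ℂ → ℝ}
    (h : Tendsto (fun k => f k * r k) l (𝓝 L)) (hr : ∀ᶠ k in l, 0 < g k ∧ ‖r k‖ = g k) :
    f =O[l] fun k => (g k)⁻¹ := by
  have h1 : (fun k => f k * r k) =O[l] fun _ => (1 : ℝ) := h.isBigO_one ℝ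
  have h2 : (fun k => (r k)⁻¹) =O[l] fun k => (g k)⁻¹ := by
    refine IsBigO.of_bound 1 ?_
    filter_upwards [hr] with k hk
    rw [norm_inv, hk.2, norm_inv, Real.norm_of_nonneg hk.1.le, one_mul]
  refine ((h1.mul h2).congr' ?_ ?_)
  · filter_upwards [hr] with k hk
    have : r k ≠ 0 := norm_pos_iff.1 (by rw [hk.2]; exact hk.1)
    field_simp
  · exact Eventually.of_forall fun k => one_mul _

theorem ptPlus_mem_contour {s : ℝ} (hs : |s| ≤ D.Ap) : D.ptPlus s ∈ D.contour :=
  mem_contour.2 (Or.inr (Or.inl ⟨rfl, hs⟩))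

theorem ptMinus_mem_contour {s : ℝ} (hs : |s| ≤ D.Am) : D.ptMinus s ∈ D.contour :=
  mem_contour.2 (Or.inr (Or.inr ⟨rfl, hs⟩))

theorem eventually_norm_sub_rpow_pos {z : ℂ} (hz : z ∈ D.contour) :
    ∀ᶠ k in 𝓝[D.contourᶜ] z, 0 < ‖k - z‖ ^ (1 / 4 : ℝ) :=
  eventually_nhdsWithin_of_forall fun k hk => Real.rpow_pos_of_pos (norm_pos_iff.2
    (sub_ne_zero.2 fun h => hk (by rw [h]; exact hz))) _

namespace IsSolution

variable {x t : ℝ} {M Mp Mm : ℂ → Mat2}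

/-- The fourth root enters the two columns with opposite exponents, and at the conjugate point the
exponents are exchanged. This is what makes the product with the reflected matrix bounded. -/
theorem isBigO_upper (hD : D.Admissible) (h : D.IsSolution x t M Mp Mm) (i : Fin 2) :
    ((fun k => M k i 0) =O[𝓝[D.contourᶜ] (D.ptPlus D.Ap)]
      fun k => (‖k - D.ptPlus D.Ap‖ ^ (1 / 4 : ℝ))⁻¹) ∧
    ((fun k => M k i 1) =O[𝓝[D.contourᶜ] (D.ptPlus D.Ap)]
      fun k => ‖k - D.ptPlus D.Ap‖ ^ (1 / 4 : ℝ)) := by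
  obtain ⟨B, hB⟩ := h.growth_p_plus
  have hpos := eventually_norm_sub_rpow_pos (D := D)
    (ptPlus_mem_contour (s := D.Ap) (abs_of_pos hD.Ap_pos).le)
  constructor
  · refine isBigO_of_mul_tendsto (r := fun k => D.rootUpper k) (L := B i 0) ?_ ?_
    · simpa [Matrix.mul_apply, Fin.sum_univ_two, powSigma3] using tendsto_mat.1 hB i 0
    · exact hpos.mono fun k hk => ⟨hk, D.norm_rootUpper k⟩
  · refine (isBigO_of_mul_tendsto (r := fun k => (D.rootUpper k)⁻¹) (L := B i 1)
      (g := fun k => (‖k - D.ptPlus D.Ap‖ ^ (1 / 4 : ℝ))⁻¹) ?_ ?_).congr_right fun k => inv_inv _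
    · simpa [Matrix.mul_apply, Fin.sum_univ_two, powSigma3] using tendsto_mat.1 hB i 1
    · exact hpos.mono fun k hk => ⟨inv_pos.2 hk, by rw [norm_inv, D.norm_rootUpper k]⟩

theorem isBigO_lower (hD : D.Admissible) (h : D.IsSolution x t M Mp Mm) (i : Fin 2) :
    ((fun k => M k i 0) =O[𝓝[D.contourᶜ] (D.ptPlus (-D.Ap))]
      fun k => ‖k - D.ptPlus (-D.Ap)‖ ^ (1 / 4 : ℝ)) ∧
    ((fun k => M k i 1) =O[𝓝[D.contourᶜ] (D.ptPlus (-D.Ap))]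
      fun k => (‖k - D.ptPlus (-D.Ap)‖ ^ (1 / 4 : ℝ))⁻¹) := by
  obtain ⟨B, hB⟩ := h.growth_conj_p_plus
  have hpos := eventually_norm_sub_rpow_pos (D := D)
    (ptPlus_mem_contour (s := -D.Ap) (by rw [abs_neg, abs_of_pos hD.Ap_pos]))
  constructor
  · refine (isBigO_of_mul_tendsto (r := fun k => (D.rootLower k)⁻¹) (L := B i 0)
      (g := fun k => (‖k - D.ptPlus (-D.Ap)‖ ^ (1 / 4 : ℝ))⁻¹) ?_ ?_).congr_right fun k => inv_inv _
    · simpa [Matrix.mul_apply, Fin.sum_univ_two, powSigma3] using tendsto_mat.1 hB i 0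
    · exact hpos.mono fun k hk => ⟨inv_pos.2 hk, by rw [norm_inv, D.norm_rootLower k]⟩
  · refine isBigO_of_mul_tendsto (r := fun k => D.rootLower k) (L := B i 1) ?_ ?_
    · simpa [Matrix.mul_apply, Fin.sum_univ_two, powSigma3] using tendsto_mat.1 hB i 1
    · exact hpos.mono fun k hk => ⟨hk, D.norm_rootLower k⟩

theorem differentiableAt (h : D.IsSolution x t M Mp Mm) {k : ℂ} (hk : k ∈ D.regularSet) :
    DifferentiableAt ℂ M k :=
  differentiableAt_mat.2 fun i j =>
    (h.analytic i j).differentiableAt (D.isOpen_regularSet.mem_nhds hk)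

end IsSolution

/-- In N₁(k) N₂(k̄)ᴴ a column meets only the column with the same index, so only the products g j ·
h j have to be bounded. -/
theorem isBigO_twist_one {x₁ t₁ x₂ t₂ : ℝ} {M₁ M₂ : ℂ → Mat2} {l : Filter ℂ} {z : ℂ} (hl : l ≤ 𝓝 z)
    {g h : Fin 2 → ℂ → ℝ} (h₁ : ∀ i j, (fun k => M₁ k i j) =O[l] g j)
    (h₂ : ∀ i j, (fun k => M₂ (starRingEnd ℂ k) i j) =O[l] h j)
    (hgh : ∀ j, (fun k => g j k * h j k) =O[l] fun _ => (1 : ℝ)) :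
    twist (fun k => M₁ k * expPhase x₁ t₁ k) (fun k => M₂ k * expPhase x₂ t₂ k) =O[l]
      fun _ => (1 : ℝ) := by
  have he : ∀ (x t : ℝ) (j : Fin 2), (fun k => expPhase x t k j j) =O[l] fun _ => (1 : ℝ) :=
    fun x t j => ((tendsto_mat.1 ((differentiable_expPhase x t).continuous.tendsto z) j j).mono_left
      hl).isBigO_one ℝ
  have he' : ∀ (x t : ℝ) (j : Fin 2), (fun k => expPhase x t (starRingEnd ℂ k) j j) =O[l]
      fun _ => (1 : ℝ) := fun x t j =>
    ((tendsto_mat.1 (((differentiable_expPhase x t).continuous.comp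
      Complex.continuous_conj).tendsto z) j j).mono_left hl).isBigO_one ℝ
  have hc : ∀ i j, (fun k => starRingEnd ℂ ((M₂ (starRingEnd ℂ k) *
      expPhase x₂ t₂ (starRingEnd ℂ k)) i j)) =O[l] h j := fun i j => by
    have := (h₂ i j).mul (he' x₂ t₂ j)
    simp only [mul_one] at this
    simp only [mul_expPhase_apply]
    exact (isBigO_iff.2 ((isBigO_iff.1 this).imp fun c hc => hc.mono fun k hk => by
      rwa [RCLike.norm_conj]))
  have h1 : ∀ i j, (fun k => (M₁ k * expPhase x₁ t₁ k) i j) =O[l] g j := fun i j => by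
    simpa only [mul_expPhase_apply, mul_one] using (h₁ i j).mul (he x₁ t₁ j)
  refine isBigO_mat fun i j => ?_
  simp only [twist_apply]
  exact (((h1 i 0).mul (hc j 0)).trans (hgh 0)).add (((h1 i 1).mul (hc j 1)).trans (hgh 1))

section Twist

variable {x₁ t₁ x₂ t₂ : ℝ} {M₁ Mp₁ Mm₁ M₂ Mp₂ Mm₂ : ℂ → Mat2}

theorem eventually_not_mem_poles {z : ℂ} (hz : z ∉ D.poles) : ∀ᶠ k in 𝓝 z, k ∉ D.poles :=
  D.finite_poles.isClosed.isOpen_compl.mem_nhds hz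

theorem mem_regularSet {k : ℂ} : k ∈ D.regularSet ↔ ¬(k.im = 0 ∨ (k.re = -D.V / 2 ∧ |k.im| ≤ D.Ap) ∨
    (k.re = D.V / 2 ∧ |k.im| ≤ D.Am)) ∧ k ∉ D.poles := by
  rw [← mem_contour, regularSet, Set.mem_compl_iff, Set.mem_union, not_or]

/-- The points of the contour that are not singular points. -/
theorem mem_contour_cases {z : ℂ} (hz : z ∉ D.singularSet) (hz' : z ∉ D.regularSet) :
    (∃ ξ : ℝ, z = ξ ∧ ξ ≠ -D.V / 2 ∧ ξ ≠ D.V / 2) ∨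
    (∃ s : ℝ, z = D.ptPlus s ∧ 0 < |s| ∧ |s| < D.Ap) ∨
    (∃ s : ℝ, z = D.ptMinus s ∧ 0 < |s| ∧ |s| < D.Am) := by
  rw [mem_singularSet] at hz
  simp only [not_or] at hz
  obtain ⟨h1, h2, h3, h4, h5, h6, h7⟩ := hz
  have hc : z ∈ D.contour := by
    by_contra hc
    exact hz' (fun h => h.elim hc h7)
  rw [mem_contour] at hc
  by_cases him : z.im = 0
  · refine Or.inl ⟨z.re, Complex.ext rfl (by simpa), fun h => h1 ?_, fun h => h2 ?_⟩
    · exact Complex.ext h him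
    · exact Complex.ext h him
  · have hpos := abs_pos.2 him
    have habs : ∀ A : ℝ, |z.im| ≤ A → z.im ≠ A → z.im ≠ -A → |z.im| < A := fun A h h' h'' =>
      lt_of_le_of_ne h fun he => by
        rcases abs_choice z.im with h0 | h0
        · exact h' (by rw [← he, h0])
        · exact h'' (by rw [← he, h0, neg_neg])
    rcases hc with hc | ⟨hre, hle⟩ | ⟨hre, hle⟩
    · exact absurd hc him
    · exact Or.inr (Or.inl ⟨z.im, Complex.ext hre rfl, hpos, habs _ hle
        (fun h => h3 (Complex.ext hre h)) fun h => h4 (Complex.ext hre h)⟩)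
    · exact Or.inr (Or.inr ⟨z.im, Complex.ext hre rfl, hpos, habs _ hle
        (fun h => h5 (Complex.ext hre h)) fun h => h6 (Complex.ext hre h)⟩)

theorem eventually_re_ne {z : ℂ} {c : ℝ} (h : z.re ≠ c) : ∀ᶠ k in 𝓝 z, k.re ≠ c :=
  (Complex.continuous_re.tendsto z).eventually (isOpen_ne.mem_nhds h)

theorem eventually_im_ne {z : ℂ} {c : ℝ} (h : z.im ≠ c) : ∀ᶠ k in 𝓝 z, k.im ≠ c :=
  (Complex.continuous_im.tendsto z).eventually (isOpen_ne.mem_nhds h)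

theorem eventually_mem_of_real {ξ : ℝ} (h1 : ξ ≠ -D.V / 2) (h2 : ξ ≠ D.V / 2)
    (hp : (ξ : ℂ) ∉ D.poles) : ∀ᶠ k in 𝓝 (ξ : ℂ), k.im ≠ 0 → k ∈ D.regularSet := by
  filter_upwards [eventually_re_ne (z := ξ) h1, eventually_re_ne (z := ξ) h2,
    eventually_not_mem_poles hp] with k h1 h2 h3 h4
  rw [mem_regularSet]; tauto

theorem eventually_mem_of_ptPlus (hV : D.V ≠ 0) {s : ℝ} (h0 : 0 < |s|)
    (hp : D.ptPlus s ∉ D.poles) :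
    ∀ᶠ k in 𝓝 (D.ptPlus s), k.re ≠ -D.V / 2 → k ∈ D.regularSet := by
  have hV' : (D.ptPlus s).re ≠ D.V / 2 := fun h => hV (by simp [ptPlus] at h; linarith)
  filter_upwards [eventually_re_ne hV', eventually_im_ne (z := D.ptPlus s) (abs_pos.1 h0),
    eventually_not_mem_poles hp] with k h1 h2 h3 h4
  rw [mem_regularSet]; tauto

theorem eventually_mem_of_ptMinus (hV : D.V ≠ 0) {s : ℝ} (h0 : 0 < |s|)
    (hp : D.ptMinus s ∉ D.poles) :
    ∀ᶠ k in 𝓝 (D.ptMinus s), k.re ≠ D.V / 2 → k ∈ D.regularSet := by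
  have hV' : (D.ptMinus s).re ≠ -D.V / 2 := fun h => hV (by simp [ptMinus] at h; linarith)
  filter_upwards [eventually_re_ne hV', eventually_im_ne (z := D.ptMinus s) (abs_pos.1 h0),
    eventually_not_mem_poles hp] with k h1 h2 h3 h4
  rw [mem_regularSet]; tauto

theorem nhdsWithin_real_le (D : RHPData) (ξ : ℝ) : 𝓝[D.contourᶜ] (ξ : ℂ) ≤
    𝓝[{z | 0 < z.im}] (ξ : ℂ) ⊔ 𝓝[{z | z.im < 0}] (ξ : ℂ) := by
  rw [← nhdsWithin_union]
  refine nhdsWithin_mono _ fun k hk => ?_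
  have : k.im ≠ 0 := fun h => hk (mem_contour.2 (Or.inl h))
  exact (lt_or_gt_of_ne this).symm

theorem nhdsWithin_ptPlus_le {s : ℝ} (hs : |s| < D.Ap) : 𝓝[D.contourᶜ] (D.ptPlus s) ≤
    𝓝[{z | z.re < -D.V / 2}] (D.ptPlus s) ⊔ 𝓝[{z | -D.V / 2 < z.re}] (D.ptPlus s) := by
  rw [← nhdsWithin_union]
  refine nhdsWithin_le_of_mem ?_
  have : ∀ᶠ k in 𝓝 (D.ptPlus s), |k.im| < D.Ap :=
    (Complex.continuous_im.abs.tendsto _).eventually (gt_mem_nhds hs)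
  filter_upwards [nhdsWithin_le_nhds this, self_mem_nhdsWithin] with k h1 h2
  have : k.re ≠ -D.V / 2 := fun h => h2 (mem_contour.2 (Or.inr (Or.inl ⟨h, h1.le⟩)))
  exact lt_or_gt_of_ne this

theorem nhdsWithin_ptMinus_le {s : ℝ} (hs : |s| < D.Am) : 𝓝[D.contourᶜ] (D.ptMinus s) ≤
    𝓝[{z | z.re < D.V / 2}] (D.ptMinus s) ⊔ 𝓝[{z | D.V / 2 < z.re}] (D.ptMinus s) := by
  rw [← nhdsWithin_union]
  refine nhdsWithin_le_of_mem ?_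
  have : ∀ᶠ k in 𝓝 (D.ptMinus s), |k.im| < D.Am :=
    (Complex.continuous_im.abs.tendsto _).eventually (gt_mem_nhds hs)
  filter_upwards [nhdsWithin_le_nhds this, self_mem_nhdsWithin] with k h1 h2
  have : k.re ≠ D.V / 2 := fun h => h2 (mem_contour.2 (Or.inr (Or.inr ⟨h, h1.le⟩)))
  exact lt_or_gt_of_ne this

theorem tendsto_mul_expPhase {M : ℂ → Mat2} {l : Filter ℂ} {z : ℂ} {L : Mat2} (hl : l ≤ 𝓝 z)
    (h : Tendsto M l (𝓝 L)) (x t : ℝ) :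
    Tendsto (fun k => M k * expPhase x t k) l (𝓝 (L * expPhase x t z)) :=
  Tendsto.mat_mul h (((differentiable_expPhase x t).continuous.tendsto z).mono_left hl)

/-- Two solutions for different parameters, multiplied by the exponentials of the phase, differ by
an entire factor. -/
theorem tendsto_twist_contour (hD : D.Admissible) (h₁ : D.IsSolution x₁ t₁ M₁ Mp₁ Mm₁)
    (h₂ : D.IsSolution x₂ t₂ M₂ Mp₂ Mm₂) {z : ℂ} (hz : z ∉ D.singularSet) (hz' : z ∉ D.regularSet) :
    ∃ L, Tendsto (twist (fun k => M₁ k * expPhase x₁ t₁ k) (fun k => M₂ k * expPhase x₂ t₂ k))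
      (𝓝[D.regularSet] z) (𝓝 L) := by
  have hmono := nhdsWithin_mono z D.regularSet_subset
  have jump : ∀ (x t : ℝ) (A B : Mat2) (k : ℂ), A = B * D.J x t k →
      A * expPhase x t k = B * expPhase x t k * D.Jo k := fun x t A B k h => by
    rw [h, mul_assoc, J_mul_expPhase, mul_assoc]
  rcases mem_contour_cases hz hz' with ⟨ξ, rfl, hξ1, hξ2⟩ | ⟨s, rfl, h0, hs⟩ | ⟨s, rfl, h0, hs⟩
  -- The limits from above and below pair opposite sides: plus with minus, minus with plus. Both
  -- equal the same expression in the minus values with one Hermitian factor J_o in the middle.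
  · obtain ⟨p1, m1, j1⟩ := h₁.jump_real ξ hξ1 hξ2
    obtain ⟨p2, m2, j2⟩ := h₂.jump_real ξ hξ1 hξ2
    have t1 := tendsto_twist (tendsto_mul_expPhase nhdsWithin_le_nhds p1 x₁ t₁)
      (tendsto_conj_upper ξ) (tendsto_mul_expPhase nhdsWithin_le_nhds m2 x₂ t₂)
    have t2 := tendsto_twist (tendsto_mul_expPhase nhdsWithin_le_nhds m1 x₁ t₁)
      (tendsto_conj_lower ξ) (tendsto_mul_expPhase nhdsWithin_le_nhds p2 x₂ t₂)
    rw [jump _ _ _ _ _ j1] at t1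
    rw [jump _ _ _ _ _ j2, Matrix.conjTranspose_mul, isHermitian_Jo, ← mul_assoc] at t2
    exact ⟨_, (t1.sup t2).mono_left (hmono.trans (D.nhdsWithin_real_le ξ))⟩
  -- On a cut the limits pair equal sides, and the two jump factors multiply to the identity.
  · obtain ⟨p1, m1, j1⟩ := h₁.jump_plus s h0 hs
    obtain ⟨p2, m2, j2⟩ := h₂.jump_plus (-s) (by simpa using h0) (by simpa using hs)
    have c1 := tendsto_conj_re_lt (D.ptPlus s) (-D.V / 2)
    have c2 := tendsto_conj_lt_re (D.ptPlus s) (-D.V / 2)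
    rw [conj_ptPlus] at c1 c2
    have t1 := tendsto_twist (tendsto_mul_expPhase nhdsWithin_le_nhds p1 x₁ t₁) c1
      (tendsto_mul_expPhase nhdsWithin_le_nhds p2 x₂ t₂)
    have t2 := tendsto_twist (tendsto_mul_expPhase nhdsWithin_le_nhds m1 x₁ t₁) c2
      (tendsto_mul_expPhase nhdsWithin_le_nhds m2 x₂ t₂)
    rw [jump _ _ _ _ _ j1, jump _ _ _ _ _ j2, Matrix.conjTranspose_mul, mul_assoc,
      ← mul_assoc (D.Jo _), Jo_mul_conj_plus hD h0 hs, one_mul] at t1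
    exact ⟨_, (t1.sup t2).mono_left (hmono.trans (nhdsWithin_ptPlus_le hs))⟩
  · obtain ⟨p1, m1, j1⟩ := h₁.jump_minus s h0 hs
    obtain ⟨p2, m2, j2⟩ := h₂.jump_minus (-s) (by simpa using h0) (by simpa using hs)
    have c1 := tendsto_conj_re_lt (D.ptMinus s) (D.V / 2)
    have c2 := tendsto_conj_lt_re (D.ptMinus s) (D.V / 2)
    rw [conj_ptMinus] at c1 c2
    have t1 := tendsto_twist (tendsto_mul_expPhase nhdsWithin_le_nhds p1 x₁ t₁) c1
      (tendsto_mul_expPhase nhdsWithin_le_nhds p2 x₂ t₂)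
    have t2 := tendsto_twist (tendsto_mul_expPhase nhdsWithin_le_nhds m1 x₁ t₁) c2
      (tendsto_mul_expPhase nhdsWithin_le_nhds m2 x₂ t₂)
    rw [jump _ _ _ _ _ j1, jump _ _ _ _ _ j2, Matrix.conjTranspose_mul, mul_assoc,
      ← mul_assoc (D.Jo _), Jo_mul_conj_minus hD h0 hs, one_mul] at t1
    exact ⟨_, (t1.sup t2).mono_left (hmono.trans (nhdsWithin_ptMinus_le hs))⟩

/-- Every product of columns has one regular factor and one factor with at most a simple pole, so no
double pole occurs; the two residue conditions make the coefficients of 1 / (k - k_n) cancel. -/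
theorem tendsto_twist_pole (h₁ : D.IsSolution x₁ t₁ M₁ Mp₁ Mm₁)
    (h₂ : D.IsSolution x₂ t₂ M₂ Mp₂ Mm₂) (n : Fin D.N) :
    Tendsto (fun k => (k - D.pole n) • twist (fun k => M₁ k * expPhase x₁ t₁ k)
      (fun k => M₂ k * expPhase x₂ t₂ k) k) (𝓝[D.regularSet] (D.pole n)) (𝓝 0) := by
  set z := D.pole n with hz
  have hzp : z ∈ D.poles := ⟨n, Or.inl rfl⟩
  have hle : 𝓝[D.regularSet] z ≤ 𝓝[≠] z := nhdsWithin_mono _ fun k hk h => hk (Or.inr (h ▸ hzp))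
  have hlez : 𝓝[D.regularSet] z ≤ 𝓝 z := nhdsWithin_le_nhds
  have hconj : Tendsto (starRingEnd ℂ) (𝓝[D.regularSet] z) (𝓝[≠] (starRingEnd ℂ z)) := by
    refine (D.tendsto_conj_regularSet z).mono_right (nhdsWithin_mono _ fun k hk h => ?_)
    have h : k = starRingEnd ℂ z := h
    exact hk (Or.inr (h ▸ conj_mem_poles.2 hzp))
  rw [tendsto_mat]
  intro i j
  have a1 : Tendsto (fun k => M₁ k i 0) (𝓝[D.regularSet] z) (𝓝 (M₁ z i 0)) :=
    (h₁.regular_upper n i).continuousAt.tendsto.mono_left hlez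
  have a2 := (h₁.residue_upper n i).mono_left hle
  have b1 : Tendsto (fun k => starRingEnd ℂ (M₂ (starRingEnd ℂ k) j 1)) (𝓝[D.regularSet] z)
      (𝓝 (starRingEnd ℂ (M₂ (starRingEnd ℂ z) j 1))) :=
    ((h₂.regular_lower n j).continuousAt.tendsto.comp
      ((Complex.continuous_conj.tendsto z).mono_left hlez)).star
  have b2 := ((h₂.residue_lower n j).comp hconj).star
  have e : ∀ (x t : ℝ) (l : Fin 2), Tendsto (fun k => expPhase x t k l l) (𝓝[D.regularSet] z)
      (𝓝 (expPhase x t z l l)) := fun x t l =>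
    (tendsto_mat.1 ((differentiable_expPhase x t).continuous.tendsto z) l l).mono_left hlez
  have e' : ∀ (x t : ℝ) (l : Fin 2), Tendsto (fun k => starRingEnd ℂ
      (expPhase x t (starRingEnd ℂ k) l l)) (𝓝[D.regularSet] z)
      (𝓝 (starRingEnd ℂ (expPhase x t (starRingEnd ℂ z) l l))) := fun x t l =>
    ((tendsto_mat.1 (((differentiable_expPhase x t).continuous.comp
      Complex.continuous_conj).tendsto z) l l).mono_left hlez).star
  have T := ((a1.mul (e x₁ t₁ 0)).mul (b2.mul (e' x₂ t₂ 0))).add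
    ((a2.mul (e x₁ t₁ 1)).mul (b1.mul (e' x₂ t₂ 1)))
  -- The factors e^{±2iθ} of the residue conditions are exactly what converts the exponential of one
  -- column into that of the other.
  have hval : M₁ z i 0 * expPhase x₁ t₁ z 0 0 *
      (star (-(starRingEnd ℂ) (D.c n) * Complex.exp (-(2 * Complex.I * phase x₂ t₂
        ((starRingEnd ℂ) (D.pole n)))) * M₂ ((starRingEnd ℂ) (D.pole n)) j 1) *
        starRingEnd ℂ (expPhase x₂ t₂ (starRingEnd ℂ z) 0 0)) +
      D.c n * Complex.exp (2 * Complex.I * phase x₁ t₁ (D.pole n)) * M₁ (D.pole n) i 0 *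
        expPhase x₁ t₁ z 1 1 * (starRingEnd ℂ (M₂ (starRingEnd ℂ z) j 1) *
        starRingEnd ℂ (expPhase x₂ t₂ (starRingEnd ℂ z) 1 1)) = 0 := by
    have hst : ∀ w : ℂ, star w = starRingEnd ℂ w := fun w => rfl
    rw [hst]
    simp only [expPhase, powSigma3, ← hz, map_mul, map_neg, Complex.conj_conj, ← Complex.exp_conj,
      conj_phase, Matrix.of_apply, Matrix.cons_val', Matrix.cons_val_zero, Matrix.cons_val_one,
      Matrix.cons_val_fin_one, ← Complex.exp_neg, Complex.conj_I, Complex.conj_ofNat]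
    have e1 : Complex.exp (2 * Complex.I * phase x₁ t₁ z) * Complex.exp (-(Complex.I * phase x₁ t₁ z))
        = Complex.exp (Complex.I * phase x₁ t₁ z) := by rw [← Complex.exp_add]; ring_nf
    have e2 : Complex.exp (-(2 * -Complex.I * phase x₂ t₂ z)) *
        Complex.exp (-Complex.I * phase x₂ t₂ z) = Complex.exp (-(-Complex.I * phase x₂ t₂ z)) := by
      rw [← Complex.exp_add]; ring_nf
    linear_combination (D.c n * M₁ z i 0 * starRingEnd ℂ (M₂ (starRingEnd ℂ z) j 1) *
      Complex.exp (-(-Complex.I * phase x₂ t₂ z))) * e1 - (M₁ z i 0 * D.c n *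
      Complex.exp (Complex.I * phase x₁ t₁ z) * starRingEnd ℂ (M₂ (starRingEnd ℂ z) j 1)) * e2
  rw [hval] at T
  refine T.congr fun k => ?_
  have hst : ∀ w : ℂ, star w = starRingEnd ℂ w := fun w => rfl
  simp only [Function.comp_apply, hst, map_mul, map_sub, Complex.conj_conj, Matrix.smul_apply,
    twist_apply, smul_eq_mul, mul_expPhase_apply]
  ring

/-- Boundedness suffices at the crossing points and at p₋. At p₊ the quarter powers cancel, and at
the poles the residues do. -/
theorem tendsto_twist_upper (hD : D.Admissible) (h₁ : D.IsSolution x₁ t₁ M₁ Mp₁ Mm₁)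
    (h₂ : D.IsSolution x₂ t₂ M₂ Mp₂ Mm₂) {z : ℂ} (hz : z = D.ptPlus 0 ∨ z = D.ptMinus 0 ∨
      z = D.ptPlus D.Ap ∨ z = D.ptMinus D.Am ∨ ∃ n, z = D.pole n) :
    Tendsto (fun k => (k - z) • twist (fun k => M₁ k * expPhase x₁ t₁ k)
      (fun k => M₂ k * expPhase x₂ t₂ k) k) (𝓝[D.regularSet] z) (𝓝 0) := by
  have hmono := fun z => nhdsWithin_mono z D.regularSet_subset
  have one : ∀ {f : ℂ → ℂ} {l : Filter ℂ}, f =O[l] (fun _ => (1 : ℂ)) → f =O[l] fun _ => (1 : ℝ) :=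
    fun {f l} h => IsBigO.trans (g := fun _ : ℂ => (1 : ℂ)) h
      (isBigO_const_const (1 : ℂ) (one_ne_zero : (1 : ℝ) ≠ 0) l)
  have bdd : (∀ i j, (fun k => M₁ k i j) =O[𝓝[D.contourᶜ] z] fun _ => (1 : ℝ)) →
      (∀ i j, (fun k => M₂ k i j) =O[𝓝[D.contourᶜ] (starRingEnd ℂ z)] fun _ => (1 : ℝ)) →
      Tendsto (fun k => (k - z) • twist (fun k => M₁ k * expPhase x₁ t₁ k)
      (fun k => M₂ k * expPhase x₂ t₂ k) k) (𝓝[D.regularSet] z) (𝓝 0) := fun b1 b2 =>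
    tendsto_sub_smul_of_isBigO_one ((isBigO_twist_one (g := fun _ _ => 1) (h := fun _ _ => 1)
      nhdsWithin_le_nhds b1 (fun i j => (b2 i j).comp_tendsto (D.tendsto_conj_contour z))
      (fun j => by simpa only [mul_one] using isBigO_refl (fun _ : ℂ => (1 : ℝ)) _)).mono (hmono z))
  rcases hz with hz | hz | hz | hz | ⟨n, rfl⟩
  · have hc : starRingEnd ℂ z = D.ptPlus 0 := by rw [hz, conj_ptPlus, neg_zero]
    exact bdd (fun i j => by rw [hz]; exact one (h₁.bounded_plus i j))
      fun i j => by rw [hc]; exact one (h₂.bounded_plus i j)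
  · have hc : starRingEnd ℂ z = D.ptMinus 0 := by rw [hz, conj_ptMinus, neg_zero]
    exact bdd (fun i j => by rw [hz]; exact one (h₁.bounded_minus i j))
      fun i j => by rw [hc]; exact one (h₂.bounded_minus i j)
  · have hc : starRingEnd ℂ z = D.ptPlus (-D.Ap) := by rw [hz, conj_ptPlus]
    have hct := D.tendsto_conj_contour z
    rw [hc] at hct
    have hn : ∀ k, ‖starRingEnd ℂ k - D.ptPlus (-D.Ap)‖ = ‖k - D.ptPlus D.Ap‖ := fun k => by
      rw [← conj_ptPlus, ← map_sub, RCLike.norm_conj]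
    have hpos := eventually_norm_sub_rpow_pos (D := D)
      (ptPlus_mem_contour (s := D.Ap) (abs_of_pos hD.Ap_pos).le)
    rw [← hz] at hpos
    refine tendsto_sub_smul_of_isBigO_one ((isBigO_twist_one
      (g := ![fun k => (‖k - D.ptPlus D.Ap‖ ^ (1 / 4 : ℝ))⁻¹,
        fun k => ‖k - D.ptPlus D.Ap‖ ^ (1 / 4 : ℝ)])
      (h := ![fun k => ‖k - D.ptPlus D.Ap‖ ^ (1 / 4 : ℝ),
        fun k => (‖k - D.ptPlus D.Ap‖ ^ (1 / 4 : ℝ))⁻¹])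
      nhdsWithin_le_nhds ?_ ?_ ?_).mono (hmono z))
    · intro i j
      rw [hz]
      fin_cases j
      · exact (h₁.isBigO_upper hD i).1
      · exact (h₁.isBigO_upper hD i).2
    · intro i j
      fin_cases j
      · exact ((h₂.isBigO_lower hD i).1.comp_tendsto hct).congr_right fun k => by
          simp [hn]
      · exact ((h₂.isBigO_lower hD i).2.comp_tendsto hct).congr_right fun k => by
          simp [hn]
    · intro j
      refine (isBigO_refl (fun _ => (1 : ℝ)) _).congr' ?_ (Eventually.of_forall fun _ => rfl)
      filter_upwards [hpos] with k hk
      rw [hz] at hk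
      fin_cases j
      · exact (inv_mul_cancel₀ hk.ne').symm
      · exact (mul_inv_cancel₀ hk.ne').symm
  · have hc : starRingEnd ℂ z = D.ptMinus (-D.Am) := by rw [hz, conj_ptMinus]
    obtain ⟨B1, hB1⟩ := h₁.growth_p_minus
    obtain ⟨B2, hB2⟩ := h₂.growth_conj_p_minus
    exact bdd (fun i j => by rw [hz]; exact (tendsto_mat.1 hB1 i j).isBigO_one ℝ)
      fun i j => by rw [hc]; exact (tendsto_mat.1 hB2 i j).isBigO_one ℝ
  · exact tendsto_twist_pole h₁ h₂ n

theorem singular_cases {z : ℂ} (hz : z ∈ D.singularSet) :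
    (z = D.ptPlus 0 ∨ z = D.ptMinus 0 ∨ z = D.ptPlus D.Ap ∨ z = D.ptMinus D.Am ∨
      ∃ n, z = D.pole n) ∨ (starRingEnd ℂ z = D.ptPlus D.Ap ∨ starRingEnd ℂ z = D.ptMinus D.Am ∨
      ∃ n, starRingEnd ℂ z = D.pole n) := by
  rw [mem_singularSet] at hz
  rcases hz with hz | hz | hz | hz | hz | hz | ⟨n, hz | hz⟩
  · tauto
  · tauto
  · tauto
  · right; left; rw [hz, conj_ptPlus, neg_neg]
  · tauto
  · right; right; left; rw [hz, conj_ptMinus, neg_neg]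
  · left; right; right; right; right; exact ⟨n, hz⟩
  · right; right; right; exact ⟨n, by rw [hz, Complex.conj_conj]⟩

/-- The source of all regularity in (x,t): two solutions at different parameters differ by an entire
left factor, apart from explicit exponentials. -/
theorem exists_entire_twist (hD : D.Admissible) (h₁ : D.IsSolution x₁ t₁ M₁ Mp₁ Mm₁)
    (h₂ : D.IsSolution x₂ t₂ M₂ Mp₂ Mm₂) : ∃ F : ℂ → Mat2, Differentiable ℂ F ∧
      ∀ z ∈ D.regularSet, F z = twist (fun k => M₁ k * expPhase x₁ t₁ k)
        (fun k => M₂ k * expPhase x₂ t₂ k) z := by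
  refine exists_entire_extension (S := D.singularSet) D.isOpen_regularSet
    D.neBot_nhdsWithin_regularSet ?_ ?_ (fun z hz hz' => tendsto_twist_contour hD h₁ h₂ hz hz') ?_ ?_
  · intro k hk
    have hk' := conj_mem_regularSet.2 hk
    refine DifferentiableAt.differentiableWithinAt ?_
    exact DifferentiableAt.mat_mul
      (DifferentiableAt.mat_mul (h₁.differentiableAt hk) (differentiable_expPhase _ _ _))
      (DifferentiableAt.mat_star
        (DifferentiableAt.mat_mul (h₂.differentiableAt hk') (differentiable_expPhase _ _ _)))
  · intro z hz hz'
    have hmem : z ∈ D.contour ∨ z ∈ D.poles := by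
      rw [mem_singularSet] at hz
      rcases hz with hz | hz | hz | hz | hz | hz | hz
      · exact Or.inl (hz ▸ ptPlus_mem_contour (by simpa using hD.Ap_pos.le))
      · exact Or.inl (hz ▸ ptMinus_mem_contour (by simpa using hD.Am_pos.le))
      · exact Or.inl (hz ▸ ptPlus_mem_contour (abs_of_pos hD.Ap_pos).le)
      · exact Or.inl (hz ▸ ptPlus_mem_contour (by rw [abs_neg, abs_of_pos hD.Ap_pos]))
      · exact Or.inl (hz ▸ ptMinus_mem_contour (abs_of_pos hD.Am_pos).le)
      · exact Or.inl (hz ▸ ptMinus_mem_contour (by rw [abs_neg, abs_of_pos hD.Am_pos]))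
      · exact Or.inr hz
    exact hz' hmem
  · intro z hz hz'
    have hp : z ∉ D.poles := fun h => hz (mem_singularSet.2 (by tauto))
    rcases mem_contour_cases hz hz' with ⟨ξ, rfl, hξ1, hξ2⟩ | ⟨s, rfl, h0, hs⟩ | ⟨s, rfl, h0, hs⟩
    · left; simpa using eventually_mem_of_real hξ1 hξ2 hp
    · right; exact eventually_mem_of_ptPlus hD.V_ne h0 hp
    · right; exact eventually_mem_of_ptMinus hD.V_ne h0 hp
  · intro z hz
    rcases singular_cases hz with h | h
    · exact tendsto_twist_upper hD h₁ h₂ h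
    · have := tendsto_twist_upper hD h₂ h₁ (z := starRingEnd ℂ z) (by tauto)
      have h2 := (Tendsto.mat_star this).comp (D.tendsto_conj_regularSet z)
      rw [Matrix.conjTranspose_zero] at h2
      refine h2.congr fun k => ?_
      rw [Function.comp_apply, Matrix.conjTranspose_smul, conjTranspose_twist]
      congr 1
      simp

end Twist

end RHPData

end CounterflowNLS

/-! ### Decay of the reflection coefficient; the symmetry M(k) M(k̄)ᴴ = I -/

namespace CounterflowNLS

attribute [local instance] Matrix.normedAddCommGroup Matrix.normedSpace

section Decay

theorem tendsto_setIntegral_rays {E : Type*} [NormedAddCommGroup E] [NormedSpace ℝ E] {g : ℝ → E}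
    (hg : Integrable g) : Tendsto (fun R => ∫ ξ in rays R, g ξ) atTop (𝓝 0) := by
  have h := tendsto_integral_filter_of_dominated_convergence (μ := volume) (l := atTop)
    (F := fun R ξ => (rays R).indicator g ξ) (f := fun _ => (0 : E)) (fun ξ => ‖g ξ‖)
    (Eventually.of_forall fun R => hg.1.indicator (measurableSet_rays R))
    (Eventually.of_forall fun R => ae_of_all _ fun ξ => norm_indicator_le_norm_self _ _) hg.norm
    (ae_of_all _ fun ξ => ?_)
  · simpa only [integral_indicator (measurableSet_rays _), integral_zero] using h
  · refine tendsto_const_nhds.congr' ?_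
    filter_upwards [eventually_ge_atTop |ξ|] with R hR
    exact (Set.indicator_of_notMem (s := rays R) (fun h : R < |ξ| => absurd h (not_lt.2 hR)) g).symm

/-- If |f(ξ)| = a, then |f| ≥ a/2 on an interval of length a / (2(L+1)) to the right of ξ, so the
integral of η²|f| over that interval is at least ξ²a² / (4(L+1)). -/
theorem sq_norm_mul_le_of_lipschitz {f : ℝ → ℂ} {L : NNReal} {X ξ : ℝ} (hX : 0 ≤ X) (hξ : X < ξ)
    (hf : LipschitzOnWith L f (Set.Ici X)) (hi : Integrable fun ξ : ℝ => (ξ : ℂ) ^ 2 * f ξ) :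
    ‖(ξ : ℂ) * f ξ‖ ^ 2 ≤ 4 * (L + 1) * ∫ η in rays X, ‖(η : ℂ) ^ 2 * f η‖ := by
  set a := ‖f ξ‖ with ha
  have hL : (0 : ℝ) < L + 1 := by positivity
  set h := a / (2 * (L + 1)) with hh
  have h0 : 0 ≤ h := by positivity
  have hsub : Set.Ioc ξ (ξ + h) ⊆ rays X := fun η hη =>
    lt_of_lt_of_le (hξ.trans hη.1) (le_abs_self η)
  have hlow : ∀ η ∈ Set.Ioc ξ (ξ + h), ξ ^ 2 * (a / 2) ≤ ‖(η : ℂ) ^ 2 * f η‖ := by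
    intro η hη
    have h1 : ‖f ξ - f η‖ ≤ L * h := by
      refine (hf.norm_sub_le (Set.mem_Ici.2 hξ.le) (Set.mem_Ici.2 (hξ.trans hη.1).le)).trans ?_
      gcongr
      rw [Real.norm_eq_abs, abs_sub_comm, abs_of_pos (sub_pos.2 hη.1)]
      linarith [hη.2]
    have h2 : (L + 1 : ℝ) * h = a / 2 := by rw [hh]; field_simp
    have h3 : a ≤ ‖f η‖ + ‖f ξ - f η‖ := by
      have := norm_add_le (f η) (f ξ - f η)
      rwa [add_sub_cancel] at this
    rw [norm_mul, norm_pow, Complex.norm_real, Real.norm_eq_abs, sq_abs]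
    have h4 : a / 2 ≤ ‖f η‖ := by nlinarith
    have h5 : ξ ^ 2 ≤ η ^ 2 := by nlinarith [hη.1]
    gcongr
  have h1 := setIntegral_ge_of_const_le (μ := volume) measurableSet_Ioc
    (by rw [Real.volume_Ioc]; exact ENNReal.ofReal_ne_top) hlow hi.norm.integrableOn
  have h2 : ∫ η in Set.Ioc ξ (ξ + h), ‖(η : ℂ) ^ 2 * f η‖ ≤
      ∫ η in rays X, ‖(η : ℂ) ^ 2 * f η‖ :=
    setIntegral_mono_set hi.norm.integrableOn (ae_of_all _ fun η => norm_nonneg _)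
      (LE.le.eventuallyLE hsub)
  rw [measureReal_def, Real.volume_Ioc, ENNReal.toReal_ofReal (by linarith)] at h1
  have h3 : ξ ^ 2 * (a / 2) * h ≤ ∫ η in rays X, ‖(η : ℂ) ^ 2 * f η‖ := by
    refine le_trans (le_of_eq ?_) (h1.trans h2); simp; ring
  calc ‖(ξ : ℂ) * f ξ‖ ^ 2 = 4 * (L + 1) * (ξ ^ 2 * (a / 2) * h) := by
        rw [norm_mul, Complex.norm_real, Real.norm_eq_abs, mul_pow, sq_abs, ← ha, hh]
        field_simp; ring
    _ ≤ _ := by gcongr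

theorem tendsto_mul_of_lipschitz {f : ℝ → ℂ} {L : NNReal} {R : ℝ}
    (hf : LipschitzOnWith L f (Set.Ici R)) (hi : Integrable fun ξ : ℝ => (ξ : ℂ) ^ 2 * f ξ) :
    Tendsto (fun ξ : ℝ => (ξ : ℂ) * f ξ) atTop (𝓝 0) := by
  have h1 : Tendsto (fun ξ : ℝ => 4 * (L + 1 : ℝ) * ∫ η in rays (ξ + -1), ‖(η : ℂ) ^ 2 * f η‖)
      atTop (𝓝 0) := by
    simpa using ((tendsto_setIntegral_rays hi.norm).comp
      (tendsto_atTop_add_const_right atTop (-1 : ℝ) tendsto_id)).const_mul (4 * (L + 1 : ℝ))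
  have h2 : Tendsto (fun ξ : ℝ => ‖(ξ : ℂ) * f ξ‖ ^ 2) atTop (𝓝 0) := by
    refine squeeze_zero' (Eventually.of_forall fun _ => by positivity) ?_ h1
    filter_upwards [eventually_ge_atTop (R + 1), eventually_ge_atTop 1] with ξ h3 h4
    exact sq_norm_mul_le_of_lipschitz (X := ξ + -1) (by linarith) (by linarith)
      (hf.mono (Set.Ici_subset_Ici.2 (by linarith))) hi
  have h3 := h2.sqrt
  simp only [Real.sqrt_zero, Real.sqrt_sq (norm_nonneg _)] at h3
  exact tendsto_zero_iff_norm_tendsto_zero.2 h3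

/-- Decay of ξρ makes ρ small outside a disc, and it is needed again where the limit at infinity is
taken up to the real line. -/
theorem RHPData.Regular.tendsto_mul_rho {D : RHPData} (hreg : D.Regular) :
    Tendsto (fun ξ : ℝ => (ξ : ℂ) * D.ρ ξ) (cocompact ℝ) (𝓝 0) := by
  obtain ⟨L, R, h1, h2⟩ := hreg.lipschitz
  rw [cocompact_eq_atBot_atTop]
  refine Tendsto.sup ?_ (tendsto_mul_of_lipschitz h1 hreg.integrable)
  have h3 : LipschitzOnWith L (fun ξ : ℝ => D.ρ ((-ξ : ℝ) : ℂ)) (Set.Ici R) := by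
    intro u hu v hv
    have := h2 (x := -u) (by simpa using hu) (y := -v) (by simpa using hv)
    simpa only [edist_neg_neg] using this
  have h4 : Integrable fun ξ : ℝ => (ξ : ℂ) ^ 2 * D.ρ ((-ξ : ℝ) : ℂ) := by
    have := hreg.integrable.comp_neg
    simpa using this
  have h5 := (tendsto_mul_of_lipschitz h3 h4).comp tendsto_neg_atBot_atTop
  simpa [Function.comp_def] using h5.neg

end Decay

theorem eventually_norm_le_of_dense {E : Type*} [NormedAddCommGroup E] {F : ℂ → E} {Ω : Set ℂ}
    (hF : Continuous F) (hdense : ∀ z, (𝓝[Ω] z).NeBot) {z : ℂ} {B : ℝ}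
    (hb : ∀ᶠ k in 𝓝[Ω] z, ‖F k‖ ≤ B) : ‖F z‖ ≤ B := by
  have := hdense z
  exact le_of_tendsto ((hF.norm.tendsto z).mono_left nhdsWithin_le_nhds) hb

theorem tendsto_cobounded_of_dense {E : Type*} [NormedAddCommGroup E] {F : ℂ → E} {Ω : Set ℂ} {e : E}
    (hF : Continuous F) (hdense : ∀ z, (𝓝[Ω] z).NeBot)
    (h : Tendsto F (Bornology.cobounded ℂ ⊓ 𝓟 Ω) (𝓝 e)) :
    Tendsto F (Bornology.cobounded ℂ) (𝓝 e) := by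
  rw [Metric.tendsto_nhds] at h ⊢
  intro ε hε
  have h1 := h (ε / 2) (by linarith)
  rw [eventually_inf_principal] at h1
  rw [(Metric.hasBasis_cobounded_compl_closedBall (0 : ℂ)).eventually_iff] at h1 ⊢
  obtain ⟨B, hB, h2⟩ := h1
  refine ⟨B, hB, fun z hz => ?_⟩
  have h3 := eventually_norm_le_of_dense (F := fun k => F k - e) (B := ε / 2) (z := z)
    (by fun_prop) hdense ?_
  · rw [dist_eq_norm]; linarith
  · filter_upwards [nhdsWithin_le_nhds (Metric.isClosed_closedBall.isOpen_compl.mem_nhds hz),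
      self_mem_nhdsWithin] with k h4 h5
    rw [← dist_eq_norm]
    exact (h2 h4 h5).le

namespace RHPData

variable {D : RHPData}

/-- Outside the disc of radius `R` the contour is real, there are no poles, and `ρ` is small. -/
structure IsFar (D : RHPData) (R : ℝ) : Prop where
  pos : 0 < R
  mem_regularSet : ∀ k : ℂ, R ≤ ‖k‖ → k.im ≠ 0 → k ∈ D.regularSet
  ne_plus : ∀ ξ : ℝ, R ≤ |ξ| → ξ ≠ -D.V / 2
  ne_minus : ∀ ξ : ℝ, R ≤ |ξ| → ξ ≠ D.V / 2
  norm_rho_le : ∀ ξ : ℝ, R ≤ |ξ| → ‖D.ρ ξ‖ ≤ 1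

theorem IsFar.mono {R R' : ℝ} (h : D.IsFar R) (hR : R ≤ R') : D.IsFar R' :=
  ⟨h.pos.trans_le hR, fun k hk => h.mem_regularSet k (hR.trans hk),
    fun k hk => h.ne_plus k (hR.trans hk), fun k hk => h.ne_minus k (hR.trans hk),
    fun k hk => h.norm_rho_le k (hR.trans hk)⟩

theorem exists_isFar (hreg : D.Regular) : ∃ R, D.IsFar R := by
  obtain ⟨P, hP⟩ := D.finite_poles.isBounded.exists_norm_le
  have h1 : ∀ᶠ ξ : ℝ in cocompact ℝ, ‖D.ρ ξ‖ ≤ 1 := by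
    have h2 : ∀ᶠ ξ : ℝ in cocompact ℝ, ‖(ξ : ℂ) * D.ρ ξ‖ < 1 :=
      hreg.tendsto_mul_rho.norm.eventually (gt_mem_nhds (by simp))
    filter_upwards [h2, tendsto_abs_cocompact.eventually (eventually_ge_atTop 1)] with ξ h3 h4
    rw [norm_mul, Complex.norm_real, Real.norm_eq_abs] at h3
    nlinarith [norm_nonneg (D.ρ ξ)]
  rw [← Metric.cobounded_eq_cocompact, Filter.HasBasis.eventually_iff
    (Metric.hasBasis_cobounded_compl_closedBall (0 : ℝ))] at h1
  obtain ⟨B, -, hB⟩ := h1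
  refine ⟨|P| + |B| + |D.V| + |D.Ap| + |D.Am| + 1, by positivity, fun k hk him => ?_, fun ξ hξ h => ?_,
    fun ξ hξ h => ?_, fun ξ hξ => hB ?_⟩
  · have a1 := abs_nonneg P; have a2 := abs_nonneg B; have a3 := abs_nonneg D.V
    have a4 := abs_nonneg D.Ap; have a5 := abs_nonneg D.Am
    have h0 := Complex.norm_le_abs_re_add_abs_im k
    rw [RHPData.mem_regularSet]
    refine ⟨?_, fun hp => ?_⟩
    · rintro (h | ⟨h, h'⟩ | ⟨h, h'⟩)
      · exact him h
      · have := le_abs_self D.Ap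
        rw [h, abs_div, abs_neg, abs_two] at h0
        linarith
      · have := le_abs_self D.Am
        rw [h, abs_div, abs_two] at h0
        linarith
    · have := hP k hp
      have := le_abs_self P
      linarith
  · rw [h, abs_div, abs_neg, abs_two] at hξ
    have a1 := abs_nonneg P; have a2 := abs_nonneg B; have a3 := abs_nonneg D.V
    have a4 := abs_nonneg D.Ap; have a5 := abs_nonneg D.Am
    linarith
  · rw [h, abs_div, abs_two] at hξ
    have a1 := abs_nonneg P; have a2 := abs_nonneg B; have a3 := abs_nonneg D.V
    have a4 := abs_nonneg D.Ap; have a5 := abs_nonneg D.Am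
    linarith
  · have a1 := abs_nonneg P; have a3 := abs_nonneg D.V
    have a4 := abs_nonneg D.Ap; have a5 := abs_nonneg D.Am
    have := le_abs_self B
    rw [Set.mem_compl_iff, Metric.mem_closedBall, dist_zero_right, Real.norm_eq_abs]
    linarith

theorem expPhase_mul_conjTranspose (x t : ℝ) (k : ℂ) :
    expPhase x t k * (expPhase x t (starRingEnd ℂ k)).conjTranspose = 1 := by
  rw [conjTranspose_expPhase, expPhase, powSigma3_mul, ← Complex.exp_add, add_neg_cancel,
    Complex.exp_zero, powSigma3_one]

namespace IsSolution

variable {x t : ℝ} {M Mp Mm : ℂ → Mat2}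

theorem tendsto_one (h : D.IsSolution x t M Mp Mm) :
    Tendsto M (Bornology.cobounded ℂ ⊓ 𝓟 D.contourᶜ) (𝓝 1) := by
  refine tendsto_mat.2 fun i j => ?_
  have h1 : Tendsto (fun k : ℂ => k⁻¹) (Bornology.cobounded ℂ ⊓ 𝓟 D.contourᶜ) (𝓝 0) :=
    tendsto_inv₀_cobounded.mono_left inf_le_left
  have h2 := (h.normalization i j).trans_tendsto h1
  simpa using h2.add_const ((1 : Mat2) i j)

/-- For equal parameters the exponentials cancel, so the entire quotient is M(k) M(k̄)ᴴ. It tends to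
I at infinity and is constant by Liouville's theorem. In particular M is invertible, with no appeal
to determinants. -/
theorem twist_self (h : D.IsSolution x t M Mp Mm) (hD : D.Admissible) {k : ℂ}
    (hk : k ∈ D.regularSet) : M k * (M (starRingEnd ℂ k)).conjTranspose = 1 := by
  obtain ⟨F, hF, hFe⟩ := exists_entire_twist hD h h
  have he : ∀ z ∈ D.regularSet, F z = M z * (M (starRingEnd ℂ z)).conjTranspose := fun z hz => by
    rw [hFe z hz, twist, Matrix.conjTranspose_mul, mul_assoc, ← mul_assoc (expPhase x t z),
      expPhase_mul_conjTranspose, one_mul]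
  have hc : Tendsto (starRingEnd ℂ) (Bornology.cobounded ℂ ⊓ 𝓟 D.contourᶜ)
      (Bornology.cobounded ℂ ⊓ 𝓟 D.contourᶜ) := by
    refine Tendsto.inf ?_ (tendsto_principal_principal.2 fun k hk =>
      (not_congr conj_mem_contour).2 hk)
    rw [← tendsto_norm_atTop_iff_cobounded]
    simpa using tendsto_norm_cobounded_atTop (E := ℂ)
  have h1 : Tendsto F (Bornology.cobounded ℂ ⊓ 𝓟 D.regularSet) (𝓝 1) := by
    have h2 := Tendsto.mat_mul h.tendsto_one (Tendsto.mat_star (h.tendsto_one.comp hc))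
    rw [Matrix.conjTranspose_one, one_mul] at h2
    refine (h2.mono_left (inf_le_inf_left _ (principal_mono.2 D.regularSet_subset))).congr' ?_
    rw [eventuallyEq_inf_principal_iff]
    exact Eventually.of_forall fun z hz => (he z hz).symm
  have h3 := tendsto_cobounded_of_dense hF.continuous D.neBot_nhdsWithin_regularSet h1
  rw [← he k hk]
  rw [Metric.cobounded_eq_cocompact] at h3
  exact hF.apply_eq_of_tendsto_cocompact k h3

theorem twist_self' (h : D.IsSolution x t M Mp Mm) (hD : D.Admissible) {k : ℂ}
    (hk : k ∈ D.regularSet) : (M (starRingEnd ℂ k)).conjTranspose * M k = 1 :=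
  mul_eq_one_comm.1 (h.twist_self hD hk)

theorem eventually_upper_regular (hD : D.Admissible) {ξ : ℝ} (h1 : ξ ≠ -D.V / 2)
    (h2 : ξ ≠ D.V / 2) : ∀ᶠ k in 𝓝 (ξ : ℂ), k.im ≠ 0 → k ∈ D.regularSet := by
  refine eventually_mem_of_real h1 h2 ?_
  rintro ⟨n, h | h⟩
  · have := hD.pole_im_pos n; rw [← h] at this; simp at this
  · have := hD.pole_im_pos n
    have h' : (starRingEnd ℂ (D.pole n)).im = 0 := by rw [← h]; simp
    rw [Complex.conj_im] at h'; linarith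

theorem plus_mul_minus (h : D.IsSolution x t M Mp Mm) (hD : D.Admissible) {ξ : ℝ}
    (h1 : ξ ≠ -D.V / 2) (h2 : ξ ≠ D.V / 2) : Mp ξ * (Mm ξ).conjTranspose = 1 := by
  obtain ⟨p, m, -⟩ := h.jump_real ξ h1 h2
  have h3 := tendsto_twist p (tendsto_conj_upper ξ) m
  have : (𝓝[{z : ℂ | 0 < z.im}] (ξ : ℂ)).NeBot := (tendsto_add_mul_I ξ).neBot
  refine tendsto_nhds_unique h3 (tendsto_const_nhds.congr' ?_)
  filter_upwards [nhdsWithin_le_nhds (eventually_upper_regular hD h1 h2), self_mem_nhdsWithin]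
    with k h4 h5
  exact (h.twist_self hD (h4 (ne_of_gt h5))).symm

theorem minus_mul_plus (h : D.IsSolution x t M Mp Mm) (hD : D.Admissible) {ξ : ℝ}
    (h1 : ξ ≠ -D.V / 2) (h2 : ξ ≠ D.V / 2) : Mm ξ * (Mp ξ).conjTranspose = 1 := by
  have := congrArg Matrix.conjTranspose (h.plus_mul_minus hD h1 h2)
  rwa [Matrix.conjTranspose_mul, Matrix.conjTranspose_conjTranspose,
    Matrix.conjTranspose_one] at this

end IsSolution

/-- The exponential `exp(2iθ)`. -/
noncomputable def osc (x t : ℝ) (k : ℂ) : ℂ := Complex.exp (2 * Complex.I * phase x t k)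

theorem norm_osc (x t ξ : ℝ) : ‖osc x t ξ‖ = 1 := by
  have : 2 * Complex.I * phase x t ξ = ((2 * (ξ * (x - 2 * ξ * t)) : ℝ) : ℂ) * Complex.I := by
    rw [phase]; push_cast; ring
  rw [osc, this, Complex.norm_exp_ofReal_mul_I]

theorem conj_osc_mul (x t ξ : ℝ) : starRingEnd ℂ (osc x t ξ) * osc x t ξ = 1 := by
  rw [mul_comm, Complex.mul_conj, Complex.normSq_eq_norm_sq, norm_osc]; simp

theorem J_real (D : RHPData) (x t ξ : ℝ) : D.J x t ξ = !![1, D.ρ ξ * osc x t ξ;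
    starRingEnd ℂ (D.ρ ξ * osc x t ξ), 1 + D.ρ ξ * starRingEnd ℂ (D.ρ ξ)] := by
  have h1 : ∀ w : ℂ, Complex.exp w * Complex.exp (-w) = 1 := fun w => by
    rw [← Complex.exp_add, add_neg_cancel, Complex.exp_zero]
  have h2 : osc x t ξ = Complex.exp (Complex.I * phase x t ξ) * Complex.exp (Complex.I * phase x t ξ)
    := by rw [osc, ← Complex.exp_add]; ring_nf
  have h3 : starRingEnd ℂ (osc x t ξ) = Complex.exp (-(Complex.I * phase x t ξ)) *
      Complex.exp (-(Complex.I * phase x t ξ)) := by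
    rw [osc, ← Complex.exp_conj, ← Complex.exp_add]
    simp only [map_mul, conj_phase, Complex.conj_ofReal, Complex.conj_I, Complex.conj_ofNat]
    ring_nf
  rw [J, Jo, if_pos (Complex.ofReal_im ξ), map_mul, h3, h2]
  set E := Complex.exp (Complex.I * phase x t ξ)
  have h4 := h1 (Complex.I * phase x t ξ)
  have hE : E⁻¹ = Complex.exp (-(Complex.I * phase x t ξ)) := (Complex.exp_neg _).symm
  have hE' : (Complex.exp (-(Complex.I * phase x t ξ)))⁻¹ = E := by rw [← hE, inv_inv]
  ext i j
  fin_cases i <;> fin_cases j <;>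
    simp [powSigma3, Matrix.mul_apply, Fin.sum_univ_two, hE, hE']
  · exact h4
  · ring
  · ring
  · linear_combination (1 + D.ρ ξ * starRingEnd ℂ (D.ρ ξ)) * h4

theorem isHermitian_J (D : RHPData) (x t ξ : ℝ) : (D.J x t ξ).conjTranspose = D.J x t ξ := by
  rw [J_real]
  ext i j
  fin_cases i <;> fin_cases j <;> simp [Matrix.conjTranspose_apply, mul_comm]

namespace IsSolution

variable {x t : ℝ} {M Mp Mm : ℂ → Mat2}

/-- From M⁻(M⁺)ᴴ = I and M⁺ = M⁻J follows (M⁺)ᴴM⁺ = J, whose diagonal holds the squared column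
norms. The resulting bounds depend on ρ alone, not on (x,t) or on the solution. -/
theorem norm_plus_sq (h : D.IsSolution x t M Mp Mm) (hD : D.Admissible) {ξ : ℝ}
    (h1 : ξ ≠ -D.V / 2) (h2 : ξ ≠ D.V / 2) : ‖Mp ξ 0 0‖ ^ 2 + ‖Mp ξ 1 0‖ ^ 2 = 1 ∧
      ‖Mp ξ 0 1‖ ^ 2 + ‖Mp ξ 1 1‖ ^ 2 = 1 + ‖D.ρ ξ‖ ^ 2 := by
  have hj := (h.jump_real ξ h1 h2).2.2
  have h3 : (Mp ξ).conjTranspose * Mp ξ = D.J x t ξ := by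
    rw [hj, ← mul_assoc, ← hj, mul_eq_one_comm.1 (h.minus_mul_plus hD h1 h2), one_mul]
  have h4 := congrFun (congrFun h3 0) 0
  have h5 := congrFun (congrFun h3 1) 1
  simp only [J_real, Matrix.mul_apply, Matrix.conjTranspose_apply, Fin.sum_univ_two, RCLike.star_def,
    Complex.conj_mul', Complex.mul_conj', Matrix.of_apply, Matrix.cons_val', Matrix.cons_val_zero,
    Matrix.cons_val_one, Matrix.cons_val_fin_one] at h4 h5
  exact ⟨by exact_mod_cast h4, by exact_mod_cast h5⟩

theorem norm_minus_sq (h : D.IsSolution x t M Mp Mm) (hD : D.Admissible) {ξ : ℝ}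
    (h1 : ξ ≠ -D.V / 2) (h2 : ξ ≠ D.V / 2) :
    ‖Mm ξ 0 0‖ ^ 2 + ‖Mm ξ 1 0‖ ^ 2 = 1 + ‖D.ρ ξ‖ ^ 2 ∧
      ‖Mm ξ 0 1‖ ^ 2 + ‖Mm ξ 1 1‖ ^ 2 = 1 := by
  have hj := (h.jump_real ξ h1 h2).2.2
  set e := D.ρ ξ * osc x t ξ with he
  have hee : e * starRingEnd ℂ e = D.ρ ξ * starRingEnd ℂ (D.ρ ξ) := by
    rw [he, map_mul]; linear_combination (D.ρ ξ * starRingEnd ℂ (D.ρ ξ)) * conj_osc_mul x t ξ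
  -- This is the inverse of J, so (M⁻)ᴴM⁻ = J⁻¹ gives the norms of the columns on the other side.
  set K : Mat2 := !![1 + D.ρ ξ * starRingEnd ℂ (D.ρ ξ), -e; -starRingEnd ℂ e, 1]
  have hJK : D.J x t ξ * K = 1 := by
    rw [J_real, ← he]
    ext i j
    fin_cases i <;> fin_cases j <;> simp [Matrix.mul_apply, Fin.sum_univ_two, K]
    · linear_combination -hee
    · ring
    · linear_combination -hee
  have hMK : Mm ξ = Mp ξ * K := by rw [hj, mul_assoc, hJK, mul_one]
  have h3 : (Mm ξ).conjTranspose * Mm ξ = K := by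
    rw [hMK, ← mul_assoc, ← hMK, mul_eq_one_comm.1 (h.plus_mul_minus hD h1 h2), one_mul]
  have h4 := congrFun (congrFun h3 0) 0
  have h5 := congrFun (congrFun h3 1) 1
  simp only [K, Matrix.mul_apply, Matrix.conjTranspose_apply, Fin.sum_univ_two, RCLike.star_def,
    Complex.conj_mul', Complex.mul_conj', Matrix.of_apply, Matrix.cons_val', Matrix.cons_val_zero,
    Matrix.cons_val_one, Matrix.cons_val_fin_one] at h4 h5
  exact ⟨by exact_mod_cast h4, by exact_mod_cast h5⟩

theorem norm_minus_le (h : D.IsSolution x t M Mp Mm) (hD : D.Admissible) {ξ : ℝ}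
    (h1 : ξ ≠ -D.V / 2) (h2 : ξ ≠ D.V / 2) : ‖Mm ξ‖ ≤ 1 + ‖D.ρ ξ‖ := by
  obtain ⟨h3, h4⟩ := h.norm_minus_sq hD h1 h2
  have h5 := norm_nonneg (D.ρ ξ)
  refine (Matrix.norm_le_iff (by positivity)).2 fun i j => abs_le_of_sq_le_sq' ?_ (by positivity) |>.2
  fin_cases i <;> fin_cases j <;> simp only [Fin.zero_eta, Fin.mk_one]
  · nlinarith [sq_nonneg ‖Mm ξ 1 0‖]
  · nlinarith [sq_nonneg ‖Mm ξ 1 1‖]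
  · nlinarith [sq_nonneg ‖Mm ξ 0 0‖]
  · nlinarith [sq_nonneg ‖Mm ξ 0 1‖]

end IsSolution

end RHPData

end CounterflowNLS

/-! ### Bounds far out, and the comparison of two solutions -/

namespace CounterflowNLS

attribute [local instance] Matrix.normedAddCommGroup Matrix.normedSpace

theorem exists_norm_le_of_isCompact {E : Type*} [NormedAddCommGroup E] {f : ℂ → E} {S K : Set ℂ}
    (hK : IsCompact K) (h : ∀ z ∈ K, ∃ C : ℝ, ∀ᶠ k in 𝓝[S] z, ‖f k‖ ≤ C) :
    ∃ C : ℝ, ∀ k ∈ K, k ∈ S → ‖f k‖ ≤ C := by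
  refine hK.induction_on (p := fun s => ∃ C : ℝ, ∀ k ∈ s, k ∈ S → ‖f k‖ ≤ C) ⟨0, by simp⟩
    (fun s t hst ⟨C, hC⟩ => ⟨C, fun k hk => hC k (hst hk)⟩) ?_ ?_
  · rintro s t ⟨C, hC⟩ ⟨C', hC'⟩
    refine ⟨max C C', fun k hk hS => ?_⟩
    rcases hk with hk | hk
    · exact (hC k hk hS).trans (le_max_left _ _)
    · exact (hC' k hk hS).trans (le_max_right _ _)
  · intro z hz
    obtain ⟨C, hC⟩ := h z hz
    rw [eventually_nhdsWithin_iff] at hC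
    exact ⟨_, mem_nhdsWithin_of_mem_nhds hC, C, fun k hk hS => hk hS⟩

theorem norm_one_mat : ‖(1 : Mat2)‖ = 1 := by
  refine le_antisymm ((Matrix.norm_le_iff zero_le_one).2 fun i j => ?_) ?_
  · fin_cases i <;> fin_cases j <;> simp
  · have h := Matrix.norm_entry_le_entrywise_sup_norm (1 : Mat2) (i := 0) (j := 0)
    rwa [Matrix.one_apply_eq, norm_one] at h

theorem phase_mul (s a b : ℝ) (k : ℂ) : phase (s * a) (s * b) k = s * phase a b k := by
  simp only [phase]; push_cast; ring

theorem continuous_phase (a b : ℝ) : Continuous (phase a b) := by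
  unfold phase; fun_prop

theorem expPhase_mul_expPhase (x t x₁ t₁ : ℝ) (k : ℂ) :
    expPhase x t k * expPhase x₁ t₁ k = expPhase (x + x₁) (t + t₁) k := by
  rw [expPhase, expPhase, powSigma3_mul, ← Complex.exp_add, expPhase]
  congr 2; simp only [phase]; push_cast; ring

theorem expPhase_zero (k : ℂ) : expPhase 0 0 k = 1 := by
  simp [expPhase, phase, powSigma3_one]

theorem norm_exp_sub_one_le_of_le {w : ℂ} {r : ℝ} (hw : ‖w‖ ≤ r) (hr : r ≤ 1) :
    ‖Complex.exp w - 1‖ ≤ 2 * r :=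
  (Complex.norm_exp_sub_one_le (hw.trans hr)).trans (by linarith)

theorem norm_expPhase_sub_one_le {s a b r : ℝ} {k : ℂ} (h : |s| * ‖phase a b k‖ ≤ r) (hr : r ≤ 1) :
    ‖expPhase (s * a) (s * b) k - 1‖ ≤ 2 * r := by
  have h0 : 0 ≤ r := (by positivity : (0 : ℝ) ≤ |s| * ‖phase a b k‖).trans h
  have h1 : ‖Complex.I * ((s : ℂ) * phase a b k)‖ ≤ r := by
    simpa using h
  have h2 : ‖-(Complex.I * ((s : ℂ) * phase a b k))‖ ≤ r := by rwa [norm_neg]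
  refine (Matrix.norm_le_iff (by positivity)).2 fun i j => ?_
  rw [expPhase, phase_mul]
  fin_cases i <;> fin_cases j
  · simpa [powSigma3] using norm_exp_sub_one_le_of_le h1 hr
  · simpa [powSigma3] using h0
  · simpa [powSigma3] using h0
  · simpa [powSigma3, ← Complex.exp_neg] using norm_exp_sub_one_le_of_le h2 hr

namespace RHPData

variable {D : RHPData}

theorem Regular.integrableOn_mul_rho (hreg : D.Regular) {R : ℝ} (hR : 0 < R) :
    IntegrableOn (fun ξ : ℝ => (ξ : ℂ) * D.ρ ξ) (rays R) := by
  have h1 : IntegrableOn (fun ξ : ℝ => (ξ : ℂ)⁻¹ * ((ξ : ℂ) ^ 2 * D.ρ ξ)) (rays R) := by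
    refine Integrable.bdd_mul (c := R⁻¹) hreg.integrable.integrableOn
      (by fun_prop : Measurable fun ξ : ℝ => (ξ : ℂ)⁻¹).aestronglyMeasurable ?_
    filter_upwards [ae_restrict_mem (measurableSet_rays R)] with ξ (hξ : R < |ξ|)
    rw [norm_inv, Complex.norm_real, Real.norm_eq_abs]
    exact inv_anti₀ hR hξ.le
  refine h1.congr_fun (fun ξ (hξ : R < |ξ|) => ?_) (measurableSet_rays R)
  have : (ξ : ℂ) ≠ 0 := by
    intro h; rw [Complex.ofReal_eq_zero] at h; rw [h, abs_zero] at hξ; linarith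
  simp only; field_simp

theorem Regular.integrableOn_phase_mul_rho (hreg : D.Regular) {R : ℝ} (hR : 0 < R) (a b : ℝ) :
    IntegrableOn (fun ξ : ℝ => phase a b ξ * D.ρ ξ) (rays R) := by
  have h := ((hreg.integrableOn_mul_rho hR).const_mul (a : ℂ)).sub
    (hreg.integrable.integrableOn.const_mul (2 * (b : ℂ)))
  refine IntegrableOn.congr_fun h (fun ξ _ => ?_) (measurableSet_rays R)
  simp only [Pi.sub_apply, phase]; ring

namespace IsSolution

variable {x t : ℝ} {M Mp Mm : ℂ → Mat2}

/-- The normalization gives the bound for large k. On the compact remainder of the exterior M is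
locally bounded, by its one-sided limits at real points, and 1/‖k‖ is bounded below. -/
theorem exists_far_bound (h : D.IsSolution x t M Mp Mm) {R : ℝ} (hR : D.IsFar R) :
    ∃ C, 0 ≤ C ∧ ∀ k : ℂ, R ≤ ‖k‖ → k.im ≠ 0 → ‖M k - 1‖ ≤ C * ‖k‖⁻¹ := by
  have h1 : (fun k => M k - 1) =O[Bornology.cobounded ℂ ⊓ 𝓟 D.contourᶜ] fun k => ‖k‖⁻¹ :=
    isBigO_mat fun i j => (h.normalization i j).trans (IsBigO.of_bound 1 (by simp))
  obtain ⟨C, hC⟩ := h1.bound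
  rw [eventually_inf_principal,
    (Metric.hasBasis_cobounded_compl_closedBall (0 : ℂ)).eventually_iff] at hC
  obtain ⟨B, -, hB⟩ := hC
  obtain ⟨C', hC'⟩ := exists_norm_le_of_isCompact (f := fun k => M k - 1) (S := {k | k.im ≠ 0})
    (K := Metric.closedBall 0 B ∩ {k | R ≤ ‖k‖})
    ((isCompact_closedBall 0 B).inter_right (isClosed_le continuous_const continuous_norm)) (by
    rintro z ⟨-, hz : R ≤ ‖z‖⟩
    by_cases him : z.im = 0
    · obtain ⟨ξ, rfl⟩ : ∃ ξ : ℝ, z = ξ := ⟨z.re, Complex.ext rfl (by simpa)⟩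
      rw [Complex.norm_real, Real.norm_eq_abs] at hz
      obtain ⟨p, m, -⟩ := h.jump_real ξ (hR.ne_plus ξ hz) (hR.ne_minus ξ hz)
      have p1 := (p.sub_const 1).norm.eventually (gt_mem_nhds (lt_add_one _))
      have m1 := (m.sub_const 1).norm.eventually (gt_mem_nhds (lt_add_one _))
      refine ⟨max (‖Mp ξ - 1‖ + 1) (‖Mm ξ - 1‖ + 1), ?_⟩
      have hle : 𝓝[{k : ℂ | k.im ≠ 0}] (ξ : ℂ) ≤
          𝓝[{z | 0 < z.im}] (ξ : ℂ) ⊔ 𝓝[{z | z.im < 0}] (ξ : ℂ) := by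
        rw [← nhdsWithin_union]
        exact nhdsWithin_mono _ fun k (hk : k.im ≠ 0) => (lt_or_gt_of_ne hk).symm
      refine hle (eventually_sup.2 ⟨?_, ?_⟩)
      · filter_upwards [p1] with k hk using hk.le.trans (le_max_left _ _)
      · filter_upwards [m1] with k hk using hk.le.trans (le_max_right _ _)
    · refine ⟨‖M z - 1‖ + 1, nhdsWithin_le_nhds ?_⟩
      have hc := (h.differentiableAt (hR.mem_regularSet z hz him)).continuousAt
      filter_upwards [(hc.tendsto.sub_const 1).norm.eventually (gt_mem_nhds (lt_add_one _))]
        with k hk using hk.le)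
  have hR0 := hR.pos
  refine ⟨max |C| (|C'| * |B|), by positivity, fun k hk him => ?_⟩
  have hk0 : 0 < ‖k‖ := hR0.trans_le hk
  by_cases hkB : k ∈ Metric.closedBall (0 : ℂ) B
  · have h2 := hC' k ⟨hkB, hk⟩ him
    rw [mem_closedBall_zero_iff] at hkB
    have h3 : 1 ≤ |B| * ‖k‖⁻¹ := by
      rw [← div_eq_mul_inv, le_div_iff₀ hk0, one_mul]; exact hkB.trans (le_abs_self B)
    calc ‖M k - 1‖ ≤ |C'| * 1 := by rw [mul_one]; exact h2.trans (le_abs_self _)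
      _ ≤ |C'| * (|B| * ‖k‖⁻¹) := by gcongr
      _ = |C'| * |B| * ‖k‖⁻¹ := by ring
      _ ≤ _ := by gcongr; exact le_max_right _ _
  · have h2 := hB hkB (D.regularSet_subset (hR.mem_regularSet k hk him))
    rw [norm_inv, norm_norm] at h2
    refine h2.trans ?_
    gcongr
    exact (le_abs_self C).trans (le_max_left _ _)

theorem exists_far_norm_le (h : D.IsSolution x t M Mp Mm) {R : ℝ} (hR : D.IsFar R) :
    ∃ K, 1 ≤ K ∧ ∀ k : ℂ, R ≤ ‖k‖ → k.im ≠ 0 → ‖M k‖ ≤ K := by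
  obtain ⟨C, hC, hb⟩ := h.exists_far_bound hR
  have hR0 := hR.pos
  refine ⟨1 + C * R⁻¹, le_add_of_nonneg_right (by positivity), fun k hk him => ?_⟩
  have h1 := norm_add_le (1 : Mat2) (M k - 1)
  rw [add_sub_cancel, norm_one_mat] at h1
  refine h1.trans (by gcongr; exact (hb k hk him).trans (by gcongr))

end IsSolution

section Pair

variable {x t x₁ t₁ : ℝ} {M Mp Mm M₁ Mp₁ Mm₁ : ℂ → Mat2}

/-- The jump of `M₁ M⁻¹` on the real line. -/
noncomputable def ratioJump (Mp Mm Mp₁ Mm₁ : ℂ → Mat2) (ξ : ℝ) : Mat2 :=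
  Mp₁ ξ * (Mm ξ).conjTranspose - Mm₁ ξ * (Mp ξ).conjTranspose

/-- The entire quotient is solved for M₁, with M(k̄)ᴴ as the inverse of M. -/
theorem exists_factor (hD : D.Admissible) (h : D.IsSolution x t M Mp Mm)
    (h₁ : D.IsSolution x₁ t₁ M₁ Mp₁ Mm₁) : ∃ F : ℂ → Mat2, Differentiable ℂ F ∧
      ∀ k ∈ D.regularSet, M₁ k = F k * M k * expPhase (x - x₁) (t - t₁) k := by
  obtain ⟨F, hF, he⟩ := exists_entire_twist hD h₁ h
  refine ⟨F, hF, fun k hk => ?_⟩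
  have h1 : (expPhase x t (starRingEnd ℂ k)).conjTranspose = expPhase (-x) (-t) k := by
    rw [conjTranspose_expPhase, expPhase]; congr 2; simp [phase]; ring
  rw [he k hk, twist, Matrix.conjTranspose_mul, h1]
  simp only [mul_assoc]
  rw [← mul_assoc (M (starRingEnd ℂ k)).conjTranspose (M k), h.twist_self' hD hk, one_mul,
    expPhase_mul_expPhase, expPhase_mul_expPhase]
  rw [show x₁ + (-x + (x - x₁)) = 0 by ring, show t₁ + (-t + (t - t₁)) = 0 by ring,
    expPhase_zero, mul_one]

variable {F : ℂ → Mat2}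

/-- The factorization persists on the boundary, since F and the exponential are continuous across
the real line. -/
theorem factor_minus (hD : D.Admissible) (h : D.IsSolution x t M Mp Mm)
    (h₁ : D.IsSolution x₁ t₁ M₁ Mp₁ Mm₁) (hF : Differentiable ℂ F)
    (he : ∀ k ∈ D.regularSet, M₁ k = F k * M k * expPhase (x - x₁) (t - t₁) k) {ξ : ℝ}
    (hξ : ξ ≠ -D.V / 2) (hξ' : ξ ≠ D.V / 2) :
    Mm₁ ξ = F ξ * Mm ξ * expPhase (x - x₁) (t - t₁) ξ := by
  have h1 := (h₁.jump_real ξ hξ hξ').2.1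
  have h2 := tendsto_mul_expPhase nhdsWithin_le_nhds (Tendsto.mat_mul
    ((hF.continuous.tendsto (ξ : ℂ)).mono_left nhdsWithin_le_nhds)
    (h.jump_real ξ hξ hξ').2.1) (x - x₁) (t - t₁)
  have : (𝓝[{z : ℂ | z.im < 0}] (ξ : ℂ)).NeBot :=
    ((tendsto_conj_upper ξ).comp (tendsto_add_mul_I ξ)).neBot
  refine tendsto_nhds_unique (h1.congr' ?_) h2
  filter_upwards [nhdsWithin_le_nhds (IsSolution.eventually_upper_regular hD hξ hξ'),
    self_mem_nhdsWithin] with k h4 h5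
  exact he k (h4 (ne_of_lt h5))

theorem norm_twist_sub_one_le {R C C₁ : ℝ} {k : ℂ} (hR : 0 < R) (hk : R ≤ ‖k‖) (hC : 0 ≤ C)
    (hC₁ : 0 ≤ C₁) (hM : ‖M (starRingEnd ℂ k) - 1‖ ≤ C * ‖k‖⁻¹) (hM₁ : ‖M₁ k - 1‖ ≤ C₁ * ‖k‖⁻¹) :
    ‖twist M₁ M k - 1‖ ≤ (2 * C₁ * (1 + C * R⁻¹) + C) * ‖k‖⁻¹ := by
  have hk0 : 0 < ‖k‖ := hR.trans_le hk
  have h1 : twist M₁ M k - 1 = (M₁ k - 1) * (M (starRingEnd ℂ k)).conjTranspose +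
      (M (starRingEnd ℂ k) - 1).conjTranspose := by
    rw [twist, Matrix.conjTranspose_sub, Matrix.conjTranspose_one]; noncomm_ring
  have h2 : ‖M (starRingEnd ℂ k)‖ ≤ 1 + C * R⁻¹ := by
    have h1 := norm_add_le (1 : Mat2) (M (starRingEnd ℂ k) - 1)
    rw [add_sub_cancel, norm_one_mat] at h1
    refine h1.trans (by gcongr; exact hM.trans (by gcongr))
  rw [h1]
  refine (norm_add_le _ _).trans ?_
  rw [Matrix.norm_conjTranspose]
  have h3 := norm_mul_le_two (M₁ k - 1) (M (starRingEnd ℂ k)).conjTranspose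
  rw [Matrix.norm_conjTranspose] at h3
  calc _ ≤ 2 * (C₁ * ‖k‖⁻¹) * (1 + C * R⁻¹) + C * ‖k‖⁻¹ := by
        refine add_le_add (h3.trans ?_) hM
        gcongr
    _ = _ := by ring

theorem differentiableAt_twist (h : D.IsSolution x t M Mp Mm)
    (h₁ : D.IsSolution x₁ t₁ M₁ Mp₁ Mm₁) {k : ℂ} (hk : k ∈ D.regularSet) :
    DifferentiableAt ℂ (twist M₁ M) k :=
  DifferentiableAt.mat_mul (h₁.differentiableAt hk)
    (DifferentiableAt.mat_star (h.differentiableAt (conj_mem_regularSet.2 hk)))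

theorem exists_twist_bound (h : D.IsSolution x t M Mp Mm) (h₁ : D.IsSolution x₁ t₁ M₁ Mp₁ Mm₁)
    {R : ℝ} (hR : D.IsFar R) :
    ∃ C, ∀ k : ℂ, R ≤ ‖k‖ → k.im ≠ 0 → ‖twist M₁ M k - 1‖ ≤ C * ‖k‖⁻¹ := by
  obtain ⟨C, hC, hb⟩ := h.exists_far_bound hR
  obtain ⟨C₁, hC₁, hb₁⟩ := h₁.exists_far_bound hR
  refine ⟨_, fun k hk him => norm_twist_sub_one_le hR.pos hk hC hC₁ ?_ (hb₁ k hk him)⟩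
  have := hb (starRingEnd ℂ k) (by rwa [RCLike.norm_conj]) (by simpa using him)
  rwa [RCLike.norm_conj] at this

theorem tendsto_twist_plus (h : D.IsSolution x t M Mp Mm) (h₁ : D.IsSolution x₁ t₁ M₁ Mp₁ Mm₁)
    {R : ℝ} (hR : D.IsFar R) (ξ : ℝ) (hξ : R < |ξ|) : Tendsto (twist M₁ M)
      (𝓝[{z | 0 < z.im}] (ξ : ℂ)) (𝓝 (Mp₁ ξ * (Mm ξ).conjTranspose)) :=
  tendsto_twist (h₁.jump_real ξ (hR.ne_plus ξ hξ.le) (hR.ne_minus ξ hξ.le)).1 (tendsto_conj_upper ξ)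
    (h.jump_real ξ (hR.ne_plus ξ hξ.le) (hR.ne_minus ξ hξ.le)).2.1

theorem tendsto_twist_minus (h : D.IsSolution x t M Mp Mm) (h₁ : D.IsSolution x₁ t₁ M₁ Mp₁ Mm₁)
    {R : ℝ} (hR : D.IsFar R) (ξ : ℝ) (hξ : R < |ξ|) : Tendsto (twist M₁ M)
      (𝓝[{z | z.im < 0}] (ξ : ℂ)) (𝓝 (Mm₁ ξ * (Mp ξ).conjTranspose)) :=
  tendsto_twist (h₁.jump_real ξ (hR.ne_plus ξ hξ.le) (hR.ne_minus ξ hξ.le)).2.1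
    (tendsto_conj_lower ξ) (h.jump_real ξ (hR.ne_plus ξ hξ.le) (hR.ne_minus ξ hξ.le)).1

/-- Represents F through densities that become small as the two parameter points approach each
other: its mismatch with M₁M⁻¹ on the circle, and the jump of M₁M⁻¹ on the rays. -/
theorem pairing_inside (h : D.IsSolution x t M Mp Mm)
    (h₁ : D.IsSolution x₁ t₁ M₁ Mp₁ Mm₁) (hF : Differentiable ℂ F) {R : ℝ} (hR : D.IsFar R) {z : ℂ}
    (hz : ‖z‖ < R) : (2 * Real.pi * Complex.I : ℂ) • (F z - 1) =
      pairing R (fun k => F k - twist M₁ M k) (ratioJump Mp Mm Mp₁ Mm₁) (fun k => (k - z)⁻¹) := by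
  obtain ⟨C, hC⟩ := exists_twist_bound h h₁ hR
  exact cauchy_inside hR.pos hF
    (fun k hk him => differentiableAt_twist h h₁ (hR.mem_regularSet k hk him))
    (tendsto_twist_plus h h₁ hR) (tendsto_twist_minus h h₁ hR) hC hz

theorem pairing_outside (h : D.IsSolution x t M Mp Mm)
    (h₁ : D.IsSolution x₁ t₁ M₁ Mp₁ Mm₁) (hF : Differentiable ℂ F) {R : ℝ} (hR : D.IsFar R) {z : ℂ}
    (hz : R < ‖z‖) (him : z.im ≠ 0) :
    (2 * Real.pi * Complex.I : ℂ) • (twist M₁ M z - 1) =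
      pairing R (fun k => F k - twist M₁ M k) (ratioJump Mp Mm Mp₁ Mm₁) (fun k => (k - z)⁻¹) := by
  obtain ⟨C, hC⟩ := exists_twist_bound h h₁ hR
  exact cauchy_outside hR.pos hF
    (fun k hk him => differentiableAt_twist h h₁ (hR.mem_regularSet k hk him))
    (tendsto_twist_plus h h₁ hR) (tendsto_twist_minus h h₁ hR) hC hz him

/-- With both jumps inserted and J Hermitian, only the difference of the two jump matrices remains.
-/
theorem ratioJump_eq (h : D.IsSolution x t M Mp Mm) (h₁ : D.IsSolution x₁ t₁ M₁ Mp₁ Mm₁) {ξ : ℝ}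
    (hξ : ξ ≠ -D.V / 2) (hξ' : ξ ≠ D.V / 2) : ratioJump Mp Mm Mp₁ Mm₁ ξ =
      Mm₁ ξ * (D.J x₁ t₁ ξ - D.J x t ξ) * (Mm ξ).conjTranspose := by
  rw [ratioJump, (h.jump_real ξ hξ hξ').2.2, (h₁.jump_real ξ hξ hξ').2.2,
    Matrix.conjTranspose_mul, isHermitian_J]
  noncomm_ring

theorem norm_osc_sub_le (s a b x t ξ : ℝ) :
    ‖osc (x + s * a) (t + s * b) ξ - osc x t ξ‖ ≤ 2 * |s| * ‖phase a b ξ‖ := by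
  have h1 : phase a b (ξ : ℂ) = ((ξ * (a - 2 * ξ * b) : ℝ) : ℂ) := by
    rw [phase]; push_cast; ring
  have h2 : osc (x + s * a) (t + s * b) ξ = osc x t ξ *
      Complex.exp (Complex.I * ((2 * s * (ξ * (a - 2 * ξ * b)) : ℝ) : ℂ)) := by
    rw [osc, osc, ← Complex.exp_add]; congr 1; simp only [phase]; push_cast; ring
  have h3 := Real.norm_exp_I_mul_ofReal_sub_one_le (x := 2 * s * (ξ * (a - 2 * ξ * b)))
  rw [h2, ← mul_sub_one, norm_mul, norm_osc, one_mul, h1, Complex.norm_real]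
  refine h3.trans (le_of_eq ?_)
  simp only [norm_mul, Real.norm_eq_abs, abs_two]

theorem norm_J_sub_le (D : RHPData) (s a b x t ξ : ℝ) :
    ‖D.J (x + s * a) (t + s * b) ξ - D.J x t ξ‖ ≤ 2 * |s| * ‖phase a b ξ * D.ρ ξ‖ := by
  have h1 : ‖D.ρ ξ * osc (x + s * a) (t + s * b) ξ - D.ρ ξ * osc x t ξ‖ ≤
      2 * |s| * ‖phase a b ξ * D.ρ ξ‖ := by
    rw [← mul_sub, norm_mul, norm_mul, mul_comm]
    have := mul_le_mul_of_nonneg_right (norm_osc_sub_le s a b x t ξ) (norm_nonneg (D.ρ ξ))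
    linarith
  refine (Matrix.norm_le_iff (by positivity)).2 fun i j => ?_
  rw [J_real, J_real]
  fin_cases i <;> fin_cases j
  · simp only [Fin.zero_eta, Matrix.sub_apply, Matrix.of_apply, Matrix.cons_val', Matrix.cons_val_zero,
      sub_self, norm_zero]
    positivity
  · simpa using h1
  · rw [← RCLike.norm_conj] at h1
    simpa using h1
  · simp only [Fin.mk_one, Matrix.sub_apply, Matrix.of_apply, Matrix.cons_val', Matrix.cons_val_one,
      Matrix.cons_val_fin_one, sub_self, norm_zero]
    positivity

/-- Both boundary values have norm at most 1 + |ρ| ≤ 2 on the rays, whatever the parameters. Hence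
the bound is uniform in s before anything is known about the dependence of M₁ on s. -/
theorem norm_ratioJump_le (hD : D.Admissible) {s a b : ℝ} (h : D.IsSolution x t M Mp Mm)
    (h₁ : D.IsSolution (x + s * a) (t + s * b) M₁ Mp₁ Mm₁) {R : ℝ} (hR : D.IsFar R) {ξ : ℝ}
    (hξ : ξ ∈ rays R) :
    ‖ratioJump Mp Mm Mp₁ Mm₁ ξ‖ ≤ 32 * |s| * ‖phase a b ξ * D.ρ ξ‖ := by
  have hξ : R < |ξ| := hξ
  have hp := hR.ne_plus ξ hξ.le
  have hm := hR.ne_minus ξ hξ.le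
  have hr := hR.norm_rho_le ξ hξ.le
  rw [ratioJump_eq h h₁ hp hm]
  have h1 := h.norm_minus_le hD hp hm
  have h2 := h₁.norm_minus_le hD hp hm
  have h3 := D.norm_J_sub_le s a b x t ξ
  have h4 := norm_mul_le_two (Mm₁ ξ * (D.J (x + s * a) (t + s * b) ξ - D.J x t ξ))
    (Mm ξ).conjTranspose
  have h5 := norm_mul_le_two (Mm₁ ξ) (D.J (x + s * a) (t + s * b) ξ - D.J x t ξ)
  rw [Matrix.norm_conjTranspose] at h4
  calc _ ≤ _ := h4
    _ ≤ 2 * (2 * (1 + 1) * (2 * |s| * ‖phase a b ξ * D.ρ ξ‖)) * (1 + 1) := by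
        gcongr
        · refine h5.trans ?_; gcongr; exact h2.trans (by linarith)
        · exact h1.trans (by linarith)
    _ = _ := by ring

/-- With M M(k̄)ᴴ = I inserted after F, the two terms differ only by the exponential in the middle.
-/
theorem factor_sub_twist (hD : D.Admissible) (h : D.IsSolution x t M Mp Mm) {k : ℂ}
    (hk : k ∈ D.regularSet) (he : M₁ k = F k * M k * expPhase (x - x₁) (t - t₁) k) :
    F k - twist M₁ M k = -(F k * (M k * (expPhase (x - x₁) (t - t₁) k - 1) *
      (M (starRingEnd ℂ k)).conjTranspose)) := by
  have h1 : F k = F k * (M k * (M (starRingEnd ℂ k)).conjTranspose) := by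
    rw [h.twist_self hD hk, mul_one]
  rw [twist, he]
  nth_rewrite 1 [h1]
  noncomm_ring

theorem norm_factor_sub_twist_le (hD : D.Admissible) {s a b K P f : ℝ} (hs : |s| * P ≤ 1)
    (h : D.IsSolution x t M Mp Mm) {k : ℂ}
    (hk : k ∈ D.regularSet)
    (he : M₁ k = F k * M k * expPhase (x - (x + s * a)) (t - (t + s * b)) k)
    (hf : ‖F k‖ ≤ f) (hM : ‖M k‖ ≤ K) (hM' : ‖M (starRingEnd ℂ k)‖ ≤ K) (hP : ‖phase a b k‖ ≤ P) :
    ‖F k - twist M₁ M k‖ ≤ 16 * K ^ 2 * P * |s| * f := by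
  have hK : 0 ≤ K := (norm_nonneg _).trans hM
  have hP0 : 0 ≤ P := (norm_nonneg _).trans hP
  have hf0 : 0 ≤ f := (norm_nonneg _).trans hf
  rw [factor_sub_twist hD h hk he, norm_neg]
  have e1 : ‖expPhase (x - (x + s * a)) (t - (t + s * b)) k - 1‖ ≤ 2 * (|s| * P) := by
    have := norm_expPhase_sub_one_le (s := -s) (a := a) (b := b) (k := k) (r := |s| * P)
      (by rw [abs_neg]; gcongr) hs
    rwa [show x - (x + s * a) = -s * a by ring, show t - (t + s * b) = -s * b by ring]
  have h1 := norm_mul_le_two (F k) (M k * (expPhase (x - (x + s * a)) (t - (t + s * b)) k - 1) *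
      (M (starRingEnd ℂ k)).conjTranspose)
  have h2 := norm_mul_le_two (M k * (expPhase (x - (x + s * a)) (t - (t + s * b)) k - 1))
    (M (starRingEnd ℂ k)).conjTranspose
  have h3 := norm_mul_le_two (M k) (expPhase (x - (x + s * a)) (t - (t + s * b)) k - 1)
  rw [Matrix.norm_conjTranspose] at h2
  calc _ ≤ _ := h1
    _ ≤ 2 * f * (2 * (2 * K * (2 * (|s| * P))) * K) := by
      gcongr
      refine h2.trans ?_
      gcongr
      refine h3.trans ?_
      gcongr
    _ = _ := by ring

end Pair

end RHPData

end CounterflowNLS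

/-! ### Uniform bounds for the entire factor -/

namespace CounterflowNLS

attribute [local instance] Matrix.normedAddCommGroup Matrix.normedSpace

/-- On the circle r² = z z̄, so z² - r² = z (z - z̄). -/
theorem norm_sq_sub_sq_of_norm_eq {z : ℂ} {r : ℝ} (hz : ‖z‖ = r) :
    ‖z ^ 2 - (r : ℂ) ^ 2‖ = 2 * r * |z.im| := by
  have h1 : z ^ 2 - (r : ℂ) ^ 2 = z * ((2 * z.im : ℝ) * Complex.I) := by
    rw [← Complex.sub_conj, mul_sub, Complex.mul_conj', hz, sq]
  rw [h1, norm_mul, norm_mul, hz, Complex.norm_I, Complex.norm_real, Real.norm_eq_abs, abs_mul,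
    abs_two]
  ring

/-- The bound on the circle degenerates at the two real points ±2R. The factor z² - (2R)² vanishes
there at just the right rate, so the maximum principle applies to the product; on the disc of radius
R that factor is at least 3R² in modulus. -/
theorem norm_le_of_sphere_bound {E : Type*} [NormedAddCommGroup E] [NormedSpace ℂ E] {F : ℂ → E}
    (hF : Differentiable ℂ F) {R A : ℝ} (hR : 0 < R) (hA : 0 ≤ A)
    (hb : ∀ z : ℂ, ‖z‖ = 2 * R → z.im ≠ 0 → |z.im| * ‖F z‖ ≤ A) {z : ℂ} (hz : ‖z‖ ≤ R) :
    ‖F z‖ ≤ 2 * A / R := by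
  have h1 : ‖(z ^ 2 - ((2 * R : ℝ) : ℂ) ^ 2) • F z‖ ≤ 4 * R * A := by
    refine Complex.norm_le_of_forall_mem_frontier_norm_le (U := Metric.ball (0 : ℂ) (2 * R))
      Metric.isBounded_ball (f := fun z => (z ^ 2 - ((2 * R : ℝ) : ℂ) ^ 2) • F z)
      (Differentiable.diffContOnCl (by fun_prop)) (fun w hw => ?_) (subset_closure ?_)
    · rw [frontier_ball _ (by positivity), mem_sphere_zero_iff_norm] at hw
      rw [norm_smul, norm_sq_sub_sq_of_norm_eq hw]
      by_cases him : w.im = 0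
      · rw [him, abs_zero, mul_zero, zero_mul]; positivity
      · have := hb w hw him
        nlinarith
    · rw [mem_ball_zero_iff]; linarith
  have h2 : 3 * R ^ 2 ≤ ‖z ^ 2 - ((2 * R : ℝ) : ℂ) ^ 2‖ := by
    have := norm_sub_norm_le (((2 * R : ℝ) : ℂ) ^ 2) (z ^ 2)
    rw [norm_sub_rev, norm_pow, norm_pow, Complex.norm_real, Real.norm_eq_abs, sq_abs] at this
    nlinarith [norm_nonneg z]
  rw [norm_smul] at h1
  rw [le_div_iff₀ hR]
  have h3 : 3 * R ^ 2 * ‖F z‖ ≤ 4 * R * A := (by gcongr : _ ≤ _).trans h1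
  nlinarith [norm_nonneg (F z), mul_pos hR hR]

theorem abs_im_le_norm_ofReal_sub (ξ : ℝ) (z : ℂ) : |z.im| ≤ ‖(ξ : ℂ) - z‖ := by
  have := Complex.abs_im_le_norm ((ξ : ℂ) - z)
  simpa using this

theorem exists_phase_bound (a b R : ℝ) : ∃ P, 0 ≤ P ∧ ∀ k : ℂ, ‖k‖ ≤ R → ‖phase a b k‖ ≤ P := by
  obtain ⟨P, hP⟩ := (isCompact_closedBall (0 : ℂ) R).exists_bound_of_continuousOn
    (continuous_phase a b).continuousOn
  exact ⟨|P|, abs_nonneg _, fun k hk => (hP k (mem_closedBall_zero_iff.2 hk)).trans (le_abs_self _)⟩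

namespace RHPData

variable {D : RHPData} {x t : ℝ} {M Mp Mm : ℂ → Mat2}

/-- `F` is the entire factor that relates the solution `M₁` at `(x + s a, t + s b)` to the solution
`M` at `(x, t)`. -/
structure IsFactor (D : RHPData) (x t a b s : ℝ) (M M₁ Mp₁ Mm₁ F : ℂ → Mat2) : Prop where
  sol : D.IsSolution (x + s * a) (t + s * b) M₁ Mp₁ Mm₁
  diff : Differentiable ℂ F
  eq : ∀ k ∈ D.regularSet, M₁ k = F k * M k * expPhase (-s * a) (-s * b) k

namespace IsFactor

variable {a b s : ℝ} {M₁ Mp₁ Mm₁ F : ℂ → Mat2}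

theorem eq' (hF : D.IsFactor x t a b s M M₁ Mp₁ Mm₁ F) : ∀ k ∈ D.regularSet,
    M₁ k = F k * M k * expPhase (x - (x + s * a)) (t - (t + s * b)) k := by
  intro k hk
  rw [show x - (x + s * a) = -s * a by ring, show t - (t + s * b) = -s * b by ring]
  exact hF.eq k hk

theorem norm_sub_le (hF : D.IsFactor x t a b s M M₁ Mp₁ Mm₁ F) (hD : D.Admissible)
    (h : D.IsSolution x t M Mp Mm) {R K P f : ℝ} (hR : D.IsFar R)
    (hK : ∀ k : ℂ, R ≤ ‖k‖ → k.im ≠ 0 → ‖M k‖ ≤ K) (hP : ∀ k : ℂ, ‖k‖ ≤ R → ‖phase a b k‖ ≤ P)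
    (hf : ∀ k : ℂ, ‖k‖ = R → ‖F k‖ ≤ f) (hs : |s| * P ≤ 1) {k : ℂ} (hk : ‖k‖ = R) (him : k.im ≠ 0) :
    ‖F k - twist M₁ M k‖ ≤ 16 * K ^ 2 * P * |s| * f := by
  have hr := hR.mem_regularSet k hk.ge him
  exact norm_factor_sub_twist_le hD hs h hr (hF.eq' k hr) (hf k hk) (hK k hk.ge him)
    (hK _ (by rw [RCLike.norm_conj]; exact hk.ge) (by simpa using him)) (hP k hk.le)

/-- On the circle of radius 2R the Cauchy kernel is at most 1/R against the inner circle but only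
1/|Im z| against the rays, whence the weight |Im z| on the left. -/
theorem norm_twist_outside_le (hF : D.IsFactor x t a b s M M₁ Mp₁ Mm₁ F) (hD : D.Admissible)
    (hreg : D.Regular)
    (h : D.IsSolution x t M Mp Mm) {R K P f : ℝ} (hR : D.IsFar R)
    (hK : ∀ k : ℂ, R ≤ ‖k‖ → k.im ≠ 0 → ‖M k‖ ≤ K) (hP : ∀ k : ℂ, ‖k‖ ≤ R → ‖phase a b k‖ ≤ P)
    (hf : ∀ k : ℂ, ‖k‖ = R → ‖F k‖ ≤ f) (hs : |s| * P ≤ 1) {z : ℂ} (hz : ‖z‖ = 2 * R)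
    (him : z.im ≠ 0) : |z.im| * ‖twist M₁ M z‖ ≤
      2 * R + 2 * R * (16 * K ^ 2 * P * |s| * f) +
        32 * |s| * ∫ ξ in rays R, ‖phase a b ξ * D.ρ ξ‖ := by
  have hR0 := hR.pos
  have hzpos : 0 < |z.im| := abs_pos.2 him
  set I := ∫ ξ in rays R, ‖phase a b ξ * D.ρ ξ‖ with hI
  have hI0 : 0 ≤ I := integral_nonneg fun _ => norm_nonneg _
  set B := 16 * K ^ 2 * P * |s| * f with hB
  have hB0 : 0 ≤ B := by
    have h1 : 0 ≤ f := (norm_nonneg _).trans (hf (R : ℂ) (by simp [hR0.le]))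
    have h2 : 0 ≤ P := (norm_nonneg _).trans (hP 0 (by simpa using hR0.le))
    positivity
  have h1 := pairing_outside h hF.sol hF.diff hR (z := z) (by linarith) him
  have h2 := norm_pairing_le (κ := fun k => (k - z)⁻¹) (K₁ := R⁻¹) (K₂ := |z.im|⁻¹) hR0
    (fun k hk hki => hF.norm_sub_le hD h hR hK hP hf hs hk hki)
    (fun ξ hξ => norm_ratioJump_le hD h hF.sol hR hξ)
    ((hreg.integrableOn_phase_mul_rho hR0 a b).norm.const_mul _) (fun k hk => by
      rw [norm_inv]
      refine inv_anti₀ hR0 ?_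
      have := norm_sub_norm_le z k
      rw [norm_sub_rev] at this
      linarith) fun ξ hξ => by
        rw [norm_inv]
        exact inv_anti₀ hzpos (abs_im_le_norm_ofReal_sub ξ z)
  rw [integral_const_mul, ← h1, norm_smul, ← hI, ← hB] at h2
  have h3 : ‖(2 * Real.pi * Complex.I : ℂ)‖ = 2 * Real.pi := by
    simp [Real.pi_pos.le]
  rw [h3] at h2
  have hpi := Real.pi_gt_three
  have h4 : |z.im| ≤ 2 * R := hz ▸ Complex.abs_im_le_norm z
  have h5 : |z.im| * ‖twist M₁ M z - 1‖ ≤ |z.im| * B + 32 * |s| * I := by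
    have h6 : 2 * Real.pi * (|z.im| * ‖twist M₁ M z - 1‖) ≤
        2 * Real.pi * (|z.im| * B + 32 * |s| * I) := by
      calc _ = |z.im| * (2 * Real.pi * ‖twist M₁ M z - 1‖) := by ring
        _ ≤ |z.im| * (2 * Real.pi * R * (R⁻¹ * B) + |z.im|⁻¹ * (32 * |s| * I)) := by gcongr
        _ = 2 * Real.pi * (|z.im| * B) + 1 * (32 * |s| * I) := by field_simp
        _ ≤ 2 * Real.pi * (|z.im| * B) + 2 * Real.pi * (32 * |s| * I) := by gcongr; linarith
        _ = _ := by ring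
    exact le_of_mul_le_mul_left h6 (by positivity)
  have h7 := norm_add_le (1 : Mat2) (twist M₁ M z - 1)
  rw [add_sub_cancel, norm_one_mat] at h7
  calc _ ≤ |z.im| * (1 + ‖twist M₁ M z - 1‖) := by gcongr
    _ = |z.im| * 1 + |z.im| * ‖twist M₁ M z - 1‖ := by ring
    _ ≤ 2 * R * 1 + (2 * R * B + 32 * |s| * I) := by
      gcongr; exact h5.trans (by gcongr)
    _ = _ := by ring

/-- F is recovered from M₁M⁻¹ by undoing the exponential; for |s|P ≤ 1 the exponential has norm at
most 3. -/
theorem norm_le_twist (hF : D.IsFactor x t a b s M M₁ Mp₁ Mm₁ F) (hD : D.Admissible)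
    (h : D.IsSolution x t M Mp Mm) {K P : ℝ} {k : ℂ} (hk : k ∈ D.regularSet) (hM : ‖M k‖ ≤ K)
    (hM' : ‖M (starRingEnd ℂ k)‖ ≤ K) (hP : ‖phase a b k‖ ≤ P) (hs : |s| * P ≤ 1) :
    ‖F k‖ ≤ 24 * K ^ 2 * ‖twist M₁ M k‖ := by
  have hK : 0 ≤ K := (norm_nonneg _).trans hM
  have e0 : expPhase (-s * a) (-s * b) k * expPhase (s * a) (s * b) k = 1 := by
    rw [expPhase_mul_expPhase, show -s * a + s * a = 0 by ring, show -s * b + s * b = 0 by ring,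
      expPhase_zero]
  have h0 : F k = twist M₁ M k * (M k * expPhase (s * a) (s * b) k *
      (M (starRingEnd ℂ k)).conjTranspose) := by
    rw [twist, hF.eq k hk]
    simp only [mul_assoc]
    rw [← mul_assoc (M (starRingEnd ℂ k)).conjTranspose (M k), h.twist_self' hD hk, one_mul,
      ← mul_assoc (expPhase _ _ k), e0, one_mul, h.twist_self hD hk, mul_one]
  have e1 : ‖expPhase (s * a) (s * b) k‖ ≤ 3 := by
    have h1 := norm_expPhase_sub_one_le (s := s) (a := a) (b := b) (k := k) (r := |s| * P)
      (by gcongr) hs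
    have h2 := norm_add_le (1 : Mat2) (expPhase (s * a) (s * b) k - 1)
    rw [add_sub_cancel, norm_one_mat] at h2
    linarith
  have h1 := norm_mul_le_two (twist M₁ M k) (M k * expPhase (s * a) (s * b) k *
      (M (starRingEnd ℂ k)).conjTranspose)
  have h2 := norm_mul_le_two (M k * expPhase (s * a) (s * b) k) (M (starRingEnd ℂ k)).conjTranspose
  have h3 := norm_mul_le_two (M k) (expPhase (s * a) (s * b) k)
  rw [Matrix.norm_conjTranspose] at h2
  rw [← h0] at h1
  calc _ ≤ _ := h1
    _ ≤ 2 * ‖twist M₁ M k‖ * (2 * (2 * K * 3) * K) := by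
      gcongr
      refine h2.trans ?_
      gcongr
      refine h3.trans ?_
      gcongr
    _ = _ := by ring

end IsFactor

/-- A bootstrap. Let f be the maximum of ‖F‖ on the disc of radius R. The formula outside bounds
M₁M⁻¹, hence F, on the circle of radius 2R by a constant plus O(|s|) f. The maximum principle
carries this back to the disc, and for small s the term with f is absorbed. No continuity of the
solution in the parameters enters. -/
theorem exists_factor_bound (hD : D.Admissible) (hreg : D.Regular) (h : D.IsSolution x t M Mp Mm)
    {R : ℝ} (hR : D.IsFar R) (a b : ℝ) : ∃ C δ : ℝ, 0 < δ ∧ ∀ s, |s| < δ → ∀ M₁ Mp₁ Mm₁ F,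
      D.IsFactor x t a b s M M₁ Mp₁ Mm₁ F → ∀ z : ℂ, ‖z‖ ≤ R → ‖F z‖ ≤ C := by
  have hR0 := hR.pos
  obtain ⟨K, hK1, hK⟩ := h.exists_far_norm_le hR
  obtain ⟨P, hP0, hP⟩ := exists_phase_bound a b (2 * R)
  set I := ∫ ξ in rays R, ‖phase a b ξ * D.ρ ξ‖ with hI
  have hI0 : 0 ≤ I := integral_nonneg fun _ => norm_nonneg _
  -- For |s| < T⁻¹ one has |s| ≤ 1 and |s|P ≤ 1, and the coefficient 1536 K⁴P|s| of f in the closing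
  -- inequality is at most 1/2.
  set T := 1 + P + 3072 * K ^ 4 * P with hT
  have hT0 : 0 < T := by positivity
  refine ⟨96 * K ^ 2 * (2 + 32 * I / R), T⁻¹, inv_pos.2 hT0, fun s hs M₁ Mp₁ Mm₁ F hF z hz => ?_⟩
  have hsT : |s| * T ≤ 1 := by
    have := mul_le_mul_of_nonneg_right hs.le hT0.le
    rwa [inv_mul_cancel₀ hT0.ne'] at this
  have hs0 := abs_nonneg s
  have hq : 0 ≤ 3072 * K ^ 4 * P := by positivity
  have hs1 : |s| ≤ 1 := by nlinarith
  have hsP : |s| * P ≤ 1 := by nlinarith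
  have hsK : |s| * (3072 * K ^ 4 * P) ≤ 1 := by nlinarith
  obtain ⟨k₀, hk₀, hmax⟩ := (isCompact_closedBall (0 : ℂ) R).exists_isMaxOn ⟨0, by simp [hR0.le]⟩
    hF.diff.continuous.norm.continuousOn
  set f := ‖F k₀‖ with hf
  have hf0 : 0 ≤ f := norm_nonneg _
  have hmax' : ∀ k : ℂ, ‖k‖ ≤ R → ‖F k‖ ≤ f := fun k hk =>
    hmax (mem_closedBall_zero_iff.2 hk)
  set A := 24 * K ^ 2 * (2 * R + 2 * R * (16 * K ^ 2 * P * |s| * f) + 32 * |s| * I) with hA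
  have h1 : ∀ z : ℂ, ‖z‖ = 2 * R → z.im ≠ 0 → |z.im| * ‖F z‖ ≤ A := by
    intro z hz him
    have hRz : R ≤ ‖z‖ := by linarith
    have h2 := hF.norm_twist_outside_le hD hreg h hR hK (fun k hk => hP k (by linarith))
      (fun k hk => hmax' k hk.le) hsP hz him
    have h3 := hF.norm_le_twist hD h (hR.mem_regularSet z hRz him) (hK z hRz him)
      (hK _ (by rwa [RCLike.norm_conj]) (by simpa using him)) (hP z hz.le) hsP
    calc _ ≤ |z.im| * (24 * K ^ 2 * ‖twist M₁ M z‖) := by gcongr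
      _ = 24 * K ^ 2 * (|z.im| * ‖twist M₁ M z‖) := by ring
      _ ≤ A := by rw [hA]; gcongr
  have hA0 : 0 ≤ A := by positivity
  have h4 := norm_le_of_sphere_bound hF.diff hR0 hA0 h1 (mem_closedBall_zero_iff.1 hk₀)
  rw [← hf] at h4
  have h5 : 2 * A / R = 48 * K ^ 2 * (2 + 32 * |s| * I / R) + f * (|s| * (3072 * K ^ 4 * P)) / 2 := by
    rw [hA]; field_simp; ring
  have h6 : f * (|s| * (3072 * K ^ 4 * P)) ≤ f := by nlinarith
  have h7 : 48 * K ^ 2 * (2 + 32 * |s| * I / R) ≤ 48 * K ^ 2 * (2 + 32 * 1 * I / R) := by gcongr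
  refine (hmax' z hz).trans ?_
  rw [h5] at h4
  linarith

/-- Once F is bounded, the densities on the circle and on the rays are both O(s), and so is their
Cauchy integral. Radius 2R for the circle keeps the kernel below 1/R on the disc of radius R. -/
theorem exists_factor_lipschitz (hD : D.Admissible) (hreg : D.Regular)
    (h : D.IsSolution x t M Mp Mm)
    {R : ℝ} (hR : D.IsFar R) (a b : ℝ) : ∃ C δ : ℝ, 0 < δ ∧ ∀ s, |s| < δ → ∀ M₁ Mp₁ Mm₁ F,
      D.IsFactor x t a b s M M₁ Mp₁ Mm₁ F → ∀ z : ℂ, ‖z‖ ≤ R → ‖F z - 1‖ ≤ C * |s| := by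
  have hR0 := hR.pos
  have hR2 : D.IsFar (2 * R) := hR.mono (by linarith)
  obtain ⟨f, δ, hδ, hf⟩ := exists_factor_bound hD hreg h hR2 a b
  obtain ⟨K, hK1, hK⟩ := h.exists_far_norm_le hR2
  obtain ⟨P, hP0, hP⟩ := exists_phase_bound a b (2 * R)
  set I := ∫ ξ in rays (2 * R), ‖phase a b ξ * D.ρ ξ‖ with hI
  have hI0 : 0 ≤ I := integral_nonneg fun _ => norm_nonneg _
  refine ⟨2 * R * (R⁻¹ * (16 * K ^ 2 * P * f)) + R⁻¹ * (32 * I), min δ (P + 1)⁻¹,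
    lt_min hδ (by positivity), fun s hs M₁ Mp₁ Mm₁ F hF z hz => ?_⟩
  have hsP : |s| * P ≤ 1 := by
    have h1 := mul_le_mul_of_nonneg_right (hs.trans_le (min_le_right _ _)).le
      (by positivity : 0 ≤ P + 1)
    rw [inv_mul_cancel₀ (by positivity)] at h1
    nlinarith [abs_nonneg s]
  have hb := hf s (hs.trans_le (min_le_left _ _)) M₁ Mp₁ Mm₁ F hF
  have h1 := pairing_inside h hF.sol hF.diff hR2 (z := z) (by linarith)
  have h2 := norm_pairing_le (κ := fun k => (k - z)⁻¹) (K₁ := R⁻¹) (K₂ := R⁻¹) hR2.pos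
    (fun k hk hki => hF.norm_sub_le hD h hR2 hK hP (fun k hk => hb k hk.le) hsP hk hki)
    (fun ξ hξ => norm_ratioJump_le hD h hF.sol hR2 hξ)
    ((hreg.integrableOn_phase_mul_rho hR2.pos a b).norm.const_mul _) (fun k hk => by
      rw [norm_inv]
      refine inv_anti₀ hR0 ?_
      have := norm_sub_norm_le k z
      linarith) fun ξ hξ => by
        rw [norm_inv]
        refine inv_anti₀ hR0 ?_
        have hξ : 2 * R < |ξ| := hξ
        have := norm_sub_norm_le (ξ : ℂ) z
        rw [Complex.norm_real, Real.norm_eq_abs] at this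
        linarith
  rw [integral_const_mul, ← h1, norm_smul, ← hI] at h2
  have h3 : ‖(2 * Real.pi * Complex.I : ℂ)‖ = 2 * Real.pi := by
    simp [Real.pi_pos.le]
  rw [h3] at h2
  have hpi := Real.pi_gt_three
  have hf0 : 0 ≤ f := (norm_nonneg _).trans (hb 0 (by simp [hR0.le]))
  refine le_of_mul_le_mul_left (h2.trans ?_) (by positivity : 0 < 2 * Real.pi)
  calc _ = 2 * Real.pi * (2 * R * (R⁻¹ * (16 * K ^ 2 * P * f)) * |s|) +
        1 * (R⁻¹ * (32 * |s| * I)) := by ring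
    _ ≤ 2 * Real.pi * (2 * R * (R⁻¹ * (16 * K ^ 2 * P * f)) * |s|) +
        2 * Real.pi * (R⁻¹ * (32 * |s| * I)) := by gcongr; linarith
    _ = _ := by ring

end RHPData

end CounterflowNLS

/-! ### Difference quotients in the parameters -/

namespace CounterflowNLS

attribute [local instance] Matrix.normedAddCommGroup Matrix.normedSpace

section Rays

variable {E : Type*} [NormedAddCommGroup E]

/-- Integrability over the two rays outside `[-R, R]`. -/
def RayIntegrable (R : ℝ) (j : ℝ → E) : Prop := IntegrableOn j (rays R)

variable [NormedSpace ℂ E]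

theorem aestronglyMeasurable_smul {R : ℝ} {j : ℝ → E}
    (h : AEStronglyMeasurable j (volume.restrict (rays R))) (c : ℂ) :
    AEStronglyMeasurable (fun ξ => c • j ξ) (volume.restrict (rays R)) := h.const_smul c

theorem rayIntegrable_of_tendsto {R : ℝ} {f : ℕ → ℝ → E} {c : ℕ → ℂ} {j : ℝ → E} {g : ℝ → ℝ}
    (hm : ∀ n, AEStronglyMeasurable (f n) (volume.restrict (rays R)))
    (hlim : ∀ ξ ∈ rays R, Tendsto (fun n => c n • f n ξ) atTop (𝓝 (j ξ)))
    (hb : ∀ ξ ∈ rays R, ‖j ξ‖ ≤ g ξ) (hg : IntegrableOn g (rays R)) : RayIntegrable R j := by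
  refine Integrable.mono' hg (aestronglyMeasurable_of_tendsto_ae atTop
    (fun n => aestronglyMeasurable_smul (hm n) (c n)) ?_) ?_
  · filter_upwards [ae_restrict_mem (measurableSet_rays R)] with ξ hξ using hlim ξ hξ
  · filter_upwards [ae_restrict_mem (measurableSet_rays R)] with ξ hξ using hb ξ hξ

end Rays

theorem tendsto_slope_exp (c : ℂ) :
    Tendsto (fun s : ℝ => (s : ℂ)⁻¹ * (Complex.exp (s * c) - 1)) (𝓝[≠] 0) (𝓝 c) := by
  have h1 : HasDerivAt (fun s : ℝ => Complex.exp (s * c)) (Complex.exp ((0 : ℝ) * c) * (1 * c)) 0 :=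
    ((Complex.ofRealCLM.hasDerivAt (x := (0 : ℝ))).mul_const c).cexp
  have h2 := hasDerivAt_iff_tendsto_slope.1 h1
  simp only [Complex.ofReal_zero, zero_mul, Complex.exp_zero, one_mul] at h2
  refine h2.congr fun s => ?_
  simp [slope_def_module, Complex.real_smul]

theorem tendsto_slope_expPhase (a b : ℝ) (k : ℂ) :
    Tendsto (fun s : ℝ => (s : ℂ)⁻¹ • (expPhase (-s * a) (-s * b) k - 1)) (𝓝[≠] 0)
      (𝓝 (-((Complex.I * phase a b k) • sigma3))) := by
  refine tendsto_mat.2 fun i j => ?_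
  have h1 := tendsto_slope_exp (-(Complex.I * phase a b k))
  have h2 := tendsto_slope_exp (Complex.I * phase a b k)
  have e1 : ∀ s : ℝ, Complex.I * phase (-s * a) (-s * b) k = s * (-(Complex.I * phase a b k)) :=
    fun s => by rw [phase_mul]; push_cast; ring
  have e2 : ∀ s : ℝ, -(Complex.I * phase (-s * a) (-s * b) k) = s * (Complex.I * phase a b k) :=
    fun s => by rw [phase_mul]; push_cast; ring
  simp only [expPhase, powSigma3, ← Complex.exp_neg, e2]
  simp only [e1]
  fin_cases i <;> fin_cases j
  · simpa [sigma3] using h1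
  · simp [sigma3]
  · simp [sigma3]
  · simpa [sigma3] using h2

namespace RHPData

variable {D : RHPData}

/-- The derivative of the jump matrix on the real line in the direction `(a, b)`. -/
noncomputable def jumpDeriv (D : RHPData) (x t a b : ℝ) (ξ : ℝ) : Mat2 :=
  !![0, 2 * Complex.I * phase a b ξ * (D.ρ ξ * osc x t ξ);
    starRingEnd ℂ (2 * Complex.I * phase a b ξ * (D.ρ ξ * osc x t ξ)), 0]

theorem tendsto_slope_J (D : RHPData) (x t a b : ℝ) (ξ : ℝ) :
    Tendsto (fun s : ℝ => (s : ℂ)⁻¹ • (D.J (x + s * a) (t + s * b) ξ - D.J x t ξ)) (𝓝[≠] 0)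
      (𝓝 (D.jumpDeriv x t a b ξ)) := by
  have h1 : Tendsto (fun s : ℝ => (s : ℂ)⁻¹ * (D.ρ ξ * osc (x + s * a) (t + s * b) ξ -
      D.ρ ξ * osc x t ξ)) (𝓝[≠] 0) (𝓝 (2 * Complex.I * phase a b ξ * (D.ρ ξ * osc x t ξ))) := by
    have h2 := (tendsto_slope_exp (2 * Complex.I * phase a b ξ)).mul_const (D.ρ ξ * osc x t ξ)
    refine h2.congr fun s => ?_
    have h3 : osc (x + s * a) (t + s * b) ξ =
        Complex.exp (s * (2 * Complex.I * phase a b ξ)) * osc x t ξ := by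
      rw [osc, osc, ← Complex.exp_add]; congr 1; simp only [phase]; push_cast; ring
    rw [h3]; ring
  have h1' := h1.star
  refine tendsto_mat.2 fun i j => ?_
  simp only [J_real, jumpDeriv]
  fin_cases i <;> fin_cases j
  · simp
  · simpa using h1
  · simpa [Complex.conj_ofNat] using h1'
  · simp

/-- A family of solutions along a line through `(x, t)`, with the entire factors that relate it to
the solution at `(x, t)`. -/
structure IsFamily (D : RHPData) (x t a b : ℝ) (M Mp Mm : ℂ → Mat2)
    (Ms Mps Mms F : ℝ → ℂ → Mat2) : Prop where
  sol : D.IsSolution x t M Mp Mm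
  diff : ∀ s, Differentiable ℂ (F s)
  factor : ∀ᶠ s in 𝓝[≠] (0 : ℝ), D.IsFactor x t a b s M (Ms s) (Mps s) (Mms s) (F s)

theorem exists_isFamily (hD : D.Admissible) {x t a b : ℝ} {M Mp Mm : ℂ → Mat2}
    {Ms Mps Mms : ℝ → ℂ → Mat2} (h : D.IsSolution x t M Mp Mm)
    (hs : ∀ᶠ s in 𝓝[≠] (0 : ℝ), D.IsSolution (x + s * a) (t + s * b) (Ms s) (Mps s) (Mms s)) :
    ∃ F, D.IsFamily x t a b M Mp Mm Ms Mps Mms F := by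
  have h1 : ∀ s : ℝ, ∃ F : ℂ → Mat2, Differentiable ℂ F ∧
      (D.IsSolution (x + s * a) (t + s * b) (Ms s) (Mps s) (Mms s) →
        D.IsFactor x t a b s M (Ms s) (Mps s) (Mms s) F) := by
    intro s
    by_cases hsol : D.IsSolution (x + s * a) (t + s * b) (Ms s) (Mps s) (Mms s)
    · obtain ⟨F, hF, he⟩ := exists_factor hD h hsol
      refine ⟨F, hF, fun _ => ⟨hsol, hF, fun k hk => ?_⟩⟩
      rw [he k hk]
      congr 2 <;> ring
    -- Where there is no solution the factor is set to 1, so that `F s` is entire for every s.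
    · exact ⟨fun _ => 1, differentiable_const _, fun h => absurd h hsol⟩
  choose F hF hF' using h1
  exact ⟨F, h, hF, hs.mono fun s hs => hF' s hs⟩

/-- The limit of the circle density in the variation of the solution. -/
noncomputable def circleVar (a b : ℝ) (M : ℂ → Mat2) (k : ℂ) : Mat2 :=
  M k * ((Complex.I * phase a b k) • sigma3) * (M (starRingEnd ℂ k)).conjTranspose

/-- The limit of the ray density in the variation of the solution. -/
noncomputable def rayVar (D : RHPData) (x t a b : ℝ) (Mm : ℂ → Mat2) (ξ : ℝ) : Mat2 :=
  Mm ξ * D.jumpDeriv x t a b ξ * (Mm ξ).conjTranspose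

/-- Reduced to the upper half plane by complex conjugation. -/
theorem aestronglyMeasurable_boundary_lower {E : Type*} [NormedAddCommGroup E] [NormedSpace ℂ E]
    {h : ℂ → E} {hm : ℝ → E} {R : ℝ}
    (hd : ∀ k : ℂ, R ≤ ‖k‖ → k.im < 0 → ContinuousAt h k)
    (hlim : ∀ ξ : ℝ, R < |ξ| → Tendsto h (𝓝[{z | z.im < 0}] (ξ : ℂ)) (𝓝 (hm ξ))) :
    AEStronglyMeasurable hm (volume.restrict (rays R)) := by
  refine aestronglyMeasurable_boundary (h := fun k => h (starRingEnd ℂ k)) (fun k hk him => ?_)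
    fun ξ hξ => (hlim ξ hξ).comp (tendsto_conj_upper ξ)
  exact (hd _ (by rwa [RCLike.norm_conj]) (by simpa using him)).comp
    Complex.continuous_conj.continuousAt

variable {x t x₁ t₁ : ℝ} {M Mp Mm M₁ Mp₁ Mm₁ : ℂ → Mat2}

theorem aestronglyMeasurable_ratioJump (h : D.IsSolution x t M Mp Mm)
    (h₁ : D.IsSolution x₁ t₁ M₁ Mp₁ Mm₁) {R : ℝ} (hR : D.IsFar R) :
    AEStronglyMeasurable (ratioJump Mp Mm Mp₁ Mm₁) (volume.restrict (rays R)) :=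
  (aestronglyMeasurable_boundary (fun k hk him =>
    (differentiableAt_twist h h₁ (hR.mem_regularSet k hk him.ne')).continuousAt)
    (tendsto_twist_plus h h₁ hR)).sub (aestronglyMeasurable_boundary_lower (fun k hk him =>
    (differentiableAt_twist h h₁ (hR.mem_regularSet k hk him.ne)).continuousAt)
    (tendsto_twist_minus h h₁ hR))

namespace IsFamily

variable {a b : ℝ} {Ms Mps Mms F : ℝ → ℂ → Mat2}

theorem eventually_lipschitz (hF : D.IsFamily x t a b M Mp Mm Ms Mps Mms F) (hD : D.Admissible)
    (hreg : D.Regular) {R : ℝ} (hR : D.IsFar R) :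
    ∃ C, ∀ᶠ s in 𝓝[≠] (0 : ℝ), ∀ z : ℂ, ‖z‖ ≤ R → ‖F s z - 1‖ ≤ C * |s| := by
  obtain ⟨C, δ, hδ, hC⟩ := exists_factor_lipschitz hD hreg hF.sol hR a b
  refine ⟨C, ?_⟩
  have h1 : ∀ᶠ s : ℝ in 𝓝[≠] 0, |s| < δ :=
    nhdsWithin_le_nhds ((continuous_abs.tendsto (0 : ℝ)).eventually (gt_mem_nhds (by simpa)))
  filter_upwards [h1, hF.factor] with s h2 h3
  exact hC s h2 _ _ _ _ h3

theorem exists_isFar_gt (hreg : D.Regular) (A : ℝ) : ∃ R, D.IsFar R ∧ A < R := by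
  obtain ⟨R, hR⟩ := exists_isFar hreg
  exact ⟨max R (A + 1), hR.mono (le_max_left _ _), (lt_add_one A).trans_le (le_max_right _ _)⟩

theorem tendsto_factor (hF : D.IsFamily x t a b M Mp Mm Ms Mps Mms F) (hD : D.Admissible)
    (hreg : D.Regular) (z : ℂ) : Tendsto (fun s => F s z) (𝓝[≠] 0) (𝓝 1) := by
  obtain ⟨R, hR, hz⟩ := exists_isFar_gt hreg ‖z‖
  obtain ⟨C, hC⟩ := hF.eventually_lipschitz hD hreg hR
  refine tendsto_iff_norm_sub_tendsto_zero.2 ?_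
  have h1 : Tendsto (fun s : ℝ => C * |s|) (𝓝[≠] 0) (𝓝 0) := by
    have : Continuous fun s : ℝ => C * |s| := by fun_prop
    exact (this.tendsto' 0 0 (by simp)).mono_left nhdsWithin_le_nhds
  exact squeeze_zero' (Eventually.of_forall fun _ => norm_nonneg _)
    (hC.mono fun s hs => hs z hz.le) h1

theorem tendsto_expPhase (a b : ℝ) (k : ℂ) :
    Tendsto (fun s : ℝ => expPhase (-s * a) (-s * b) k) (𝓝[≠] 0) (𝓝 1) := by
  have h1 : Tendsto (fun s : ℝ => (s : ℂ)) (𝓝[≠] 0) (𝓝 0) :=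
    (Complex.continuous_ofReal.tendsto' 0 0 (by simp)).mono_left nhdsWithin_le_nhds
  have h2 := (h1.smul (tendsto_slope_expPhase a b k)).add_const 1
  rw [zero_smul, zero_add] at h2
  refine h2.congr' ?_
  filter_upwards [self_mem_nhdsWithin] with s (hs : s ≠ 0)
  rw [smul_smul, mul_inv_cancel₀ (by exact_mod_cast hs), one_smul, sub_add_cancel]

/-- The difference F_s - M_sM⁻¹ is linear in the exponential minus 1, whose slope is explicit, and
F_s tends to 1. -/
theorem tendsto_circle (hF : D.IsFamily x t a b M Mp Mm Ms Mps Mms F) (hD : D.Admissible)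
    (hreg : D.Regular) {k : ℂ} (hk : k ∈ D.regularSet) :
    Tendsto (fun s : ℝ => (s : ℂ)⁻¹ • (F s k - twist (Ms s) M k)) (𝓝[≠] 0)
      (𝓝 (circleVar a b M k)) := by
  have h1 := Tendsto.mat_mul (hF.tendsto_factor hD hreg k) (Tendsto.mat_mul (Tendsto.mat_mul
    (tendsto_const_nhds (x := M k)) (tendsto_slope_expPhase a b k).neg)
    (tendsto_const_nhds (x := (M (starRingEnd ℂ k)).conjTranspose)))
  rw [one_mul, neg_neg] at h1
  refine h1.congr' ?_
  filter_upwards [hF.factor] with s hs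
  rw [factor_sub_twist hD hF.sol hk (hs.eq' k hk),
    show x - (x + s * a) = -s * a by ring, show t - (t + s * b) = -s * b by ring]
  simp only [mul_neg, neg_mul, Matrix.mul_smul, Matrix.smul_mul, smul_neg]

/-- Continuity of the boundary values in s comes from the factorization on the boundary. -/
theorem tendsto_minus (hF : D.IsFamily x t a b M Mp Mm Ms Mps Mms F) (hD : D.Admissible)
    (hreg : D.Regular) {ξ : ℝ} (hξ : ξ ≠ -D.V / 2) (hξ' : ξ ≠ D.V / 2) :
    Tendsto (fun s => Mms s ξ) (𝓝[≠] 0) (𝓝 (Mm ξ)) := by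
  have h1 := Tendsto.mat_mul (Tendsto.mat_mul (hF.tendsto_factor hD hreg ξ)
    (tendsto_const_nhds (x := Mm ξ))) (tendsto_expPhase a b ξ)
  rw [one_mul, mul_one] at h1
  refine h1.congr' ?_
  filter_upwards [hF.factor] with s hs
  rw [factor_minus hD hF.sol hs.sol hs.diff hs.eq' hξ hξ',
    show x - (x + s * a) = -s * a by ring, show t - (t + s * b) = -s * b by ring]

theorem tendsto_ray (hF : D.IsFamily x t a b M Mp Mm Ms Mps Mms F) (hD : D.Admissible)
    (hreg : D.Regular) {ξ : ℝ} (hξ : ξ ≠ -D.V / 2) (hξ' : ξ ≠ D.V / 2) :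
    Tendsto (fun s : ℝ => (s : ℂ)⁻¹ • ratioJump Mp Mm (Mps s) (Mms s) ξ) (𝓝[≠] 0)
      (𝓝 (D.rayVar x t a b Mm ξ)) := by
  have h1 := Tendsto.mat_mul (Tendsto.mat_mul (hF.tendsto_minus hD hreg hξ hξ')
    (D.tendsto_slope_J x t a b ξ)) (tendsto_const_nhds (x := (Mm ξ).conjTranspose))
  refine h1.congr' ?_
  filter_upwards [hF.factor] with s hs
  rw [ratioJump_eq hF.sol hs.sol hξ hξ', Matrix.mul_smul, Matrix.smul_mul]

theorem exists_circle_bound (hF : D.IsFamily x t a b M Mp Mm Ms Mps Mms F) (hD : D.Admissible)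
    (hreg : D.Regular) {R : ℝ} (hR : D.IsFar R) : ∃ B : ℝ, ∀ᶠ s : ℝ in 𝓝[≠] 0, ∀ k : ℂ, ‖k‖ = R →
      k.im ≠ 0 → ‖(s : ℂ)⁻¹ • (F s k - twist (Ms s) M k)‖ ≤ B := by
  obtain ⟨C, hC⟩ := hF.eventually_lipschitz hD hreg hR
  obtain ⟨K, hK1, hK⟩ := hF.sol.exists_far_norm_le hR
  obtain ⟨P, hP0, hP⟩ := exists_phase_bound a b R
  refine ⟨16 * K ^ 2 * P * (1 + |C|), ?_⟩
  have h0 : ∀ r : ℝ, 0 < r → ∀ᶠ s : ℝ in 𝓝[≠] 0, |s| < r := fun r hr =>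
    nhdsWithin_le_nhds ((continuous_abs.tendsto (0 : ℝ)).eventually (gt_mem_nhds (by simpa)))
  filter_upwards [hC, hF.factor, h0 1 one_pos, h0 (P + 1)⁻¹ (by positivity), self_mem_nhdsWithin]
    with s h1 h2 h3 h4 (h5 : s ≠ 0) k hk him
  have hs : 0 < |s| := abs_pos.2 h5
  have hsP : |s| * P ≤ 1 := by
    have h1 := mul_le_mul_of_nonneg_right h4.le (by positivity : 0 ≤ P + 1)
    rw [inv_mul_cancel₀ (by positivity)] at h1
    nlinarith
  have hf : ∀ k : ℂ, ‖k‖ = R → ‖F s k‖ ≤ 1 + |C| := fun k hk => by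
    have h6 := norm_add_le (1 : Mat2) (F s k - 1)
    rw [add_sub_cancel, norm_one_mat] at h6
    have h7 := h1 k hk.le
    have h8 : C * |s| ≤ |C| * 1 := by
      gcongr
      · exact le_abs_self C
    linarith
  rw [norm_smul, norm_inv, Complex.norm_real, Real.norm_eq_abs]
  refine (mul_le_mul_of_nonneg_left (h2.norm_sub_le hD hF.sol hR hK hP hf hsP hk him)
    (by positivity)).trans (le_of_eq ?_)
  field_simp

theorem eventually_norm_ray_le (hF : D.IsFamily x t a b M Mp Mm Ms Mps Mms F) (hD : D.Admissible)
    {R : ℝ} (hR : D.IsFar R) : ∀ᶠ s : ℝ in 𝓝[≠] 0, ∀ ξ ∈ rays R,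
      ‖(s : ℂ)⁻¹ • ratioJump Mp Mm (Mps s) (Mms s) ξ‖ ≤ 32 * ‖phase a b ξ * D.ρ ξ‖ := by
  filter_upwards [hF.factor, self_mem_nhdsWithin] with s hs (h0 : s ≠ 0) ξ hξ
  have h1 : 0 < |s| := abs_pos.2 h0
  rw [norm_smul, norm_inv, Complex.norm_real, Real.norm_eq_abs]
  refine (mul_le_mul_of_nonneg_left (norm_ratioJump_le hD hF.sol hs.sol hR hξ)
    (by positivity)).trans (le_of_eq ?_)
  field_simp

theorem circleIntegrable_sub (hF : D.IsFamily x t a b M Mp Mm Ms Mps Mms F) (hD : D.Admissible)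
    (hreg : D.Regular) {R : ℝ} (hR : D.IsFar R) : ∀ᶠ s : ℝ in 𝓝[≠] 0,
      CircleIntegrable (fun k => (s : ℂ)⁻¹ • (F s k - twist (Ms s) M k)) 0 R := by
  obtain ⟨B, hB⟩ := hF.exists_circle_bound hD hreg hR
  filter_upwards [hB, hF.factor] with s h1 h2
  refine circleIntegrable_of_im_ne_zero hR.pos (fun k hk him => ?_) h1
  exact (((h2.diff k).sub (differentiableAt_twist hF.sol h2.sol
    (hR.mem_regularSet k hk.ge him))).const_smul ((s : ℂ)⁻¹)).continuousAt

/-- The densities divided by s converge pointwise and are dominated by a constant on the circle and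
by 32 ‖φρ‖ on the rays, where φ is the phase in direction (a,b); the integrability assumption on the
kernel turns the latter into an integrable majorant. -/
theorem tendsto_pairing_slope (hF : D.IsFamily x t a b M Mp Mm Ms Mps Mms F) (hD : D.Admissible)
    (hreg : D.Regular) {R : ℝ} (hR : D.IsFar R) {κ : ℂ → ℂ}
    (hκ : ContinuousOn κ (Metric.sphere 0 R)) (hκm : Measurable κ)
    (hi : IntegrableOn (fun ξ : ℝ => κ ξ * (phase a b ξ * D.ρ ξ)) (rays R)) :
    Tendsto (fun s : ℝ => (s : ℂ)⁻¹ • pairing R (fun k => F s k - twist (Ms s) M k)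
      (ratioJump Mp Mm (Mps s) (Mms s)) κ) (𝓝[≠] 0)
      (𝓝 (pairing R (circleVar a b M) (D.rayVar x t a b Mm) κ)) := by
  obtain ⟨B, hB⟩ := hF.exists_circle_bound hD hreg hR
  have h1 := tendsto_pairing (l := 𝓝[≠] (0 : ℝ)) (d' := circleVar a b M)
    (j' := D.rayVar x t a b Mm) (g := fun ξ => 32 * ‖phase a b ξ * D.ρ ξ‖) hR.pos
    (hF.circleIntegrable_sub hD hreg hR) hB
    (fun k hk him => hF.tendsto_circle hD hreg (hR.mem_regularSet k hk.ge him))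
    (hF.factor.mono fun s hs =>
      aestronglyMeasurable_smul (aestronglyMeasurable_ratioJump hF.sol hs.sol hR) _)
    (hF.eventually_norm_ray_le hD hR)
    (fun ξ (hξ : R < |ξ|) => hF.tendsto_ray hD hreg (hR.ne_plus ξ hξ.le) (hR.ne_minus ξ hξ.le))
    hκ hκm (by
      refine IntegrableOn.congr_fun (hi.norm.const_mul 32) (fun ξ _ => ?_) (measurableSet_rays R)
      simp only [norm_mul]; ring)
  refine h1.congr fun s => ?_
  rw [← pairing_smul]

theorem norm_rayVar_le (hF : D.IsFamily x t a b M Mp Mm Ms Mps Mms F) (hD : D.Admissible)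
    (hreg : D.Regular) {R : ℝ} (hR : D.IsFar R) {ξ : ℝ} (hξ : ξ ∈ rays R) :
    ‖D.rayVar x t a b Mm ξ‖ ≤ 32 * ‖phase a b ξ * D.ρ ξ‖ := by
  have hξ' : R < |ξ| := hξ
  exact le_of_tendsto (hF.tendsto_ray hD hreg (hR.ne_plus ξ hξ'.le) (hR.ne_minus ξ hξ'.le)).norm
    ((hF.eventually_norm_ray_le hD hR).mono fun s hs => hs ξ hξ)

/-- Measurability is obtained along a sequence s → 0; the size is inherited from the difference
quotients. -/
theorem rayIntegrable_rayVar (hF : D.IsFamily x t a b M Mp Mm Ms Mps Mms F) (hD : D.Admissible)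
    (hreg : D.Regular) {R : ℝ} (hR : D.IsFar R) : RayIntegrable R (D.rayVar x t a b Mm) := by
  obtain ⟨u, hu⟩ := exists_seq_tendsto (𝓝[≠] (0 : ℝ))
  obtain ⟨N, hN⟩ := eventually_atTop.1 (hu.eventually hF.factor)
  refine rayIntegrable_of_tendsto (f := fun n => ratioJump Mp Mm (Mps (u (n + N))) (Mms (u (n + N))))
    (c := fun n => ((u (n + N) : ℝ) : ℂ)⁻¹) (fun n => aestronglyMeasurable_ratioJump hF.sol
      (hN (n + N) (Nat.le_add_left _ _)).sol hR)
    (fun ξ (hξ : R < |ξ|) => ?_)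
    (fun ξ hξ => hF.norm_rayVar_le hD hreg hR hξ)
    ((hreg.integrableOn_phase_mul_rho hR.pos a b).norm.const_mul 32)
  exact (hF.tendsto_ray hD hreg (hR.ne_plus ξ hξ.le) (hR.ne_minus ξ hξ.le)).comp
      (hu.comp (tendsto_add_atTop_nat N))

end IsFamily

/-- The phase is a quadratic polynomial without constant term. This growth is what limits the
derivative of the factor to degree two. -/
theorem exists_circleVar_bound (h : D.IsSolution x t M Mp Mm) {R₀ : ℝ} (hR₀ : D.IsFar R₀)
    (a b : ℝ) : ∃ B, 0 ≤ B ∧ ∀ k : ℂ, R₀ ≤ ‖k‖ → k.im ≠ 0 → ‖circleVar a b M k‖ ≤ B * ‖k‖ ^ 2 := by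
  obtain ⟨K, hK1, hK⟩ := h.exists_far_norm_le hR₀
  have hpos := hR₀.pos
  refine ⟨4 * K ^ 2 * (|a| * R₀⁻¹ + 2 * |b|), by positivity, fun k hk him => ?_⟩
  have h1 := hK k hk him
  have h2 := hK (starRingEnd ℂ k) (by rwa [RCLike.norm_conj]) (by simpa using him)
  have h3 : ‖sigma3‖ ≤ 1 := by
    refine (Matrix.norm_le_iff zero_le_one).2 fun i j => ?_
    fin_cases i <;> fin_cases j <;> simp [sigma3]
  have hk0 : 0 < ‖k‖ := hpos.trans_le hk
  have h4 : ‖phase a b k‖ ≤ (|a| * R₀⁻¹ + 2 * |b|) * ‖k‖ ^ 2 := by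
    have h5 : ‖phase a b k‖ ≤ ‖k‖ * (|a| + 2 * ‖k‖ * |b|) := by
      rw [phase, norm_mul]
      gcongr
      refine (norm_sub_le _ _).trans ?_
      simp
    have h6 : 1 ≤ R₀⁻¹ * ‖k‖ := by rw [← div_eq_inv_mul, le_div_iff₀ hpos]; linarith
    have h7 : |a| * ‖k‖ * 1 ≤ |a| * ‖k‖ * (R₀⁻¹ * ‖k‖) := by gcongr
    nlinarith
  have h5 := norm_mul_le_two (M k * ((Complex.I * phase a b k) • sigma3))
    (M (starRingEnd ℂ k)).conjTranspose
  have h6 := norm_mul_le_two (M k) ((Complex.I * phase a b k) • sigma3)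
  rw [norm_smul (Complex.I * phase a b k), norm_mul Complex.I, Complex.norm_I, one_mul] at h6
  rw [Matrix.norm_conjTranspose] at h5
  calc _ ≤ _ := h5
    _ ≤ 2 * (2 * K * (((|a| * R₀⁻¹ + 2 * |b|) * ‖k‖ ^ 2) * 1)) * K := by
      gcongr
      refine h6.trans ?_
      gcongr
    _ = _ := by ring

theorem circleIntegrable_circleVar (h : D.IsSolution x t M Mp Mm) {R : ℝ} (hR : D.IsFar R)
    (a b : ℝ) : CircleIntegrable (circleVar a b M) 0 R := by
  obtain ⟨B, hB0, hB⟩ := exists_circleVar_bound h hR a b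
  refine circleIntegrable_of_im_ne_zero (B := B * R ^ 2) hR.pos (fun k hk him => ?_)
    fun k hk him => hk ▸ hB k hk.ge him
  have hr := hR.mem_regularSet k hk.ge him
  have h1 : DifferentiableAt ℂ (phase a b) k := by unfold phase; fun_prop
  exact (DifferentiableAt.mat_mul (DifferentiableAt.mat_mul (h.differentiableAt hr)
    ((h1.const_mul _).smul_const sigma3))
    (DifferentiableAt.mat_star (h.differentiableAt (conj_mem_regularSet.2 hr)))).continuousAt

end RHPData

end CounterflowNLS

/-! ### Moments at infinity and the derivative of the entire factor -/

namespace CounterflowNLS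

attribute [local instance] Matrix.normedAddCommGroup Matrix.normedSpace

/-- The first moment of `M` along the imaginary axis: `M = 1 + m₁ / k + o(1 / k)`. -/
def HasFirstMoment (M : ℂ → Mat2) (m₁ : Mat2) : Prop :=
  Tendsto (fun y : ℝ => ((y : ℂ) * Complex.I) • (M (y * Complex.I) - 1)) (cocompact ℝ) (𝓝 m₁)

/-- The second moment of `M` along the imaginary axis: `M = 1 + m₁ / k + m₂ / k² + o(1 / k²)`. -/
def HasSecondMoment (M : ℂ → Mat2) (m₁ m₂ : Mat2) : Prop :=
  Tendsto (fun y : ℝ => ((y : ℂ) * Complex.I) • (((y : ℂ) * Complex.I) •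
    (M (y * Complex.I) - 1) - m₁)) (cocompact ℝ) (𝓝 m₂)

theorem eventually_cocompact_far (R : ℝ) : ∀ᶠ y : ℝ in cocompact ℝ,
    R < ‖(y : ℂ) * Complex.I‖ ∧ ((y : ℂ) * Complex.I).im ≠ 0 := by
  filter_upwards [tendsto_abs_cocompact.eventually (eventually_gt_atTop R),
    tendsto_abs_cocompact.eventually (eventually_gt_atTop 0)] with y h1 h2
  exact ⟨by simpa using h1, by simpa using abs_pos.1 h2⟩

namespace HasFirstMoment

variable {M N : ℂ → Mat2} {m₁ n₁ : Mat2}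

theorem unique (h : HasFirstMoment M m₁) (h' : HasFirstMoment M n₁) : m₁ = n₁ :=
  tendsto_nhds_unique h h'

theorem tendsto_one (h : HasFirstMoment M m₁) :
    Tendsto (fun y : ℝ => M (y * Complex.I)) (cocompact ℝ) (𝓝 1) := by
  have h1 : Tendsto (fun y : ℝ => ((y : ℂ) * Complex.I)⁻¹) (cocompact ℝ) (𝓝 0) := by
    refine tendsto_inv₀_cobounded.comp (tendsto_norm_atTop_iff_cobounded.1 ?_)
    simpa using tendsto_abs_cocompact
  have h2 := (h1.smul h).add_const 1
  rw [zero_smul, zero_add] at h2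
  refine h2.congr' ?_
  filter_upwards [eventually_cocompact_far 0] with y hy
  rw [smul_smul, inv_mul_cancel₀ (norm_pos_iff.1 hy.1), one_smul, sub_add_cancel]

end HasFirstMoment

/-- First moments add: GN - 1 = (G - 1)N + (N - 1), and N tends to 1. -/
theorem HasFirstMoment.mul {G N : ℂ → Mat2} {g₁ n₁ : Mat2} (hG : HasFirstMoment G g₁)
    (hN : HasFirstMoment N n₁) : HasFirstMoment (fun k => G k * N k) (g₁ + n₁) := by
  have h1 := (Tendsto.mat_mul hG hN.tendsto_one).add hN
  rw [mul_one] at h1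
  refine h1.congr fun y => ?_
  rw [Matrix.smul_mul, ← smul_add]
  congr 1
  noncomm_ring

theorem HasSecondMoment.mul {G N : ℂ → Mat2} {g₁ n₁ g₂ n₂ : Mat2} (hG : HasSecondMoment G g₁ g₂)
    (hN₁ : HasFirstMoment N n₁)
    (hN : HasSecondMoment N n₁ n₂) :
    HasSecondMoment (fun k => G k * N k) (g₁ + n₁) (g₂ + g₁ * n₁ + n₂) := by
  have h1 := ((Tendsto.mat_mul hG hN₁.tendsto_one).add
    (Tendsto.mat_mul (tendsto_const_nhds (x := g₁)) hN₁)).add hN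
  rw [mul_one] at h1
  refine h1.congr fun y => ?_
  simp only [Matrix.smul_mul, Matrix.mul_smul, sub_mul, mul_sub, mul_one, one_mul, smul_sub, smul_smul,
    smul_add]
  abel

theorem HasFirstMoment.congr {G N : ℂ → Mat2} {g₁ : Mat2} (h : HasFirstMoment G g₁)
    (he : ∀ᶠ y : ℝ in cocompact ℝ, G (y * Complex.I) = N (y * Complex.I)) : HasFirstMoment N g₁ :=
  Tendsto.congr' (he.mono fun y hy => by simp only [hy]) h

theorem HasSecondMoment.congr {G N : ℂ → Mat2} {g₁ g₂ : Mat2} (h : HasSecondMoment G g₁ g₂)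
    (he : ∀ᶠ y : ℝ in cocompact ℝ, G (y * Complex.I) = N (y * Complex.I)) : HasSecondMoment N g₁ g₂ :=
  Tendsto.congr' (he.mono fun y hy => by simp only [hy]) h

namespace RHPData

variable {D : RHPData} {x t x₁ t₁ : ℝ} {M Mp Mm M₁ Mp₁ Mm₁ : ℂ → Mat2}

theorem IsSolution.norm_jump_le (h : D.IsSolution x t M Mp Mm) (hD : D.Admissible) {R : ℝ}
    (hR : D.IsFar R) {ξ : ℝ} (hξ : ξ ∈ rays R) : ‖Mp ξ - Mm ξ‖ ≤ 8 * ‖D.ρ ξ‖ := by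
  have hξ : R < |ξ| := hξ
  have hp := hR.ne_plus ξ hξ.le
  have hm := hR.ne_minus ξ hξ.le
  have hr := hR.norm_rho_le ξ hξ.le
  have h1 := h.norm_minus_le hD hp hm
  have h2 : ‖D.J x t ξ - 1‖ ≤ ‖D.ρ ξ‖ := by
    refine (Matrix.norm_le_iff (norm_nonneg _)).2 fun i j => ?_
    rw [J_real]
    fin_cases i <;> fin_cases j
    · simp
    · simp [norm_osc]
    · simp [norm_osc]
    · simp
      nlinarith [norm_nonneg (D.ρ ξ)]
  have h3 := norm_mul_le_two (Mm ξ) (D.J x t ξ - 1)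
  rw [(h.jump_real ξ hp hm).2.2, ← mul_sub_one]
  calc _ ≤ _ := h3
    _ ≤ 2 * (1 + 1) * ‖D.ρ ξ‖ := by gcongr; exact h1.trans (by linarith)
    _ ≤ _ := by nlinarith [norm_nonneg (D.ρ ξ)]

theorem rayIntegrable_of_norm_le {E : Type*} [NormedAddCommGroup E] {R : ℝ} {j : ℝ → E} {g : ℝ → ℝ}
    (hm : AEStronglyMeasurable j (volume.restrict (rays R)))
    (hb : ∀ ξ ∈ rays R, ‖j ξ‖ ≤ g ξ) (hg : IntegrableOn g (rays R)) : RayIntegrable R j := by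
  refine Integrable.mono' hg hm ?_
  filter_upwards [ae_restrict_mem (measurableSet_rays R)] with ξ hξ using hb ξ hξ

theorem rayIntegrable_mul_of_norm_le {E : Type*} [NormedAddCommGroup E] [NormedSpace ℂ E] {R : ℝ}
    {j : ℝ → E} {g : ℝ → ℝ} (hm : AEStronglyMeasurable j (volume.restrict (rays R)))
    (hb : ∀ ξ ∈ rays R, ‖(ξ : ℂ)‖ * ‖j ξ‖ ≤ g ξ) (hg : IntegrableOn g (rays R)) :
    RayIntegrable R fun ξ => (ξ : ℂ) • j ξ := by
  refine rayIntegrable_of_norm_le (Continuous.aestronglyMeasurable (by fun_prop) |>.smul hm)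
    (fun ξ hξ => ?_) hg
  rw [norm_smul]
  exact hb ξ hξ

theorem norm_rho_le_of_mem_rays {R : ℝ} (hR : 0 < R) {ξ : ℝ} (hξ : ξ ∈ rays R) {w : ℂ} :
    ‖w‖ ≤ R⁻¹ * ‖(ξ : ℂ) * w‖ := by
  have hξ : R < |ξ| := hξ
  rw [norm_mul, Complex.norm_real, Real.norm_eq_abs, ← mul_assoc]
  refine le_mul_of_one_le_left (norm_nonneg _) ?_
  rw [← div_eq_inv_mul, one_le_div hR]
  exact hξ.le

/-- Outside a disc M - 1 is a Cauchy integral of M on the circle and of its jump on the rays. The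
jump is O(|ρ|), so integrability of ξρ allows two orders of expansion. -/
theorem IsSolution.exists_moments (h : D.IsSolution x t M Mp Mm) (hD : D.Admissible)
    (hreg : D.Regular) : ∃ m₁ m₂, HasFirstMoment M m₁ ∧ HasSecondMoment M m₁ m₂ := by
  obtain ⟨R, hR⟩ := exists_isFar hreg
  have hR0 := hR.pos
  obtain ⟨C, hC0, hC⟩ := h.exists_far_bound hR
  obtain ⟨K, hK1, hK⟩ := h.exists_far_norm_le hR
  have hd : ∀ k : ℂ, R ≤ ‖k‖ → k.im ≠ 0 → DifferentiableAt ℂ M k :=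
    fun k hk him => h.differentiableAt (hR.mem_regularSet k hk him)
  have hp : ∀ ξ : ℝ, R < |ξ| → Tendsto M (𝓝[{z | 0 < z.im}] (ξ : ℂ)) (𝓝 (Mp ξ)) :=
    fun ξ hξ => (h.jump_real ξ (hR.ne_plus ξ hξ.le) (hR.ne_minus ξ hξ.le)).1
  have hm : ∀ ξ : ℝ, R < |ξ| → Tendsto M (𝓝[{z | z.im < 0}] (ξ : ℂ)) (𝓝 (Mm ξ)) :=
    fun ξ hξ => (h.jump_real ξ (hR.ne_plus ξ hξ.le) (hR.ne_minus ξ hξ.le)).2.1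
  have hci : CircleIntegrable (fun k => 0 - M k) 0 R := circleIntegrable_of_im_ne_zero (B := K) hR0
    (fun k hk him => ((hd k hk.ge him).const_sub 0).continuousAt) fun k hk him => by
      rw [zero_sub, norm_neg]; exact hK k hk.ge him
  have hb : ∀ k : ℂ, ‖k‖ = R → k.im ≠ 0 → ‖0 - M k‖ ≤ K := fun k hk him => by
      rw [zero_sub, norm_neg]; exact hK k hk.ge him
  have hjm : AEStronglyMeasurable (fun ξ : ℝ => Mp ξ - Mm ξ) (volume.restrict (rays R)) :=
    (aestronglyMeasurable_boundary (fun k hk him => (hd k hk him.ne').continuousAt) hp).sub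
      (aestronglyMeasurable_boundary_lower (fun k hk him => (hd k hk him.ne).continuousAt) hm)
  have hj : RayIntegrable R fun ξ : ℝ => Mp ξ - Mm ξ := rayIntegrable_of_norm_le hjm
    (g := fun ξ => 8 * (R⁻¹ * ‖(ξ : ℂ) * D.ρ ξ‖)) (fun ξ hξ => (h.norm_jump_le hD hR hξ).trans
      (by gcongr; exact norm_rho_le_of_mem_rays hR0 hξ))
    (((hreg.integrableOn_mul_rho hR0).norm.const_mul _).const_mul _)
  have hj' : RayIntegrable R fun ξ : ℝ => (ξ : ℂ) • (Mp ξ - Mm ξ) :=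
    rayIntegrable_mul_of_norm_le hjm (g := fun ξ => 8 * ‖(ξ : ℂ) * D.ρ ξ‖) (fun ξ hξ => by
      have := mul_le_mul_of_nonneg_left (h.norm_jump_le hD hR hξ) (norm_nonneg (ξ : ℂ))
      rw [norm_mul]; linarith) ((hreg.integrableOn_mul_rho hR0).norm.const_mul _)
  set c : ℂ := (2 * Real.pi * Complex.I)⁻¹ with hc
  have hc0 : (2 * Real.pi * Complex.I : ℂ) ≠ 0 := by simp [Real.pi_ne_zero]
  -- The interior function in Cauchy's formula is taken to be zero: nothing about M inside the disc
  -- is used.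
  have key : ∀ᶠ y : ℝ in cocompact ℝ, M (y * Complex.I) - 1 = c • pairing R (fun k => 0 - M k)
      (fun ξ : ℝ => Mp ξ - Mm ξ) (fun k => (k - y * Complex.I)⁻¹) := by
    filter_upwards [eventually_cocompact_far R] with y hy
    rw [← cauchy_outside (F := fun _ => (0 : Mat2)) hR0 (differentiable_const _) hd hp hm hC hy.1 hy.2,
      smul_smul, inv_mul_cancel₀ hc0, one_smul]
  have t1 := (tendsto_pairing_cauchy hR0 hci hb hj).const_smul c
  have t2 := (tendsto_pairing_cauchy_sq hR0 hci hb hj hj').const_smul c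
  refine ⟨_, _, t1.congr' ?_, t2.congr' ?_⟩
  · filter_upwards [key] with y hy
    rw [hy, smul_comm]
  · filter_upwards [key] with y hy
    rw [hy, smul_comm c, smul_add, smul_neg, sub_neg_eq_add, smul_comm c]

/-- The first moment of the variation `Ṁ M⁻¹`. -/
noncomputable def varMoment (D : RHPData) (x t a b : ℝ) (M Mm : ℂ → Mat2) (R : ℝ) (κ : ℂ → ℂ) :
    Mat2 := -((2 * Real.pi * Complex.I : ℂ)⁻¹ •
      pairing R (circleVar a b M) (D.rayVar x t a b Mm) κ)

namespace IsFamily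

variable {a b : ℝ} {Ms Mps Mms F : ℝ → ℂ → Mat2}

theorem continuousOn_cauchyKernel {R : ℝ} {z : ℂ} (hz : ‖z‖ ≠ R) :
    ContinuousOn (fun k : ℂ => (k - z)⁻¹) (Metric.sphere 0 R) :=
  ContinuousOn.inv₀ (by fun_prop) fun k hk h => hz (by
    rw [← sub_eq_zero.1 h]; exact mem_sphere_zero_iff_norm.1 hk)

theorem measurable_cauchyKernel (z : ℂ) : Measurable fun k : ℂ => (k - z)⁻¹ := by fun_prop

theorem integrableOn_kernel_mul (hreg : D.Regular) {R : ℝ} (hR : 0 < R) {κ : ℂ → ℂ} {B : ℝ}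
    (hκ : Measurable κ) (hb : ∀ ξ ∈ rays R, ‖κ (ξ : ℂ)‖ ≤ B) :
    IntegrableOn (fun ξ : ℝ => κ ξ * (phase a b ξ * D.ρ ξ)) (rays R) := by
  refine Integrable.bdd_mul (c := B) (hreg.integrableOn_phase_mul_rho hR a b)
    (hκ.comp Complex.measurable_ofReal).aestronglyMeasurable ?_
  filter_upwards [ae_restrict_mem (measurableSet_rays R)] with ξ hξ using hb ξ hξ

theorem tendsto_factor_slope (hF : D.IsFamily x t a b M Mp Mm Ms Mps Mms F) (hD : D.Admissible)
    (hreg : D.Regular) {R : ℝ} (hR : D.IsFar R) {z : ℂ} (hz : ‖z‖ < R) :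
    Tendsto (fun s : ℝ => (s : ℂ)⁻¹ • (F s z - 1)) (𝓝[≠] 0)
      (𝓝 ((2 * Real.pi * Complex.I : ℂ)⁻¹ • pairing R (circleVar a b M) (D.rayVar x t a b Mm)
        (fun k => (k - z)⁻¹))) := by
  have hc0 : (2 * Real.pi * Complex.I : ℂ) ≠ 0 := by simp [Real.pi_ne_zero]
  have h1 := (hF.tendsto_pairing_slope hD hreg hR (continuousOn_cauchyKernel hz.ne)
    (measurable_cauchyKernel z) (integrableOn_kernel_mul (B := (R - ‖z‖)⁻¹) hreg hR.pos
      (measurable_cauchyKernel z) fun ξ (hξ : R < |ξ|) => by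
        rw [norm_inv]
        refine inv_anti₀ (by linarith) ?_
        have := norm_sub_norm_le (ξ : ℂ) z
        rw [Complex.norm_real, Real.norm_eq_abs] at this
        linarith)).const_smul (2 * Real.pi * Complex.I : ℂ)⁻¹
  refine h1.congr' ?_
  filter_upwards [hF.factor] with s hs
  rw [← pairing_inside hF.sol hs.sol hs.diff hR hz, smul_comm, smul_smul (2 * Real.pi * Complex.I)⁻¹,
    inv_mul_cancel₀ hc0, one_smul]

/-- The same pairing describes F_s inside and M_sM⁻¹ outside the circle, so the slopes of both are
governed by one Cauchy integral. -/
theorem tendsto_twist_slope (hF : D.IsFamily x t a b M Mp Mm Ms Mps Mms F) (hD : D.Admissible)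
    (hreg : D.Regular) {R : ℝ} (hR : D.IsFar R) {z : ℂ} (hz : R < ‖z‖) (him : z.im ≠ 0) :
    Tendsto (fun s : ℝ => (s : ℂ)⁻¹ • (twist (Ms s) M z - 1)) (𝓝[≠] 0)
      (𝓝 ((2 * Real.pi * Complex.I : ℂ)⁻¹ • pairing R (circleVar a b M) (D.rayVar x t a b Mm)
        (fun k => (k - z)⁻¹))) := by
  have hc0 : (2 * Real.pi * Complex.I : ℂ) ≠ 0 := by simp [Real.pi_ne_zero]
  have h1 := (hF.tendsto_pairing_slope hD hreg hR (continuousOn_cauchyKernel hz.ne')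
    (measurable_cauchyKernel z) (integrableOn_kernel_mul (B := |z.im|⁻¹) hreg hR.pos
      (measurable_cauchyKernel z) fun ξ hξ => by
        rw [norm_inv]
        exact inv_anti₀ (abs_pos.2 him) (abs_im_le_norm_ofReal_sub ξ z))).const_smul
          (2 * Real.pi * Complex.I : ℂ)⁻¹
  refine h1.congr' ?_
  filter_upwards [hF.factor] with s hs
  rw [← pairing_outside hF.sol hs.sol hs.diff hR hz him, smul_comm,
    smul_smul (2 * Real.pi * Complex.I)⁻¹, inv_mul_cancel₀ hc0, one_smul]

/-- The slopes are locally bounded, so their limit is entire. As the limit does not depend on R, the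
radius may be adapted to z, and this yields quadratic growth. -/
theorem exists_factor_deriv (hF : D.IsFamily x t a b M Mp Mm Ms Mps Mms F) (hD : D.Admissible)
    (hreg : D.Regular) : ∃ c₀ c₁ c₂ : Mat2, ∀ z : ℂ,
      Tendsto (fun s : ℝ => (s : ℂ)⁻¹ • (F s z - 1)) (𝓝[≠] 0)
        (𝓝 (c₀ + z • c₁ + z ^ 2 • c₂)) := by
  obtain ⟨R₀, hR₀⟩ := exists_isFar hreg
  have h1 : ∀ z : ℂ, ∃ L, Tendsto (fun s : ℝ => (s : ℂ)⁻¹ • (F s z - 1)) (𝓝[≠] 0) (𝓝 L) := fun z => by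
    obtain ⟨R, hR, hz⟩ := exists_isFar_gt hreg ‖z‖
    exact ⟨_, hF.tendsto_factor_slope hD hreg hR hz⟩
  choose Fd hFd using h1
  have hdiff : Differentiable ℂ Fd := by
    refine differentiable_of_tendsto_of_bounded (l := 𝓝[≠] (0 : ℝ))
      (u := fun s z => (s : ℂ)⁻¹ • (F s z - 1))
      (fun s => ((hF.diff s).sub_const 1).const_smul ((s : ℂ)⁻¹)) hFd fun A => ?_
    obtain ⟨R, hR, hA⟩ := exists_isFar_gt hreg A
    obtain ⟨C, hC⟩ := hF.eventually_lipschitz hD hreg hR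
    refine ⟨C, ?_⟩
    filter_upwards [hC, self_mem_nhdsWithin] with s hs (h0 : s ≠ 0) z hz
    rw [norm_smul, norm_inv, Complex.norm_real, Real.norm_eq_abs]
    rw [inv_mul_le_iff₀ (abs_pos.2 h0), mul_comm]
    exact hs z (hz.trans hA.le)
  obtain ⟨B, hB0, hB⟩ := exists_circleVar_bound hF.sol hR₀ a b
  have hpos := hR₀.pos
  set I := ∫ ξ in rays R₀, 32 * ‖phase a b ξ * D.ρ ξ‖ with hI
  have hgi : IntegrableOn (fun ξ : ℝ => 32 * ‖phase a b ξ * D.ρ ξ‖) (rays R₀) :=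
    (hreg.integrableOn_phase_mul_rho hpos a b).norm.const_mul 32
  have hI0 : 0 ≤ I := integral_nonneg fun _ => by positivity
  have hgrow : ∀ z : ℂ, R₀ ≤ ‖z‖ → ‖Fd z‖ ≤ (8 * B + R₀⁻¹ ^ 3 * I) * ‖z‖ ^ 2 := by
    intro z hz
    have hz0 : 0 < ‖z‖ := hpos.trans_le hz
    -- With radius 2‖z‖ the kernel is at most 1/‖z‖ on the circle and on the rays, and the density
    -- on the circle is O(‖z‖²).
    have hR : D.IsFar (2 * ‖z‖) := hR₀.mono (by linarith)
    have h2 := tendsto_nhds_unique (hFd z) (hF.tendsto_factor_slope hD hreg hR (z := z) (by linarith))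
    have h3 := norm_pairing_le (R := 2 * ‖z‖) (d := circleVar a b M) (j := D.rayVar x t a b Mm)
      (κ := fun k => (k - z)⁻¹) (K₁ := ‖z‖⁻¹) (K₂ := ‖z‖⁻¹) (B := B * (2 * ‖z‖) ^ 2) hR.pos
      (fun k hk him => hk ▸ hB k (by linarith) him)
      (fun ξ hξ => hF.norm_rayVar_le hD hreg hR hξ)
      ((hreg.integrableOn_phase_mul_rho hR.pos a b).norm.const_mul 32) (fun k hk => by
        rw [norm_inv]
        refine inv_anti₀ hz0 ?_
        have := norm_sub_norm_le k z
        linarith) (fun ξ (hξ : 2 * ‖z‖ < |ξ|) => by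
        rw [norm_inv]
        refine inv_anti₀ hz0 ?_
        have := norm_sub_norm_le (ξ : ℂ) z
        rw [Complex.norm_real, Real.norm_eq_abs] at this
        linarith)
    have h4 : ∫ ξ in rays (2 * ‖z‖), 32 * ‖phase a b ξ * D.ρ ξ‖ ≤ I :=
      setIntegral_mono_set hgi (ae_of_all _ fun ξ => by positivity)
        (LE.le.eventuallyLE fun ξ (hξ : 2 * ‖z‖ < |ξ|) => (by linarith : R₀ < |ξ|))
    have hnc : ‖(2 * Real.pi * Complex.I : ℂ)⁻¹‖ = (2 * Real.pi)⁻¹ := by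
      simp [Real.pi_pos.le]
    rw [h2, norm_smul, hnc, inv_mul_le_iff₀ (by positivity)]
    have hpi := Real.pi_gt_three
    have h5 : ‖z‖⁻¹ ≤ R₀⁻¹ := inv_anti₀ hpos hz
    have h6 : 1 ≤ R₀⁻¹ ^ 2 * ‖z‖ ^ 2 := by
      rw [← mul_pow, ← div_eq_inv_mul]
      exact one_le_pow₀ ((one_le_div hpos).2 hz)
    refine h3.trans ?_
    have h7 : ‖z‖⁻¹ * ∫ ξ in rays (2 * ‖z‖), 32 * ‖phase a b ξ * D.ρ ξ‖ ≤
        2 * Real.pi * (R₀⁻¹ ^ 3 * I * ‖z‖ ^ 2) := by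
      calc _ ≤ R₀⁻¹ * I := by gcongr
        _ = 1 * (R₀⁻¹ * I) * 1 := by ring
        _ ≤ (2 * Real.pi) * (R₀⁻¹ * I) * (R₀⁻¹ ^ 2 * ‖z‖ ^ 2) := by gcongr; linarith
        _ = _ := by ring
    have h8 : 2 * Real.pi * (2 * ‖z‖) * (‖z‖⁻¹ * (B * (2 * ‖z‖) ^ 2)) =
        2 * Real.pi * (8 * B * ‖z‖ ^ 2) := by field_simp; ring
    rw [h8]
    linarith
  obtain ⟨c₀, c₁, c₂, hc⟩ := exists_quadratic_of_growth hdiff hgrow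
  exact ⟨c₀, c₁, c₂, fun z => hc z ▸ hFd z⟩

/-- The product rule for M_s = F_s M e^{-isφσ₃}, φ being the phase in direction (a,b). -/
theorem tendsto_solution_slope (hF : D.IsFamily x t a b M Mp Mm Ms Mps Mms F) {k : ℂ}
    (hk : k ∈ D.regularSet) {L : Mat2}
    (hL : Tendsto (fun s : ℝ => (s : ℂ)⁻¹ • (F s k - 1)) (𝓝[≠] 0) (𝓝 L)) :
    Tendsto (fun s : ℝ => (s : ℂ)⁻¹ • (Ms s k - M k)) (𝓝[≠] 0)
      (𝓝 (L * M k - (Complex.I * phase a b k) • (M k * sigma3))) := by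
  have h1 := (Tendsto.mat_mul (Tendsto.mat_mul hL (tendsto_const_nhds (x := M k)))
    (tendsto_expPhase a b k)).add (Tendsto.mat_mul (tendsto_const_nhds (x := M k))
    (tendsto_slope_expPhase a b k))
  rw [mul_one, mul_neg, ← sub_eq_add_neg, Matrix.mul_smul] at h1
  refine h1.congr' ?_
  filter_upwards [hF.factor] with s hs
  rw [hs.eq k hk, Matrix.smul_mul, Matrix.smul_mul, Matrix.mul_smul, ← smul_add]
  congr 1
  noncomm_ring

theorem solution_eq_twist_mul (h : D.IsSolution x t M Mp Mm) (hD : D.Admissible) (N : ℂ → Mat2)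
    {k : ℂ} (hk : k ∈ D.regularSet) : N k = twist N M k * M k := by
  rw [twist, mul_assoc, h.twist_self' hD hk, mul_one]

/-- The formula outside the disc is expanded for each fixed s: the moments of M_sM⁻¹ are pairings
with the kernels 1 and k, to which convergence of slopes applies. -/
theorem hasFirstMoment_twist (hF : D.IsFamily x t a b M Mp Mm Ms Mps Mms F) (hD : D.Admissible)
    (hreg : D.Regular) {R : ℝ} (hR : D.IsFar R) : ∀ᶠ s : ℝ in 𝓝[≠] 0,
      HasFirstMoment (twist (Ms s) M) (-((2 * Real.pi * Complex.I : ℂ)⁻¹ • pairing R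
        (fun k => F s k - twist (Ms s) M k) (ratioJump Mp Mm (Mps s) (Mms s)) (fun _ => 1))) ∧
      (IntegrableOn (fun ξ : ℝ => (ξ : ℂ) * (phase a b ξ * D.ρ ξ)) (rays R) →
      HasSecondMoment (twist (Ms s) M) (-((2 * Real.pi * Complex.I : ℂ)⁻¹ • pairing R
        (fun k => F s k - twist (Ms s) M k) (ratioJump Mp Mm (Mps s) (Mms s)) (fun _ => 1)))
        (-((2 * Real.pi * Complex.I : ℂ)⁻¹ • pairing R
        (fun k => F s k - twist (Ms s) M k) (ratioJump Mp Mm (Mps s) (Mms s)) (fun k => k)))) := by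
  obtain ⟨B, hB⟩ := hF.exists_circle_bound hD hreg hR
  filter_upwards [hF.factor, hB, self_mem_nhdsWithin] with s hs h1 (h0 : s ≠ 0)
  have hsc : (s : ℂ) ≠ 0 := by exact_mod_cast h0
  have hb : ∀ k : ℂ, ‖k‖ = R → k.im ≠ 0 → ‖F s k - twist (Ms s) M k‖ ≤ |s| * B := by
    intro k hk him
    have h2 := h1 k hk him
    rw [norm_smul, norm_inv, Complex.norm_real, Real.norm_eq_abs,
      inv_mul_le_iff₀ (abs_pos.2 h0)] at h2
    exact h2
  have hci : CircleIntegrable (fun k => F s k - twist (Ms s) M k) 0 R :=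
    circleIntegrable_of_im_ne_zero hR.pos (fun k hk him => ((hs.diff k).sub (differentiableAt_twist
      hF.sol hs.sol (hR.mem_regularSet k hk.ge him))).continuousAt) hb
  have hjm := aestronglyMeasurable_ratioJump hF.sol hs.sol hR
  have hj : RayIntegrable R (ratioJump Mp Mm (Mps s) (Mms s)) := rayIntegrable_of_norm_le hjm
    (fun ξ hξ => norm_ratioJump_le hD hF.sol hs.sol hR hξ)
    ((hreg.integrableOn_phase_mul_rho hR.pos a b).norm.const_mul _)
  set c : ℂ := (2 * Real.pi * Complex.I)⁻¹ with hc
  have hc0 : (2 * Real.pi * Complex.I : ℂ) ≠ 0 := by simp [Real.pi_ne_zero]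
  have key : ∀ᶠ y : ℝ in cocompact ℝ, twist (Ms s) M (y * Complex.I) - 1 = c • pairing R
      (fun k => F s k - twist (Ms s) M k) (ratioJump Mp Mm (Mps s) (Mms s))
      (fun k => (k - y * Complex.I)⁻¹) := by
    filter_upwards [eventually_cocompact_far R] with y hy
    rw [← pairing_outside hF.sol hs.sol hs.diff hR hy.1 hy.2, smul_smul, inv_mul_cancel₀ hc0,
      one_smul]
  refine ⟨?_, fun hi => ?_⟩
  · have t1 := (tendsto_pairing_cauchy hR.pos hci hb hj).const_smul c
    rw [smul_neg] at t1
    refine t1.congr' ?_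
    filter_upwards [key] with y hy
    rw [hy, smul_comm]
  · have hj' : RayIntegrable R fun ξ : ℝ => (ξ : ℂ) • ratioJump Mp Mm (Mps s) (Mms s) ξ :=
      rayIntegrable_mul_of_norm_le hjm
        (g := fun ξ => 32 * |s| * ‖(ξ : ℂ) * (phase a b ξ * D.ρ ξ)‖) (fun ξ hξ => by
        have := mul_le_mul_of_nonneg_left (norm_ratioJump_le hD hF.sol hs.sol hR hξ)
          (norm_nonneg (ξ : ℂ))
        rw [norm_mul (ξ : ℂ)]; linarith) (hi.norm.const_mul _)
    have t2 := (tendsto_pairing_cauchy_sq hR.pos hci hb hj hj').const_smul c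
    rw [smul_neg] at t2
    refine t2.congr' ?_
    filter_upwards [key] with y hy
    rw [hy, smul_comm c, smul_add, sub_neg_eq_add, smul_comm c]

end IsFamily

end RHPData

end CounterflowNLS

/-! ### Identification of the coefficients: the Lax equations -/

namespace CounterflowNLS

attribute [local instance] Matrix.normedAddCommGroup Matrix.normedSpace

/-- Division by κ² and then by κ isolates the coefficients in turn. -/
theorem eq_zero_of_tendsto_polynomial {ι : Type*} {l : Filter ι} [l.NeBot] {κ : ι → ℂ}
    (hκ : Tendsto (fun i => (κ i)⁻¹) l (𝓝 0)) (hκ0 : ∀ᶠ i in l, κ i ≠ 0) {A B L g₀ : Mat2}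
    {g : ι → Mat2} (hg : Tendsto g l (𝓝 g₀))
    (h : Tendsto (fun i => κ i ^ 2 • A + κ i • B + g i) l (𝓝 L)) : A = 0 ∧ B = 0 ∧ g₀ = L := by
  have h1 := h.sub hg
  have hA : A = 0 := by
    have h2 := ((hκ.mul hκ).smul h1).sub (hκ.smul (tendsto_const_nhds (x := B)))
    rw [mul_zero, zero_smul, zero_smul, sub_zero] at h2
    refine tendsto_nhds_unique (tendsto_const_nhds.congr' ?_) h2
    filter_upwards [hκ0] with i hi
    rw [add_sub_cancel_right, smul_add, smul_smul, smul_smul]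
    rw [show (κ i)⁻¹ * (κ i)⁻¹ * κ i ^ 2 = 1 by field_simp,
      show (κ i)⁻¹ * (κ i)⁻¹ * κ i = (κ i)⁻¹ by field_simp, one_smul, add_sub_cancel_right]
  subst hA
  simp only [smul_zero, zero_add] at h1 h
  have hB : B = 0 := by
    have h2 := hκ.smul h1
    rw [zero_smul] at h2
    refine tendsto_nhds_unique (tendsto_const_nhds.congr' ?_) h2
    filter_upwards [hκ0] with i hi
    rw [add_sub_cancel_right, smul_smul, inv_mul_cancel₀ hi, one_smul]
  subst hB
  simp only [smul_zero, zero_add] at h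
  exact ⟨rfl, rfl, tendsto_nhds_unique hg h⟩

theorem tendsto_inv_mul_I :
    Tendsto (fun y : ℝ => ((y : ℂ) * Complex.I)⁻¹) (cocompact ℝ) (𝓝 0) := by
  refine tendsto_inv₀_cobounded.comp (tendsto_norm_atTop_iff_cobounded.1 ?_)
  simpa using tendsto_abs_cocompact

theorem eventually_mul_I_ne_zero : ∀ᶠ y : ℝ in cocompact ℝ, (y : ℂ) * Complex.I ≠ 0 :=
  (eventually_cocompact_far 0).mono fun _ hy => norm_pos_iff.1 hy.1

section Expansion

variable {M : ℂ → Mat2} {m₁ m₂ : Mat2}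

theorem tendsto_smul_of_tendsto_zero {X : ℂ → Mat2} {γ : Mat2}
    (hX : Tendsto (fun y : ℝ => ((y : ℂ) * Complex.I) • X (y * Complex.I)) (cocompact ℝ) (𝓝 γ)) :
    Tendsto (fun y : ℝ => X (y * Complex.I)) (cocompact ℝ) (𝓝 0) := by
  have h1 := tendsto_inv_mul_I.smul hX
  rw [zero_smul] at h1
  refine h1.congr' (eventually_mul_I_ne_zero.mono fun y hy => ?_)
  rw [smul_smul, inv_mul_cancel₀ hy, one_smul]

/-- Since κX converges, X tends to zero; in its expansion at infinity the coefficients of κ², κ and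
1 must vanish. -/
theorem coefficients_of_tendsto (h₁ : HasFirstMoment M m₁) (h₂ : HasSecondMoment M m₁ m₂)
    {c₀ c₁ c₂ γ : Mat2} {p q : ℂ}
    (hX : Tendsto (fun y : ℝ => ((y : ℂ) * Complex.I) •
      ((c₀ + ((y : ℂ) * Complex.I) • c₁ + ((y : ℂ) * Complex.I) ^ 2 • c₂) * M (y * Complex.I) -
        (p * ((y : ℂ) * Complex.I) + q * ((y : ℂ) * Complex.I) ^ 2) •
          (M (y * Complex.I) * sigma3))) (cocompact ℝ) (𝓝 γ)) :
    c₂ = q • sigma3 ∧ c₁ + c₂ * m₁ = p • sigma3 + q • (m₁ * sigma3) ∧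
      c₂ * m₂ + c₁ * m₁ + c₀ = p • (m₁ * sigma3) + q • (m₂ * sigma3) := by
  have h3 := tendsto_smul_of_tendsto_zero (X := fun k => (c₀ + k • c₁ + k ^ 2 • c₂) * M k -
    (p * k + q * k ^ 2) • (M k * sigma3)) hX
  have hg := ((((Tendsto.mat_mul (tendsto_const_nhds (x := c₂)) h₂).add
    (Tendsto.mat_mul (tendsto_const_nhds (x := c₁)) h₁)).add
    (Tendsto.mat_mul (tendsto_const_nhds (x := c₀)) h₁.tendsto_one)).sub
    ((Tendsto.mat_mul h₁ (tendsto_const_nhds (x := sigma3))).const_smul p)).sub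
    ((Tendsto.mat_mul h₂ (tendsto_const_nhds (x := sigma3))).const_smul q)
  obtain ⟨hA, hB, hC⟩ := eq_zero_of_tendsto_polynomial tendsto_inv_mul_I eventually_mul_I_ne_zero
    (A := c₂ - q • sigma3) (B := c₁ + c₂ * m₁ - p • sigma3 - q • (m₁ * sigma3)) (L := 0) hg (by
      refine h3.congr fun y => ?_
      simp only [sub_mul, mul_sub, add_mul, mul_one, one_mul, smul_sub, smul_add,
        smul_mul_assoc, mul_smul_comm, smul_smul]
      module)
  rw [mul_one] at hC
  refine ⟨sub_eq_zero.1 hA, ?_, ?_⟩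
  · rw [← sub_eq_zero, ← hB]; abel
  · rw [← sub_eq_zero, ← hC]; abel

/-- The next order of the same expansion: once the polynomial part cancels, the coefficient of 1/κ
is the limit of κX. -/
theorem first_coefficient_of_tendsto (h₁ : HasFirstMoment M m₁) (h₂ : HasSecondMoment M m₁ m₂)
    {c₀ c₁ γ : Mat2} {p : ℂ} (hc₁ : c₁ = p • sigma3) (hc₀ : c₁ * m₁ + c₀ = p • (m₁ * sigma3))
    (hX : Tendsto (fun y : ℝ => ((y : ℂ) * Complex.I) •
      ((c₀ + ((y : ℂ) * Complex.I) • c₁) * M (y * Complex.I) -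
        (p * ((y : ℂ) * Complex.I)) • (M (y * Complex.I) * sigma3))) (cocompact ℝ) (𝓝 γ)) :
    γ = c₁ * m₂ + c₀ * m₁ - p • (m₂ * sigma3) := by
  have hg := ((Tendsto.mat_mul (tendsto_const_nhds (x := c₁)) h₂).add
    (Tendsto.mat_mul (tendsto_const_nhds (x := c₀)) h₁)).sub
    ((Tendsto.mat_mul h₂ (tendsto_const_nhds (x := sigma3))).const_smul p)
  refine tendsto_nhds_unique hX (hg.congr fun y => ?_)
  have e1 : c₀ = p • (m₁ * sigma3) - c₁ * m₁ := by rw [← hc₀]; abel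
  set κ := (y : ℂ) * Complex.I
  set N := M κ
  have e2 : (κ ^ 2) • c₁ = (κ ^ 2 * p) • sigma3 := by rw [hc₁, smul_smul]
  have e3 : κ • c₀ = κ • (p • (m₁ * sigma3)) - κ • (c₁ * m₁) := by rw [e1, smul_sub]
  have e4 : c₁ * (κ • (κ • (N - 1) - m₁)) + c₀ * (κ • (N - 1)) -
      p • (κ • (κ • (N - 1) - m₁) * sigma3) =
      κ • ((c₀ + κ • c₁) * N - (p * κ) • (N * sigma3)) - ((κ ^ 2) • c₁ - (κ ^ 2 * p) • sigma3)
      - (κ • c₀ - (κ • (p • (m₁ * sigma3)) - κ • (c₁ * m₁))) := by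
    simp only [sub_mul, mul_sub, add_mul, mul_one, one_mul, smul_sub, smul_add,
        smul_mul_assoc, mul_smul_comm, smul_smul]
    module
  rw [e4, e2, e3]; abel

end Expansion

namespace RHPData

variable {D : RHPData} {x t : ℝ} {M Mp Mm : ℂ → Mat2}

namespace IsFamily

variable {a b : ℝ} {Ms Mps Mms F : ℝ → ℂ → Mat2} {m₁ m₂ : Mat2} {m₁s m₂s : ℝ → Mat2}

theorem eventually_twist_mul (h : D.IsSolution x t M Mp Mm) (hD : D.Admissible) {R : ℝ}
    (hR : D.IsFar R) (N : ℂ → Mat2) :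
    ∀ᶠ y : ℝ in cocompact ℝ, twist N M (y * Complex.I) * M (y * Complex.I) = N (y * Complex.I) := by
  filter_upwards [eventually_cocompact_far R] with y hy
  exact (solution_eq_twist_mul h hD N (hR.mem_regularSet _ hy.1.le hy.2)).symm

/-- Because M_s = (M_sM⁻¹) M, the increment of the first moment is the first moment of M_sM⁻¹. -/
theorem tendsto_first_moment_slope (hF : D.IsFamily x t a b M Mp Mm Ms Mps Mms F)
    (hD : D.Admissible) (hreg : D.Regular) {R : ℝ} (hR : D.IsFar R) (h₁ : HasFirstMoment M m₁)
    (h₁s : ∀ᶠ s in 𝓝[≠] (0 : ℝ), HasFirstMoment (Ms s) (m₁s s)) :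
    Tendsto (fun s : ℝ => (s : ℂ)⁻¹ • (m₁s s - m₁)) (𝓝[≠] 0)
      (𝓝 (D.varMoment x t a b M Mm R fun _ => 1)) := by
  have h2 := ((hF.tendsto_pairing_slope hD hreg hR (κ := fun _ => 1) continuousOn_const
    measurable_const (integrableOn_kernel_mul (B := 1) hreg hR.pos measurable_const
      fun ξ _ => by simp)).const_smul (2 * Real.pi * Complex.I : ℂ)⁻¹).neg
  refine h2.congr' ?_
  filter_upwards [hF.hasFirstMoment_twist hD hreg hR, h₁s] with s h3 h4
  have h5 := h4.unique (HasFirstMoment.congr (HasFirstMoment.mul h3.1 h₁)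
    (eventually_twist_mul hF.sol hD hR (Ms s)))
  rw [h5, add_sub_cancel_right, smul_neg, smul_comm]

theorem tendsto_second_moment_slope (hF : D.IsFamily x t a b M Mp Mm Ms Mps Mms F)
    (hD : D.Admissible) (hreg : D.Regular) {R : ℝ} (hR : D.IsFar R)
    (hi : IntegrableOn (fun ξ : ℝ => (ξ : ℂ) * (phase a b ξ * D.ρ ξ)) (rays R))
    (h₁ : HasFirstMoment M m₁) (h₂ : HasSecondMoment M m₁ m₂)
    (h₁s : ∀ᶠ s in 𝓝[≠] (0 : ℝ), HasFirstMoment (Ms s) (m₁s s))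
    (h₂s : ∀ᶠ s in 𝓝[≠] (0 : ℝ), HasSecondMoment (Ms s) (m₁s s) (m₂s s)) :
    Tendsto (fun s : ℝ => (s : ℂ)⁻¹ • (m₂s s - m₂)) (𝓝[≠] 0)
      (𝓝 (D.varMoment x t a b M Mm R (fun k => k) +
        D.varMoment x t a b M Mm R (fun _ => 1) * m₁)) := by
  have h2 := ((hF.tendsto_pairing_slope hD hreg hR (κ := fun k => k) continuousOn_id
    measurable_id hi).const_smul (2 * Real.pi * Complex.I : ℂ)⁻¹).neg
  have h3 := hF.tendsto_first_moment_slope hD hreg hR h₁ h₁s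
  refine (h2.add (Tendsto.mat_mul h3 (tendsto_const_nhds (x := m₁)))).congr' ?_
  filter_upwards [hF.hasFirstMoment_twist hD hreg hR, h₁s, h₂s] with s h3 h4 h5
  have he := eventually_twist_mul hF.sol hD hR (Ms s)
  have h6 := h4.unique (HasFirstMoment.congr (HasFirstMoment.mul h3.1 h₁) he)
  have h7 := HasSecondMoment.congr (HasSecondMoment.mul (h3.2 hi) h₁ h₂) he
  rw [← h6] at h7
  have h8 := tendsto_nhds_unique h5 h7
  rw [h8, add_sub_cancel_right, h6, add_sub_cancel_right, smul_add, ← Matrix.smul_mul]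
  congr 1
  rw [smul_neg, smul_comm]

/-- Expansion at infinity and differentiation in the parameter commute: outside the disc X = V M
with V a Cauchy integral of the limiting densities, and the moments of V are the very pairings found
for the slopes of the moments of M. -/
theorem tendsto_variation (hF : D.IsFamily x t a b M Mp Mm Ms Mps Mms F)
    (hD : D.Admissible) (hreg : D.Regular) {R : ℝ} (hR : D.IsFar R) (h₁ : HasFirstMoment M m₁)
    {X : ℂ → Mat2} (hX : ∀ k ∈ D.regularSet,
      Tendsto (fun s : ℝ => (s : ℂ)⁻¹ • (Ms s k - M k)) (𝓝[≠] 0) (𝓝 (X k))) :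
    Tendsto (fun y : ℝ => ((y : ℂ) * Complex.I) • X (y * Complex.I)) (cocompact ℝ)
      (𝓝 (D.varMoment x t a b M Mm R fun _ => 1)) ∧
    (IntegrableOn (fun ξ : ℝ => (ξ : ℂ) * (phase a b ξ * D.ρ ξ)) (rays R) →
      Tendsto (fun y : ℝ => ((y : ℂ) * Complex.I) • (((y : ℂ) * Complex.I) • X (y * Complex.I) -
        D.varMoment x t a b M Mm R fun _ => 1)) (cocompact ℝ)
      (𝓝 (D.varMoment x t a b M Mm R (fun k => k) +
        D.varMoment x t a b M Mm R (fun _ => 1) * m₁))) := by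
  obtain ⟨B, hB0, hB⟩ := exists_circleVar_bound hF.sol hR a b
  have hb : ∀ k : ℂ, ‖k‖ = R → k.im ≠ 0 → ‖circleVar a b M k‖ ≤ B * R ^ 2 :=
    fun k hk him => hk ▸ hB k hk.ge him
  have hci := circleIntegrable_circleVar hF.sol hR a b
  have hj := hF.rayIntegrable_rayVar hD hreg hR
  set c : ℂ := (2 * Real.pi * Complex.I)⁻¹ with hc
  set V : ℂ → Mat2 := fun z => c • pairing R (circleVar a b M) (D.rayVar x t a b Mm)
        (fun k => (k - z)⁻¹) with hV
  have hXV : ∀ᶠ y : ℝ in cocompact ℝ, X (y * Complex.I) = V (y * Complex.I) * M (y * Complex.I) := by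
    filter_upwards [eventually_cocompact_far R] with y hy
    have hr := hR.mem_regularSet _ hy.1.le hy.2
    refine tendsto_nhds_unique (hX _ hr) ((Tendsto.mat_mul
      (hF.tendsto_twist_slope hD hreg hR hy.1 hy.2) (tendsto_const_nhds (x := M _))).congr fun s => ?_)
    rw [Matrix.smul_mul, sub_mul, one_mul, ← solution_eq_twist_mul hF.sol hD _ hr]
  have t1 : Tendsto (fun y : ℝ => ((y : ℂ) * Complex.I) • V (y * Complex.I)) (cocompact ℝ)
      (𝓝 (D.varMoment x t a b M Mm R fun _ => 1)) := by
    have h2 := (tendsto_pairing_cauchy hR.pos hci hb hj).const_smul c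
    rw [smul_neg] at h2
    exact h2.congr fun y => smul_comm _ _ _
  refine ⟨?_, fun hi => ?_⟩
  · have h2 := Tendsto.mat_mul t1 h₁.tendsto_one
    rw [mul_one] at h2
    refine h2.congr' (hXV.mono fun y hy => ?_)
    simp only [hy, Matrix.smul_mul]
  · have hj' : RayIntegrable R fun ξ : ℝ => (ξ : ℂ) • D.rayVar x t a b Mm ξ :=
      rayIntegrable_mul_of_norm_le (Integrable.aestronglyMeasurable hj)
        (g := fun ξ => 32 * ‖(ξ : ℂ) * (phase a b ξ * D.ρ ξ)‖) (fun ξ hξ => by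
        have := mul_le_mul_of_nonneg_left (hF.norm_rayVar_le hD hreg hR hξ)
          (norm_nonneg (ξ : ℂ))
        rw [norm_mul (ξ : ℂ)]; linarith) (hi.norm.const_mul _)
    have t2 : Tendsto (fun y : ℝ => ((y : ℂ) * Complex.I) • (((y : ℂ) * Complex.I) •
        V (y * Complex.I) - D.varMoment x t a b M Mm R fun _ => 1)) (cocompact ℝ)
        (𝓝 (D.varMoment x t a b M Mm R (fun k => k))) := by
      have h2 := (tendsto_pairing_cauchy_sq hR.pos hci hb hj hj').const_smul c
      rw [smul_neg] at h2
      refine h2.congr fun y => ?_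
      rw [smul_comm c, smul_add, smul_comm c, varMoment, sub_neg_eq_add]
    have h3 := (Tendsto.mat_mul t2 h₁.tendsto_one).add (Tendsto.mat_mul
      (tendsto_const_nhds (x := D.varMoment x t a b M Mm R fun _ => 1)) h₁)
    rw [mul_one] at h3
    refine h3.congr' (hXV.mono fun y hy => ?_)
    simp only [hy, Matrix.smul_mul, Matrix.mul_smul, sub_mul, mul_sub, mul_one, smul_sub]
    abel

end IsFamily

/-- The coefficient of 1/k in M(k) M(k̄)ᴴ = I along the imaginary axis is m₁ + m₁ᴴ. -/
theorem IsSolution.conjTranspose_first_moment (h : D.IsSolution x t M Mp Mm) (hD : D.Admissible)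
    (hreg : D.Regular) {m₁ : Mat2} (h₁ : HasFirstMoment M m₁) : m₁.conjTranspose = -m₁ := by
  obtain ⟨R, hR⟩ := exists_isFar hreg
  have hneg : Tendsto (fun y : ℝ => -y) (cocompact ℝ) (cocompact ℝ) :=
    (Homeomorph.neg ℝ).isClosedEmbedding.tendsto_cocompact
  have h2 := Tendsto.mat_star (Tendsto.comp (f := fun y : ℝ => -y) h₁ hneg)
  have h3 := (Tendsto.mat_mul h₁ (Tendsto.mat_star (h₁.tendsto_one.comp hneg))).add h2
  rw [Matrix.conjTranspose_one, mul_one] at h3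
  have h4 : Tendsto (fun _ : ℝ => (0 : Mat2)) (cocompact ℝ) (𝓝 (m₁ + m₁.conjTranspose)) := by
    refine h3.congr' ?_
    filter_upwards [eventually_cocompact_far R] with y hy
    have hr := h.twist_self hD (hR.mem_regularSet _ hy.1.le hy.2)
    have hc : starRingEnd ℂ ((y : ℂ) * Complex.I) = ((-y : ℝ) : ℂ) * Complex.I := by simp
    rw [hc] at hr
    simp only [Function.comp_apply]
    rw [Matrix.conjTranspose_smul, Matrix.conjTranspose_sub, Matrix.conjTranspose_one,
      Matrix.smul_mul, sub_mul, hr, one_mul]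
    have hst : star (((-y : ℝ) : ℂ) * Complex.I) = (y : ℂ) * Complex.I := by simp
    rw [hst, ← smul_add]
    simp
  have h5 := tendsto_nhds_unique h4 tendsto_const_nhds
  exact eq_neg_of_add_eq_zero_right h5

/-- The Lax equations for the solution and the evolution of its moments. -/
theorem exists_lax (hD : D.Admissible) (hreg : D.Regular)
    {Ms Mps Mms F Ns Nps Nms G : ℝ → ℂ → Mat2} (hF : D.IsFamily x t 1 0 M Mp Mm Ms Mps Mms F)
    (hG : D.IsFamily x t 0 1 M Mp Mm Ns Nps Nms G) {m₁ m₂ Q : Mat2} (h₁ : HasFirstMoment M m₁)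
    (h₂ : HasSecondMoment M m₁ m₂) (hQ : Q = (-Complex.I) • (sigma3 * m₁ - m₁ * sigma3)) :
    ∃ μ τ ν : Mat2,
      (∀ k ∈ D.regularSet, Tendsto (fun s : ℝ => (s : ℂ)⁻¹ • (Ms s k - M k)) (𝓝[≠] 0)
        (𝓝 ((Q + k • (Complex.I • sigma3)) * M k - (Complex.I * k) • (M k * sigma3)))) ∧
      (∀ k ∈ D.regularSet, Tendsto (fun s : ℝ => (s : ℂ)⁻¹ • (Ns s k - M k)) (𝓝[≠] 0)
        (𝓝 (((2 : ℂ) • μ - (2 * k) • Q - (2 * Complex.I * k ^ 2) • sigma3) * M k +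
          (2 * Complex.I * k ^ 2) • (M k * sigma3)))) ∧
      μ = Complex.I • (sigma3 * m₂ - m₂ * sigma3) + Q * m₁ ∧ τ + (2 : ℂ) • ν = (2 : ℂ) • (μ * m₁) ∧
      (∀ m₁s : ℝ → Mat2, (∀ᶠ s in 𝓝[≠] (0 : ℝ), HasFirstMoment (Ms s) (m₁s s)) →
        Tendsto (fun s : ℝ => (s : ℂ)⁻¹ • (m₁s s - m₁)) (𝓝[≠] 0) (𝓝 μ)) ∧
      (∀ m₁s : ℝ → Mat2, (∀ᶠ s in 𝓝[≠] (0 : ℝ), HasFirstMoment (Ns s) (m₁s s)) →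
        Tendsto (fun s : ℝ => (s : ℂ)⁻¹ • (m₁s s - m₁)) (𝓝[≠] 0) (𝓝 τ)) ∧
      (∀ m₁s m₂s : ℝ → Mat2, (∀ᶠ s in 𝓝[≠] (0 : ℝ), HasFirstMoment (Ms s) (m₁s s)) →
        (∀ᶠ s in 𝓝[≠] (0 : ℝ), HasSecondMoment (Ms s) (m₁s s) (m₂s s)) →
        Tendsto (fun s : ℝ => (s : ℂ)⁻¹ • (m₂s s - m₂)) (𝓝[≠] 0) (𝓝 ν)) := by
  obtain ⟨R, hR⟩ := exists_isFar hreg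
  have hp1 : ∀ k : ℂ, phase 1 0 k = k := fun k => by simp [phase]
  have hp2 : ∀ k : ℂ, phase 0 1 k = -2 * k ^ 2 := fun k => by simp [phase]; ring
  -- In the x direction one weight ξ comes from the phase and one from the second moment; in the t
  -- direction the phase alone contributes ξ². So k²ρ integrable is what both need.
  have hi : IntegrableOn (fun ξ : ℝ => (ξ : ℂ) * (phase 1 0 ξ * D.ρ ξ)) (rays R) :=
    hreg.integrable.integrableOn.congr_fun (fun ξ _ => by simp only [hp1]; ring)
      (measurableSet_rays R)
  obtain ⟨c₀, c₁, c₂, hc⟩ := hF.exists_factor_deriv hD hreg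
  obtain ⟨d₀, d₁, d₂, hd⟩ := hG.exists_factor_deriv hD hreg
  have hX : ∀ k ∈ D.regularSet, Tendsto (fun s : ℝ => (s : ℂ)⁻¹ • (Ms s k - M k)) (𝓝[≠] 0)
      (𝓝 ((c₀ + k • c₁ + k ^ 2 • c₂) * M k - (Complex.I * k + 0 * k ^ 2) • (M k * sigma3))) := by
    intro k hk
    have := hF.tendsto_solution_slope hk (hc k)
    rwa [hp1, ← add_zero (Complex.I * k), ← zero_mul (k ^ 2)] at this
  have hY : ∀ k ∈ D.regularSet, Tendsto (fun s : ℝ => (s : ℂ)⁻¹ • (Ns s k - M k)) (𝓝[≠] 0)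
      (𝓝 ((d₀ + k • d₁ + k ^ 2 • d₂) * M k - (0 * k + (-2 * Complex.I) * k ^ 2) •
        (M k * sigma3))) := by
    intro k hk
    have := hG.tendsto_solution_slope hk (hd k)
    rwa [hp2, show Complex.I * (-2 * k ^ 2) = 0 * k + (-2 * Complex.I) * k ^ 2 by ring] at this
  obtain ⟨vX, vX2⟩ := hF.tendsto_variation hD hreg hR h₁ hX
  have vX2 := vX2 hi
  obtain ⟨vY, -⟩ := hG.tendsto_variation hD hreg hR h₁ hY
  obtain ⟨e2, e1, e0⟩ := coefficients_of_tendsto h₁ h₂ vX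
  obtain ⟨f2, f1, f0⟩ := coefficients_of_tendsto h₁ h₂ vY
  set μ := D.varMoment x t 1 0 M Mm R fun _ => 1 with hμ
  set τ := D.varMoment x t 0 1 M Mm R fun _ => 1 with hτ
  set ν := D.varMoment x t 1 0 M Mm R (fun k => k) + μ * m₁ with hν
  -- In the x direction the phase has no quadratic part, so the quadratic coefficient of the factor
  -- vanishes.
  rw [zero_smul] at e2
  subst e2
  simp only [zero_mul, zero_smul, add_zero, zero_add] at e1 e0 f1 f0
  have eQ : c₀ = Q := by
    rw [e1] at e0
    have h5 : c₀ = Complex.I • (m₁ * sigma3) - Complex.I • sigma3 * m₁ := by rw [← e0]; abel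
    rw [h5, hQ, Matrix.smul_mul]; module
  have eμ : μ = c₁ * m₂ + c₀ * m₁ - Complex.I • (m₂ * sigma3) :=
    first_coefficient_of_tendsto h₁ h₂ e1 e0 (by simpa only [smul_zero, add_zero, zero_mul] using vX)
  have eμ' : μ = Complex.I • (sigma3 * m₂ - m₂ * sigma3) + Q * m₁ := by
    rw [eμ, e1, eQ, Matrix.smul_mul]; module
  have fQ : d₁ = (-2 : ℂ) • Q := by
    have h5 : d₁ = (-2 * Complex.I) • (m₁ * sigma3) - d₂ * m₁ := by rw [← f1]; abel
    rw [h5, f2, hQ, Matrix.smul_mul]; module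
  have fμ : d₀ = (2 : ℂ) • μ := by
    have h5 : d₀ = (-2 * Complex.I) • (m₂ * sigma3) - d₂ * m₂ - d₁ * m₁ := by rw [← f0]; abel
    rw [h5, f2, fQ, eμ', Matrix.smul_mul, Matrix.smul_mul]; module
  -- With X and Y the x and t derivatives of M, one has Y + 2kX = 2μM. So kY + 2k(kX - μ) = 2μ · k(M
  -- - 1), whose limit is 2μm₁, while the two terms on the left tend to τ and 2ν.
  have comb : τ + (2 : ℂ) • ν = (2 : ℂ) • (μ * m₁) := by
    have h5 := vY.add (vX2.const_smul (2 : ℂ))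
    have h6 := (Tendsto.mat_mul (tendsto_const_nhds (x := μ)) h₁).const_smul (2 : ℂ)
    refine tendsto_nhds_unique h5 (h6.congr fun y => ?_)
    rw [e1, eQ, fμ, fQ, f2]
    simp only [mul_sub, add_mul, mul_one, smul_sub, smul_add,
        smul_mul_assoc, mul_smul_comm, smul_smul, add_smul, smul_zero, zero_mul]
    module
  refine ⟨μ, τ, ν, fun k hk => ?_, fun k hk => ?_, eμ', comb, fun m₁s h => ?_, fun m₁s h => ?_,
    fun m₁s m₂s h h' => ?_⟩
  · have h5 := hX k hk
    rwa [eQ, e1, smul_zero, add_zero, zero_mul, add_zero] at h5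
  · have h5 := hY k hk
    rw [fμ, fQ, f2] at h5
    convert h5 using 2
    simp only [sub_mul, add_mul, smul_mul_assoc, smul_smul, add_smul]
    module
  · exact hF.tendsto_first_moment_slope hD hreg hR h₁ h
  · exact hG.tendsto_first_moment_slope hD hreg hR h₁ h
  · exact hF.tendsto_second_moment_slope hD hreg hR hi h₁ h₂ h h'

end RHPData

end CounterflowNLS

/-! ### From the moments to the modified Lax pair and the NLS equation -/

namespace CounterflowNLS

attribute [local instance] Matrix.normedAddCommGroup Matrix.normedSpace

theorem hasDerivAt_of_tendsto_slope {f : ℝ → ℂ} {x : ℝ} {L : ℂ}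
    (h : Tendsto (fun s : ℝ => (s : ℂ)⁻¹ * (f (x + s) - f x)) (𝓝[≠] 0) (𝓝 L)) :
    HasDerivAt f L x := by
  rw [hasDerivAt_iff_tendsto_slope_zero]
  refine h.congr fun s => ?_
  rw [Complex.real_smul, Complex.ofReal_inv]

theorem tendsto_slope_entry {A : ℝ → Mat2} {B L : Mat2}
    (h : Tendsto (fun s : ℝ => (s : ℂ)⁻¹ • (A s - B)) (𝓝[≠] 0) (𝓝 L)) (i j : Fin 2) :
    Tendsto (fun s : ℝ => (s : ℂ)⁻¹ * (A s i j - B i j)) (𝓝[≠] 0) (𝓝 (L i j)) := by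
  simpa only [Matrix.smul_apply, Matrix.sub_apply, smul_eq_mul] using tendsto_mat.1 h i j

namespace RHPData

variable {D : RHPData} {U : Set (ℝ × ℝ)} {M Mp Mm : ℝ → ℝ → ℂ → Mat2} {m₁ m₂ : ℝ → ℝ → Mat2}

theorem eventually_mem_line {x t : ℝ} (hU : IsOpen U) (h : (x, t) ∈ U) (a b : ℝ) :
    ∀ᶠ s : ℝ in 𝓝[≠] 0, (x + s * a, t + s * b) ∈ U := by
  have hc : Continuous fun s : ℝ => (x + s * a, t + s * b) := by fun_prop
  exact nhdsWithin_le_nhds ((hc.tendsto' 0 (x, t) (by simp)).eventually (hU.mem_nhds h))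

theorem eventually_mem_fst {x t : ℝ} (hU : IsOpen U) (h : (x, t) ∈ U) : ∀ᶠ y in 𝓝 x, (y, t) ∈ U :=
  ((by fun_prop : Continuous fun y : ℝ => (y, t)).tendsto x).eventually (hU.mem_nhds h)

theorem eventually_mem_snd {x t : ℝ} (hU : IsOpen U) (h : (x, t) ∈ U) : ∀ᶠ s in 𝓝 t, (x, s) ∈ U :=
  ((by fun_prop : Continuous fun s : ℝ => (x, s)).tendsto t).eventually (hU.mem_nhds h)

/-- The differential equations at a point in terms of the moments. -/
theorem exists_moment_derivatives (hD : D.Admissible) (hreg : D.Regular) (hU : IsOpen U)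
    (hM : ∀ x t : ℝ, (x, t) ∈ U → D.IsSolution x t (M x t) (Mp x t) (Mm x t))
    (h₁ : ∀ x t : ℝ, (x, t) ∈ U → HasFirstMoment (M x t) (m₁ x t))
    (h₂ : ∀ x t : ℝ, (x, t) ∈ U → HasSecondMoment (M x t) (m₁ x t) (m₂ x t))
    {x t : ℝ} (hxt : (x, t) ∈ U) {Q : Mat2}
    (hQ : Q = (-Complex.I) • (sigma3 * m₁ x t - m₁ x t * sigma3)) :
    ∃ μ τ ν : Mat2,
      (∀ k ∈ D.regularSet, ∀ i j, HasDerivAt (fun y => M y t k i j)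
        (((Q + k • (Complex.I • sigma3)) * M x t k -
          (Complex.I * k) • (M x t k * sigma3)) i j) x) ∧
      (∀ k ∈ D.regularSet, ∀ i j, HasDerivAt (fun s => M x s k i j)
        ((((2 : ℂ) • μ - (2 * k) • Q - (2 * Complex.I * k ^ 2) • sigma3) * M x t k +
          (2 * Complex.I * k ^ 2) • (M x t k * sigma3)) i j) t) ∧
      μ = Complex.I • (sigma3 * m₂ x t - m₂ x t * sigma3) + Q * m₁ x t ∧
      τ + (2 : ℂ) • ν = (2 : ℂ) • (μ * m₁ x t) ∧
      (∀ i j, HasDerivAt (fun y => m₁ y t i j) (μ i j) x) ∧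
      (∀ i j, HasDerivAt (fun s => m₁ x s i j) (τ i j) t) ∧
      (∀ i j, HasDerivAt (fun y => m₂ y t i j) (ν i j) x) := by
  have hx := eventually_mem_line hU hxt 1 0
  have ht := eventually_mem_line hU hxt 0 1
  obtain ⟨F, hF⟩ := exists_isFamily hD (hM x t hxt) (hx.mono fun s hs => hM _ _ hs)
  obtain ⟨G, hG⟩ := exists_isFamily hD (hM x t hxt) (ht.mono fun s hs => hM _ _ hs)
  obtain ⟨μ, τ, ν, a1, a2, a3, a4, a5, a6, a7⟩ :=
    exists_lax hD hreg hF hG (h₁ x t hxt) (h₂ x t hxt) hQ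
  have a5 := a5 (fun s => m₁ (x + s * 1) (t + s * 0)) (hx.mono fun s hs => h₁ _ _ hs)
  have a6 := a6 (fun s => m₁ (x + s * 0) (t + s * 1)) (ht.mono fun s hs => h₁ _ _ hs)
  have a7 := a7 (fun s => m₁ (x + s * 1) (t + s * 0)) (fun s => m₂ (x + s * 1) (t + s * 0))
    (hx.mono fun s hs => h₁ _ _ hs) (hx.mono fun s hs => h₂ _ _ hs)
  simp only [mul_one, mul_zero, add_zero] at a1 a2 a5 a6 a7
  exact ⟨μ, τ, ν, fun k hk i j => hasDerivAt_of_tendsto_slope (tendsto_slope_entry (a1 k hk) i j),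
    fun k hk i j => hasDerivAt_of_tendsto_slope (tendsto_slope_entry (a2 k hk) i j), a3, a4,
    fun i j => hasDerivAt_of_tendsto_slope (tendsto_slope_entry a5 i j),
    fun i j => hasDerivAt_of_tendsto_slope (tendsto_slope_entry a6 i j),
    fun i j => hasDerivAt_of_tendsto_slope (tendsto_slope_entry a7 i j)⟩

/-- Antihermitian m₁ turns the lower left entry of the commutator into -q̄, the focusing symmetry.
-/
theorem potentialMatrix_of_moment {m : Mat2} {q : ℂ} (hm : m.conjTranspose = -m)
    (hq : q = -2 * Complex.I * m 0 1) :
    potentialMatrix q = (-Complex.I) • (sigma3 * m - m * sigma3) := by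
  have h1 : starRingEnd ℂ (m 0 1) = -m 1 0 := by
    simpa [Matrix.conjTranspose_apply] using congrFun (congrFun hm 1) 0
  ext i j
  fin_cases i <;> fin_cases j <;>
    simp [potentialMatrix, sigma3, Matrix.mul_apply, Matrix.vecMul, dotProduct, Fin.sum_univ_two, hq, Complex.conj_ofNat, h1] <;>
    ring

/-- Brings the t equation into Lax form: the off-diagonal part of 2μ is iσ₃Q_x because q_x = -2iμ₁₂,
and its diagonal part comes from Q m₁, in which the off-diagonal entries of m₁ are expressed by q.
-/
theorem two_smul_eq_of_moment {m m' μ : Mat2} {q qx : ℂ} (hm : m.conjTranspose = -m)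
    (hq : q = -2 * Complex.I * m 0 1) (hqx : qx = -2 * Complex.I * μ 0 1)
    (hμ : μ = Complex.I • (sigma3 * m' - m' * sigma3) + potentialMatrix q * m)
    (hμc : μ 1 0 = -starRingEnd ℂ (μ 0 1)) :
    (2 : ℂ) • μ = Complex.I • (sigma3 * (potentialMatrix qx - potentialMatrix q ^ 2)) := by
  have h1 : m 1 0 = -starRingEnd ℂ (m 0 1) := by
    have : starRingEnd ℂ (m 0 1) = -m 1 0 := by
      simpa [Matrix.conjTranspose_apply] using congrFun (congrFun hm 1) 0
    rw [this, neg_neg]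
  have hI := Complex.I_mul_I
  have h00 : μ 0 0 = q * m 1 0 := by
    rw [hμ]; simp [sigma3, potentialMatrix, Matrix.mul_apply, Matrix.vecMul, dotProduct, Fin.sum_univ_two]
  have h11 : μ 1 1 = -(starRingEnd ℂ q * m 0 1) := by
    rw [hμ]; simp [sigma3, potentialMatrix, Matrix.mul_apply, Matrix.vecMul, dotProduct, Fin.sum_univ_two]
  have hqc : starRingEnd ℂ q = 2 * Complex.I * starRingEnd ℂ (m 0 1) := by
    rw [hq]; simp [Complex.conj_ofNat]
  have hqxc : starRingEnd ℂ qx = 2 * Complex.I * starRingEnd ℂ (μ 0 1) := by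
    rw [hqx]; simp [Complex.conj_ofNat]
  ext i j
  fin_cases i <;> fin_cases j
  · simp [sigma3, potentialMatrix, sq, h00, h1, hqc]
    linear_combination (-2 * q * starRingEnd ℂ (m 0 1)) * hI
  · simp [sigma3, potentialMatrix, sq, hqx]
    linear_combination (2 * μ 0 1) * hI
  · simp [sigma3, potentialMatrix, sq, hqxc, hμc]
    linear_combination (-2 * starRingEnd ℂ (μ 0 1)) * hI
  · simp [sigma3, potentialMatrix, sq, h11]
    rw [hq]
    linear_combination (2 * starRingEnd ℂ (-2 * Complex.I * m 0 1) * m 0 1) * hI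

/-- Here q_x is an expression in q, m₁ and m₂, so q_xx exists because these are differentiable in x.
Then iq_t + q_xx contains 2(τ + 2ν)₁₂, and τ + 2ν = 2μm₁ supplies the cubic term. -/
theorem lax_and_nls_of_moments (hD : D.Admissible) (hreg : D.Regular) (hU : IsOpen U)
    (hM : ∀ x t : ℝ, (x, t) ∈ U → D.IsSolution x t (M x t) (Mp x t) (Mm x t))
    (h₁ : ∀ x t : ℝ, (x, t) ∈ U → HasFirstMoment (M x t) (m₁ x t))
    (h₂ : ∀ x t : ℝ, (x, t) ∈ U → HasSecondMoment (M x t) (m₁ x t) (m₂ x t))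
    {q : ℝ → ℝ → ℂ} (hq : ∀ x t : ℝ, (x, t) ∈ U → q x t = -2 * Complex.I * m₁ x t 0 1)
    {x t : ℝ} (hxt : (x, t) ∈ U) :
    (∀ k ∈ D.regularSet, ModifiedLaxPairAt q M x t k) ∧ SolvesNLSAt q x t := by
  have hm : ∀ x t : ℝ, (x, t) ∈ U → (m₁ x t).conjTranspose = -m₁ x t := fun x t h =>
    (hM x t h).conjTranspose_first_moment hD hreg (h₁ x t h)
  have hQ : ∀ x t : ℝ, (x, t) ∈ U → potentialMatrix (q x t) =
      (-Complex.I) • (sigma3 * m₁ x t - m₁ x t * sigma3) := fun x t h =>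
    potentialMatrix_of_moment (hm x t h) (hq x t h)
  have hqx : ∀ y, (y, t) ∈ U → HasDerivAt (fun z => q z t)
      (4 * m₂ y t 0 1 - 2 * Complex.I * (q y t * m₁ y t 1 1)) y := by
    intro y hy
    obtain ⟨μ, τ, ν, -, -, a3, -, a5, -, -⟩ := exists_moment_derivatives hD hreg hU hM h₁ h₂ hy (hQ y t hy)
    have h3 := ((a5 0 1).const_mul (-2 * Complex.I)).congr_of_eventuallyEq
      (f₁ := fun z => q z t) ((eventually_mem_fst hU hy).mono fun z hz => hq z t hz)
    refine h3.congr_deriv ?_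
    rw [a3]
    simp [sigma3, potentialMatrix, Matrix.mul_apply, Matrix.vecMul, dotProduct, Fin.sum_univ_two]
    linear_combination (-4 * m₂ y t 0 1) * Complex.I_mul_I
  obtain ⟨μ, τ, ν, a1, a2, a3, a4, a5, a6, a7⟩ := exists_moment_derivatives hD hreg hU hM h₁ h₂ hxt
    (hQ x t hxt)
  have hqx0 : HasDerivAt (fun z => q z t) (-2 * Complex.I * μ 0 1) x :=
    ((a5 0 1).const_mul (-2 * Complex.I)).congr_of_eventuallyEq
      (f₁ := fun z => q z t) ((eventually_mem_fst hU hxt).mono fun z hz => hq z t hz)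
  have hqt0 : HasDerivAt (fun s => q x s) (-2 * Complex.I * τ 0 1) t :=
    ((a6 0 1).const_mul (-2 * Complex.I)).congr_of_eventuallyEq
      (f₁ := fun s => q x s) ((eventually_mem_snd hU hxt).mono fun s hs => hq x s hs)
  -- The symmetry of m₁ holds near (x,t) and may be differentiated in x.
  have hμc : μ 1 0 = -starRingEnd ℂ (μ 0 1) := by
    have h3 := (a5 0 1).star.neg.congr_of_eventuallyEq (f₁ := fun y => m₁ y t 1 0)
      ((eventually_mem_fst hU hxt).mono fun z hz => by
        have := congrFun (congrFun (hm z t hz) 1) 0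
        simp only [Matrix.conjTranspose_apply, Matrix.neg_apply] at this
        exact (neg_eq_iff_eq_neg.1 this.symm))
    exact (a5 1 0).unique h3
  refine ⟨fun k hk => ?_, ?_⟩
  · have h2μ := two_smul_eq_of_moment (hm x t hxt) (hq x t hxt) rfl a3 hμc
    refine ⟨_, _, _, hqx0, a1 k hk, a2 k hk, ?_, ?_⟩
    · simp only [smul_sub, add_mul, smul_mul_assoc]
      module
    · rw [← h2μ]
      simp only [sub_mul, smul_sub, smul_mul_assoc]
      module
  -- The formula for q_x holds on a neighbourhood in x, so differentiating it once more gives q_xx.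
  · have hd : HasDerivAt (fun y => 4 * m₂ y t 0 1 - 2 * Complex.I * (q y t * m₁ y t 1 1))
        (4 * ν 0 1 - 2 * Complex.I * (-2 * Complex.I * μ 0 1 * m₁ x t 1 1 + q x t * μ 1 1)) x :=
      ((a7 0 1).const_mul 4).sub ((hqx0.mul (a5 1 1)).const_mul (2 * Complex.I))
    have he : (deriv fun z => q z t) =ᶠ[𝓝 x]
        fun y => 4 * m₂ y t 0 1 - 2 * Complex.I * (q y t * m₁ y t 1 1) :=
      (eventually_mem_fst hU hxt).mono fun y hy => (hqx y hy).deriv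
    have hdd := hd.congr_of_eventuallyEq he
    refine ⟨hqt0.differentiableAt, (eventually_mem_fst hU hxt).mono fun y hy =>
      (hqx y hy).differentiableAt, hdd.differentiableAt, ?_⟩
    rw [hqt0.deriv, hdd.deriv]
    have e1 : μ 0 0 = q x t * m₁ x t 1 0 := by
      rw [a3]; simp [sigma3, potentialMatrix, Matrix.mul_apply, Matrix.vecMul, dotProduct, Fin.sum_univ_two]
    have e2 : μ 1 1 = -(starRingEnd ℂ (q x t) * m₁ x t 0 1) := by
      rw [a3]; simp [sigma3, potentialMatrix, Matrix.mul_apply, Matrix.vecMul, dotProduct, Fin.sum_univ_two]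
    have e3 : τ 0 1 + 2 * ν 0 1 = 2 * (μ 0 0 * m₁ x t 0 1 + μ 0 1 * m₁ x t 1 1) := by
      have := congrFun (congrFun a4 0) 1
      simpa [Matrix.mul_apply, Matrix.vecMul, dotProduct, Fin.sum_univ_two] using this
    have e4 : m₁ x t 1 0 = -starRingEnd ℂ (m₁ x t 0 1) := by
      have := congrFun (congrFun (hm x t hxt) 1) 0
      simp only [Matrix.conjTranspose_apply, Matrix.neg_apply] at this
      rw [← neg_eq_iff_eq_neg, ← this]; rfl
    have e5 : m₁ x t 0 1 = Complex.I / 2 * q x t := by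
      rw [hq x t hxt]; linear_combination (m₁ x t 0 1) * Complex.I_mul_I
    have e6 : starRingEnd ℂ (m₁ x t 0 1) = -(Complex.I / 2 * starRingEnd ℂ (q x t)) := by
      rw [e5]; simp only [map_mul, map_div₀, Complex.conj_I, Complex.conj_ofNat]; ring
    have e7 : (‖q x t‖ : ℂ) ^ 2 = q x t * starRingEnd ℂ (q x t) := (Complex.mul_conj' _).symm
    rw [e7, e2]
    rw [e1, e4, e6] at e3
    rw [e5] at e3 ⊢
    set Z := starRingEnd ℂ (q x t)
    linear_combination 2 * e3 + (-2 * τ 0 1 + 2 * q x t * q x t * Z + 4 * μ 0 1 * m₁ x t 1 1) *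
      Complex.I_mul_I

end RHPData

end CounterflowNLS

/-! ### Cauchy integrals over short intervals near the pole of the kernel -/

namespace CounterflowNLS

attribute [local instance] Matrix.normedAddCommGroup Matrix.normedSpace

section Near

/-- The pole lies below and g is holomorphic in the box above, so the integral moves to the other
three sides. There |k - z| ≥ r, the total length is 4r and the integrand is at most C/r. The bound
does not involve the distance of z from the real line. -/
theorem norm_intervalIntegral_div_le_of_upper {g : ℂ → ℂ} {w : ℝ → ℂ} {a r C : ℝ} {z : ℂ}
    (hr : 0 < r) (hre : z.re = a) (him : z.im < 0)
    (hd : ∀ k : ℂ, |k.re - a| ≤ r → 0 < k.im → k.im ≤ r → DifferentiableAt ℂ g k)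
    (hb : ∀ k : ℂ, |k.re - a| ≤ r → 0 < k.im → k.im ≤ r → ‖g k‖ ≤ C)
    (hlim : ∀ ξ : ℝ, |ξ - a| < r → Tendsto g (𝓝[{z | 0 < z.im}] (ξ : ℂ)) (𝓝 (w ξ))) :
    ‖∫ ξ in (a - r)..(a + r), w ξ * ((ξ : ℂ) - z)⁻¹‖ ≤ 4 * C := by
  have hre' : ∀ u v : ℝ, ((u : ℂ) + v * Complex.I).re = u := fun u v => by simp
  have him' : ∀ u v : ℝ, ((u : ℂ) + v * Complex.I).im = v := fun u v => by simp
  have hC : 0 ≤ C := (norm_nonneg _).trans (hb ⟨a, r⟩ (by simpa using hr.le) hr le_rfl)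
  have hne : ∀ k : ℂ, 0 ≤ k.im → k - z ≠ 0 := fun k hk h => by
    have := congrArg Complex.im h
    simp at this; linarith
  -- This majorant blows up as z approaches the line; it only serves to justify the deformation.
  have hker : ∀ k : ℂ, 0 ≤ k.im → ‖(k - z)⁻¹‖ ≤ |z.im|⁻¹ := fun k hk => by
    rw [norm_inv]
    refine inv_anti₀ (abs_pos.2 him.ne) ?_
    have h1 := Complex.abs_im_le_norm (k - z)
    rw [Complex.sub_im, abs_of_pos (by linarith)] at h1
    rw [abs_of_neg him]; linarith
  have hcont : ∀ k : ℂ, |k.re - a| ≤ r → 0 < k.im → k.im ≤ r →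
      ContinuousAt (fun k => g k * (k - z)⁻¹) k := fun k h1 h2 h3 =>
    (hd k h1 h2 h3).continuousAt.mul (ContinuousAt.inv₀ (by fun_prop) (hne k h2.le))
  have hbound : ∀ x ∈ Set.Ioo (a - r) (a + r), ∀ y ∈ Set.Ioo (0 : ℝ) r,
      ‖g (x + y * Complex.I) * ((x + y * Complex.I : ℂ) - z)⁻¹‖ ≤ C * |z.im|⁻¹ := by
    intro x hx y hy
    rw [norm_mul]
    refine mul_le_mul (hb _ ?_ ?_ ?_) (hker _ ?_) (norm_nonneg _) hC
    · rw [hre']; exact abs_le.2 ⟨by linarith [hx.1], by linarith [hx.2]⟩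
    · rw [him']; exact hy.1
    · rw [him']; exact hy.2.le
    · rw [him']; exact hy.1.le
  have hline : ∀ u v : ℝ, Continuous fun y : ℝ => (u : ℂ) + y * Complex.I := fun u v => by fun_prop
  have hline2 : ∀ v : ℝ, Continuous fun x : ℝ => (x : ℂ) + v * Complex.I := fun v => by fun_prop
  have key := integral_boundary_rect_eq_zero_of_dominated (f := fun k => g k * (k - z)⁻¹)
    (a := a - r) (b := a + r) (c := 0) (d := r)
    (fb := fun ξ => w ξ * ((ξ : ℂ) - z)⁻¹)
    (ft := fun x => g (x + r * Complex.I) * ((x + r * Complex.I : ℂ) - z)⁻¹)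
    (fl := fun y => g ((a - r : ℝ) + y * Complex.I) * (((a - r : ℝ) + y * Complex.I : ℂ) - z)⁻¹)
    (fr := fun y => g ((a + r : ℝ) + y * Complex.I) * (((a + r : ℝ) + y * Complex.I : ℂ) - z)⁻¹)
    (g₁ := fun _ => C * |z.im|⁻¹) (g₂ := fun _ => C * |z.im|⁻¹)
    (by linarith) hr (fun k hk => by
      obtain ⟨h1, h2⟩ := Complex.mem_reProdIm.1 hk
      refine DifferentiableAt.differentiableWithinAt ?_
      exact (hd k (abs_le.2 ⟨by linarith [h1.1], by linarith [h1.2]⟩) h2.1 h2.2.le).mul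
        (DifferentiableAt.inv (by fun_prop) (hne k h2.1.le)))
    (ae_of_all _ fun x hx => by
      have h1 : Tendsto (fun k : ℂ => g k * (k - z)⁻¹) (𝓝[{z | 0 < z.im}] (x : ℂ))
          (𝓝 (w x * ((x : ℂ) - z)⁻¹)) := by
        refine (hlim x (abs_lt.2 ⟨by linarith [hx.1], by linarith [hx.2]⟩)).mul ?_
        have hci : ContinuousAt (fun k : ℂ => (k - z)⁻¹) (x : ℂ) :=
          ContinuousAt.inv₀ (by fun_prop) (hne x (by simp))
        exact hci.tendsto.mono_left nhdsWithin_le_nhds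
      exact h1.comp (tendsto_add_mul_I x))
    (ae_of_all _ fun x hx => by
      have h1 := hcont (x + r * Complex.I)
        (by rw [hre']; exact abs_le.2 ⟨by linarith [hx.1], by linarith [hx.2]⟩)
        (by rw [him']; exact hr) (by rw [him'])
      exact h1.tendsto.comp (((hline x 0).tendsto r).mono_left nhdsWithin_le_nhds))
    (ae_of_all _ fun y hy => by
      have h1 := hcont ((a - r : ℝ) + y * Complex.I)
        (by rw [hre', show a - r - a = -r by ring, abs_neg, abs_of_pos hr])
        (by rw [him']; exact hy.1) (by rw [him']; exact hy.2.le)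
      exact h1.tendsto.comp (((hline2 y).tendsto (a - r)).mono_left nhdsWithin_le_nhds))
    (ae_of_all _ fun y hy => by
      have h1 := hcont ((a + r : ℝ) + y * Complex.I)
        (by rw [hre', show a + r - a = r by ring, abs_of_pos hr])
        (by rw [him']; exact hy.1) (by rw [him']; exact hy.2.le)
      exact h1.tendsto.comp (((hline2 y).tendsto (a + r)).mono_left nhdsWithin_le_nhds))
    hbound (ae_of_all _ fun y hy x hx => hbound x hx y hy) (integrableOn_const measure_Ioo_lt_top.ne) (integrableOn_const measure_Ioo_lt_top.ne)
  have hfar : ∀ k : ℂ, |k.re - a| ≤ r → 0 < k.im → k.im ≤ r → r ≤ ‖k - z‖ →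
      ‖g k * (k - z)⁻¹‖ ≤ C * r⁻¹ := fun k h1 h2 h3 h4 => by
    rw [norm_mul, norm_inv]
    exact mul_le_mul (hb k h1 h2 h3) (inv_anti₀ hr h4) (by positivity) hC
  have htop : ‖∫ x in (a - r)..(a + r),
      g (x + r * Complex.I) * ((x + r * Complex.I : ℂ) - z)⁻¹‖ ≤ 2 * C := by
    refine (intervalIntegral.norm_integral_le_of_norm_le_const (C := C * r⁻¹) fun x hx => ?_).trans
      (le_of_eq ?_)
    · rw [Set.uIoc_of_le (by linarith)] at hx
      refine hfar _ ?_ ?_ ?_ ?_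
      · rw [hre']; exact abs_le.2 ⟨by linarith [hx.1], by linarith [hx.2]⟩
      · rw [him']; exact hr
      · rw [him']
      · have h1 := Complex.abs_im_le_norm ((x + r * Complex.I : ℂ) - z)
        rw [Complex.sub_im, him', abs_of_pos (by linarith)] at h1
        linarith
    · rw [show a + r - (a - r) = 2 * r by ring, abs_of_pos (by linarith)]
      field_simp
  have hside : ∀ σ : ℝ, |σ| = r → ‖∫ y in (0 : ℝ)..r,
      g ((a + σ : ℝ) + y * Complex.I) * (((a + σ : ℝ) + y * Complex.I : ℂ) - z)⁻¹‖ ≤ C := by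
    intro σ hσ
    refine (intervalIntegral.norm_integral_le_of_norm_le_const (C := C * r⁻¹) fun y hy => ?_).trans
      (le_of_eq ?_)
    · rw [Set.uIoc_of_le hr.le] at hy
      refine hfar _ ?_ ?_ ?_ ?_
      · rw [hre', add_sub_cancel_left, hσ]
      · rw [him']; exact hy.1
      · rw [him']; exact hy.2
      · have h1 := Complex.abs_re_le_norm (((a + σ : ℝ) + y * Complex.I : ℂ) - z)
        rwa [Complex.sub_re, hre', hre, add_sub_cancel_left, hσ] at h1
    · rw [sub_zero, abs_of_pos hr]
      field_simp
  have hl := hside (-r) (by rw [abs_neg, abs_of_pos hr])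
  have hr' := hside r (abs_of_pos hr)
  rw [← sub_eq_add_neg] at hl
  set Ib := ∫ ξ in (a - r)..(a + r), w ξ * ((ξ : ℂ) - z)⁻¹
  set It := ∫ x in (a - r)..(a + r), g (x + r * Complex.I) * ((x + r * Complex.I : ℂ) - z)⁻¹
  set Il := ∫ y in (0 : ℝ)..r,
      g ((a - r : ℝ) + y * Complex.I) * (((a - r : ℝ) + y * Complex.I : ℂ) - z)⁻¹
  set Ir := ∫ y in (0 : ℝ)..r,
      g ((a + r : ℝ) + y * Complex.I) * (((a + r : ℝ) + y * Complex.I : ℂ) - z)⁻¹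
  have h5 : Ib = It - Complex.I • Ir + Complex.I • Il := by linear_combination key.2
  rw [h5]
  refine (norm_add_le _ _).trans ?_
  have h6 := norm_sub_le It (Complex.I • Ir)
  rw [norm_smul, Complex.norm_I, one_mul] at h6 ⊢
  linarith

theorem norm_intervalIntegral_div_le_of_lower {g : ℂ → ℂ} {w : ℝ → ℂ} {a r C : ℝ} {z : ℂ}
    (hr : 0 < r) (hre : z.re = a) (him : 0 < z.im)
    (hd : ∀ k : ℂ, |k.re - a| ≤ r → k.im < 0 → -r ≤ k.im → DifferentiableAt ℂ g k)
    (hb : ∀ k : ℂ, |k.re - a| ≤ r → k.im < 0 → -r ≤ k.im → ‖g k‖ ≤ C)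
    (hlim : ∀ ξ : ℝ, |ξ - a| < r → Tendsto g (𝓝[{z | z.im < 0}] (ξ : ℂ)) (𝓝 (w ξ))) :
    ‖∫ ξ in (a - r)..(a + r), w ξ * ((ξ : ℂ) - z)⁻¹‖ ≤ 4 * C := by
  have h1 := norm_intervalIntegral_div_le_of_upper (z := starRingEnd ℂ z)
    (g := fun k => starRingEnd ℂ (g (starRingEnd ℂ k))) (w := fun ξ => starRingEnd ℂ (w ξ)) hr
    (by simpa using hre) (by simpa using him) (fun k h1 h2 h3 => by
      have := (hd (starRingEnd ℂ k) (by simpa using h1) (by simpa using h2)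
        (by simp; linarith)).conj_conj
      rwa [Complex.conj_conj] at this) (fun k h1 h2 h3 => by
      rw [RCLike.norm_conj]
      exact hb _ (by simpa using h1) (by simpa using h2) (by simp; linarith)) fun ξ hξ =>
      ((hlim ξ hξ).comp (tendsto_conj_upper ξ)).star
  have h2 : ∫ ξ in (a - r)..(a + r), starRingEnd ℂ (w ξ) * ((ξ : ℂ) - starRingEnd ℂ z)⁻¹ =
      starRingEnd ℂ (∫ ξ in (a - r)..(a + r), w ξ * ((ξ : ℂ) - z)⁻¹) := by
    rw [← intervalIntegral.intervalIntegral_conj]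
    congr 1; funext ξ; simp
  rwa [h2, RCLike.norm_conj] at h1

/-- The coefficient φ need not extend off the line. It is frozen at a; the error is at most Λ|ξ - a|
≤ Λ|ξ - z| and absorbs the kernel. -/
theorem norm_intervalIntegral_mul_div_le {φ w : ℝ → ℂ} {a r C Λ : ℝ} {z : ℂ} (hr : 0 < r)
    (hre : z.re = a) (hC : 0 ≤ C) (hΛ : 0 ≤ Λ)
    (hi : IntervalIntegrable (fun ξ => w ξ * ((ξ : ℂ) - z)⁻¹) volume (a - r) (a + r))
    (hi' : IntervalIntegrable (fun ξ => φ ξ * (w ξ * ((ξ : ℂ) - z)⁻¹)) volume (a - r) (a + r))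
    (hw : ∀ ξ, |ξ - a| ≤ r → ‖w ξ‖ ≤ C) (hφ : ∀ ξ, |ξ - a| ≤ r → ‖φ ξ - φ a‖ ≤ Λ * |ξ - a|)
    (hI : ‖∫ ξ in (a - r)..(a + r), w ξ * ((ξ : ℂ) - z)⁻¹‖ ≤ 4 * C) :
    ‖∫ ξ in (a - r)..(a + r), φ ξ * (w ξ * ((ξ : ℂ) - z)⁻¹)‖ ≤
      2 * r * Λ * C + ‖φ a‖ * (4 * C) := by
  have h1 : ∫ ξ in (a - r)..(a + r), φ ξ * (w ξ * ((ξ : ℂ) - z)⁻¹) =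
      (∫ ξ in (a - r)..(a + r), (φ ξ - φ a) * (w ξ * ((ξ : ℂ) - z)⁻¹)) +
      φ a * ∫ ξ in (a - r)..(a + r), w ξ * ((ξ : ℂ) - z)⁻¹ := by
    rw [← intervalIntegral.integral_const_mul, ← intervalIntegral.integral_add]
    · congr 1; funext ξ; ring
    · simpa only [sub_mul] using hi'.sub (hi.const_mul (φ a))
    · exact hi.const_mul _
  rw [h1]
  refine (norm_add_le _ _).trans (add_le_add ?_ ?_)
  · refine (intervalIntegral.norm_integral_le_of_norm_le_const (C := Λ * C) fun ξ hξ => ?_).trans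
      (le_of_eq ?_)
    · rw [Set.uIoc_of_le (by linarith)] at hξ
      have h2 : |ξ - a| ≤ r := abs_le.2 ⟨by linarith [hξ.1], by linarith [hξ.2]⟩
      have h3 : |ξ - a| ≤ ‖(ξ : ℂ) - z‖ := by
        have := Complex.abs_re_le_norm ((ξ : ℂ) - z)
        rwa [Complex.sub_re, Complex.ofReal_re, hre] at this
      rw [norm_mul, norm_mul, norm_inv]
      calc _ ≤ Λ * ‖(ξ : ℂ) - z‖ * (C * ‖(ξ : ℂ) - z‖⁻¹) := by
            gcongr
            · exact (hφ ξ h2).trans (by gcongr)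
            · exact hw ξ h2
        _ = Λ * C * (‖(ξ : ℂ) - z‖ * ‖(ξ : ℂ) - z‖⁻¹) := by ring
        _ ≤ Λ * C * 1 := by gcongr; exact mul_inv_le_one
        _ = _ := mul_one _
    · rw [show a + r - (a - r) = 2 * r by ring, abs_of_pos (by linarith)]; ring
  · rw [norm_mul]; gcongr

end Near

end CounterflowNLS

/-! ### The local estimate for the jump of the upper right entry -/

namespace CounterflowNLS

attribute [local instance] Matrix.normedAddCommGroup Matrix.normedSpace

section Near

theorem norm_intervalIntegral_mul_div_le_of_bounded {φ w : ℝ → ℂ} {a r C Λ : ℝ} {z : ℂ} (hr : 0 < r)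
    (hre : z.re = a) (him : z.im ≠ 0) (hC : 0 ≤ C) (hΛ : 0 ≤ Λ)
    (hmφ : AEStronglyMeasurable φ (volume.restrict (Set.Ioc (a - r) (a + r))))
    (hmw : AEStronglyMeasurable w (volume.restrict (Set.Ioc (a - r) (a + r))))
    (hw : ∀ ξ, |ξ - a| ≤ r → ‖w ξ‖ ≤ C) (hφ : ∀ ξ, |ξ - a| ≤ r → ‖φ ξ - φ a‖ ≤ Λ * |ξ - a|)
    (hI : ‖∫ ξ in (a - r)..(a + r), w ξ * ((ξ : ℂ) - z)⁻¹‖ ≤ 4 * C) :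
    IntervalIntegrable (fun ξ => φ ξ * (w ξ * ((ξ : ℂ) - z)⁻¹)) volume (a - r) (a + r) ∧
    ‖∫ ξ in (a - r)..(a + r), φ ξ * (w ξ * ((ξ : ℂ) - z)⁻¹)‖ ≤
      2 * r * Λ * C + ‖φ a‖ * (4 * C) := by
  have hm : AEStronglyMeasurable (fun ξ : ℝ => w ξ * ((ξ : ℂ) - z)⁻¹)
      (volume.restrict (Set.Ioc (a - r) (a + r))) :=
    hmw.mul (by fun_prop : Measurable fun ξ : ℝ => ((ξ : ℂ) - z)⁻¹).aestronglyMeasurable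
  have hb : ∀ ξ : ℝ, |ξ - a| ≤ r → ‖w ξ * ((ξ : ℂ) - z)⁻¹‖ ≤ C * |z.im|⁻¹ := fun ξ hξ => by
    rw [norm_mul, norm_inv]
    exact mul_le_mul (hw ξ hξ) (inv_anti₀ (abs_pos.2 him) (abs_im_le_norm_ofReal_sub ξ z))
      (by positivity) hC
  have hmem : ∀ ξ ∈ Set.Ioc (a - r) (a + r), |ξ - a| ≤ r := fun ξ hξ =>
    abs_le.2 ⟨by linarith [hξ.1], by linarith [hξ.2]⟩
  have hbφ : ∀ ξ : ℝ, |ξ - a| ≤ r → ‖φ ξ‖ ≤ Λ * r + ‖φ a‖ := fun ξ hξ => by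
    have h1 := norm_add_le (φ ξ - φ a) (φ a)
    rw [sub_add_cancel] at h1
    refine h1.trans (by gcongr; exact (hφ ξ hξ).trans (by gcongr))
  have hi : IntervalIntegrable (fun ξ => w ξ * ((ξ : ℂ) - z)⁻¹) volume (a - r) (a + r) := by
    rw [intervalIntegrable_iff_integrableOn_Ioc_of_le (by linarith)]
    refine Integrable.of_bound hm (C * |z.im|⁻¹) ?_
    filter_upwards [ae_restrict_mem measurableSet_Ioc] with ξ hξ using hb ξ (hmem ξ hξ)
  have hi' : IntervalIntegrable (fun ξ => φ ξ * (w ξ * ((ξ : ℂ) - z)⁻¹)) volume (a - r) (a + r) := by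
    rw [intervalIntegrable_iff_integrableOn_Ioc_of_le (by linarith)]
    refine Integrable.of_bound (hmφ.mul hm) ((Λ * r + ‖φ a‖) * (C * |z.im|⁻¹)) ?_
    filter_upwards [ae_restrict_mem measurableSet_Ioc] with ξ hξ
    rw [norm_mul]
    exact mul_le_mul (hbφ ξ (hmem ξ hξ)) (hb ξ (hmem ξ hξ)) (norm_nonneg _) (by positivity)
  exact ⟨hi', norm_intervalIntegral_mul_div_le hr hre hC hΛ hi hi' hw hφ hI⟩

end Near

namespace RHPData

variable {D : RHPData}

theorem Regular.exists_lipschitz (hreg : D.Regular) : ∃ (L R : ℝ), 0 ≤ L ∧ ∀ a ξ : ℝ, R + 1 ≤ |a| →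
    |ξ - a| ≤ 1 → ‖D.ρ ξ - D.ρ a‖ ≤ L * |ξ - a| := by
  obtain ⟨L, R, h1, h2⟩ := hreg.lipschitz
  refine ⟨L, |R|, L.2, fun a ξ ha hξ => ?_⟩
  have hR := le_abs_self R
  obtain ⟨h3, h4⟩ := abs_le.1 hξ
  rcases le_total 0 a with h0 | h0
  · rw [abs_of_nonneg h0] at ha
    have := h1.dist_le_mul ξ (by change R ≤ ξ; linarith) a (by change R ≤ a; linarith)
    rwa [dist_eq_norm, Real.dist_eq] at this
  · rw [abs_of_nonpos h0] at ha
    have := h2.dist_le_mul ξ (by change ξ ≤ -R; linarith) a (by change a ≤ -R; linarith)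
    rwa [dist_eq_norm, Real.dist_eq] at this

/-- The growth of e^{2iθ} off the line is governed by t Re k Im k. In a box of height at most 1/|a|
this product stays bounded, which dictates intervals of length proportional to 1/|a|. -/
theorem norm_osc_le {x t a r : ℝ} {k : ℂ} (hr : 0 ≤ r) (hr1 : r ≤ 1) (hra : r * |a| ≤ 1)
    (h1 : |k.re - a| ≤ r) (h2 : |k.im| ≤ r) :
    ‖osc x t k‖ ≤ Real.exp (2 * |x| + 16 * |t|) := by
  have e : (2 * Complex.I * phase x t k).re = -(2 * x * k.im) + 8 * t * (k.re * k.im) := by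
    simp [phase]; ring
  rw [osc, Complex.norm_exp, e]
  refine Real.exp_le_exp.2 ?_
  have h3 : |k.re * k.im| ≤ 2 := by
    have h4 : |k.re| ≤ |a| + r := by
      have := abs_add_le (k.re - a) a
      rw [sub_add_cancel] at this; linarith
    rw [abs_mul]
    calc |k.re| * |k.im| ≤ (|a| + r) * r := by gcongr
      _ ≤ 2 := by nlinarith
  have h5 : |x * k.im| ≤ |x| := by
    rw [abs_mul]; exact mul_le_of_le_one_right (abs_nonneg _) (h2.trans hr1)
  have h6 : |t * (k.re * k.im)| ≤ |t| * 2 := by rw [abs_mul]; gcongr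
  have h7 := neg_abs_le (x * k.im)
  have h8 := le_abs_self (t * (k.re * k.im))
  nlinarith

theorem continuous_osc (x t : ℝ) : Continuous (osc x t) := by
  unfold osc phase; fun_prop

theorem differentiable_osc (x t : ℝ) : Differentiable ℂ (osc x t) := by
  unfold osc phase; fun_prop

namespace IsSolution

variable {x t : ℝ} {M Mp Mm : ℂ → Mat2}

/-- Two forms of one jump, one with boundary values from below and one from above. Each consists of
functions that extend to a single half plane, and the side opposite to z is the one needed. -/
theorem jump_entry_eq (h : D.IsSolution x t M Mp Mm) {ξ : ℝ} (h1 : ξ ≠ -D.V / 2) (h2 : ξ ≠ D.V / 2) :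
    Mp ξ 0 1 - Mm ξ 0 1 = D.ρ ξ * (osc x t ξ * Mm ξ 0 0) +
      D.ρ ξ * starRingEnd ℂ (D.ρ ξ) * Mm ξ 0 1 ∧
    Mp ξ 0 1 - Mm ξ 0 1 = D.ρ ξ * (osc x t ξ * Mp ξ 0 0) := by
  have hj := (h.jump_real ξ h1 h2).2.2
  have h4 := congrFun (congrFun hj 0) 0
  have h5 := congrFun (congrFun hj 0) 1
  simp only [J_real, Matrix.mul_apply, Fin.sum_univ_two, Matrix.of_apply, Matrix.cons_val',
    Matrix.cons_val_zero, Matrix.cons_val_one, Matrix.cons_val_fin_one, map_mul] at h4 h5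
  have h6 := conj_osc_mul x t ξ
  constructor
  · rw [h5]; ring
  · rw [h4, h5]
    linear_combination -(D.ρ ξ * starRingEnd ℂ (D.ρ ξ) * Mm ξ 0 1) * h6

theorem aestronglyMeasurable_plus (h : D.IsSolution x t M Mp Mm) {R : ℝ} (hR : D.IsFar R)
    (i j : Fin 2) : AEStronglyMeasurable (fun ξ : ℝ => Mp ξ i j) (volume.restrict (rays R)) := by
  refine aestronglyMeasurable_boundary (h := fun k => M k i j) (fun k hk him => ?_) fun ξ hξ => ?_
  · exact (differentiableAt_mat.1 (h.differentiableAt (hR.mem_regularSet k hk him.ne')) i j).continuousAt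
  · exact tendsto_mat.1 (h.jump_real ξ (hR.ne_plus ξ hξ.le) (hR.ne_minus ξ hξ.le)).1 i j

theorem aestronglyMeasurable_minus (h : D.IsSolution x t M Mp Mm) {R : ℝ} (hR : D.IsFar R)
    (i j : Fin 2) : AEStronglyMeasurable (fun ξ : ℝ => Mm ξ i j) (volume.restrict (rays R)) := by
  refine aestronglyMeasurable_boundary_lower (h := fun k => M k i j) (fun k hk him => ?_)
    fun ξ hξ => ?_
  · exact (differentiableAt_mat.1 (h.differentiableAt (hR.mem_regularSet k hk him.ne)) i j).continuousAt
  · exact tendsto_mat.1 (h.jump_real ξ (hR.ne_plus ξ hξ.le) (hR.ne_minus ξ hξ.le)).2.1 i j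

/-- The jump is ρ or |ρ|² times boundary values of functions holomorphic and bounded in a box of
size ε/|a|. Freezing the coefficient at a = Re z leaves an error of order ε and a term of order
|aρ(a)|, uniformly in the distance of z from the line. -/
theorem exists_near_bound (h : D.IsSolution x t M Mp Mm) (hD : D.Admissible) (hreg : D.Regular)
    {R₀ : ℝ} (hR₀ : D.IsFar R₀) : ∃ C R : ℝ, 0 ≤ C ∧ 0 < R ∧ ∀ (ε : ℝ) (z : ℂ), 0 < ε → ε ≤ 1 →
      R ≤ |z.re| → z.im ≠ 0 →
      ‖∫ ξ in (z.re - ε / |z.re|)..(z.re + ε / |z.re|),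
        (ξ : ℂ) * (Mp ξ 0 1 - Mm ξ 0 1) * ((ξ : ℂ) - z)⁻¹‖ ≤ C * (ε + ‖(z.re : ℂ) * D.ρ z.re‖) := by
  obtain ⟨L, R₁, hL, hlip⟩ := hreg.exists_lipschitz
  obtain ⟨K, hK1, hK⟩ := h.exists_far_norm_le hR₀
  have hR0 := hR₀.pos
  set C₀ := Real.exp (2 * |x| + 16 * |t|) * K with hC₀
  have hexp : 1 ≤ Real.exp (2 * |x| + 16 * |t|) := Real.one_le_exp (by positivity)
  have hC0 : K ≤ C₀ := le_mul_of_one_le_left (by linarith) hexp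
  have hC0' : 2 ≤ 2 * C₀ := by linarith
  refine ⟨32 * C₀ * (1 + 2 * L), R₀ + |R₁| + 2, by positivity, by positivity,
    fun ε z hε hε1 hz him => ?_⟩
  set a := z.re with ha
  have hR₁ := abs_nonneg R₁
  have hR₁' := le_abs_self R₁
  have ha1 : 1 ≤ |a| := by linarith
  have ha0 : 0 < |a| := by linarith
  set r := ε / |a| with hr
  have hr0 : 0 < r := by positivity
  have hra : r * |a| = ε := by rw [hr]; field_simp
  have hr1 : r ≤ 1 := by nlinarith
  have hfar : ∀ ξ : ℝ, |ξ - a| ≤ r → R₀ < |ξ| := fun ξ hξ => by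
    have := abs_sub_abs_le_abs_sub a ξ
    rw [abs_sub_comm] at this; linarith
  have hrho1 : ∀ ξ : ℝ, |ξ - a| ≤ r → ‖D.ρ ξ‖ ≤ 1 := fun ξ hξ => hR₀.norm_rho_le ξ (hfar ξ hξ).le
  have hmem : ∀ ξ ∈ Set.Ioc (a - r) (a + r), |ξ - a| ≤ r := fun ξ hξ =>
    abs_le.2 ⟨by linarith [hξ.1], by linarith [hξ.2]⟩
  have hsub : Set.Ioc (a - r) (a + r) ⊆ rays R₀ := fun ξ hξ => hfar ξ (hmem ξ hξ)
  have hl : ∀ ξ : ℝ, |ξ - a| ≤ r → ‖D.ρ ξ - D.ρ a‖ ≤ L * |ξ - a| := fun ξ hξ =>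
    hlip a ξ (by linarith) (by linarith)
  have haa : |a - a| ≤ r := by simpa using hr0.le
  have hφ₁ : ∀ ξ : ℝ, |ξ - a| ≤ r → ‖(ξ : ℂ) * D.ρ ξ - a * D.ρ a‖ ≤ (1 + |a| * L) * |ξ - a| :=
    fun ξ hξ => by
    have e : (ξ : ℂ) * D.ρ ξ - a * D.ρ a = ((ξ - a : ℝ) : ℂ) * D.ρ ξ + a * (D.ρ ξ - D.ρ a) := by
      push_cast; ring
    rw [e]
    refine (norm_add_le _ _).trans ?_
    rw [norm_mul, norm_mul, Complex.norm_real, Complex.norm_real, Real.norm_eq_abs, Real.norm_eq_abs]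
    have h1 := mul_le_mul_of_nonneg_left (hrho1 ξ hξ) (abs_nonneg (ξ - a))
    have h2 := mul_le_mul_of_nonneg_left (hl ξ hξ) (abs_nonneg a)
    nlinarith
  have hφ₂ : ∀ ξ : ℝ, |ξ - a| ≤ r → ‖(ξ : ℂ) * D.ρ ξ * starRingEnd ℂ (D.ρ ξ) -
      a * D.ρ a * starRingEnd ℂ (D.ρ a)‖ ≤ (1 + |a| * L + |a| * L) * |ξ - a| := fun ξ hξ => by
    have e : (ξ : ℂ) * D.ρ ξ * starRingEnd ℂ (D.ρ ξ) - a * D.ρ a * starRingEnd ℂ (D.ρ a) =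
        ((ξ : ℂ) * D.ρ ξ - a * D.ρ a) * starRingEnd ℂ (D.ρ ξ) +
        a * D.ρ a * starRingEnd ℂ (D.ρ ξ - D.ρ a) := by rw [map_sub]; ring
    rw [e]
    refine (norm_add_le _ _).trans ?_
    rw [norm_mul, norm_mul (_ * _), RCLike.norm_conj, RCLike.norm_conj, norm_mul (a : ℂ),
      Complex.norm_real, Real.norm_eq_abs, add_mul]
    refine add_le_add ?_ ?_
    · exact (mul_le_of_le_one_right (norm_nonneg _) (hrho1 ξ hξ)).trans (hφ₁ ξ hξ)
    · rw [mul_assoc |a|, mul_assoc |a|]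
      refine mul_le_mul_of_nonneg_left ?_ ha0.le
      exact (mul_le_of_le_one_left (norm_nonneg _) (hrho1 a haa)).trans (hl ξ hξ)
  have hmρ : AEStronglyMeasurable (fun ξ : ℝ => (ξ : ℂ) * D.ρ ξ)
      (volume.restrict (Set.Ioc (a - r) (a + r))) :=
    (hreg.integrableOn_mul_rho hR0).1.mono_set hsub
  have hmρ' : AEStronglyMeasurable (fun ξ : ℝ => (ξ : ℂ) * D.ρ ξ * starRingEnd ℂ (D.ρ ξ))
      (volume.restrict (Set.Ioc (a - r) (a + r))) := by
    have h1 : AEStronglyMeasurable (fun ξ : ℝ => (ξ : ℂ)⁻¹ *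
        ((ξ : ℂ) * D.ρ ξ * starRingEnd ℂ ((ξ : ℂ) * D.ρ ξ)))
        (volume.restrict (Set.Ioc (a - r) (a + r))) :=
      (by fun_prop : Measurable fun ξ : ℝ => (ξ : ℂ)⁻¹).aestronglyMeasurable.mul
        (hmρ.mul (Complex.continuous_conj.comp_aestronglyMeasurable hmρ))
    refine h1.congr ?_
    filter_upwards [ae_restrict_mem measurableSet_Ioc] with ξ hξ
    have : (ξ : ℂ) ≠ 0 := fun h0 => by
      rw [Complex.ofReal_eq_zero] at h0
      have := hfar ξ (hmem ξ hξ)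
      rw [h0, abs_zero] at this; linarith
    simp only [map_mul, Complex.conj_ofReal]; field_simp
  have hbox : ∀ k : ℂ, |k.re - a| ≤ r → R₀ ≤ ‖k‖ := fun k hk =>
    (hfar _ hk).le.trans (Complex.abs_re_le_norm k)
  have hbd : ∀ k : ℂ, |k.re - a| ≤ r → |k.im| ≤ r → k.im ≠ 0 → ∀ i j,
      ‖M k i j‖ ≤ C₀ ∧ ‖osc x t k * M k i j‖ ≤ C₀ := fun k h1 h2 h3 i j => by
    have h4 : ‖M k i j‖ ≤ K := (Matrix.norm_entry_le_entrywise_sup_norm _).trans (hK k (hbox k h1) h3)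
    refine ⟨h4.trans hC0, ?_⟩
    rw [norm_mul]
    exact mul_le_mul (norm_osc_le hr0.le hr1 (hra.le.trans hε1) h1 h2) h4 (norm_nonneg _)
      (by positivity)
  have hdiff : ∀ k : ℂ, |k.re - a| ≤ r → k.im ≠ 0 → ∀ i j,
      DifferentiableAt ℂ (fun k => M k i j) k := fun k h1 h2 i j =>
    differentiableAt_mat.1 (h.differentiableAt (hR₀.mem_regularSet k (hbox k h1) h2)) i j
  have hjr := fun (ξ : ℝ) (hξ : |ξ - a| ≤ r) =>
    h.jump_real ξ (hR₀.ne_plus ξ (hfar ξ hξ).le) (hR₀.ne_minus ξ (hfar ξ hξ).le)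
  have hosc : ∀ (ξ : ℝ) (s : Set ℂ), Tendsto (osc x t) (𝓝[s] (ξ : ℂ)) (𝓝 (osc x t ξ)) :=
    fun ξ s => ((continuous_osc x t).tendsto _).mono_left nhdsWithin_le_nhds
  have hmosc : AEStronglyMeasurable (fun ξ : ℝ => osc x t ξ)
      (volume.restrict (Set.Ioc (a - r) (a + r))) :=
    ((continuous_osc x t).comp Complex.continuous_ofReal).aestronglyMeasurable
  -- The Lipschitz constant of ξρ grows like |a|L, but it is multiplied by the radius r = ε/|a|.
  have hfin : ∀ Λ P : ℝ, Λ ≤ 1 + |a| * L + |a| * L → P ≤ ‖(a : ℂ) * D.ρ a‖ →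
      2 * r * Λ * C₀ + P * (4 * C₀) ≤ 8 * C₀ * (1 + 2 * L) * (ε + ‖(a : ℂ) * D.ρ a‖) := by
    intro Λ P h1 h2
    have h3 : r * Λ ≤ (1 + 2 * L) * ε := by
      calc r * Λ ≤ r * (1 + |a| * L + |a| * L) := by gcongr
        _ = r + 2 * L * ε := by rw [← hra]; ring
        _ ≤ _ := by nlinarith
    have h4 : P ≤ (1 + 2 * L) * ‖(a : ℂ) * D.ρ a‖ :=
      h2.trans (le_mul_of_one_le_left (norm_nonneg _) (by linarith))
    have h5 : 0 ≤ (1 + 2 * L) * ε := by positivity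
    have h6 : 0 ≤ (1 + 2 * L) * ‖(a : ℂ) * D.ρ a‖ := by positivity
    have hC : 0 < C₀ := by linarith
    nlinarith
  have hIoc : ∀ ξ ∈ Set.uIcc (a - r) (a + r), |ξ - a| ≤ r := fun ξ hξ => by
    rw [Set.uIcc_of_le (by linarith)] at hξ
    exact abs_le.2 ⟨by linarith [hξ.1], by linarith [hξ.2]⟩
  have hbal : ∀ ξ : ℝ, |ξ - a| ≤ r → R₀ ≤ |ξ| := fun ξ hξ => (hfar ξ hξ).le
  -- For z below the line the form with upper boundary values is a single term; for z above it the
  -- other form has a second term with |ρ|².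
  rcases lt_or_gt_of_ne him with him | him
  · obtain ⟨-, h2⟩ := norm_intervalIntegral_mul_div_le_of_bounded (φ := fun ξ => (ξ : ℂ) * D.ρ ξ)
      (w := fun ξ => osc x t ξ * Mp ξ 0 0) (C := C₀) (Λ := 1 + |a| * L) hr0 ha.symm him.ne
      (by positivity) (by positivity) hmρ
      (hmosc.mul ((h.aestronglyMeasurable_plus hR₀ 0 0).mono_set hsub)) (fun ξ hξ => by
        rw [norm_mul, norm_osc, one_mul]
        refine le_trans ?_ (by linarith : (1 : ℝ) ≤ C₀)
        have := (h.norm_plus_sq hD (hR₀.ne_plus ξ (hbal ξ hξ)) (hR₀.ne_minus ξ (hbal ξ hξ))).1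
        nlinarith [sq_nonneg ‖Mp ξ 1 0‖, norm_nonneg (Mp ξ 0 0)]) hφ₁
      (norm_intervalIntegral_div_le_of_upper (g := fun k => osc x t k * M k 0 0) hr0 ha.symm him
        (fun k h1 h2 h3 => (differentiable_osc x t k).mul (hdiff k h1 h2.ne' 0 0))
        (fun k h1 h2 h3 => (hbd k h1 (by rwa [abs_of_pos h2]) h2.ne' 0 0).2)
        fun ξ hξ => (hosc ξ _).mul (tendsto_mat.1 (hjr ξ hξ.le).1 0 0))
    have h3 : ∫ ξ in (a - r)..(a + r), (ξ : ℂ) * (Mp ξ 0 1 - Mm ξ 0 1) * ((ξ : ℂ) - z)⁻¹ =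
        ∫ ξ in (a - r)..(a + r), (ξ : ℂ) * D.ρ ξ * (osc x t ξ * Mp ξ 0 0 * ((ξ : ℂ) - z)⁻¹) := by
      refine intervalIntegral.integral_congr fun ξ hξ => ?_
      have hb := hbal ξ (hIoc ξ hξ)
      rw [(h.jump_entry_eq (hR₀.ne_plus ξ hb) (hR₀.ne_minus ξ hb)).2]; ring
    rw [h3]
    refine (h2.trans (hfin _ _ (by nlinarith [mul_nonneg ha0.le hL]) le_rfl)).trans ?_
    gcongr; norm_num
  · have hbm : ∀ ξ : ℝ, |ξ - a| ≤ r → ‖Mm ξ‖ ≤ 2 * C₀ := fun ξ hξ => by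
      have h1 := h.norm_minus_le hD (hR₀.ne_plus ξ (hbal ξ hξ)) (hR₀.ne_minus ξ (hbal ξ hξ))
      linarith [hrho1 ξ hξ]
    obtain ⟨i2, h2⟩ := norm_intervalIntegral_mul_div_le_of_bounded (φ := fun ξ => (ξ : ℂ) * D.ρ ξ)
      (w := fun ξ => osc x t ξ * Mm ξ 0 0) (C := 2 * C₀) (Λ := 1 + |a| * L) hr0 ha.symm him.ne'
      (by positivity) (by positivity) hmρ
      (hmosc.mul ((h.aestronglyMeasurable_minus hR₀ 0 0).mono_set hsub)) (fun ξ hξ => by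
        rw [norm_mul, norm_osc, one_mul]
        exact (Matrix.norm_entry_le_entrywise_sup_norm _).trans (hbm ξ hξ)) hφ₁
      ((norm_intervalIntegral_div_le_of_lower (g := fun k => osc x t k * M k 0 0) hr0 ha.symm him
        (fun k h1 h2 h3 => (differentiable_osc x t k).mul (hdiff k h1 h2.ne 0 0))
        (fun k h1 h2 h3 => (hbd k h1 (by rw [abs_of_neg h2]; linarith) h2.ne 0 0).2)
        fun ξ hξ => (hosc ξ _).mul (tendsto_mat.1 (hjr ξ hξ.le).2.1 0 0)).trans (by linarith))
    obtain ⟨i3, h3⟩ := norm_intervalIntegral_mul_div_le_of_bounded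
      (φ := fun ξ => (ξ : ℂ) * D.ρ ξ * starRingEnd ℂ (D.ρ ξ))
      (w := fun ξ => Mm ξ 0 1) (C := 2 * C₀) (Λ := 1 + |a| * L + |a| * L) hr0 ha.symm him.ne'
      (by positivity) (by positivity) hmρ'
      ((h.aestronglyMeasurable_minus hR₀ 0 1).mono_set hsub) (fun ξ hξ =>
        (Matrix.norm_entry_le_entrywise_sup_norm _).trans (hbm ξ hξ)) hφ₂
      ((norm_intervalIntegral_div_le_of_lower (g := fun k => M k 0 1) hr0 ha.symm him
        (fun k h1 h2 h3 => hdiff k h1 h2.ne 0 1)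
        (fun k h1 h2 h3 => (hbd k h1 (by rw [abs_of_neg h2]; linarith) h2.ne 0 1).1)
        fun ξ hξ => tendsto_mat.1 (hjr ξ hξ.le).2.1 0 1).trans (by linarith))
    have h4 : ∫ ξ in (a - r)..(a + r), (ξ : ℂ) * (Mp ξ 0 1 - Mm ξ 0 1) * ((ξ : ℂ) - z)⁻¹ =
        (∫ ξ in (a - r)..(a + r), (ξ : ℂ) * D.ρ ξ * (osc x t ξ * Mm ξ 0 0 * ((ξ : ℂ) - z)⁻¹)) +
        ∫ ξ in (a - r)..(a + r), (ξ : ℂ) * D.ρ ξ * starRingEnd ℂ (D.ρ ξ) *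
          (Mm ξ 0 1 * ((ξ : ℂ) - z)⁻¹) := by
      rw [← intervalIntegral.integral_add i2 i3]
      refine intervalIntegral.integral_congr fun ξ hξ => ?_
      have hb := hbal ξ (hIoc ξ hξ)
      rw [(h.jump_entry_eq (hR₀.ne_plus ξ hb) (hR₀.ne_minus ξ hb)).1]; ring
    rw [h4]
    refine (norm_add_le _ _).trans ?_
    have h5 := hfin (1 + |a| * L) ‖(a : ℂ) * D.ρ a‖ (by nlinarith [mul_nonneg ha0.le hL]) le_rfl
    have h6 := hfin (1 + |a| * L + |a| * L) ‖(a : ℂ) * D.ρ a * starRingEnd ℂ (D.ρ a)‖ le_rfl (by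
      rw [norm_mul _ (starRingEnd ℂ _), RCLike.norm_conj]
      exact mul_le_of_le_one_right (norm_nonneg _) (hrho1 a haa))
    linarith

end IsSolution

end RHPData

end CounterflowNLS

/-! ### The limit at infinity, up to the real line -/

namespace CounterflowNLS

attribute [local instance] Matrix.normedAddCommGroup Matrix.normedSpace

/-- Away from the real direction the kernel is O(1/‖z‖). Otherwise a = Re z is large and the rays
split into three pieces: |ξ| ≤ |a|/2, where the kernel is at most 2/|a|; |ξ| > |a|/2 off the window
around a, where it is at most 2|ξ|/ε and a tail of the integral of |ξG| appears; and the window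
itself, where `hnear` applies. -/
theorem tendsto_setIntegral_div_of_near {G : ℝ → ℂ} {p : ℝ → ℝ} {R R' C : ℝ} (hR : 0 < R)
    (hC : 0 ≤ C) (hG : IntegrableOn G (rays R)) (hG' : IntegrableOn (fun ξ : ℝ => (ξ : ℂ) * G ξ) (rays R))
    (hnear : ∀ (ε : ℝ) (z : ℂ), 0 < ε → ε ≤ 1 → R' ≤ |z.re| → z.im ≠ 0 →
      ‖∫ ξ in (z.re - ε / |z.re|)..(z.re + ε / |z.re|), G ξ * ((ξ : ℂ) - z)⁻¹‖ ≤ C * (ε + p z.re))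
    (hp : Tendsto p (cocompact ℝ) (𝓝 0)) :
    Tendsto (fun z => ∫ ξ in rays R, G ξ * ((ξ : ℂ) - z)⁻¹)
      (Bornology.cobounded ℂ ⊓ 𝓟 {z | z.im ≠ 0}) (𝓝 0) := by
  set g₀ : ℝ → ℝ := (rays R).indicator fun ξ => ‖G ξ‖ with hg₀
  set H : ℝ → ℝ := (rays R).indicator fun ξ => ‖(ξ : ℂ) * G ξ‖ with hH
  have ig₀ : Integrable g₀ := (IntegrableOn.integrable_indicator hG (measurableSet_rays R)).norm.congr (ae_of_all _ fun ξ => by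
    simp only [hg₀, norm_indicator_eq_indicator_norm])
  have iH : Integrable H := (IntegrableOn.integrable_indicator hG' (measurableSet_rays R)).norm.congr (ae_of_all _ fun ξ => by
    simp only [hH, norm_indicator_eq_indicator_norm])
  have hg₀0 : ∀ ξ, 0 ≤ g₀ ξ := fun ξ => Set.indicator_nonneg (fun _ _ => norm_nonneg _) ξ
  have hH0 : ∀ ξ, 0 ≤ H ξ := fun ξ => Set.indicator_nonneg (fun _ _ => norm_nonneg _) ξ
  have hfar : ∀ (z : ℂ) (S : Set ℝ), S ⊆ rays R → MeasurableSet S → ∀ K₁ K₂ A : ℝ, 0 ≤ K₁ → 0 ≤ K₂ →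
      (∀ ξ ∈ S, |ξ| ≤ A → ‖((ξ : ℂ) - z)⁻¹‖ ≤ K₁) →
      (∀ ξ ∈ S, A < |ξ| → ‖((ξ : ℂ) - z)⁻¹‖ ≤ K₂ * |ξ|) →
      ‖∫ ξ in S, G ξ * ((ξ : ℂ) - z)⁻¹‖ ≤ K₁ * (∫ ξ, g₀ ξ) + K₂ * ∫ ξ in rays A, H ξ := by
    intro z S hS hmS K₁ K₂ A h1 h2 h3 h4
    have hi : Integrable fun ξ => K₁ * g₀ ξ + K₂ * (rays A).indicator H ξ :=
      (ig₀.const_mul K₁).add ((iH.indicator (measurableSet_rays A)).const_mul K₂)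
    have hnn : ∀ ξ, 0 ≤ K₂ * (rays A).indicator H ξ := fun ξ =>
      mul_nonneg h2 (Set.indicator_nonneg (fun _ _ => hH0 _) _)
    have hb : ‖∫ ξ in S, G ξ * ((ξ : ℂ) - z)⁻¹‖ ≤
        ∫ ξ in S, (K₁ * g₀ ξ + K₂ * (rays A).indicator H ξ) := by
      refine norm_integral_le_of_norm_le hi.integrableOn ?_
      filter_upwards [ae_restrict_mem hmS] with ξ hξ
      have e1 : g₀ ξ = ‖G ξ‖ := Set.indicator_of_mem (hS hξ) _
      have e2 : H ξ = ‖(ξ : ℂ) * G ξ‖ := Set.indicator_of_mem (hS hξ) _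
      rw [norm_mul]
      by_cases hA : |ξ| ≤ A
      · rw [e1, mul_comm]
        exact (mul_le_mul_of_nonneg_right (h3 ξ hξ hA) (norm_nonneg _)).trans
          (le_add_of_nonneg_right (hnn ξ))
      · rw [not_le] at hA
        rw [Set.indicator_of_mem (show ξ ∈ rays A from hA), e2, norm_mul, Complex.norm_real,
          Real.norm_eq_abs]
        refine le_trans ?_ (le_add_of_nonneg_left (mul_nonneg h1 (hg₀0 ξ)))
        calc ‖G ξ‖ * ‖((ξ : ℂ) - z)⁻¹‖ ≤ ‖G ξ‖ * (K₂ * |ξ|) := by gcongr; exact h4 ξ hξ hA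
          _ = _ := by ring
    refine hb.trans ((setIntegral_le_integral hi (ae_of_all _ fun ξ =>
      add_nonneg (mul_nonneg h1 (hg₀0 ξ)) (hnn ξ))).trans (le_of_eq ?_))
    rw [integral_add (ig₀.const_mul K₁) ((iH.indicator (measurableSet_rays A)).const_mul K₂),
      integral_const_mul, integral_const_mul, integral_indicator (measurableSet_rays A)]
  have I0 : 0 ≤ ∫ ξ, g₀ ξ := integral_nonneg hg₀0
  rw [Metric.tendsto_nhds]
  intro η hη
  -- The window size is fixed first, so that Cε ≤ η/2; all other terms vanish as |a| grows with ε
  -- held fixed.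
  set ε := min 1 (η / (2 * (C + 1))) with hε
  have hε0 : 0 < ε := lt_min one_pos (by positivity)
  have hε1 : ε ≤ 1 := min_le_left _ _
  have hεη : C * ε ≤ η / 2 := by
    calc C * ε ≤ (C + 1) * (η / (2 * (C + 1))) := by gcongr; linarith; exact min_le_right _ _
      _ = η / 2 := by field_simp
  have hlim : Tendsto (fun a : ℝ => 2 * |a|⁻¹ * (∫ ξ, g₀ ξ) + 2 * ε⁻¹ * (∫ ξ in rays (|a| / 2), H ξ) +
      C * p a) (cocompact ℝ) (𝓝 0) := by
    have h1 : Tendsto (fun a : ℝ => 2 * |a|⁻¹ * (∫ ξ, g₀ ξ)) (cocompact ℝ) (𝓝 0) := by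
      simpa using ((tendsto_inv_atTop_zero.comp tendsto_abs_cocompact).const_mul 2).mul_const
        (∫ ξ, g₀ ξ)
    have h2 : Tendsto (fun a : ℝ => 2 * ε⁻¹ * (∫ ξ in rays (|a| / 2), H ξ)) (cocompact ℝ) (𝓝 0) := by
      simpa using ((tendsto_setIntegral_rays iH).comp
        (tendsto_abs_cocompact.atTop_div_const two_pos)).const_mul (2 * ε⁻¹)
    simpa using (h1.add h2).add (hp.const_mul C)
  have hev := (hlim.eventually (gt_mem_nhds (half_pos hη))).and
    (tendsto_abs_cocompact.eventually (eventually_ge_atTop (max R' (2 * R + 2))))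
  rw [← Metric.cobounded_eq_cocompact,
    (Metric.hasBasis_cobounded_compl_closedBall (0 : ℝ)).eventually_iff] at hev
  obtain ⟨B, -, hB⟩ := hev
  rw [eventually_inf_principal, (Metric.hasBasis_cobounded_compl_closedBall (0 : ℂ)).eventually_iff]
  refine ⟨max (2 * |B|) (2 * (∫ ξ, g₀ ξ) / η), trivial, fun z hz him => ?_⟩
  rw [Set.mem_compl_iff, mem_closedBall_zero_iff, not_le, max_lt_iff, div_lt_iff₀ hη] at hz
  rw [dist_zero_right]
  have him : z.im ≠ 0 := him
  have hz0 : 0 < ‖z‖ := by linarith [abs_nonneg B]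
  -- In the first case |Im z| exceeds ‖z‖/2 and bounds the kernel on all of the rays.
  by_cases hre : |z.re| < ‖z‖ / 2
  · have h1 : ‖∫ ξ in rays R, G ξ * ((ξ : ℂ) - z)⁻¹‖ ≤ ∫ ξ in rays R, 2 * ‖z‖⁻¹ * ‖G ξ‖ := by
      refine norm_integral_le_of_norm_le (hG.norm.const_mul _) (ae_of_all _ fun ξ => ?_)
      rw [norm_mul, mul_comm, norm_inv]
      refine mul_le_mul_of_nonneg_right ?_ (norm_nonneg _)
      have h2 := Complex.norm_le_abs_re_add_abs_im z
      rw [← inv_inv (2 : ℝ), ← mul_inv]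
      exact inv_anti₀ (by positivity) (by linarith [abs_im_le_norm_ofReal_sub ξ z])
    have h2 : ∫ ξ in rays R, ‖G ξ‖ = ∫ ξ, g₀ ξ := (integral_indicator (measurableSet_rays R)).symm
    rw [integral_const_mul, h2] at h1
    refine h1.trans_lt ?_
    calc 2 * ‖z‖⁻¹ * (∫ ξ, g₀ ξ) = 2 * (∫ ξ, g₀ ξ) / ‖z‖ := by ring
      _ < η := by rw [div_lt_iff₀ hz0]; linarith [hz.2]
  · rw [not_lt] at hre
    set a := z.re with ha
    have haB : a ∈ (Metric.closedBall (0 : ℝ) B)ᶜ := by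
      rw [Set.mem_compl_iff, mem_closedBall_zero_iff, not_le, Real.norm_eq_abs]
      linarith [le_abs_self B]
    obtain ⟨h1, h2⟩ := hB haB
    rw [max_le_iff] at h2
    have ha0 : 0 < |a| := by linarith
    have h3 := hnear ε z hε0 hε1 h2.1 him
    set r := ε / |a| with hr
    have hr0 : 0 < r := by positivity
    have hr1 : r ≤ 1 := by rw [hr, div_le_one ha0]; linarith
    have hsub : Set.Ioc (a - r) (a + r) ⊆ rays R := fun ξ hξ => by
      have h4 : |ξ - a| ≤ r := abs_le.2 ⟨by linarith [hξ.1], by linarith [hξ.2]⟩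
      have := abs_sub_abs_le_abs_sub a ξ
      rw [abs_sub_comm] at this
      change R < |ξ|; linarith
    have hint : IntegrableOn (fun ξ => G ξ * ((ξ : ℂ) - z)⁻¹) (rays R) := by
      refine Integrable.mul_bdd (c := |z.im|⁻¹) hG
        (by fun_prop : Measurable fun ξ : ℝ => ((ξ : ℂ) - z)⁻¹).aestronglyMeasurable
        (ae_of_all _ fun ξ => ?_)
      rw [norm_inv]
      exact inv_anti₀ (abs_pos.2 him) (abs_im_le_norm_ofReal_sub ξ z)
    have h5 := hfar z (rays R \ Set.Ioc (a - r) (a + r)) Set.sdiff_subset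
      ((measurableSet_rays R).diff measurableSet_Ioc) (2 * |a|⁻¹) (2 * ε⁻¹) (|a| / 2)
      (by positivity) (by positivity) (fun ξ _ hξ => by
        rw [norm_inv, ← inv_inv (2 : ℝ), ← mul_inv]
        refine inv_anti₀ (by positivity) ?_
        have h6 := Complex.abs_re_le_norm ((ξ : ℂ) - z)
        rw [Complex.sub_re, Complex.ofReal_re, ← ha] at h6
        have h7 := abs_sub_abs_le_abs_sub a ξ
        rw [abs_sub_comm] at h7
        linarith) (fun ξ hξ hA => by
        have h6 := Complex.abs_re_le_norm ((ξ : ℂ) - z)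
        rw [Complex.sub_re, Complex.ofReal_re, ← ha] at h6
        have h7 : r ≤ |ξ - a| := by
          by_contra hlt
          rw [not_le, abs_lt] at hlt
          exact hξ.2 ⟨by linarith [hlt.1], by linarith [hlt.2]⟩
        rw [norm_inv]
        calc ‖(ξ : ℂ) - z‖⁻¹ ≤ r⁻¹ := inv_anti₀ hr0 (h7.trans h6)
          _ = ε⁻¹ * |a| := by rw [hr, inv_div]; ring
          _ ≤ ε⁻¹ * (2 * |ξ|) := by gcongr; linarith
          _ = _ := by ring)
    rw [intervalIntegral.integral_of_le (by linarith)] at h3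
    have h8 := setIntegral_sdiff measurableSet_Ioc hint hsub
    have h9 := norm_add_le (∫ ξ in rays R \ Set.Ioc (a - r) (a + r), G ξ * ((ξ : ℂ) - z)⁻¹)
      (∫ ξ in Set.Ioc (a - r) (a + r), G ξ * ((ξ : ℂ) - z)⁻¹)
    rw [h8, sub_add_cancel, ← h8] at h9
    linarith

end CounterflowNLS

namespace CounterflowNLS

attribute [local instance] Matrix.normedAddCommGroup Matrix.normedSpace

section Kernel

/-- From z/(k - z) = k/(k - z) - 1: multiplication by z moves one power of k into the density and
splits off the leading coefficient. -/
theorem mul_pairing_cauchy {d : ℂ → ℂ} {j : ℝ → ℂ} {R : ℝ} {z : ℂ} (hR0 : 0 < R)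
    (hci : CircleIntegrable d 0 R) (hj : IntegrableOn j (rays R)) (hz : R < ‖z‖) (him : z.im ≠ 0) :
    z * pairing R d j (fun k => (k - z)⁻¹) = (∮ k in C(0, R), (k * (k - z)⁻¹) * d k) +
      (∫ ξ in rays R, (ξ : ℂ) * j ξ * ((ξ : ℂ) - z)⁻¹) - pairing R d j (fun _ => 1) := by
  have hk0 : ∀ k : ℂ, k ∈ Metric.sphere (0 : ℂ) R → k - z ≠ 0 := fun k hk h0 => by
    rw [mem_sphere_zero_iff_norm] at hk
    rw [sub_eq_zero.1 h0] at hk; linarith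
  have hcont : ContinuousOn (fun k : ℂ => (k - z)⁻¹) (Metric.sphere 0 R) :=
    ContinuousOn.inv₀ (by fun_prop) hk0
  have hi : CircleIntegrable (fun k => (k - z)⁻¹ * d k) 0 R :=
    CircleIntegrable.smul_of_continuous hci hR0.le hcont
  have hi' : CircleIntegrable (fun k => z * ((k - z)⁻¹ * d k)) 0 R :=
    CircleIntegrable.smul_of_continuous hi hR0.le continuousOn_const
  have h1 : (∮ k in C(0, R), (k * (k - z)⁻¹) * d k) =
      z * (∮ k in C(0, R), (k - z)⁻¹ * d k) + ∮ k in C(0, R), d k := by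
    rw [← circleIntegral.integral_const_mul, ← circleIntegral.integral_add hi' hci]
    refine circleIntegral.integral_congr hR0.le fun k hk => ?_
    have := hk0 k hk
    field_simp; ring
  have h2 : (∫ ξ in rays R, (ξ : ℂ) * j ξ * ((ξ : ℂ) - z)⁻¹) =
      z * (∫ ξ in rays R, ((ξ : ℂ) - z)⁻¹ * j ξ) + ∫ ξ in rays R, j ξ := by
    rw [← integral_const_mul, ← integral_add _ hj]
    · refine integral_congr_ae (ae_of_all _ fun ξ => ?_)
      have : (ξ : ℂ) - z ≠ 0 := fun h0 => by
        have := congrArg Complex.im h0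
        simp at this; exact him this
      simp only; field_simp; ring
    · refine (Integrable.bdd_mul (c := |z.im|⁻¹) hj
        (by fun_prop : Measurable fun ξ : ℝ => ((ξ : ℂ) - z)⁻¹).aestronglyMeasurable
        (ae_of_all _ fun ξ => ?_)).const_mul z
      rw [norm_inv]
      exact inv_anti₀ (abs_pos.2 him) (abs_im_le_norm_ofReal_sub ξ z)
  rw [h1, h2]
  simp only [pairing, smul_eq_mul, one_mul]
  ring

theorem tendsto_circleIntegral_mul_cauchy {d : ℂ → ℂ} {R K : ℝ} (hR0 : 0 < R)
    (hb : ∀ k : ℂ, ‖k‖ = R → k.im ≠ 0 → ‖d k‖ ≤ K) :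
    Tendsto (fun z : ℂ => ∮ k in C(0, R), (k * (k - z)⁻¹) * d k)
      (Bornology.cobounded ℂ ⊓ 𝓟 {k : ℂ | k.im ≠ 0}) (𝓝 0) := by
  have hln : Tendsto (fun z : ℂ => ‖z‖) (Bornology.cobounded ℂ ⊓ 𝓟 {k : ℂ | k.im ≠ 0}) atTop :=
    tendsto_norm_cobounded_atTop.mono_left inf_le_left
  have hli : ∀ᶠ z in Bornology.cobounded ℂ ⊓ 𝓟 {k : ℂ | k.im ≠ 0}, z.im ≠ 0 :=
    mem_inf_of_right (mem_principal_self _)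
  have hz : Tendsto (fun z : ℂ => 2 * Real.pi * R * (R * (2 * ‖z‖⁻¹) * K)) (Bornology.cobounded ℂ ⊓ 𝓟 {k : ℂ | k.im ≠ 0})
      (𝓝 0) := by
    have := ((((tendsto_inv_atTop_zero.comp hln).const_mul 2).const_mul R).mul_const K).const_mul
      (2 * Real.pi * R)
    simpa using this
  refine squeeze_zero_norm' ?_ hz
  filter_upwards [hln.eventually (eventually_gt_atTop (2 * R)), hli] with z hz him
  have := norm_pairing_le (j := fun _ => (0 : ℂ)) (g := fun _ => 0) (κ := fun k => k * (k - z)⁻¹)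
    (K₁ := R * (2 * ‖z‖⁻¹)) (K₂ := 1 + ‖z‖ * |z.im|⁻¹) hR0 hb (fun _ _ => by simp) integrableOn_zero
    (fun k hk => by
      rw [norm_mul, hk, norm_inv]
      gcongr
      rw [← inv_inv (2 : ℝ), ← mul_inv]
      refine inv_anti₀ (by linarith) ?_
      have := norm_sub_norm_le z k
      rw [norm_sub_rev] at this; linarith) (fun ξ hξ => by
      have hne : (ξ : ℂ) - z ≠ 0 := fun h0 => by
        have := congrArg Complex.im h0
        simp at this; exact him this
      have e : (ξ : ℂ) * ((ξ : ℂ) - z)⁻¹ = 1 + z * ((ξ : ℂ) - z)⁻¹ := by field_simp; ring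
      rw [e]
      refine (norm_add_le _ _).trans ?_
      rw [norm_one, norm_mul, norm_inv]
      gcongr
      exact abs_im_le_norm_ofReal_sub ξ z)
  simpa [pairing] using this

end Kernel

namespace RHPData

namespace IsSolution

variable {D : RHPData} {x t : ℝ} {M Mp Mm : ℂ → Mat2}

theorem integrableOn_jump (h : D.IsSolution x t M Mp Mm) (hD : D.Admissible) (hreg : D.Regular)
    {R : ℝ} (hR : D.IsFar R) : IntegrableOn (fun ξ : ℝ => Mp ξ 0 1 - Mm ξ 0 1) (rays R) := by
  refine rayIntegrable_of_norm_le
    ((h.aestronglyMeasurable_plus hR 0 1).sub (h.aestronglyMeasurable_minus hR 0 1))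
    (g := fun ξ => 8 * (R⁻¹ * ‖(ξ : ℂ) * D.ρ ξ‖)) (fun ξ hξ => ?_)
    (((hreg.integrableOn_mul_rho hR.pos).norm.const_mul _).const_mul _)
  refine ((Matrix.norm_entry_le_entrywise_sup_norm (Mp ξ - Mm ξ)).trans
    (h.norm_jump_le hD hR hξ)).trans ?_
  gcongr
  exact norm_rho_le_of_mem_rays hR.pos hξ

/-- After multiplication by z the circle contributes O(1/‖z‖), and the ray integral of ξj(ξ)/(ξ - z)
tends to zero by the local estimate, even when z approaches the real line. -/
theorem tendsto_mul_upper_entry (h : D.IsSolution x t M Mp Mm) (hD : D.Admissible) (hreg : D.Regular)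
    {m₁ : Mat2} (h₁ : HasFirstMoment M m₁) :
    Tendsto (fun k => k * M k 0 1) (Bornology.cobounded ℂ ⊓ 𝓟 {k | k.im ≠ 0}) (𝓝 (m₁ 0 1)) := by
  obtain ⟨R, hR⟩ := exists_isFar hreg
  have hR0 := hR.pos
  obtain ⟨C, hC0, hC⟩ := h.exists_far_bound hR
  obtain ⟨K, hK1, hK⟩ := h.exists_far_norm_le hR
  have hd : ∀ k : ℂ, R ≤ ‖k‖ → k.im ≠ 0 → DifferentiableAt ℂ (fun k => M k 0 1) k :=
    fun k hk him => differentiableAt_mat.1 (h.differentiableAt (hR.mem_regularSet k hk him)) 0 1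
  have hb : ∀ k : ℂ, ‖k‖ = R → k.im ≠ 0 → ‖0 - M k 0 1‖ ≤ K := fun k hk him => by
    rw [zero_sub, norm_neg]
    exact (Matrix.norm_entry_le_entrywise_sup_norm _).trans (hK k hk.ge him)
  have hci : CircleIntegrable (fun k => 0 - M k 0 1) 0 R := circleIntegrable_of_im_ne_zero (B := K) hR0
    (fun k hk him => ((hd k hk.ge him).const_sub 0).continuousAt) hb
  set j : ℝ → ℂ := fun ξ => Mp ξ 0 1 - Mm ξ 0 1
  have hjb : ∀ ξ ∈ rays R, ‖j ξ‖ ≤ 8 * ‖D.ρ ξ‖ := fun ξ hξ =>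
    (Matrix.norm_entry_le_entrywise_sup_norm (Mp ξ - Mm ξ)).trans (h.norm_jump_le hD hR hξ)
  have hj : IntegrableOn j (rays R) := h.integrableOn_jump hD hreg hR
  have hj' : IntegrableOn (fun ξ : ℝ => (ξ : ℂ) * j ξ) (rays R) :=
    rayIntegrable_mul_of_norm_le hj.1 (g := fun ξ => 8 * ‖(ξ : ℂ) * D.ρ ξ‖) (fun ξ hξ => by
      have := mul_le_mul_of_nonneg_left (hjb ξ hξ) (norm_nonneg (ξ : ℂ))
      rw [norm_mul]; linarith) ((hreg.integrableOn_mul_rho hR0).norm.const_mul _)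
  have hj'' : IntegrableOn (fun ξ : ℝ => (ξ : ℂ) * ((ξ : ℂ) * j ξ)) (rays R) := by
    refine rayIntegrable_mul_of_norm_le (j := fun ξ : ℝ => (ξ : ℂ) * j ξ) hj'.1
      (g := fun ξ => 8 * ‖(ξ : ℂ) ^ 2 * D.ρ ξ‖) (fun ξ hξ => ?_)
      (hreg.integrable.norm.const_mul _).integrableOn
    have := mul_le_mul_of_nonneg_left (hjb ξ hξ) (sq_nonneg ‖(ξ : ℂ)‖)
    rw [norm_mul, norm_mul, norm_pow]; linarith
  set P := pairing R (fun k => 0 - M k 0 1) j (fun _ => 1) with hP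
  have key : ∀ z : ℂ, R < ‖z‖ → z.im ≠ 0 → (2 * Real.pi * Complex.I : ℂ) * (z * M z 0 1) =
      (∮ k in C(0, R), (k * (k - z)⁻¹) * (0 - M k 0 1)) +
      (∫ ξ in rays R, (ξ : ℂ) * j ξ * ((ξ : ℂ) - z)⁻¹) - P := by
    intro z hz him
    have h0 := cauchy_outside (F := fun _ => (0 : ℂ)) (G := fun k => M k 0 1) (e := 0) hR0
      (differentiable_const _) hd
      (fun ξ hξ => tendsto_mat.1 (h.jump_real ξ (hR.ne_plus ξ hξ.le) (hR.ne_minus ξ hξ.le)).1 0 1)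
      (fun ξ hξ => tendsto_mat.1 (h.jump_real ξ (hR.ne_plus ξ hξ.le) (hR.ne_minus ξ hξ.le)).2.1 0 1)
      (C := C) (fun k hk him => by
        refine le_trans ?_ (hC k hk him)
        have e : M k 0 1 - 0 = (M k - 1) 0 1 := by simp [Matrix.sub_apply]
        rw [e]
        exact Matrix.norm_entry_le_entrywise_sup_norm _) hz him
    rw [sub_zero, smul_eq_mul] at h0
    rw [← mul_pairing_cauchy hR0 hci hj hz him, ← h0]
    ring
  set l := Bornology.cobounded ℂ ⊓ 𝓟 {k : ℂ | k.im ≠ 0} with hl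
  have hlc : l ≤ Bornology.cobounded ℂ := inf_le_left
  have hln : Tendsto (fun z : ℂ => ‖z‖) l atTop := tendsto_norm_cobounded_atTop.mono_left hlc
  have hli : ∀ᶠ z in l, z.im ≠ 0 := mem_inf_of_right (mem_principal_self _)
  have t1 := tendsto_circleIntegral_mul_cauchy (d := fun k => 0 - M k 0 1) hR0 hb
  obtain ⟨C', R', hC', -, hnear⟩ := h.exists_near_bound hD hreg hR
  have t2 := tendsto_setIntegral_div_of_near (G := fun ξ => (ξ : ℂ) * j ξ)
    (p := fun ξ => ‖(ξ : ℂ) * D.ρ ξ‖) hR0 hC' hj' hj'' hnear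
    (by simpa only [norm_zero] using hreg.tendsto_mul_rho.norm)
  have hc0 : (2 * Real.pi * Complex.I : ℂ) ≠ 0 := by simp [Real.pi_ne_zero]
  have t3 : Tendsto (fun z => z * M z 0 1) l (𝓝 ((2 * Real.pi * Complex.I : ℂ)⁻¹ * (0 + 0 - P))) := by
    refine (((t1.add t2).sub_const P).const_mul (2 * Real.pi * Complex.I : ℂ)⁻¹).congr' ?_
    filter_upwards [hln.eventually (eventually_gt_atTop R), hli] with z hz him
    rw [← key z hz him, inv_mul_cancel_left₀ hc0]
  -- The limit exists by now; its value is read off along the imaginary axis, where the first moment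
  -- is defined.
  have haxis : Tendsto (fun y : ℝ => (y : ℂ) * Complex.I) (cocompact ℝ) l := by
    refine tendsto_inf.2 ⟨tendsto_norm_atTop_iff_cobounded.1 (by simpa using tendsto_abs_cocompact),
      tendsto_principal.2 ?_⟩
    filter_upwards [eventually_cocompact_far 0] with y hy using hy.2
  have t4 : Tendsto (fun y : ℝ => ((y : ℂ) * Complex.I) * M (y * Complex.I) 0 1) (cocompact ℝ)
      (𝓝 (m₁ 0 1)) := by
    refine (tendsto_mat.1 h₁ 0 1).congr fun y => ?_
    simp
  rwa [tendsto_nhds_unique (t3.comp haxis) t4] at t3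

theorem tendsto_potentialMatrix (h : D.IsSolution x t M Mp Mm) (hD : D.Admissible)
    (hreg : D.Regular) {m₁ : Mat2} (h₁ : HasFirstMoment M m₁) :
    Tendsto (fun k : ℂ => (-Complex.I) • (k • (sigma3 * M k - M k * sigma3)))
      (Bornology.cobounded ℂ ⊓ 𝓟 D.contourᶜ) (𝓝 (potentialMatrix (-2 * Complex.I * m₁ 0 1))) := by
  have hm := h.conjTranspose_first_moment hD hreg h₁
  obtain ⟨R, hR⟩ := exists_isFar hreg
  set l := Bornology.cobounded ℂ ⊓ 𝓟 {k : ℂ | k.im ≠ 0} with hl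
  have hle : Bornology.cobounded ℂ ⊓ 𝓟 D.contourᶜ ≤ l :=
    inf_le_inf_left _ (principal_mono.2 fun k hk him => hk (Or.inl (Or.inl him)))
  have hln : Tendsto (fun z : ℂ => ‖z‖) l atTop := tendsto_norm_cobounded_atTop.mono_left inf_le_left
  have hli : ∀ᶠ z in l, z.im ≠ 0 := mem_inf_of_right (mem_principal_self _)
  have hreg' : ∀ᶠ z in l, z ∈ D.regularSet := by
    filter_upwards [hln.eventually (eventually_ge_atTop R), hli] with z h1 h2
      using hR.mem_regularSet z h1 h2
  have hcont : l ≤ Bornology.cobounded ℂ ⊓ 𝓟 D.contourᶜ := le_inf inf_le_left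
    (le_principal_iff.2 (hreg'.mono fun z hz => D.regularSet_subset hz))
  have hconj : Tendsto (starRingEnd ℂ) l l := by
    refine tendsto_inf.2 ⟨?_, tendsto_principal.2 (hli.mono fun z hz => by simpa using hz)⟩
    rw [← tendsto_norm_atTop_iff_cobounded]
    simpa using hln
  have h01 := h.tendsto_mul_upper_entry hD hreg h₁
  have hone := h.tendsto_one.mono_left hcont
  -- The lower left entry needs no second analysis: an entry of M(k) M(k̄)ᴴ = I expresses it by the
  -- upper right entry at k̄ and by diagonal entries that tend to 1.
  have h10 : Tendsto (fun k => k * M k 1 0) l (𝓝 (m₁ 1 0)) := by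
    have a1 := (Complex.continuous_conj.tendsto _).comp (h01.comp hconj)
    have a2 := (Complex.continuous_conj.tendsto _).comp ((tendsto_mat.1 hone 0 0).comp hconj)
    have a3 := ((tendsto_mat.1 hone 1 1).neg.mul a1).div a2 (by simp)
    have hlim : -(1 : Mat2) 1 1 * starRingEnd ℂ (m₁ 0 1) / starRingEnd ℂ ((1 : Mat2) 0 0) = m₁ 1 0 := by
      have := congrFun (congrFun hm 1) 0
      simp [Matrix.conjTranspose_apply] at this
      simp [this]
    rw [hlim] at a3
    refine a3.congr' ?_
    have a4 := ((tendsto_mat.1 hone 0 0).comp hconj).eventually_ne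
      (b₂ := (0 : ℂ)) (by simp)
    filter_upwards [a4, hreg'] with k hk hkr
    have a5 := congrFun (congrFun (h.twist_self hD hkr) 1) 0
    simp [Matrix.mul_apply, Fin.sum_univ_two, Matrix.conjTranspose_apply] at a5
    have hk' : starRingEnd ℂ (M (starRingEnd ℂ k) 0 0) ≠ 0 := by simpa using hk
    simp only [Pi.div_apply, Function.comp_apply, map_mul, Complex.conj_conj]
    field_simp
    linear_combination -k * a5
  refine tendsto_mat.2 fun i j => ?_
  fin_cases i <;> fin_cases j
  · simp [potentialMatrix, sigma3, Matrix.mul_apply, Fin.sum_univ_two, Matrix.vecMul, dotProduct]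
    exact tendsto_const_nhds
  · refine ((h01.mono_left hle).const_mul (-2 * Complex.I)).congr fun k => ?_
    simp [sigma3, Matrix.mul_apply, Fin.sum_univ_two, Matrix.vecMul, dotProduct]
    ring
  · have e : potentialMatrix (-2 * Complex.I * m₁ 0 1) 1 0 = 2 * Complex.I * m₁ 1 0 := by
      have := congrFun (congrFun hm 1) 0
      simp [Matrix.conjTranspose_apply] at this
      simp [potentialMatrix, this, Complex.conj_ofNat]
    change Tendsto _ _ (𝓝 (potentialMatrix (-2 * Complex.I * m₁ 0 1) 1 0))
    rw [e]
    refine ((h10.mono_left hle).const_mul (2 * Complex.I)).congr fun k => ?_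
    simp [sigma3, Matrix.mul_apply, Fin.sum_univ_two, Matrix.vecMul, dotProduct]
    ring
  · simp [potentialMatrix, sigma3, Matrix.mul_apply, Fin.sum_univ_two, Matrix.vecMul, dotProduct]
    exact tendsto_const_nhds

end IsSolution

end RHPData

end CounterflowNLS

/-! ### Cauchy's theorem on a square cut by three lines -/

namespace CounterflowNLS

section Column

theorem tendsto_sub_mul_I (ξ : ℝ) :
    Tendsto (fun η : ℝ => (ξ : ℂ) + η * Complex.I) (𝓝[<] 0) (𝓝[{z | z.im < 0}] (ξ : ℂ)) := by
  refine tendsto_nhdsWithin_iff.2 ⟨?_, ?_⟩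
  · have : Continuous fun η : ℝ => (ξ : ℂ) + η * Complex.I := by fun_prop
    exact (this.tendsto' 0 _ (by simp)).mono_left nhdsWithin_le_nhds
  · filter_upwards [self_mem_nhdsWithin] with η hη
    simpa using hη

theorem tendsto_ofReal_add_left (c y : ℝ) : Tendsto (fun u : ℝ => (u : ℂ) + y * Complex.I) (𝓝[<] c)
    (𝓝[{z | z.re < c}] ((c : ℂ) + y * Complex.I)) := by
  refine tendsto_nhdsWithin_iff.2 ⟨?_, ?_⟩
  · have : Continuous fun u : ℝ => (u : ℂ) + y * Complex.I := by fun_prop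
    exact (this.tendsto c).mono_left nhdsWithin_le_nhds
  · filter_upwards [self_mem_nhdsWithin] with η hη
    simpa using hη

theorem tendsto_ofReal_add_right (c y : ℝ) : Tendsto (fun u : ℝ => (u : ℂ) + y * Complex.I) (𝓝[>] c)
    (𝓝[{z | c < z.re}] ((c : ℂ) + y * Complex.I)) := by
  refine tendsto_nhdsWithin_iff.2 ⟨?_, ?_⟩
  · have : Continuous fun u : ℝ => (u : ℂ) + y * Complex.I := by fun_prop
    exact (this.tendsto c).mono_left nhdsWithin_le_nhds
  · filter_upwards [self_mem_nhdsWithin] with η hη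
    simpa using hη

/-- Cauchy's theorem for a column that is cut by the real line. -/
theorem column_integral_eq_zero {g : ℂ → ℂ} {x₀ x₁ S : ℝ} {gp gm gl gr : ℝ → ℂ} {g₁ g₂ : ℝ → ℝ}
    (hx : x₀ < x₁) (hS : 0 < S)
    (hd : ∀ k : ℂ, x₀ < k.re → k.re < x₁ → k.im ≠ 0 → DifferentiableAt ℂ g k)
    (hp : ∀ x ∈ Set.Ioo x₀ x₁, Tendsto g (𝓝[{z | 0 < z.im}] (x : ℂ)) (𝓝 (gp x)))
    (hm : ∀ x ∈ Set.Ioo x₀ x₁, Tendsto g (𝓝[{z | z.im < 0}] (x : ℂ)) (𝓝 (gm x)))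
    (hr : ∀ᵐ y : ℝ, Tendsto g (𝓝[{z | z.re < x₁}] ((x₁ : ℂ) + y * Complex.I)) (𝓝 (gl y)))
    (hl : ∀ᵐ y : ℝ, Tendsto g (𝓝[{z | x₀ < z.re}] ((x₀ : ℂ) + y * Complex.I)) (𝓝 (gr y)))
    (h₁ : ∀ x ∈ Set.Ioo x₀ x₁, ∀ y ∈ Set.Ioo (-S) S, y ≠ 0 → ‖g (x + y * Complex.I)‖ ≤ g₁ x)
    (h₂ : ∀ᵐ y : ℝ, y ∈ Set.Ioo (-S) S → ∀ x ∈ Set.Ioo x₀ x₁, ‖g (x + y * Complex.I)‖ ≤ g₂ y)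
    (hg₁ : IntegrableOn g₁ (Set.Ioo x₀ x₁)) (hg₂ : IntegrableOn g₂ (Set.Ioo (-S) S)) :
    (IntervalIntegrable gp volume x₀ x₁ ∧ IntervalIntegrable gm volume x₀ x₁ ∧
      IntervalIntegrable (fun x : ℝ => g (x + S * Complex.I)) volume x₀ x₁ ∧
      IntervalIntegrable (fun x : ℝ => g (x - S * Complex.I)) volume x₀ x₁ ∧
      IntervalIntegrable gl volume (-S) S ∧ IntervalIntegrable gr volume (-S) S) ∧
    (∫ x in x₀..x₁, (gp x - gm x)) - (∫ x in x₀..x₁, g (x + S * Complex.I)) +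
      (∫ x in x₀..x₁, g (x - S * Complex.I)) + Complex.I * (∫ y in (-S)..S, gl y) -
      Complex.I * (∫ y in (-S)..S, gr y) = 0 := by
  have hre : ∀ u v : ℝ, ((u : ℂ) + v * Complex.I).re = u := fun u v => by simp
  have him : ∀ u v : ℝ, ((u : ℂ) + v * Complex.I).im = v := fun u v => by simp
  have hc : ∀ x ∈ Set.Ioo x₀ x₁, ∀ y : ℝ, y ≠ 0 →
      Tendsto (fun v : ℝ => g (x + v * Complex.I)) (𝓝 y) (𝓝 (g (x + y * Complex.I))) := by
    intro x hx y hy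
    have h1 := (hd (x + y * Complex.I) (by rw [hre]; exact hx.1) (by rw [hre]; exact hx.2)
      (by rwa [him])).continuousAt
    have h2 : Continuous fun v : ℝ => (x : ℂ) + v * Complex.I := by fun_prop
    exact h1.tendsto.comp (h2.tendsto y)
  have hrl : ∀ᵐ y : ℝ, Tendsto (fun u : ℝ => g (u + y * Complex.I)) (𝓝[<] x₁) (𝓝 (gl y)) :=
    hr.mono fun y hy => hy.comp (tendsto_ofReal_add_left x₁ y)
  have hll : ∀ᵐ y : ℝ, Tendsto (fun u : ℝ => g (u + y * Complex.I)) (𝓝[>] x₀) (𝓝 (gr y)) :=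
    hl.mono fun y hy => hy.comp (tendsto_ofReal_add_right x₀ y)
  have up := integral_boundary_rect_eq_zero_of_dominated (f := g) (fb := gp)
    (ft := fun x => g (x + S * Complex.I)) (fl := gr) (fr := gl) hx hS (fun k hk => by
      rw [Complex.mem_reProdIm] at hk
      exact (hd k hk.1.1 hk.1.2 hk.2.1.ne').differentiableWithinAt)
    (ae_of_all _ fun x hx => (hp x hx).comp (tendsto_add_mul_I x))
    (ae_of_all _ fun x hx => (hc x hx S hS.ne').mono_left nhdsWithin_le_nhds)
    (hll.mono fun y hy _ => hy) (hrl.mono fun y hy _ => hy)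
    (fun x hx y hy => h₁ x hx y ⟨by linarith [hy.1], hy.2⟩ hy.1.ne')
    (h₂.mono fun y h hy => h ⟨by linarith [hy.1], hy.2⟩) hg₁
    (hg₂.mono_set (Set.Ioo_subset_Ioo_left (by linarith)))
  have down := integral_boundary_rect_eq_zero_of_dominated (f := g) (ft := gm)
    (fb := fun x => g (x - S * Complex.I)) (fl := gr) (fr := gl) hx (neg_lt_zero.2 hS) (fun k hk => by
      rw [Complex.mem_reProdIm] at hk
      exact (hd k hk.1.1 hk.1.2 hk.2.2.ne).differentiableWithinAt)
    (ae_of_all _ fun x hx => by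
      have := (hc x hx (-S) (by linarith)).mono_left (nhdsWithin_le_nhds (s := Set.Ioi (-S)))
      simpa [sub_eq_add_neg] using this)
    (ae_of_all _ fun x hx => (hm x hx).comp (tendsto_sub_mul_I x))
    (hll.mono fun y hy _ => hy) (hrl.mono fun y hy _ => hy)
    (fun x hx y hy => h₁ x hx y ⟨hy.1, by linarith [hy.2]⟩ hy.2.ne)
    (h₂.mono fun y h hy => h ⟨hy.1, by linarith [hy.2]⟩) hg₁
    (hg₂.mono_set (Set.Ioo_subset_Ioo_right (by linarith)))
  have cv : ∀ {f : ℝ → ℂ} {a b : ℝ}, a < b → IntegrableOn f (Set.Ioo a b) →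
      IntervalIntegrable f volume a b := fun hab hf =>
    (intervalIntegrable_iff_integrableOn_Ioo_of_le hab.le).2 hf
  obtain ⟨⟨u1, u2, u3, u4⟩, ue⟩ := up
  obtain ⟨⟨d1, d2, d3, d4⟩, de⟩ := down
  have u3 := cv hS u3
  have u4 := cv hS u4
  have d3 := cv (neg_lt_zero.2 hS) d3
  have d4 := cv (neg_lt_zero.2 hS) d4
  refine ⟨⟨cv hx u1, cv hx d2, cv hx u2, cv hx d1, d4.trans u4, d3.trans u3⟩, ?_⟩
  rw [intervalIntegral.integral_sub (cv hx u1) (cv hx d2),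
    ← intervalIntegral.integral_add_adjacent_intervals d4 u4,
    ← intervalIntegral.integral_add_adjacent_intervals d3 u3]
  simp only [smul_eq_mul] at ue de
  linear_combination ue + de

/-- Cauchy's theorem for a square that is cut by the real line and by two vertical lines. -/
theorem square_integral_eq {g : ℂ → ℂ} {a b S : ℝ} {gp gm al ar bl br : ℝ → ℂ} {g₁ g₂ : ℝ → ℝ}
    (hab : a < b) (haS : -S < a) (hbS : b < S)
    (hd : ∀ k : ℂ, k.im ≠ 0 → k.re ≠ a → k.re ≠ b → DifferentiableAt ℂ g k)
    (hp : ∀ x : ℝ, x ≠ a → x ≠ b → Tendsto g (𝓝[{z | 0 < z.im}] (x : ℂ)) (𝓝 (gp x)))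
    (hm : ∀ x : ℝ, x ≠ a → x ≠ b → Tendsto g (𝓝[{z | z.im < 0}] (x : ℂ)) (𝓝 (gm x)))
    (hal : ∀ᵐ y : ℝ, Tendsto g (𝓝[{z | z.re < a}] ((a : ℂ) + y * Complex.I)) (𝓝 (al y)))
    (har : ∀ᵐ y : ℝ, Tendsto g (𝓝[{z | a < z.re}] ((a : ℂ) + y * Complex.I)) (𝓝 (ar y)))
    (hbl : ∀ᵐ y : ℝ, Tendsto g (𝓝[{z | z.re < b}] ((b : ℂ) + y * Complex.I)) (𝓝 (bl y)))
    (hbr : ∀ᵐ y : ℝ, Tendsto g (𝓝[{z | b < z.re}] ((b : ℂ) + y * Complex.I)) (𝓝 (br y)))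
    (h₁ : ∀ k : ℂ, |k.re| ≤ S → |k.im| ≤ S → k.im ≠ 0 → k.re ≠ a → k.re ≠ b → ‖g k‖ ≤ g₁ k.re)
    (h₂ : ∀ᵐ y : ℝ, ∀ k : ℂ, k.im = y → |k.re| ≤ S → |k.im| ≤ S → k.re ≠ a → k.re ≠ b → ‖g k‖ ≤ g₂ y)
    (hg₁ : IntegrableOn g₁ (Set.Ioo (-S) S)) (hg₂ : IntegrableOn g₂ (Set.Ioo (-S) S)) :
    (IntervalIntegrable (fun x => gp x - gm x) volume (-S) S ∧
      IntervalIntegrable (fun y => al y - ar y) volume (-S) S ∧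
      IntervalIntegrable (fun y => bl y - br y) volume (-S) S) ∧
    (∫ x in (-S)..S, g (x + S * Complex.I)) - (∫ x in (-S)..S, g (x - S * Complex.I)) -
      Complex.I * (∫ y in (-S)..S, g (S + y * Complex.I)) +
      Complex.I * (∫ y in (-S)..S, g (-S + y * Complex.I)) =
    (∫ x in (-S)..S, (gp x - gm x)) + Complex.I * (∫ y in (-S)..S, (al y - ar y)) +
      Complex.I * (∫ y in (-S)..S, (bl y - br y)) := by
  have hS : 0 < S := by linarith
  have hre : ∀ u v : ℝ, ((u : ℂ) + v * Complex.I).re = u := fun u v => by simp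
  have him : ∀ u v : ℝ, ((u : ℂ) + v * Complex.I).im = v := fun u v => by simp
  have hside : ∀ (u : ℝ) (s : Set ℂ), u ≠ a → u ≠ b → ∀ᵐ y : ℝ,
      Tendsto g (𝓝[s] ((u : ℂ) + y * Complex.I)) (𝓝 (g (u + y * Complex.I))) := by
    intro u s h1 h2
    have h0 : ∀ᵐ y : ℝ, y ≠ 0 := by simp [ae_iff, measure_singleton]
    filter_upwards [h0] with y hy
    exact (hd _ (by rwa [him]) (by rwa [hre]) (by rwa [hre])).continuousAt.tendsto.mono_left
      nhdsWithin_le_nhds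
  -- The square is cut into three columns by the two vertical lines, and each column is itself cut
  -- by the real line.
  have col := fun (x₀ x₁ : ℝ) (gl gr : ℝ → ℂ) (hx : x₀ < x₁) (hl : -S ≤ x₀) (hr : x₁ ≤ S)
      (hne : ∀ x ∈ Set.Ioo x₀ x₁, x ≠ a ∧ x ≠ b) (hgl) (hgr) =>
    column_integral_eq_zero (g := g) (gp := gp) (gm := gm) (gl := gl) (gr := gr) (g₁ := g₁) (g₂ := g₂)
      hx hS (fun k k1 k2 k3 => hd k k3 (hne _ ⟨k1, k2⟩).1 (hne _ ⟨k1, k2⟩).2)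
      (fun x hx => hp x (hne x hx).1 (hne x hx).2) (fun x hx => hm x (hne x hx).1 (hne x hx).2)
      hgl hgr (fun x hx y hy hy0 => by
        have := h₁ (x + y * Complex.I)
        rw [hre, him] at this
        exact this (abs_le.2 ⟨by linarith [hx.1], by linarith [hx.2]⟩)
          (abs_le.2 ⟨hy.1.le, hy.2.le⟩) hy0 (hne x hx).1 (hne x hx).2)
      (h₂.mono fun y h hy x hx => by
        have := h (x + y * Complex.I)
        rw [hre, him] at this
        exact this rfl (abs_le.2 ⟨by linarith [hx.1], by linarith [hx.2]⟩)
          (abs_le.2 ⟨hy.1.le, hy.2.le⟩) (hne x hx).1 (hne x hx).2)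
      (hg₁.mono_set (Set.Ioo_subset_Ioo hl hr)) hg₂
  obtain ⟨⟨p1, m1, t1, b1, l1, r1⟩, e1⟩ := col (-S) a al (fun y => g ((-S : ℝ) + y * Complex.I)) haS
    le_rfl (by linarith) (fun x hx => ⟨hx.2.ne, by linarith [hx.2]⟩) hal
    (hside (-S) _ haS.ne (by linarith))
  obtain ⟨⟨p2, m2, t2, b2, l2, r2⟩, e2⟩ := col a b bl ar hab haS.le hbS.le
    (fun x hx => ⟨hx.1.ne', hx.2.ne⟩) hbl har
  obtain ⟨⟨p3, m3, t3, b3, l3, r3⟩, e3⟩ := col b S (fun y => g (S + y * Complex.I)) br hbS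
    (by linarith) le_rfl (fun x hx => ⟨by linarith [hx.1], hx.1.ne'⟩) (hside S _ (by linarith) hbS.ne')
    hbr
  refine ⟨⟨((p1.sub m1).trans (p2.sub m2)).trans (p3.sub m3), l1.sub r2, l2.sub r3⟩, ?_⟩
  rw [← intervalIntegral.integral_add_adjacent_intervals ((p1.sub m1).trans (p2.sub m2)) (p3.sub m3),
    ← intervalIntegral.integral_add_adjacent_intervals (p1.sub m1) (p2.sub m2),
    ← intervalIntegral.integral_add_adjacent_intervals (t1.trans t2) t3,
    ← intervalIntegral.integral_add_adjacent_intervals t1 t2,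
    ← intervalIntegral.integral_add_adjacent_intervals (b1.trans b2) b3,
    ← intervalIntegral.integral_add_adjacent_intervals b1 b2,
    intervalIntegral.integral_sub l1 r2, intervalIntegral.integral_sub l2 r3]
  push_cast at e1
  linear_combination -e1 - e2 - e3

end Column

end CounterflowNLS

/-! ### The boundary integral over large squares -/

namespace CounterflowNLS

section Square

/-- By scaling, S g(Sw) = (Sw g(Sw))/w tends to m/w; points with nonreal Sw suffice, as they are
almost all of the segment. -/
theorem tendsto_segment_integral {g : ℂ → ℂ} {m : ℂ} {R : ℝ} {w : ℝ → ℂ}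
    (hg : Tendsto (fun k => k * g k) (Bornology.cobounded ℂ ⊓ 𝓟 {k | k.im ≠ 0}) (𝓝 m))
    (hc : ∀ k : ℂ, R ≤ ‖k‖ → k.im ≠ 0 → ContinuousAt g k) (hw : Continuous w)
    (hw1 : ∀ u, 1 ≤ ‖w u‖) (hw2 : ∀ u, u ≠ 0 → (w u).im ≠ 0) :
    Tendsto (fun S : ℝ => (S : ℂ) * ∫ u in (-1 : ℝ)..1, g (S * w u)) atTop
      (𝓝 (∫ u in (-1 : ℝ)..1, m * (w u)⁻¹)) := by
  have hae : ∀ᵐ u : ℝ, u ≠ 0 := by simp [ae_iff, measure_singleton]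
  have hpath : ∀ u : ℝ, u ≠ 0 → Tendsto (fun S : ℝ => (S : ℂ) * w u) atTop
      (Bornology.cobounded ℂ ⊓ 𝓟 {k | k.im ≠ 0}) := by
    intro u hu
    refine tendsto_inf.2 ⟨tendsto_norm_atTop_iff_cobounded.1 ?_, tendsto_principal.2 ?_⟩
    · refine tendsto_atTop_mono' _ ?_ tendsto_id
      filter_upwards [eventually_ge_atTop 0] with S hS
      rw [norm_mul, Complex.norm_real, Real.norm_of_nonneg hS]
      exact le_mul_of_one_le_right hS (hw1 u)
    · filter_upwards [eventually_gt_atTop 0] with S hS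
      rw [Complex.im_ofReal_mul]
      exact mul_ne_zero hS.ne' (hw2 u hu)
  have hb : ∀ᶠ k in Bornology.cobounded ℂ ⊓ 𝓟 {k : ℂ | k.im ≠ 0}, ‖k * g k‖ ≤ ‖m‖ + 1 :=
    (hg.norm.eventually (gt_mem_nhds (lt_add_one ‖m‖))).mono fun _ h => h.le
  rw [eventually_inf_principal, (Metric.hasBasis_cobounded_compl_closedBall (0 : ℂ)).eventually_iff]
    at hb
  obtain ⟨B, -, hB⟩ := hb
  simp only [← intervalIntegral.integral_const_mul]
  refine intervalIntegral.tendsto_integral_filter_of_dominated_convergence (fun _ => ‖m‖ + 1) ?_ ?_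
    intervalIntegrable_const ?_
  · filter_upwards [eventually_ge_atTop R, eventually_gt_atTop 0] with S hS hS0
    have h1 : ContinuousOn (fun u : ℝ => (S : ℂ) * g (S * w u)) {u | u ≠ 0} := fun u hu => by
      have h2 : ContinuousAt g (S * w u) := hc _ (by
        rw [norm_mul, Complex.norm_real, Real.norm_of_nonneg hS0.le]
        exact hS.trans (le_mul_of_one_le_right hS0.le (hw1 u))) (by
        rw [Complex.im_ofReal_mul]
        exact mul_ne_zero hS0.ne' (hw2 u hu))
      exact (continuousAt_const.mul (ContinuousAt.comp (f := fun u : ℝ => (S : ℂ) * w u) h2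
        (by fun_prop))).continuousWithinAt
    have h3 := h1.aestronglyMeasurable (μ := volume) isOpen_ne.measurableSet
    rw [Measure.restrict_eq_self_of_ae_mem (by exact hae)] at h3
    exact h3.restrict
  · filter_upwards [eventually_gt_atTop B, eventually_gt_atTop 0] with S hS hS0
    filter_upwards [hae] with u hu _
    have hS1 : S ≤ ‖(S : ℂ) * w u‖ := by
      rw [norm_mul, Complex.norm_real, Real.norm_of_nonneg hS0.le]
      exact le_mul_of_one_le_right hS0.le (hw1 u)
    have h1 := @hB ((S : ℂ) * w u) (by
      rw [Set.mem_compl_iff, mem_closedBall_zero_iff, not_le]; linarith) (by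
      change ((S : ℂ) * w u).im ≠ 0
      rw [Complex.im_ofReal_mul]
      exact mul_ne_zero hS0.ne' (hw2 u hu))
    refine le_trans ?_ h1
    rw [norm_mul, norm_mul, Complex.norm_real, Real.norm_of_nonneg hS0.le]
    gcongr
  · filter_upwards [hae] with u hu _
    refine ((hg.comp (hpath u hu)).mul_const (w u)⁻¹).congr' ?_
    filter_upwards with S
    have : w u ≠ 0 := fun h => by
      have := hw1 u
      rw [h, norm_zero] at this; linarith
    simp only [Function.comp_apply]
    field_simp

/-- This is the integral of dk/k around a square, traversed clockwise. The four sides add up to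
-4i/(1 + u²), which integrates to an arctangent. -/
theorem integral_inv_square : (∫ u in (-1 : ℝ)..1, ((u : ℂ) + Complex.I)⁻¹) -
    (∫ u in (-1 : ℝ)..1, ((u : ℂ) - Complex.I)⁻¹) -
    Complex.I * (∫ u in (-1 : ℝ)..1, (1 + u * Complex.I : ℂ)⁻¹) +
    Complex.I * (∫ u in (-1 : ℝ)..1, (-1 + u * Complex.I : ℂ)⁻¹) = -(2 * Real.pi * Complex.I) := by
  have hne1 : ∀ u : ℝ, (u : ℂ) + Complex.I ≠ 0 := fun u h => by simpa using congrArg Complex.im h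
  have hne2 : ∀ u : ℝ, (u : ℂ) - Complex.I ≠ 0 := fun u h => by simpa using congrArg Complex.im h
  have hne3 : ∀ u : ℝ, (1 : ℂ) + u * Complex.I ≠ 0 := fun u h => by simpa using congrArg Complex.re h
  have hne4 : ∀ u : ℝ, (-1 : ℂ) + u * Complex.I ≠ 0 := fun u h => by simpa using congrArg Complex.re h
  have hi : ∀ {f : ℝ → ℂ}, Continuous f → (∀ u, f u ≠ 0) →
      IntervalIntegrable (fun u => (f u)⁻¹) volume (-1) 1 := fun hf h0 =>
    (hf.inv₀ h0).intervalIntegrable _ _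
  have i1 := hi (by fun_prop) hne1
  have i2 := hi (by fun_prop) hne2
  have i3 := hi (by fun_prop) hne3
  have i4 := hi (by fun_prop) hne4
  rw [← intervalIntegral.integral_const_mul, ← intervalIntegral.integral_const_mul,
    ← intervalIntegral.integral_sub i1 i2, ← intervalIntegral.integral_sub (i1.sub i2) (i3.const_mul _),
    ← intervalIntegral.integral_add ((i1.sub i2).sub (i3.const_mul _)) (i4.const_mul _)]
  have h1 : ∀ u : ℝ, ((u : ℂ) + Complex.I)⁻¹ - ((u : ℂ) - Complex.I)⁻¹ -
      Complex.I * (1 + u * Complex.I : ℂ)⁻¹ + Complex.I * (-1 + u * Complex.I : ℂ)⁻¹ =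
      -(4 * Complex.I) * ((1 / (1 + u ^ 2) : ℝ) : ℂ) := by
    intro u
    have h0 : (1 + (u : ℂ) ^ 2) ≠ 0 := by
      have : (1 + u ^ 2 : ℝ) ≠ 0 := by positivity
      exact_mod_cast this
    have e1 : (u : ℂ) + Complex.I = Complex.I * (1 - u * Complex.I) := by
      linear_combination u * Complex.I_sq
    have e2 : (u : ℂ) - Complex.I = -Complex.I * (1 + u * Complex.I) := by
      linear_combination u * Complex.I_sq
    have h4 : (1 - u * Complex.I : ℂ) ≠ 0 := fun h => hne1 u (by rw [e1, h, mul_zero])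
    have h3 := hne3 u
    have e4 : (-1 : ℂ) + u * Complex.I = -(1 - u * Complex.I) := by ring
    have e5 : (1 : ℂ) + u ^ 2 = (1 + u * Complex.I) * (1 - u * Complex.I) := by
      linear_combination (u : ℂ) ^ 2 * Complex.I_sq
    push_cast
    rw [e1, e2, e4, e5]
    have e6 : (1 + u * Complex.I : ℂ) = 2 - (1 - u * Complex.I) := by ring
    generalize (1 - u * Complex.I : ℂ) = p at h4 e6 ⊢
    generalize (1 + u * Complex.I : ℂ) = v at h3 e6 ⊢
    have hI := Complex.I_ne_zero
    field_simp
    rw [e6, Complex.I_sq]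
    ring
  simp only [h1]
  rw [intervalIntegral.integral_const_mul, intervalIntegral.integral_ofReal,
    integral_one_div_one_add_sq]
  simp only [Real.arctan_neg, Real.arctan_one]
  push_cast; ring

theorem tendsto_square_integral {g : ℂ → ℂ} {m : ℂ} {R : ℝ}
    (hg : Tendsto (fun k => k * g k) (Bornology.cobounded ℂ ⊓ 𝓟 {k | k.im ≠ 0}) (𝓝 m))
    (hc : ∀ k : ℂ, R ≤ ‖k‖ → k.im ≠ 0 → ContinuousAt g k) :
    Tendsto (fun S : ℝ => (∫ x in (-S)..S, g (x + S * Complex.I)) -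
      (∫ x in (-S)..S, g (x - S * Complex.I)) - Complex.I * (∫ y in (-S)..S, g (S + y * Complex.I)) +
      Complex.I * (∫ y in (-S)..S, g (-S + y * Complex.I))) atTop (𝓝 (-(2 * Real.pi * Complex.I) * m)) := by
  have hre : ∀ z : ℂ, |z.re| = 1 → 1 ≤ ‖z‖ := fun z h => h ▸ Complex.abs_re_le_norm z
  have him : ∀ z : ℂ, |z.im| = 1 → 1 ≤ ‖z‖ := fun z h => h ▸ Complex.abs_im_le_norm z
  have T1 := tendsto_segment_integral (w := fun u => (u : ℂ) + Complex.I) hg hc (by fun_prop)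
    (fun u => him _ (by simp)) (fun u _ => by simp)
  have T2 := tendsto_segment_integral (w := fun u => (u : ℂ) - Complex.I) hg hc (by fun_prop)
    (fun u => him _ (by simp)) (fun u _ => by simp)
  have T3 := tendsto_segment_integral (w := fun u => 1 + u * Complex.I) hg hc (by fun_prop)
    (fun u => hre _ (by simp)) (fun u hu => by simpa using hu)
  have T4 := tendsto_segment_integral (w := fun u => -1 + u * Complex.I) hg hc (by fun_prop)
    (fun u => hre _ (by simp)) (fun u hu => by simpa using hu)
  have T := ((T1.sub T2).sub (T3.const_mul Complex.I)).add (T4.const_mul Complex.I)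
  simp only [intervalIntegral.integral_const_mul] at T
  have e : -(2 * Real.pi * Complex.I) * m = m * (∫ u in (-1 : ℝ)..1, ((u : ℂ) + Complex.I)⁻¹) -
      m * (∫ u in (-1 : ℝ)..1, ((u : ℂ) - Complex.I)⁻¹) -
      Complex.I * (m * (∫ u in (-1 : ℝ)..1, (1 + u * Complex.I : ℂ)⁻¹)) +
      Complex.I * (m * (∫ u in (-1 : ℝ)..1, (-1 + u * Complex.I : ℂ)⁻¹)) := by
    rw [← integral_inv_square]; ring
  rw [e]
  refine T.congr fun S => ?_
  have hs : ∀ f : ℝ → ℂ, (S : ℂ) * ∫ u in (-1 : ℝ)..1, f (S * u) = ∫ x in (-S)..S, f x := fun f => by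
    have := intervalIntegral.smul_integral_comp_mul_left (a := -1) (b := 1) f S
    rw [mul_neg_one, mul_one] at this
    rw [← this, Complex.real_smul]
  rw [← hs fun x => g (x + S * Complex.I), ← hs fun x => g (x - S * Complex.I),
    ← hs fun y => g (S + y * Complex.I), ← hs fun y => g (-S + y * Complex.I)]
  have a1 : ∀ u : ℝ, (S : ℂ) * (u + Complex.I) = ((S * u : ℝ) : ℂ) + S * Complex.I := fun u => by
    push_cast; ring
  have a2 : ∀ u : ℝ, (S : ℂ) * (u - Complex.I) = ((S * u : ℝ) : ℂ) - S * Complex.I := fun u => by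
    push_cast; ring
  have a3 : ∀ u : ℝ, (S : ℂ) * (1 + u * Complex.I) = S + ((S * u : ℝ) : ℂ) * Complex.I := fun u => by
    push_cast; ring
  have a4 : ∀ u : ℝ, (S : ℂ) * (-1 + u * Complex.I) = -S + ((S * u : ℝ) : ℂ) * Complex.I := fun u => by
    push_cast; ring
  simp only [a1, a2, a3, a4]

end Square

end CounterflowNLS

/-! ### The upper right entry without its principal parts -/

namespace CounterflowNLS

attribute [local instance] Matrix.normedAddCommGroup Matrix.normedSpace

namespace RHPData

variable {D : RHPData} {x t : ℝ} {M Mp Mm : ℂ → Mat2}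

/-- The residue of the upper right entry at the pole `k_n`. -/
noncomputable def residue (D : RHPData) (x t : ℝ) (M : ℂ → Mat2) (n : Fin D.N) : ℂ :=
  D.c n * Complex.exp (2 * Complex.I * phase x t (D.pole n)) * M (D.pole n) 0 0

/-- The principal parts of the upper right entry. -/
noncomputable def poleSum (D : RHPData) (x t : ℝ) (M : ℂ → Mat2) (k : ℂ) : ℂ :=
  ∑ n, D.residue x t M n * (k - D.pole n)⁻¹

theorem differentiableAt_poleSum {k : ℂ} (hk : ∀ n, k ≠ D.pole n) :
    DifferentiableAt ℂ (D.poleSum x t M) k := by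
  unfold poleSum
  refine DifferentiableAt.fun_sum fun n _ => ?_
  have h1 : DifferentiableAt ℂ (fun k => (k - D.pole n)⁻¹) k :=
    DifferentiableAt.inv (by fun_prop) (sub_ne_zero.2 (hk n))
  exact h1.const_mul _

theorem tendsto_mul_poleSum : Tendsto (fun k => k * D.poleSum x t M k) (Bornology.cobounded ℂ)
    (𝓝 (∑ n, D.residue x t M n)) := by
  simp only [poleSum, Finset.mul_sum]
  refine tendsto_finsetSum _ fun n _ => ?_
  have h1 : Tendsto (fun k : ℂ => (k - D.pole n)⁻¹) (Bornology.cobounded ℂ) (𝓝 0) := by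
    refine tendsto_inv₀_cobounded.comp (tendsto_norm_atTop_iff_cobounded.1 ?_)
    refine tendsto_atTop_mono (fun k => norm_sub_norm_le k (D.pole n)) ?_
    exact tendsto_atTop_add_const_right _ _ tendsto_norm_cobounded_atTop
  have h2 : Tendsto (fun k : ℂ => D.residue x t M n * (1 + D.pole n * (k - D.pole n)⁻¹))
      (Bornology.cobounded ℂ) (𝓝 (D.residue x t M n)) := by
    simpa using ((h1.const_mul (D.pole n)).const_add 1).const_mul (D.residue x t M n)
  refine h2.congr' ?_
  have hne : ∀ᶠ k in Bornology.cobounded ℂ, k ≠ D.pole n := Bornology.eventually_ne_cobounded _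
  filter_upwards [hne] with k hk
  have := sub_ne_zero.2 hk
  field_simp; ring

theorem not_mem_contour_of_mem_poles (hD : D.Admissible) {z : ℂ} (hz : z ∈ D.poles) :
    z ∉ D.contour := by
  obtain ⟨n, rfl | rfl⟩ := hz
  · exact hD.pole_not_mem n
  · rw [conj_mem_contour]; exact hD.pole_not_mem n

namespace IsSolution

/-- Only the poles k_n matter: at the conjugate points the second column is regular by assumption.
-/
theorem exists_regular_part (h : D.IsSolution x t M Mp Mm) (hD : D.Admissible) :
    ∃ g : ℂ → ℂ, (∀ k ∉ D.contour, DifferentiableAt ℂ g k) ∧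
      ∀ k ∈ D.regularSet, g k = M k 0 1 - D.poleSum x t M k := by
  classical
  obtain ⟨g, hg, hgf⟩ := exists_differentiableAt_of_isolated D.isClosed_contour.isOpen_compl
    (f := fun k => M k 0 1 - D.poleSum x t M k) (Finset.univ.image D.pole) (fun z hz => by
      obtain ⟨n, -, rfl⟩ := Finset.mem_image.1 hz
      exact hD.pole_not_mem n) (fun z hz hzS => by
      have hzn : ∀ n, z ≠ D.pole n := fun n hn => hzS (Finset.mem_image.2 ⟨n, by simp, hn.symm⟩)
      refine DifferentiableAt.sub ?_ (differentiableAt_poleSum hzn)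
      by_cases hp : z ∈ D.poles
      · obtain ⟨n, hn | rfl⟩ := hp
        · exact absurd hn (hzn n)
        · exact (h.regular_lower n 0).differentiableAt
      · exact differentiableAt_mat.1 (h.differentiableAt (fun hk => hk.elim hz hp)) 0 1) fun z hz => by
      obtain ⟨n, -, rfl⟩ := Finset.mem_image.1 hz
      -- As the poles are distinct, only the n-th term of the sum contributes to the residue at k_n.
      have h1 : Tendsto (fun k => (k - D.pole n) * D.poleSum x t M k) (𝓝[≠] D.pole n)
          (𝓝 (D.residue x t M n)) := by
        have h2 : ∀ m ∈ Finset.univ, Tendsto (fun k => D.residue x t M m *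
            ((k - D.pole n) * (k - D.pole m)⁻¹)) (𝓝[≠] D.pole n)
            (𝓝 (if m = n then D.residue x t M n else 0)) := fun m _ => by
          by_cases hm : m = n
          · subst hm
            rw [if_pos rfl]
            refine tendsto_const_nhds.congr' ?_
            filter_upwards [self_mem_nhdsWithin] with k (hk : k ≠ D.pole m)
            rw [mul_inv_cancel₀ (sub_ne_zero.2 hk), mul_one]
          · rw [if_neg hm]
            have hne : D.pole n - D.pole m ≠ 0 :=
              sub_ne_zero.2 fun he => hm (hD.pole_injective he).symm
            have hc : ContinuousAt (fun k => D.residue x t M m * ((k - D.pole n) * (k - D.pole m)⁻¹))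
                (D.pole n) := by
              refine continuousAt_const.mul ((by fun_prop : ContinuousAt _ _).mul
                (ContinuousAt.inv₀ (by fun_prop) hne))
            have := hc.tendsto.mono_left (nhdsWithin_le_nhds (s := {D.pole n}ᶜ))
            simpa using this
        have h3 := tendsto_finsetSum Finset.univ h2
        simp only [Finset.sum_ite_eq', Finset.mem_univ, if_true] at h3
        refine h3.congr fun k => ?_
        rw [poleSum, Finset.mul_sum]
        exact Finset.sum_congr rfl fun m _ => by ring
      have h4 := (h.residue_upper n 0).sub h1
      rw [show D.c n * Complex.exp (2 * Complex.I * phase x t (D.pole n)) * M (D.pole n) 0 0 =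
        D.residue x t M n from rfl, sub_self] at h4
      refine h4.congr fun k => ?_
      simp only [smul_eq_mul]; ring
  refine ⟨g, hg, fun k hk => hgf k fun hk' => ?_⟩
  obtain ⟨n, -, rfl⟩ := Finset.mem_image.1 hk'
  exact (mem_regularSet.1 hk).2 ⟨n, Or.inl rfl⟩

/-- The regular part of the upper right entry. -/
structure IsRegularPart (D : RHPData) (x t : ℝ) (M : ℂ → Mat2) (g : ℂ → ℂ) : Prop where
  differentiableAt : ∀ k ∉ D.contour, DifferentiableAt ℂ g k
  eq : ∀ k ∈ D.regularSet, g k = M k 0 1 - D.poleSum x t M k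

variable {g : ℂ → ℂ}

theorem IsRegularPart.eventuallyEq (hg : IsRegularPart D x t M g) (hD : D.Admissible) {z : ℂ}
    (hz : z ∈ D.contour) :
    g =ᶠ[𝓝[D.contourᶜ] z] fun k => M k 0 1 - D.poleSum x t M k := by
  have hp : z ∉ D.poles := fun hp => not_mem_contour_of_mem_poles hD hp hz
  filter_upwards [nhdsWithin_le_nhds (eventually_not_mem_poles hp), self_mem_nhdsWithin] with k h1 h2
  exact hg.eq k fun hk => hk.elim h2 h1

theorem continuousAt_poleSum (hD : D.Admissible) {z : ℂ} (hz : z ∈ D.contour) :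
    ContinuousAt (D.poleSum x t M) z :=
  (differentiableAt_poleSum fun n hn => hD.pole_not_mem n (hn ▸ hz)).continuousAt

theorem IsRegularPart.tendsto (hg : IsRegularPart D x t M g) (hD : D.Admissible) {z : ℂ}
    {A : Mat2} {s : Set ℂ} (hz : z ∈ D.contour) (hs : ∀ᶠ k in 𝓝[s] z, k ∉ D.contour)
    (hM : Tendsto M (𝓝[s] z) (𝓝 A)) :
    Tendsto g (𝓝[s] z) (𝓝 (A 0 1 - D.poleSum x t M z)) := by
  have h1 : 𝓝[s] z ≤ 𝓝[D.contourᶜ] z :=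
    le_inf nhdsWithin_le_nhds (le_principal_iff.2 hs)
  refine (((tendsto_mat.1 hM 0 1).sub
    ((continuousAt_poleSum hD hz).tendsto.mono_left nhdsWithin_le_nhds))).congr' ?_
  exact ((hg.eventuallyEq hD hz).filter_mono h1).symm

/-- In the second column the only unbounded behaviour on the contour is the quarter power at the
conjugate of p₊, so one weight makes the entry bounded near every point of Σ. -/
theorem isBigO_contour (h : D.IsSolution x t M Mp Mm) (hD : D.Admissible) {z : ℂ}
    (hz : z ∈ D.contour) : (fun k => ((‖k - D.ptPlus (-D.Ap)‖ ^ (1 / 4 : ℝ) : ℝ) : ℂ) * M k 0 1)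
      =O[𝓝[D.contourᶜ] z] fun _ => (1 : ℝ) := by
  have hw : (fun k : ℂ => ((‖k - D.ptPlus (-D.Ap)‖ ^ (1 / 4 : ℝ) : ℝ) : ℂ)) =O[𝓝[D.contourᶜ] z]
      fun _ => (1 : ℝ) := by
    have hc : Continuous fun k : ℂ => ((‖k - D.ptPlus (-D.Ap)‖ ^ (1 / 4 : ℝ) : ℝ) : ℂ) := by
      refine Complex.continuous_ofReal.comp (Continuous.rpow_const (by fun_prop) fun _ => Or.inr ?_)
      norm_num
    exact ((hc.tendsto z).mono_left nhdsWithin_le_nhds).isBigO_one ℝ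
  have hmul : (fun k => M k 0 1) =O[𝓝[D.contourᶜ] z] (fun _ => (1 : ℝ)) →
      (fun k => ((‖k - D.ptPlus (-D.Ap)‖ ^ (1 / 4 : ℝ) : ℝ) : ℂ) * M k 0 1)
      =O[𝓝[D.contourᶜ] z] fun _ => (1 : ℝ) := fun hb => by
    simpa using hw.mul hb
  have hlim : ∀ {l l' : Filter ℂ} {A B : Mat2}, 𝓝[D.contourᶜ] z ≤ l ⊔ l' → Tendsto M l (𝓝 A) →
      Tendsto M l' (𝓝 B) → (fun k => M k 0 1) =O[𝓝[D.contourᶜ] z] fun _ => (1 : ℝ) :=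
    fun hl hA hB => IsBigO.mono (((tendsto_mat.1 hA 0 1).isBigO_one ℝ).sup
      ((tendsto_mat.1 hB 0 1).isBigO_one ℝ)) hl
  have hp : z ∉ D.poles := fun hp => not_mem_contour_of_mem_poles hD hp hz
  by_cases hs : z ∈ D.singularSet
  · rw [mem_singularSet] at hs
    rcases hs with rfl | rfl | rfl | rfl | rfl | rfl | hs
    · exact hmul ((h.bounded_plus 0 1).trans (isBigO_of_le _ fun _ => by simp))
    · exact hmul ((h.bounded_minus 0 1).trans (isBigO_of_le _ fun _ => by simp))
    · refine hmul ((h.isBigO_upper hD 0).2.trans ?_)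
      have hc : Continuous fun k : ℂ => ‖k - D.ptPlus D.Ap‖ ^ (1 / 4 : ℝ) :=
        Continuous.rpow_const (by fun_prop) fun _ => Or.inr (by norm_num)
      exact ((hc.tendsto _).mono_left nhdsWithin_le_nhds).isBigO_one ℝ
    · have h1 := (isBigO_refl (fun k : ℂ => ((‖k - D.ptPlus (-D.Ap)‖ ^ (1 / 4 : ℝ) : ℝ) : ℂ))
        (𝓝[D.contourᶜ] (D.ptPlus (-D.Ap)))).norm_right.mul (h.isBigO_lower hD 0).2
      refine h1.trans (IsBigO.of_bound 1 (Eventually.of_forall fun k => ?_))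
      have h0 : 0 ≤ ‖k - D.ptPlus (-D.Ap)‖ ^ (1 / 4 : ℝ) := by positivity
      rw [Complex.norm_real, Real.norm_of_nonneg h0, Real.norm_of_nonneg (by positivity), norm_one,
        mul_one]
      exact mul_inv_le_one
    · obtain ⟨B, hB⟩ := h.growth_p_minus
      exact hmul ((tendsto_mat.1 hB 0 1).isBigO_one ℝ)
    · obtain ⟨B, hB⟩ := h.growth_conj_p_minus
      exact hmul ((tendsto_mat.1 hB 0 1).isBigO_one ℝ)
    · exact absurd hs hp
  · rcases mem_contour_cases hs (fun hr => D.regularSet_subset hr hz) with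
      ⟨ξ, rfl, h1, h2⟩ | ⟨s, rfl, h0, h1⟩ | ⟨s, rfl, h0, h1⟩
    · obtain ⟨a, b, -⟩ := h.jump_real ξ h1 h2
      exact hmul (hlim (D.nhdsWithin_real_le ξ) a b)
    · obtain ⟨a, b, -⟩ := h.jump_plus s h0 h1
      exact hmul (hlim (nhdsWithin_ptPlus_le h1) a b)
    · obtain ⟨a, b, -⟩ := h.jump_minus s h0 h1
      exact hmul (hlim (nhdsWithin_ptMinus_le h1) a b)

/-- The exponent 1/4 is below 1, so this bound yields integrable majorants on horizontal and on
vertical lines. -/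
theorem IsRegularPart.exists_norm_le (hg : IsRegularPart D x t M g) (h : D.IsSolution x t M Mp Mm)
    (hD : D.Admissible) (S : ℝ) : ∃ C, 0 ≤ C ∧ ∀ k : ℂ, |k.re| ≤ S → |k.im| ≤ S → k ∉ D.contour →
      ‖g k‖ ≤ C * (‖k - D.ptPlus (-D.Ap)‖ ^ (1 / 4 : ℝ))⁻¹ := by
  have hc : Continuous fun k : ℂ => ((‖k - D.ptPlus (-D.Ap)‖ ^ (1 / 4 : ℝ) : ℝ) : ℂ) := by
    refine Complex.continuous_ofReal.comp (Continuous.rpow_const (by fun_prop) fun _ => Or.inr ?_)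
    norm_num
  obtain ⟨C, hC⟩ := exists_norm_le_of_isCompact
    (f := fun k => ((‖k - D.ptPlus (-D.Ap)‖ ^ (1 / 4 : ℝ) : ℝ) : ℂ) * g k) (S := D.contourᶜ)
    (K := Set.Icc (-S) S ×ℂ Set.Icc (-S) S) (isCompact_Icc.reProdIm isCompact_Icc) (fun z _ => by
      have hO : (fun k => ((‖k - D.ptPlus (-D.Ap)‖ ^ (1 / 4 : ℝ) : ℝ) : ℂ) * g k)
          =O[𝓝[D.contourᶜ] z] fun _ => (1 : ℝ) := by
        by_cases hz : z ∈ D.contour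
        · have h1 := (h.isBigO_contour hD hz).sub
            (((hc.continuousAt.mul (continuousAt_poleSum (x := x) (t := t) (M := M) hD hz)).tendsto.mono_left
              (nhdsWithin_le_nhds (s := D.contourᶜ))).isBigO_one ℝ)
          refine h1.congr' ((hg.eventuallyEq hD hz).mono fun k hk => ?_) EventuallyEq.rfl
          have hk : g k = M k 0 1 - D.poleSum x t M k := hk
          simp only [Pi.mul_apply, hk]; ring
        · exact ((hc.continuousAt.mul (hg.differentiableAt z hz).continuousAt).tendsto.mono_left
            nhdsWithin_le_nhds).isBigO_one ℝ
      obtain ⟨C, hC⟩ := hO.bound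
      exact ⟨C, hC.mono fun k hk => by simpa using hk⟩)
  refine ⟨|C|, abs_nonneg C, fun k h1 h2 h3 => ?_⟩
  have h4 := hC k (Complex.mem_reProdIm.2 ⟨abs_le.1 h1, abs_le.1 h2⟩) h3
  have hne : k ≠ D.ptPlus (-D.Ap) := fun he =>
    h3 (he ▸ ptPlus_mem_contour (by rw [abs_neg, abs_of_pos hD.Ap_pos]))
  have hpos : 0 < ‖k - D.ptPlus (-D.Ap)‖ ^ (1 / 4 : ℝ) :=
    Real.rpow_pos_of_pos (norm_pos_iff.2 (sub_ne_zero.2 hne)) _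
  rw [norm_mul, Complex.norm_real, Real.norm_of_nonneg hpos.le] at h4
  rw [← div_eq_mul_inv, le_div_iff₀ hpos]
  linarith [le_abs_self C]

end IsSolution

end RHPData

end CounterflowNLS

/-! ### The contour integral and the reconstruction formula -/

namespace CounterflowNLS

attribute [local instance] Matrix.normedAddCommGroup Matrix.normedSpace

theorem integrableOn_abs_sub_rpow_inv (c S : ℝ) :
    IntegrableOn (fun x : ℝ => (|x - c| ^ (1 / 4 : ℝ))⁻¹) (Set.Ioo (-S) S) := by
  have h1 : ∀ a b : ℝ, IntervalIntegrable (fun x : ℝ => (|x| ^ (1 / 4 : ℝ))⁻¹) volume a b := by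
    intro a b
    refine intervalIntegrable_of_even (fun x => by rw [abs_neg]) fun x hx => ?_
    refine (intervalIntegral.intervalIntegrable_rpow' (r := -(1 / 4)) (by norm_num)).congr ?_
    intro u hu
    rw [Set.uIoc_of_le hx.le] at hu
    change u ^ (-(1 / 4) : ℝ) = (|u| ^ (1 / 4 : ℝ))⁻¹
    rw [abs_of_pos hu.1, Real.rpow_neg hu.1.le]
  have h2 := (h1 (-S - c) (S - c)).comp_sub_right c
  simp only [sub_add_cancel] at h2
  exact (h2.1.mono_set Set.Ioo_subset_Ioc_self)

/-- The vertical lines run through the whole square, but jumps occur only on the cuts. -/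
theorem intervalIntegral_ite_abs_lt {j : ℝ → ℂ} {A S : ℝ} (hA : 0 < A) (hAS : A ≤ S) :
    ∫ y in (-S)..S, (if |y| < A then j y else 0) = ∫ y in (-A)..A, j y := by
  have e : (fun y => if |y| < A then j y else 0) = (Set.Ioo (-A) A).indicator j := by
    ext y
    by_cases hy : |y| < A
    · rw [if_pos hy, Set.indicator_of_mem (Set.mem_Ioo.2 (abs_lt.1 hy))]
    · have h0 : y ∉ Set.Ioo (-A) A := fun h => hy (abs_lt.2 h)
      rw [if_neg hy, Set.indicator_of_notMem h0]
  rw [e, intervalIntegral.integral_of_le (by linarith), intervalIntegral.integral_of_le (by linarith),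
    integral_Ioc_eq_integral_Ioo, integral_Ioc_eq_integral_Ioo, setIntegral_indicator measurableSet_Ioo,
    Set.inter_eq_right.2 (Set.Ioo_subset_Ioo (by linarith) hAS)]

/-- Cauchy's theorem for a square that is cut by the real line and by two vertical lines in either
order. -/
theorem square_integral_eq_of_ne {g : ℂ → ℂ} {a b S : ℝ} {gp gm al ar bl br : ℝ → ℂ} {g₁ g₂ : ℝ → ℝ}
    (hab : a ≠ b) (haS : |a| < S) (hbS : |b| < S)
    (hd : ∀ k : ℂ, k.im ≠ 0 → k.re ≠ a → k.re ≠ b → DifferentiableAt ℂ g k)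
    (hp : ∀ x : ℝ, x ≠ a → x ≠ b → Tendsto g (𝓝[{z | 0 < z.im}] (x : ℂ)) (𝓝 (gp x)))
    (hm : ∀ x : ℝ, x ≠ a → x ≠ b → Tendsto g (𝓝[{z | z.im < 0}] (x : ℂ)) (𝓝 (gm x)))
    (hal : ∀ᵐ y : ℝ, Tendsto g (𝓝[{z | z.re < a}] ((a : ℂ) + y * Complex.I)) (𝓝 (al y)))
    (har : ∀ᵐ y : ℝ, Tendsto g (𝓝[{z | a < z.re}] ((a : ℂ) + y * Complex.I)) (𝓝 (ar y)))
    (hbl : ∀ᵐ y : ℝ, Tendsto g (𝓝[{z | z.re < b}] ((b : ℂ) + y * Complex.I)) (𝓝 (bl y)))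
    (hbr : ∀ᵐ y : ℝ, Tendsto g (𝓝[{z | b < z.re}] ((b : ℂ) + y * Complex.I)) (𝓝 (br y)))
    (h₁ : ∀ k : ℂ, |k.re| ≤ S → |k.im| ≤ S → k.im ≠ 0 → k.re ≠ a → k.re ≠ b → ‖g k‖ ≤ g₁ k.re)
    (h₂ : ∀ᵐ y : ℝ, ∀ k : ℂ, k.im = y → |k.re| ≤ S → |k.im| ≤ S → k.re ≠ a → k.re ≠ b → ‖g k‖ ≤ g₂ y)
    (hg₁ : IntegrableOn g₁ (Set.Ioo (-S) S)) (hg₂ : IntegrableOn g₂ (Set.Ioo (-S) S)) :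
    (IntervalIntegrable (fun x => gp x - gm x) volume (-S) S ∧
      IntervalIntegrable (fun y => al y - ar y) volume (-S) S ∧
      IntervalIntegrable (fun y => bl y - br y) volume (-S) S) ∧
    (∫ x in (-S)..S, g (x + S * Complex.I)) - (∫ x in (-S)..S, g (x - S * Complex.I)) -
      Complex.I * (∫ y in (-S)..S, g (S + y * Complex.I)) +
      Complex.I * (∫ y in (-S)..S, g (-S + y * Complex.I)) =
    (∫ x in (-S)..S, (gp x - gm x)) + Complex.I * (∫ y in (-S)..S, (al y - ar y)) +
      Complex.I * (∫ y in (-S)..S, (bl y - br y)) := by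
  rw [abs_lt] at haS hbS
  rcases lt_or_gt_of_ne hab with hlt | hlt
  · exact square_integral_eq hlt haS.1 hbS.2 hd hp hm hal har hbl hbr h₁ h₂ hg₁ hg₂
  · obtain ⟨⟨i1, i2, i3⟩, e⟩ := square_integral_eq hlt hbS.1 haS.2
      (fun k h h' h'' => hd k h h'' h') (fun x h h' => hp x h' h) (fun x h h' => hm x h' h)
      hbl hbr hal har (fun k k1 k2 k3 k4 k5 => h₁ k k1 k2 k3 k5 k4)
      (h₂.mono fun y h k k1 k2 k3 k4 k5 => h k k1 k2 k3 k5 k4) hg₁ hg₂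
    exact ⟨⟨i1, i3, i2⟩, e.trans (add_right_comm _ _ _)⟩

namespace RHPData

variable {D : RHPData} {x t : ℝ} {M Mp Mm : ℂ → Mat2} {g : ℂ → ℂ}

theorem jumpEntry_eq {k : ℂ} (hj : Mp k = Mm k * D.J x t k) :
    D.jumpEntry x t Mm k = Mp k 0 1 - Mm k 0 1 := by
  rw [jumpEntry, Matrix.mul_sub, mul_one, ← hj, Matrix.sub_apply]

theorem IsFar.lt_abs_of_mem_contour {R : ℝ} (hR : D.IsFar R) {k : ℂ} (hk : k ∈ D.contour)
    (him : k.im ≠ 0) : ‖k‖ < R := by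
  by_contra h
  exact D.regularSet_subset (hR.mem_regularSet k (not_lt.1 h) him) hk

theorem IsFar.Ap_lt {R : ℝ} (hR : D.IsFar R) (hD : D.Admissible) : D.Ap < R := by
  refine ((le_abs_self _).trans (Complex.abs_im_le_norm (D.ptPlus D.Ap))).trans_lt
    (hR.lt_abs_of_mem_contour (ptPlus_mem_contour (abs_of_pos hD.Ap_pos).le) hD.Ap_pos.ne')

theorem IsFar.Am_lt {R : ℝ} (hR : D.IsFar R) (hD : D.Admissible) : D.Am < R := by
  refine ((le_abs_self _).trans (Complex.abs_im_le_norm (D.ptMinus D.Am))).trans_lt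
    (hR.lt_abs_of_mem_contour (ptMinus_mem_contour (abs_of_pos hD.Am_pos).le) hD.Am_pos.ne')

theorem ptPlus_eq (D : RHPData) (s : ℝ) : D.ptPlus s = ((-D.V / 2 : ℝ) : ℂ) + s * Complex.I := by
  apply Complex.ext <;> simp [ptPlus, -Complex.ofReal_div, -Complex.ofReal_neg]

theorem ptMinus_eq (D : RHPData) (s : ℝ) : D.ptMinus s = ((D.V / 2 : ℝ) : ℂ) + s * Complex.I := by
  apply Complex.ext <;> simp [ptMinus, -Complex.ofReal_div]

theorem ae_abs_pos_and_ne (A : ℝ) : ∀ᵐ y : ℝ, 0 < |y| ∧ |y| ≠ A := by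
  have h : ∀ c : ℝ, ∀ᵐ y : ℝ, y ≠ c := fun c => by simp [ae_iff, measure_singleton]
  filter_upwards [h 0, h A, h (-A)] with y h0 h1 h2
  exact ⟨abs_pos.2 h0, fun h => (eq_or_eq_neg_of_abs_eq h).elim h1 h2⟩

namespace IsSolution

/-- One-sided limits of the regular part on the line that carries `Σ₊`. -/
theorem tendsto_regular_part_plus (h : D.IsSolution x t M Mp Mm) (hD : D.Admissible)
    (hg : IsRegularPart D x t M g) {y : ℝ} (h0 : 0 < |y|) (hy : |y| ≠ D.Ap) :
    Tendsto g (𝓝[{z | z.re < -D.V / 2}] (D.ptPlus y)) (𝓝 (if |y| < D.Ap then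
      Mp (D.ptPlus y) 0 1 - D.poleSum x t M (D.ptPlus y) else g (D.ptPlus y))) ∧
    Tendsto g (𝓝[{z | -D.V / 2 < z.re}] (D.ptPlus y)) (𝓝 (if |y| < D.Ap then
      Mm (D.ptPlus y) 0 1 - D.poleSum x t M (D.ptPlus y) else g (D.ptPlus y))) := by
  by_cases hlt : |y| < D.Ap
  · have hc : D.ptPlus y ∈ D.contour := ptPlus_mem_contour hlt.le
    have hp := eventually_mem_of_ptPlus hD.V_ne h0
      fun hp => not_mem_contour_of_mem_poles hD hp hc
    obtain ⟨a, b, -⟩ := h.jump_plus y h0 hlt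
    simp only [if_pos hlt]
    refine ⟨hg.tendsto hD hc ?_ a, hg.tendsto hD hc ?_ b⟩
    · filter_upwards [nhdsWithin_le_nhds hp, self_mem_nhdsWithin] with k h1 (h2 : k.re < _)
      exact D.regularSet_subset (h1 h2.ne)
    · filter_upwards [nhdsWithin_le_nhds hp, self_mem_nhdsWithin] with k h1 (h2 : _ < k.re)
      exact D.regularSet_subset (h1 h2.ne')
  · simp only [if_neg hlt]
    have hc : D.ptPlus y ∉ D.contour := fun hc => by
      rw [mem_contour] at hc
      rcases hc with hc | hc | hc
      · exact h0.ne' (by simpa [ptPlus] using hc)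
      · exact hlt (lt_of_le_of_ne hc.2 hy)
      · have := hc.1
        have := hD.V_ne
        simp only [ptPlus] at *
        exact this (by linarith)
    have := (hg.differentiableAt _ hc).continuousAt.tendsto
    exact ⟨this.mono_left nhdsWithin_le_nhds, this.mono_left nhdsWithin_le_nhds⟩

/-- One-sided limits of the regular part on the line that carries `Σ₋`. -/
theorem tendsto_regular_part_minus (h : D.IsSolution x t M Mp Mm) (hD : D.Admissible)
    (hg : IsRegularPart D x t M g) {y : ℝ} (h0 : 0 < |y|) (hy : |y| ≠ D.Am) :
    Tendsto g (𝓝[{z | z.re < D.V / 2}] (D.ptMinus y)) (𝓝 (if |y| < D.Am then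
      Mp (D.ptMinus y) 0 1 - D.poleSum x t M (D.ptMinus y) else g (D.ptMinus y))) ∧
    Tendsto g (𝓝[{z | D.V / 2 < z.re}] (D.ptMinus y)) (𝓝 (if |y| < D.Am then
      Mm (D.ptMinus y) 0 1 - D.poleSum x t M (D.ptMinus y) else g (D.ptMinus y))) := by
  by_cases hlt : |y| < D.Am
  · have hc : D.ptMinus y ∈ D.contour := ptMinus_mem_contour hlt.le
    have hp := eventually_mem_of_ptMinus hD.V_ne h0
      fun hp => not_mem_contour_of_mem_poles hD hp hc
    obtain ⟨a, b, -⟩ := h.jump_minus y h0 hlt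
    simp only [if_pos hlt]
    refine ⟨hg.tendsto hD hc ?_ a, hg.tendsto hD hc ?_ b⟩
    · filter_upwards [nhdsWithin_le_nhds hp, self_mem_nhdsWithin] with k h1 (h2 : k.re < _)
      exact D.regularSet_subset (h1 h2.ne)
    · filter_upwards [nhdsWithin_le_nhds hp, self_mem_nhdsWithin] with k h1 (h2 : _ < k.re)
      exact D.regularSet_subset (h1 h2.ne')
  · simp only [if_neg hlt]
    have hc : D.ptMinus y ∉ D.contour := fun hc => by
      rw [mem_contour] at hc
      rcases hc with hc | hc | hc
      · exact h0.ne' (by simpa [ptMinus] using hc)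
      · have := hc.1
        have := hD.V_ne
        simp only [ptMinus] at *
        exact this (by linarith)
      · exact hlt (lt_of_le_of_ne hc.2 hy)
    have := (hg.differentiableAt _ hc).continuousAt.tendsto
    exact ⟨this.mono_left nhdsWithin_le_nhds, this.mono_left nhdsWithin_le_nhds⟩

/-- One-sided limits of the regular part on the real line. -/
theorem tendsto_regular_part_real (h : D.IsSolution x t M Mp Mm) (hD : D.Admissible)
    (hg : IsRegularPart D x t M g) {ξ : ℝ} (h1 : ξ ≠ -D.V / 2) (h2 : ξ ≠ D.V / 2) :
    Tendsto g (𝓝[{z | 0 < z.im}] (ξ : ℂ)) (𝓝 (Mp ξ 0 1 - D.poleSum x t M ξ)) ∧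
    Tendsto g (𝓝[{z | z.im < 0}] (ξ : ℂ)) (𝓝 (Mm ξ 0 1 - D.poleSum x t M ξ)) := by
  have hc : (ξ : ℂ) ∈ D.contour := mem_contour.2 (Or.inl (by simp))
  have hp := eventually_mem_of_real h1 h2 fun hp => not_mem_contour_of_mem_poles hD hp hc
  obtain ⟨a, b, -⟩ := h.jump_real ξ h1 h2
  refine ⟨hg.tendsto hD hc ?_ a, hg.tendsto hD hc ?_ b⟩
  · filter_upwards [nhdsWithin_le_nhds hp, self_mem_nhdsWithin] with k h1 (h2 : 0 < k.im)
    exact D.regularSet_subset (h1 h2.ne')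
  · filter_upwards [nhdsWithin_le_nhds hp, self_mem_nhdsWithin] with k h1 (h2 : k.im < 0)
    exact D.regularSet_subset (h1 h2.ne)

/-- Cauchy's theorem for the upper right entry on a large square. -/
theorem square_integral_regular_part (h : D.IsSolution x t M Mp Mm) (hD : D.Admissible)
    (hg : IsRegularPart D x t M g) {S : ℝ} (hS : D.IsFar S) :
    (IntervalIntegrable (fun ξ : ℝ => Mp ξ 0 1 - Mm ξ 0 1) volume (-S) S ∧
      IntervalIntegrable (fun y => Mp (D.ptPlus y) 0 1 - Mm (D.ptPlus y) 0 1) volume (-D.Ap) D.Ap ∧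
      IntervalIntegrable (fun y => Mp (D.ptMinus y) 0 1 - Mm (D.ptMinus y) 0 1) volume
        (-D.Am) D.Am) ∧
    (∫ x in (-S)..S, g (x + S * Complex.I)) - (∫ x in (-S)..S, g (x - S * Complex.I)) -
      Complex.I * (∫ y in (-S)..S, g (S + y * Complex.I)) +
      Complex.I * (∫ y in (-S)..S, g (-S + y * Complex.I)) =
    (∫ ξ : ℝ in (-S)..S, (Mp ξ 0 1 - Mm ξ 0 1)) +
      Complex.I * (∫ y in (-D.Ap)..D.Ap, (Mp (D.ptPlus y) 0 1 - Mm (D.ptPlus y) 0 1)) +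
      Complex.I * (∫ y in (-D.Am)..D.Am, (Mp (D.ptMinus y) 0 1 - Mm (D.ptMinus y) 0 1)) := by
  obtain ⟨C, hC0, hC⟩ := hg.exists_norm_le h hD S
  have hVS : |D.V / 2| < S := by
    by_contra hV
    exact hS.ne_minus _ (not_lt.1 hV) rfl
  have hVS' : |-D.V / 2| < S := by rwa [neg_div, abs_neg]
  have hne : -D.V / 2 ≠ D.V / 2 := fun he => hD.V_ne (by linarith)
  have hoff : ∀ k : ℂ, k.im ≠ 0 → k.re ≠ -D.V / 2 → k.re ≠ D.V / 2 → k ∉ D.contour :=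
    fun k h1 h2 h3 => by rw [mem_contour]; tauto
  have hle : ∀ (k : ℂ) (d : ℝ), 0 < d → d ≤ ‖k - D.ptPlus (-D.Ap)‖ →
      C * (‖k - D.ptPlus (-D.Ap)‖ ^ (1 / 4 : ℝ))⁻¹ ≤ C * (d ^ (1 / 4 : ℝ))⁻¹ := fun k d hd hdk => by
    have := Real.rpow_pos_of_pos hd (1 / 4)
    gcongr
  have hplus := (ae_abs_pos_and_ne D.Ap).mono fun y hy =>
    h.tendsto_regular_part_plus hD hg hy.1 hy.2
  have hminus := (ae_abs_pos_and_ne D.Am).mono fun y hy =>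
    h.tendsto_regular_part_minus hD hg hy.1 hy.2
  simp only [ptPlus_eq] at hplus
  simp only [ptMinus_eq] at hminus
  -- The distance to the branch point is bounded below by its horizontal and by its vertical
  -- component, which gives one majorant depending on Re k alone and one on Im k alone.
  obtain ⟨⟨i1, i2, i3⟩, e⟩ := square_integral_eq_of_ne
    (g₁ := fun u => C * (|u - -D.V / 2| ^ (1 / 4 : ℝ))⁻¹)
    (g₂ := fun v => C * (|v - -D.Ap| ^ (1 / 4 : ℝ))⁻¹) hne hVS' hVS
    (fun k h1 h2 h3 => hg.differentiableAt k (hoff k h1 h2 h3))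
    (fun ξ h1 h2 => (h.tendsto_regular_part_real hD hg h1 h2).1)
    (fun ξ h1 h2 => (h.tendsto_regular_part_real hD hg h1 h2).2)
    (hplus.mono fun y hy => hy.1) (hplus.mono fun y hy => hy.2)
    (hminus.mono fun y hy => hy.1) (hminus.mono fun y hy => hy.2)
    (fun k h1 h2 h3 h4 h5 => by
      refine (hC k h1 h2 (hoff k h3 h4 h5)).trans (hle k _ (abs_pos.2 (sub_ne_zero.2 h4)) ?_)
      simpa [ptPlus] using Complex.abs_re_le_norm (k - D.ptPlus (-D.Ap)))
    ((ae_abs_pos_and_ne D.Ap).mono fun y hy k hk h1 h2 h3 h4 => by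
      have hy1 : y - -D.Ap ≠ 0 := fun h0 => hy.2 (by
        rw [sub_eq_zero.1 h0, abs_neg, abs_of_pos hD.Ap_pos])
      refine (hC k h1 h2 (hoff k (hk ▸ abs_pos.1 hy.1) h3 h4)).trans (hle k _ (abs_pos.2 hy1) ?_)
      simpa [ptPlus, hk] using Complex.abs_im_le_norm (k - D.ptPlus (-D.Ap)))
    ((integrableOn_abs_sub_rpow_inv _ S).const_mul C) ((integrableOn_abs_sub_rpow_inv _ S).const_mul C)
  -- The principal parts are continuous across Σ and cancel in the jumps; beyond the ends of a cut
  -- the two one-sided limits agree.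
  have cut : ∀ {A : ℝ} {u v w z : ℝ → ℂ}, (fun y : ℝ => (if |y| < A then u y - w y else z y) -
      (if |y| < A then v y - w y else z y)) = fun y => if |y| < A then u y - v y else 0 := by
    intro A u v w z
    ext y
    split_ifs <;> ring
  have restr : ∀ {A : ℝ} {j : ℝ → ℂ}, 0 < A → A < S →
      IntervalIntegrable (fun y => if |y| < A then j y else 0) volume (-S) S →
      IntervalIntegrable j volume (-A) A := fun {A j} hA hAS hj => by
    rw [intervalIntegrable_iff_integrableOn_Ioo_of_le (by linarith)] at hj ⊢
    refine (hj.mono_set (Set.Ioo_subset_Ioo (by linarith) hAS.le)).congr_fun (fun y hy => ?_)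
      measurableSet_Ioo
    exact if_pos (abs_lt.2 hy)
  simp only [← ptPlus_eq, ← ptMinus_eq] at i2 i3 e
  rw [cut] at i2 i3
  rw [cut, cut, intervalIntegral_ite_abs_lt hD.Ap_pos (hS.Ap_lt hD).le,
    intervalIntegral_ite_abs_lt hD.Am_pos (hS.Am_lt hD).le] at e
  simp only [sub_sub_sub_cancel_right] at i1 e
  exact ⟨⟨i1, restr hD.Ap_pos (hS.Ap_lt hD) i2, restr hD.Am_pos (hS.Am_lt hD) i3⟩, e⟩

theorem ae_jumpEntry_real (h : D.IsSolution x t M Mp Mm) :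
    (fun ξ : ℝ => D.jumpEntry x t Mm ξ) =ᵐ[volume] fun ξ : ℝ => Mp ξ 0 1 - Mm ξ 0 1 := by
  have hc : ∀ c : ℝ, ∀ᵐ y : ℝ, y ≠ c := fun c => by simp [ae_iff, measure_singleton]
  filter_upwards [hc (-D.V / 2), hc (D.V / 2)] with ξ h1 h2
  exact jumpEntry_eq (h.jump_real ξ h1 h2).2.2

theorem ae_jumpEntry_plus (h : D.IsSolution x t M Mp Mm) (hD : D.Admissible) :
    ∀ᵐ s : ℝ, s ∈ Set.uIoc (-D.Ap) D.Ap →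
      D.jumpEntry x t Mm (D.ptPlus s) = Mp (D.ptPlus s) 0 1 - Mm (D.ptPlus s) 0 1 := by
  filter_upwards [ae_abs_pos_and_ne D.Ap] with s hs hmem
  rw [Set.uIoc_of_le (by linarith [hD.Ap_pos])] at hmem
  exact jumpEntry_eq (h.jump_plus s hs.1 (lt_of_le_of_ne (abs_le.2 ⟨hmem.1.le, hmem.2⟩) hs.2)).2.2

theorem ae_jumpEntry_minus (h : D.IsSolution x t M Mp Mm) (hD : D.Admissible) :
    ∀ᵐ s : ℝ, s ∈ Set.uIoc (-D.Am) D.Am →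
      D.jumpEntry x t Mm (D.ptMinus s) = Mp (D.ptMinus s) 0 1 - Mm (D.ptMinus s) 0 1 := by
  filter_upwards [ae_abs_pos_and_ne D.Am] with s hs hmem
  rw [Set.uIoc_of_le (by linarith [hD.Am_pos])] at hmem
  exact jumpEntry_eq (h.jump_minus s hs.1 (lt_of_le_of_ne (abs_le.2 ⟨hmem.1.le, hmem.2⟩) hs.2)).2.2

/-- On a bounded interval this comes from Cauchy's theorem on the square, on the rays from the bound
of the jump by a multiple of |ρ|. -/
theorem integrable_jump (h : D.IsSolution x t M Mp Mm) (hD : D.Admissible) (hreg : D.Regular) :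
    Integrable (fun ξ : ℝ => Mp ξ 0 1 - Mm ξ 0 1) := by
  obtain ⟨g, hg, hgM⟩ := h.exists_regular_part hD
  obtain ⟨S, hS⟩ := exists_isFar hreg
  have h1 := (h.square_integral_regular_part hD ⟨hg, hgM⟩ hS).1.1
  have h2 := h.integrableOn_jump hD hreg hS
  rw [← integrableOn_univ]
  have h3 : IntegrableOn (fun ξ : ℝ => Mp ξ 0 1 - Mm ξ 0 1) (Set.Icc (-S) S) := by
    rw [integrableOn_Icc_iff_integrableOn_Ioc]
    exact h1.1
  refine (h3.union h2).mono_set fun ξ _ => ?_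
  by_cases hξ : S < |ξ|
  · exact Or.inr hξ
  · exact Or.inl (abs_le.1 (not_lt.1 hξ))

theorem contourIntegrable_jumpEntry (h : D.IsSolution x t M Mp Mm) (hD : D.Admissible)
    (hreg : D.Regular) : D.ContourIntegrable (D.jumpEntry x t Mm) := by
  obtain ⟨g, hg, hgM⟩ := h.exists_regular_part hD
  obtain ⟨S, hS⟩ := exists_isFar hreg
  obtain ⟨⟨-, h2, h3⟩, -⟩ := h.square_integral_regular_part hD ⟨hg, hgM⟩ hS
  refine ⟨(h.integrable_jump hD hreg).congr h.ae_jumpEntry_real.symm, h2.congr_ae ?_, h3.congr_ae ?_⟩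
  · rw [EventuallyEq, ae_restrict_iff' measurableSet_uIoc]
    exact (h.ae_jumpEntry_plus hD).mono fun s hs hm => (hs hm).symm
  · rw [EventuallyEq, ae_restrict_iff' measurableSet_uIoc]
    exact (h.ae_jumpEntry_minus hD).mono fun s hs hm => (hs hm).symm

/-- For large S the boundary integral of the regular part over the square equals the integral of the
jumps inside. As S grows the former tends to -2πi times the limit of k g(k), which is the first
moment minus the sum of the residues. -/
theorem contourIntegral_jumpEntry (h : D.IsSolution x t M Mp Mm) (hD : D.Admissible)
    (hreg : D.Regular) {m₁ : Mat2} (h₁ : HasFirstMoment M m₁) :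
    D.contourIntegral (D.jumpEntry x t Mm) =
      -(2 * Real.pi * Complex.I) * (m₁ 0 1 - ∑ n, D.residue x t M n) := by
  obtain ⟨g, hg, hgM⟩ := h.exists_regular_part hD
  obtain ⟨R, hR⟩ := exists_isFar hreg
  have hgt : Tendsto (fun k => k * g k) (Bornology.cobounded ℂ ⊓ 𝓟 {k | k.im ≠ 0})
      (𝓝 (m₁ 0 1 - ∑ n, D.residue x t M n)) := by
    refine ((h.tendsto_mul_upper_entry hD hreg h₁).sub
      (tendsto_mul_poleSum.mono_left inf_le_left)).congr' ?_
    have h1 : ∀ᶠ k : ℂ in Bornology.cobounded ℂ ⊓ 𝓟 {k | k.im ≠ 0}, R ≤ ‖k‖ :=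
      (tendsto_norm_cobounded_atTop.mono_left inf_le_left).eventually (eventually_ge_atTop R)
    filter_upwards [h1, mem_inf_of_right (mem_principal_self _)] with k hk him
    rw [hgM k (hR.mem_regularSet k hk him), mul_sub]
  have T := tendsto_square_integral hgt fun k hk him => (hg k
    (D.regularSet_subset (hR.mem_regularSet k hk him))).continuousAt
  have T' : Tendsto (fun S : ℝ => (∫ ξ : ℝ in (-S)..S, (Mp ξ 0 1 - Mm ξ 0 1)) +
      Complex.I * (∫ y in (-D.Ap)..D.Ap, (Mp (D.ptPlus y) 0 1 - Mm (D.ptPlus y) 0 1)) +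
      Complex.I * (∫ y in (-D.Am)..D.Am, (Mp (D.ptMinus y) 0 1 - Mm (D.ptMinus y) 0 1))) atTop
      (𝓝 ((∫ ξ : ℝ, (Mp ξ 0 1 - Mm ξ 0 1)) +
      Complex.I * (∫ y in (-D.Ap)..D.Ap, (Mp (D.ptPlus y) 0 1 - Mm (D.ptPlus y) 0 1)) +
      Complex.I * (∫ y in (-D.Am)..D.Am, (Mp (D.ptMinus y) 0 1 - Mm (D.ptMinus y) 0 1)))) :=
    ((intervalIntegral_tendsto_integral (h.integrable_jump hD hreg) tendsto_neg_atTop_atBot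
      tendsto_id).add_const _).add_const _
  have e := tendsto_nhds_unique (T.congr' (by
    filter_upwards [eventually_ge_atTop R] with S hS
      using (h.square_integral_regular_part hD ⟨hg, hgM⟩ (hR.mono hS)).2)) T'
  rw [e, contourIntegral, integral_congr_ae h.ae_jumpEntry_real,
    intervalIntegral.integral_mul_const, intervalIntegral.integral_mul_const,
    intervalIntegral.integral_congr_ae (h.ae_jumpEntry_plus hD),
    intervalIntegral.integral_congr_ae (h.ae_jumpEntry_minus hD), mul_comm Complex.I,
    mul_comm Complex.I]

end IsSolution

/-- The residue sum in the definition of q cancels the one produced by the contour integral. -/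
theorem reconstruction_eq {M Mp Mm : ℝ → ℝ → ℂ → Mat2} {x t : ℝ}
    (h : D.IsSolution x t (M x t) (Mp x t) (Mm x t)) (hD : D.Admissible)
    (hreg : D.Regular) {m₁ : Mat2} (h₁ : HasFirstMoment (M x t) m₁) :
    D.reconstruction M Mm x t = -2 * Complex.I * m₁ 0 1 := by
  rw [reconstruction, h.contourIntegral_jumpEntry hD hreg h₁]
  have : (Real.pi : ℂ) ≠ 0 := by simp [Real.pi_ne_zero]
  simp only [residue]
  field_simp
  ring

end RHPData

end CounterflowNLS

/-! ### The main theorem -/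

theorem corollaryc (D : CounterflowNLS.RHPData) (hD : D.Admissible) (hreg : D.Regular)
    (U : Set (ℝ × ℝ)) (hU : IsOpen U)
    (M Mp Mm : ℝ → ℝ → ℂ → CounterflowNLS.Mat2)
    (hM : ∀ x t : ℝ, (x, t) ∈ U → D.IsSolution x t (M x t) (Mp x t) (Mm x t)) :
    ∀ x t : ℝ, (x, t) ∈ U →
      D.ContourIntegrable (D.jumpEntry x t (Mm x t)) ∧
      Filter.Tendsto
        (fun k : ℂ => (-Complex.I) • (k •
          (CounterflowNLS.sigma3 * M x t k - M x t k * CounterflowNLS.sigma3)))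
        (Bornology.cobounded ℂ ⊓ Filter.principal D.contourᶜ)
        (nhds (CounterflowNLS.potentialMatrix (D.reconstruction M Mm x t))) ∧
      (∀ k : ℂ, k ∉ D.contour → k ∉ D.poles →
        CounterflowNLS.ModifiedLaxPairAt (D.reconstruction M Mm) M x t k) ∧
      CounterflowNLS.SolvesNLSAt (D.reconstruction M Mm) x t := by
  have hmom : ∀ x t : ℝ, ∃ m₁ m₂ : CounterflowNLS.Mat2, (x, t) ∈ U →
      CounterflowNLS.HasFirstMoment (M x t) m₁ ∧ CounterflowNLS.HasSecondMoment (M x t) m₁ m₂ := by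
    intro x t
    by_cases hxt : (x, t) ∈ U
    · obtain ⟨m₁, m₂, h⟩ := (hM x t hxt).exists_moments hD hreg
      exact ⟨m₁, m₂, fun _ => h⟩
    -- Outside `U` the moments get arbitrary values, so that they are functions on the whole plane.
    · exact ⟨0, 0, fun h => absurd h hxt⟩
  choose m₁ m₂ hm using hmom
  have hq : ∀ x t : ℝ, (x, t) ∈ U → D.reconstruction M Mm x t = -2 * Complex.I * m₁ x t 0 1 :=
    fun x t hxt => CounterflowNLS.RHPData.reconstruction_eq (hM x t hxt) hD hreg (hm x t hxt).1
  intro x t hxt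
  obtain ⟨hlax, hnls⟩ := CounterflowNLS.RHPData.lax_and_nls_of_moments hD hreg hU hM
    (fun x t h => (hm x t h).1) (fun x t h => (hm x t h).2) hq hxt
  refine ⟨(hM x t hxt).contourIntegrable_jumpEntry hD hreg, ?_, fun k h1 h2 => hlax k ?_, hnls⟩
  · rw [hq x t hxt]
    exact (hM x t hxt).tendsto_potentialMatrix hD hreg (hm x t hxt).1
  · exact fun hk => hk.elim h1 h2
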